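/- **Setting.** For a bicategory $\mathscr{C}$ and a class $\mathbf{W}$ of morphisms of $\mathscr{C}$, we say that $(\mathscr{C},\mathbf{W})$ satisfies conditions (BF) if: - (BF1) $\mathbf{W}$ contains all identities; - (BF2) $\mathbf{W}$ is closed under composition; - (BF3) for all $w:A\to B$ in $\mathbf{W}$ and $f:C\to B$ there are $w':D\to C$ in $\mathbf{W}$, $f':D\to A$ and an invertible 2-morphism $f\circ w'\Rightarrow w\circ f'$; - (BF4) for all $w:B\to A$ in $\mathbf{W}$, $f^1,f^2:C\to B$ and $\alpha:w\circ f^1\Rightarrow w\circ f^2$: (a) there are $v:D\to C$ in $\mathbf{W}$ and $\beta:f^1\circ v\Rightarrow f^2\circ v$ such that $\alpha\ast i_v=i_w\ast\beta$ (up to associators); (b) if $\alpha$ is invertible, such a pair can be chosen with $\beta$ invertible; (c) for any two such pairs $(v,\beta)$, $(v',\beta')$ there are $z,z'$ and an invertible $\zeta:v\circ z\Rightarrow v'\circ z'$ such that $v\circ z$ is in $\mathbf{W}$ and $(f^2\ast\zeta)\odot(\beta\ast z)=(\beta'\ast z')\odot(f^1\ast\zeta)$ (up to associators); - (BF5) if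 $g$ is in $\mathbf{W}$ and there is an invertible 2-morphism $f\Rightarrow g$, then $f$ is in $\mathbf{W}$. The (right) saturation $\mathbf{W}_{\mathrm{sat}}$ is the class of all $f:B\to A$ for which there are $g:C\to B$ and $h:D\to C$ with $f\circ g\in\mathbf{W}$ and $g\circ h\in\mathbf{W}$. A set of choices for $(\mathscr{C},\mathbf{W})$ selects, for every $f:A'\to B$ and every $v:B'\to B$ in $\mathbf{W}$, an object $A''$, morphisms $v':A''\to A'$ in $\mathbf{W}$ and $f':A''\to B'$, and an invertible 2-morphism $\rho:f\circ v'\Rightarrow v\circ f'$; if $f=\mathrm{id}_B$, the choice is $v'=v$, $f'=\mathrm{id}$, with $\rho$ given by unitors; if $v=\mathrm{id}_B$, it is $v'=\mathrm{id}$, $f'=f$, with $\rho$ given by unitors. For $(\mathscr{C},\mathbf{W})$ satisfying (BF) and any set of choices, let $\mathscr{C}[\mathbf{W}^{-1}]$ be Pronk's right bicategory of fractions: - its objects are those of $\mathscr{C}$; - its morphisms $A\to B$ are the triples $(A',w,f)$ with $w:A'\to A$ in $\mathbf{W}$ and $f:A'\to B$; they are composed by means of the chosen squares; - its 2-morphisms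 $(A^1,w^1,f^1)\Rightarrow(A^2,w^2,f^2)$ are the classes $[A^3,v^1,v^2,\alpha,\beta]$, where $v^m:A^3\to A^m$, $w^1\circ v^1\in\mathbf{W}$, $\alpha:w^1\circ v^1\Rightarrow w^2\circ v^2$ is invertible and $\beta:f^1\circ v^1\Rightarrow f^2\circ v^2$, two representatives being identified if they agree on a common refinement. Let $\mathcal{U}_{\mathbf{W}}:\mathscr{C}\to\mathscr{C}[\mathbf{W}^{-1}]$ be the universal pseudofunctor, which is the identity on objects and is given by $f\mapsto(A,\mathrm{id}_A,f)$ on morphisms $f:A\to B$ and by $\gamma\mapsto[A,\mathrm{id}_A,\mathrm{id}_A,i,\gamma\ast i_{\mathrm{id}_A}]$ on 2-morphisms. For a bicategory $\mathscr{D}$, let $\mathrm{Cyl}(\mathscr{D})$ be the bicategory of cylinders, whose objects are the morphisms of $\mathscr{D}$, whose morphisms are the squares of $\mathscr{D}$ filled by a 2-morphism, and whose 2-morphisms are the compatible pairs of 2-morphisms of $\mathscr{D}$. A pseudonatural transformation $\kappa$ between pseudofunctors $\mathscr{A}\to\mathscr{D}$ is the same as a pseudofunctor $\mu_\kappa:\mathscr{A}\to\mathrm{Cyl}(\mathscr{D})$,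 given by $A\mapsto\kappa(A)$ and $f\mapsto\kappa(f)$, whose squares are filled by invertible 2-morphisms. An internal equivalence is a 1-morphism with a quasi-inverse up to invertible 2-morphisms; a pseudonatural equivalence is an internal equivalence in the bicategory of pseudofunctors, pseudonatural transformations and modifications. **Theorem.** Let $(\mathscr{A},\mathbf{W}_{\mathscr{A}})$ and $(\mathscr{B},\mathbf{W}_{\mathscr{B}})$ both satisfy conditions (BF), and let $\mathcal{F}=(\mathcal{F}_0,\mathcal{F}_1,\mathcal{F}_2):\mathscr{A}\to\mathscr{B}$ be any pseudofunctor, with structure 2-morphisms (associators) $\psi^{\mathcal{F}}_{g,f}:\mathcal{F}_1(g\circ f)\Rightarrow\mathcal{F}_1(g)\circ\mathcal{F}_1(f)$. (A) If $\mathcal{F}_1(\mathbf{W}_{\mathscr{A}})\subseteq\mathbf{W}_{\mathscr{B},\mathrm{sat}}$, then $(\mathscr{B},\mathbf{W}_{\mathscr{B},\mathrm{sat}})$ satisfies (BF) and, for any sets of choices defining the bicategories of fractions, there are a pseudofunctor $$\widetilde{\mathcal{G}}:\mathscr{A}[\mathbf{W}_{\mathscr{A}}^{-1}]\longrightarrow\mathscr{B}[\mathbf{W}_{\mathscr{B},\mathrm{sat}}^{-1}]$$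 and a pseudonatural equivalence $\widetilde{\kappa}:\mathcal{U}_{\mathbf{W}_{\mathscr{B},\mathrm{sat}}}\circ\mathcal{F}\Rightarrow\widetilde{\mathcal{G}}\circ\mathcal{U}_{\mathbf{W}_{\mathscr{A}}}$ such that: - (I) the pseudofunctor $\mu_{\widetilde{\kappa}}:\mathscr{A}\to\mathrm{Cyl}(\mathscr{B}[\mathbf{W}_{\mathscr{B},\mathrm{sat}}^{-1}])$ associated to $\widetilde{\kappa}$ sends each morphism of $\mathbf{W}_{\mathscr{A}}$ to an internal equivalence; - (II) $\widetilde{\mathcal{G}}_0(A)=\mathcal{F}_0(A)$ for each object $A$; - (III) $\widetilde{\mathcal{G}}_1(A',w,f)=(\mathcal{F}_0(A'),\mathcal{F}_1(w),\mathcal{F}_1(f))$ for each morphism $(A',w,f)$ of $\mathscr{A}[\mathbf{W}_{\mathscr{A}}^{-1}]$; - (IV) for each 2-morphism $[A^3,v^1,v^2,\alpha,\beta]:(A^1,w^1,f^1)\Rightarrow(A^2,w^2,f^2)$ of $\mathscr{A}[\mathbf{W}_{\mathscr{A}}^{-1}]$, $$\widetilde{\mathcal{G}}_2\big([A^3,v^1,v^2,\alpha,\beta]\big)=\Big[\mathcal{F}_0(A^3),\mathcal{F}_1(v^1),\mathcal{F}_1(v^2),\psi^{\mathcal{F}}_{w^2,v^2}\odot\mathcal{F}_2(\alpha)\odot(\psi^{\mathcal{F}}_{w^1,v^1})^{-1},\psi^{\mathcal{F}}_{f^2,v^2}\odot\mathcal{F}_2(\beta)\odot(\psi^{\mathcal{F}}_{f^1,v^1})^{-1}\Big].$$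 (B) If moreover $\mathcal{F}_1(\mathbf{W}_{\mathscr{A}})\subseteq\mathbf{W}_{\mathscr{B}}$, then, for any sets of choices, there are a pseudofunctor $\widetilde{\mathcal{G}}:\mathscr{A}[\mathbf{W}_{\mathscr{A}}^{-1}]\to\mathscr{B}[\mathbf{W}_{\mathscr{B}}^{-1}]$ and a pseudonatural equivalence $\widetilde{\kappa}:\mathcal{U}_{\mathbf{W}_{\mathscr{B}}}\circ\mathcal{F}\Rightarrow\widetilde{\mathcal{G}}\circ\mathcal{U}_{\mathbf{W}_{\mathscr{A}}}$ such that $\mu_{\widetilde{\kappa}}:\mathscr{A}\to\mathrm{Cyl}(\mathscr{B}[\mathbf{W}_{\mathscr{B}}^{-1}])$ sends each morphism of $\mathbf{W}_{\mathscr{A}}$ to an internal equivalence, and such that (II), (III) and (IV) hold. (In both parts, that the constructions above do define bicategories and pseudofunctors is part of the assertion.) -/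

import Mathlib

open CategoryTheory Bicategory

universe w v u w₁ v₁ u₁ w₂ v₂ u₂

namespace BicatFrac

/-! ### Bicategories and pseudofunctors: data and laws -/

/-- The data of a bicategory on a type of objects `B`, without any law. -/
structure BicategoryData (B : Type u) where
  Hom : B → B → Type v
  Hom₂ : ∀ {a b : B}, Hom a b → Hom a b → Type w
  id₁ : ∀ a : B, Hom a a
  comp₁ : ∀ {a b c : B}, Hom a b → Hom b c → Hom a c
  id₂ : ∀ {a b : B} (f : Hom a b), Hom₂ f f
  comp₂ : ∀ {a b : B} {f g h : Hom a b}, Hom₂ f g → Hom₂ g h → Hom₂ f h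
  whiskerLeft : ∀ {a b c : B} (f : Hom a b) {g h : Hom b c},
    Hom₂ g h → Hom₂ (comp₁ f g) (comp₁ f h)
  whiskerRight : ∀ {a b c : B} {f g : Hom a b},
    Hom₂ f g → ∀ h : Hom b c, Hom₂ (comp₁ f h) (comp₁ g h)
  assocHom : ∀ {a b c d : B} (f : Hom a b) (g : Hom b c) (h : Hom c d),
    Hom₂ (comp₁ (comp₁ f g) h) (comp₁ f (comp₁ g h))
  assocInv : ∀ {a b c d : B} (f : Hom a b) (g : Hom b c) (h : Hom c d),
    Hom₂ (comp₁ f (comp₁ g h)) (comp₁ (comp₁ f g) h)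
  leftHom : ∀ {a b : B} (f : Hom a b), Hom₂ (comp₁ (id₁ a) f) f
  leftInv : ∀ {a b : B} (f : Hom a b), Hom₂ f (comp₁ (id₁ a) f)
  rightHom : ∀ {a b : B} (f : Hom a b), Hom₂ (comp₁ f (id₁ b)) f
  rightInv : ∀ {a b : B} (f : Hom a b), Hom₂ f (comp₁ f (id₁ b))

/-- The laws of a bicategory, for given data. -/
structure BicategoryData.IsBicategory {B : Type u} (D : BicategoryData.{w, v} B) : Prop where
  id_comp : ∀ {a b : B} {f g : D.Hom a b} (η : D.Hom₂ f g), D.comp₂ (D.id₂ f) η = η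
  comp_id : ∀ {a b : B} {f g : D.Hom a b} (η : D.Hom₂ f g), D.comp₂ η (D.id₂ g) = η
  assoc : ∀ {a b : B} {f g h i : D.Hom a b} (η : D.Hom₂ f g) (θ : D.Hom₂ g h) (κ : D.Hom₂ h i),
    D.comp₂ (D.comp₂ η θ) κ = D.comp₂ η (D.comp₂ θ κ)
  assoc_hom_inv : ∀ {a b c d : B} (f : D.Hom a b) (g : D.Hom b c) (h : D.Hom c d),
    D.comp₂ (D.assocHom f g h) (D.assocInv f g h) = D.id₂ _
  assoc_inv_hom : ∀ {a b c d : B} (f : D.Hom a b) (g : D.Hom b c) (h : D.Hom c d),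
    D.comp₂ (D.assocInv f g h) (D.assocHom f g h) = D.id₂ _
  left_hom_inv : ∀ {a b : B} (f : D.Hom a b), D.comp₂ (D.leftHom f) (D.leftInv f) = D.id₂ _
  left_inv_hom : ∀ {a b : B} (f : D.Hom a b), D.comp₂ (D.leftInv f) (D.leftHom f) = D.id₂ _
  right_hom_inv : ∀ {a b : B} (f : D.Hom a b), D.comp₂ (D.rightHom f) (D.rightInv f) = D.id₂ _
  right_inv_hom : ∀ {a b : B} (f : D.Hom a b), D.comp₂ (D.rightInv f) (D.rightHom f) = D.id₂ _
  whiskerLeft_id : ∀ {a b c : B} (f : D.Hom a b) (g : D.Hom b c),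
    D.whiskerLeft f (D.id₂ g) = D.id₂ (D.comp₁ f g)
  whiskerLeft_comp : ∀ {a b c : B} (f : D.Hom a b) {g h i : D.Hom b c} (η : D.Hom₂ g h)
    (θ : D.Hom₂ h i),
    D.whiskerLeft f (D.comp₂ η θ) = D.comp₂ (D.whiskerLeft f η) (D.whiskerLeft f θ)
  id_whiskerLeft : ∀ {a b : B} {f g : D.Hom a b} (η : D.Hom₂ f g),
    D.whiskerLeft (D.id₁ a) η = D.comp₂ (D.leftHom f) (D.comp₂ η (D.leftInv g))
  comp_whiskerLeft : ∀ {a b c d : B} (f : D.Hom a b) (g : D.Hom b c) {h h' : D.Hom c d}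
    (η : D.Hom₂ h h'),
    D.whiskerLeft (D.comp₁ f g) η = D.comp₂ (D.assocHom f g h)
      (D.comp₂ (D.whiskerLeft f (D.whiskerLeft g η)) (D.assocInv f g h'))
  id_whiskerRight : ∀ {a b c : B} (f : D.Hom a b) (g : D.Hom b c),
    D.whiskerRight (D.id₂ f) g = D.id₂ (D.comp₁ f g)
  comp_whiskerRight : ∀ {a b c : B} {f g h : D.Hom a b} (η : D.Hom₂ f g) (θ : D.Hom₂ g h)
    (i : D.Hom b c),
    D.whiskerRight (D.comp₂ η θ) i = D.comp₂ (D.whiskerRight η i) (D.whiskerRight θ i)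
  whiskerRight_id : ∀ {a b : B} {f g : D.Hom a b} (η : D.Hom₂ f g),
    D.whiskerRight η (D.id₁ b) = D.comp₂ (D.rightHom f) (D.comp₂ η (D.rightInv g))
  whiskerRight_comp : ∀ {a b c d : B} {f f' : D.Hom a b} (η : D.Hom₂ f f') (g : D.Hom b c)
    (h : D.Hom c d),
    D.whiskerRight η (D.comp₁ g h) = D.comp₂ (D.assocInv f g h)
      (D.comp₂ (D.whiskerRight (D.whiskerRight η g) h) (D.assocHom f' g h))
  whisker_assoc : ∀ {a b c d : B} (f : D.Hom a b) {g g' : D.Hom b c} (η : D.Hom₂ g g')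
    (h : D.Hom c d),
    D.whiskerRight (D.whiskerLeft f η) h = D.comp₂ (D.assocHom f g h)
      (D.comp₂ (D.whiskerLeft f (D.whiskerRight η h)) (D.assocInv f g' h))
  whisker_exchange : ∀ {a b c : B} {f g : D.Hom a b} {h i : D.Hom b c} (η : D.Hom₂ f g)
    (θ : D.Hom₂ h i),
    D.comp₂ (D.whiskerLeft f θ) (D.whiskerRight η i) =
      D.comp₂ (D.whiskerRight η h) (D.whiskerLeft g θ)
  pentagon : ∀ {a b c d e : B} (f : D.Hom a b) (g : D.Hom b c) (h : D.Hom c d) (i : D.Hom d e),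
    D.comp₂ (D.whiskerRight (D.assocHom f g h) i)
        (D.comp₂ (D.assocHom f (D.comp₁ g h) i) (D.whiskerLeft f (D.assocHom g h i))) =
      D.comp₂ (D.assocHom (D.comp₁ f g) h i) (D.assocHom f g (D.comp₁ h i))
  triangle : ∀ {a b c : B} (f : D.Hom a b) (g : D.Hom b c),
    D.comp₂ (D.assocHom f (D.id₁ b) g) (D.whiskerLeft f (D.leftHom g)) =
      D.whiskerRight (D.rightHom f) g

/-- The objects of the bicategory given by lawful data `D` on `B`: a copy of `B`. -/
@[ext]
structure BicategoryData.Carrier {B : Type u} {D : BicategoryData.{w, v} B}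
    (h : D.IsBicategory) where
  as : B

instance BicategoryData.Carrier.instCategoryStruct {B : Type u} {D : BicategoryData.{w, v} B}
    (h : D.IsBicategory) : CategoryStruct.{v} (BicategoryData.Carrier h) where
  Hom a b := D.Hom a.as b.as
  id a := D.id₁ a.as
  comp f g := D.comp₁ f g

instance BicategoryData.Carrier.instCategory {B : Type u} {D : BicategoryData.{w, v} B}
    (h : D.IsBicategory) (a b : BicategoryData.Carrier h) : Category.{w} (a ⟶ b) where
  Hom f g := D.Hom₂ f g
  id f := D.id₂ f
  comp η θ := D.comp₂ η θ
  id_comp := h.id_comp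
  comp_id := h.comp_id
  assoc := h.assoc

/-- The bicategory given by lawful data. -/
instance BicategoryData.Carrier.instBicategory {B : Type u} {D : BicategoryData.{w, v} B}
    (h : D.IsBicategory) : Bicategory.{w, v} (BicategoryData.Carrier h) where
  homCategory := BicategoryData.Carrier.instCategory h
  whiskerLeft f _ _ η := D.whiskerLeft f η
  whiskerRight η f := D.whiskerRight η f
  associator f g k :=
    { hom := D.assocHom f g k
      inv := D.assocInv f g k
      hom_inv_id := h.assoc_hom_inv f g k
      inv_hom_id := h.assoc_inv_hom f g k }
  leftUnitor f :=
    { hom := D.leftHom f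
      inv := D.leftInv f
      hom_inv_id := h.left_hom_inv f
      inv_hom_id := h.left_inv_hom f }
  rightUnitor f :=
    { hom := D.rightHom f
      inv := D.rightInv f
      hom_inv_id := h.right_hom_inv f
      inv_hom_id := h.right_inv_hom f }
  whiskerLeft_id := h.whiskerLeft_id
  whiskerLeft_comp := h.whiskerLeft_comp
  id_whiskerLeft := h.id_whiskerLeft
  comp_whiskerLeft := h.comp_whiskerLeft
  id_whiskerRight := h.id_whiskerRight
  comp_whiskerRight := h.comp_whiskerRight
  whiskerRight_id := h.whiskerRight_id
  whiskerRight_comp := h.whiskerRight_comp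
  whisker_assoc := h.whisker_assoc
  whisker_exchange := h.whisker_exchange
  pentagon := h.pentagon
  triangle := h.triangle

/-- The data of a pseudofunctor, without any law. -/
structure PseudofunctorData (B : Type u₁) [Bicategory.{w₁, v₁} B] (C : Type u₂)
    [Bicategory.{w₂, v₂} C] extends PrelaxFunctorStruct B C where
  idHom : ∀ a : B, map (𝟙 a) ⟶ 𝟙 (obj a)
  idInv : ∀ a : B, 𝟙 (obj a) ⟶ map (𝟙 a)
  compHom : ∀ {a b c : B} (f : a ⟶ b) (g : b ⟶ c), map (f ≫ g) ⟶ map f ≫ map g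
  compInv : ∀ {a b c : B} (f : a ⟶ b) (g : b ⟶ c), map f ≫ map g ⟶ map (f ≫ g)

/-- The laws of a pseudofunctor, for given data. -/
structure PseudofunctorData.IsPseudofunctor {B : Type u₁} [Bicategory.{w₁, v₁} B] {C : Type u₂}
    [Bicategory.{w₂, v₂} C] (F : PseudofunctorData B C) : Prop where
  map₂_id : ∀ {a b : B} (f : a ⟶ b), F.map₂ (𝟙 f) = 𝟙 (F.map f)
  map₂_comp : ∀ {a b : B} {f g h : a ⟶ b} (η : f ⟶ g) (θ : g ⟶ h),
    F.map₂ (η ≫ θ) = F.map₂ η ≫ F.map₂ θ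
  id_hom_inv : ∀ a : B, F.idHom a ≫ F.idInv a = 𝟙 _
  id_inv_hom : ∀ a : B, F.idInv a ≫ F.idHom a = 𝟙 _
  comp_hom_inv : ∀ {a b c : B} (f : a ⟶ b) (g : b ⟶ c), F.compHom f g ≫ F.compInv f g = 𝟙 _
  comp_inv_hom : ∀ {a b c : B} (f : a ⟶ b) (g : b ⟶ c), F.compInv f g ≫ F.compHom f g = 𝟙 _
  map₂_whisker_left : ∀ {a b c : B} (f : a ⟶ b) {g h : b ⟶ c} (η : g ⟶ h),
    F.map₂ (f ◁ η) = F.compHom f g ≫ F.map f ◁ F.map₂ η ≫ F.compInv f h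
  map₂_whisker_right : ∀ {a b c : B} {f g : a ⟶ b} (η : f ⟶ g) (h : b ⟶ c),
    F.map₂ (η ▷ h) = F.compHom f h ≫ F.map₂ η ▷ F.map h ≫ F.compInv g h
  map₂_associator : ∀ {a b c d : B} (f : a ⟶ b) (g : b ⟶ c) (h : c ⟶ d),
    F.map₂ (α_ f g h).hom = F.compHom (f ≫ g) h ≫ F.compHom f g ▷ F.map h ≫
      (α_ (F.map f) (F.map g) (F.map h)).hom ≫ F.map f ◁ F.compInv g h ≫ F.compInv f (g ≫ h)
  map₂_left_unitor : ∀ {a b : B} (f : a ⟶ b),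
    F.map₂ (λ_ f).hom = F.compHom (𝟙 a) f ≫ F.idHom a ▷ F.map f ≫ (λ_ (F.map f)).hom
  map₂_right_unitor : ∀ {a b : B} (f : a ⟶ b),
    F.map₂ (ρ_ f).hom = F.compHom f (𝟙 b) ≫ F.map f ◁ F.idHom b ≫ (ρ_ (F.map f)).hom

/-- The pseudofunctor given by lawful data. -/
def PseudofunctorData.toPseudofunctor {B : Type u₁} [Bicategory.{w₁, v₁} B] {C : Type u₂}
    [Bicategory.{w₂, v₂} C] (F : PseudofunctorData B C) (h : F.IsPseudofunctor) : B ⥤ᵖ C where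
  toPrelaxFunctorStruct := F.toPrelaxFunctorStruct
  map₂_id := h.map₂_id
  map₂_comp := h.map₂_comp
  mapId a := ⟨F.idHom a, F.idInv a, h.id_hom_inv a, h.id_inv_hom a⟩
  mapComp f g := ⟨F.compHom f g, F.compInv f g, h.comp_hom_inv f g, h.comp_inv_hom f g⟩
  map₂_whisker_left := h.map₂_whisker_left
  map₂_whisker_right := h.map₂_whisker_right
  map₂_associator := h.map₂_associator
  map₂_left_unitor := h.map₂_left_unitor
  map₂_right_unitor := h.map₂_right_unitor

section General

variable {C : Type u} [Bicategory.{w, v} C]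

/-! ### Internal equivalences and cylinders -/

/-- `e` is an internal equivalence. -/
def IsInternalEquivalence {a b : C} (e : a ⟶ b) : Prop :=
  ∃ e' : b ⟶ a, Nonempty (𝟙 a ≅ e ≫ e') ∧ Nonempty (e' ≫ e ≅ 𝟙 b)

/-- Objects of the bicategory of cylinders: the 1-morphisms of `C`. -/
structure Cyl (C : Type u) [Bicategory.{w, v} C] where
  src : C
  tgt : C
  mor : src ⟶ tgt

namespace Cyl

/-- 1-morphisms of the bicategory of cylinders: squares filled by a 2-morphism. -/
@[ext]
structure Mor (X Y : Cyl C) where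
  top : X.src ⟶ Y.src
  bot : X.tgt ⟶ Y.tgt
  cell : top ≫ Y.mor ⟶ X.mor ≫ bot

/-- 2-morphisms of the bicategory of cylinders: compatible pairs of 2-morphisms. -/
@[ext]
structure Mor₂ {X Y : Cyl C} (f g : Mor X Y) where
  top : f.top ⟶ g.top
  bot : f.bot ⟶ g.bot
  comm : f.cell ≫ X.mor ◁ bot = top ▷ Y.mor ≫ g.cell

instance : CategoryStruct (Cyl C) where
  Hom := Mor
  id X := ⟨𝟙 _, 𝟙 _, (λ_ X.mor).hom ≫ (ρ_ X.mor).inv⟩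
  comp f g := ⟨f.top ≫ g.top, f.bot ≫ g.bot,
    (α_ _ _ _).hom ≫ f.top ◁ g.cell ≫ (α_ _ _ _).inv ≫ f.cell ▷ g.bot ≫ (α_ _ _ _).hom⟩

instance (X Y : Cyl C) : Category (X ⟶ Y) where
  Hom f g := Mor₂ f g
  id f := ⟨𝟙 _, 𝟙 _, by simp⟩
  comp η θ := ⟨η.top ≫ θ.top, η.bot ≫ θ.bot, by
    rw [Bicategory.whiskerLeft_comp, reassoc_of% η.comm, θ.comm,
      Bicategory.comp_whiskerRight, Category.assoc]⟩
  id_comp _ := Mor₂.ext (Category.id_comp _) (Category.id_comp _)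
  comp_id _ := Mor₂.ext (Category.comp_id _) (Category.comp_id _)
  assoc _ _ _ := Mor₂.ext (Category.assoc _ _ _) (Category.assoc _ _ _)

variable {X Y Z : Cyl C}

@[simp] theorem id_top : Mor.top (𝟙 X : X ⟶ X) = 𝟙 X.src := rfl
@[simp] theorem id_bot : Mor.bot (𝟙 X : X ⟶ X) = 𝟙 X.tgt := rfl
@[simp] theorem id_cell : Mor.cell (𝟙 X : X ⟶ X) = (λ_ X.mor).hom ≫ (ρ_ X.mor).inv := rfl
@[simp] theorem comp_top (f : X ⟶ Y) (g : Y ⟶ Z) :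
    Mor.top (f ≫ g) = Mor.top f ≫ Mor.top g := rfl
@[simp] theorem comp_bot (f : X ⟶ Y) (g : Y ⟶ Z) :
    Mor.bot (f ≫ g) = Mor.bot f ≫ Mor.bot g := rfl
@[simp] theorem comp_cell (f : X ⟶ Y) (g : Y ⟶ Z) :
    Mor.cell (f ≫ g) = (α_ _ _ _).hom ≫ Mor.top f ◁ Mor.cell g ≫ (α_ _ _ _).inv ≫
      Mor.cell f ▷ Mor.bot g ≫ (α_ _ _ _).hom := rfl
@[simp] theorem id₂_top (f : X ⟶ Y) : Mor₂.top (𝟙 f) = 𝟙 (Mor.top f) := rfl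
@[simp] theorem id₂_bot (f : X ⟶ Y) : Mor₂.bot (𝟙 f) = 𝟙 (Mor.bot f) := rfl
@[simp] theorem comp₂_top {f g h : X ⟶ Y} (η : f ⟶ g) (θ : g ⟶ h) :
    Mor₂.top (η ≫ θ) = Mor₂.top η ≫ Mor₂.top θ := rfl
@[simp] theorem comp₂_bot {f g h : X ⟶ Y} (η : f ⟶ g) (θ : g ⟶ h) :
    Mor₂.bot (η ≫ θ) = Mor₂.bot η ≫ Mor₂.bot θ := rfl

theorem hom₂_ext {f g : X ⟶ Y} {η θ : f ⟶ g} (h₁ : Mor₂.top η = Mor₂.top θ)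
    (h₂ : Mor₂.bot η = Mor₂.bot θ) : η = θ := Mor₂.ext h₁ h₂

/-- An invertible 2-morphism of cylinders from a compatible pair of invertible 2-morphisms. -/
def mkIso {f g : X ⟶ Y} (t : Mor.top f ≅ Mor.top g) (b : Mor.bot f ≅ Mor.bot g)
    (comm : Mor.cell f ≫ X.mor ◁ b.hom = t.hom ▷ Y.mor ≫ Mor.cell g) : f ≅ g where
  hom := Mor₂.mk t.hom b.hom comm
  inv := Mor₂.mk t.inv b.inv (by
    rw [← cancel_epi (t.hom ▷ Y.mor), ← reassoc_of% comm]; simp)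
  hom_inv_id := Mor₂.ext t.hom_inv_id b.hom_inv_id
  inv_hom_id := Mor₂.ext t.inv_hom_id b.inv_hom_id

/-- Left whiskering in the bicategory of cylinders. -/
def wL (f : X ⟶ Y) {g h : Y ⟶ Z} (η : g ⟶ h) : (f ≫ g) ⟶ (f ≫ h) :=
  Mor₂.mk (Mor.top f ◁ η.top) (Mor.bot f ◁ η.bot) (by
    have e := η.comm
    simp only [comp_cell, comp_top, comp_bot]
    calc
      _ = 𝟙 _ ⊗≫ Mor.top f ◁ Mor.cell g ⊗≫
          (Mor.cell f ▷ Mor.bot g ≫ (X.mor ≫ Mor.bot f) ◁ η.bot) ⊗≫ 𝟙 _ := by bicategory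
      _ = 𝟙 _ ⊗≫ Mor.top f ◁ (Mor.cell g ≫ Y.mor ◁ η.bot) ⊗≫
          Mor.cell f ▷ Mor.bot h ⊗≫ 𝟙 _ := by
        rw [← whisker_exchange]; bicategory
      _ = _ := by rw [e]; bicategory)

/-- Right whiskering in the bicategory of cylinders. -/
def wR {f g : X ⟶ Y} (η : f ⟶ g) (h : Y ⟶ Z) : (f ≫ h) ⟶ (g ≫ h) :=
  Mor₂.mk (η.top ▷ Mor.top h) (η.bot ▷ Mor.bot h) (by
    have e := η.comm
    simp only [comp_cell, comp_top, comp_bot]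
    calc
      _ = 𝟙 _ ⊗≫ Mor.top f ◁ Mor.cell h ⊗≫
          (Mor.cell f ≫ X.mor ◁ η.bot) ▷ Mor.bot h ⊗≫ 𝟙 _ := by bicategory
      _ = 𝟙 _ ⊗≫ (Mor.top f ◁ Mor.cell h ≫ η.top ▷ (Y.mor ≫ Mor.bot h)) ⊗≫
          Mor.cell g ▷ Mor.bot h ⊗≫ 𝟙 _ := by rw [e]; bicategory
      _ = _ := by rw [whisker_exchange]; bicategory)

/-- The associator of the bicategory of cylinders. -/
def assocIso {T : Cyl C} (f : X ⟶ Y) (g : Y ⟶ Z) (h : Z ⟶ T) : (f ≫ g) ≫ h ≅ f ≫ (g ≫ h) :=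
  mkIso (α_ (Mor.top f) (Mor.top g) (Mor.top h)) (α_ (Mor.bot f) (Mor.bot g) (Mor.bot h)) (by
    simp only [comp_cell, comp_top, comp_bot]; bicategory)

/-- The left unitor of the bicategory of cylinders. -/
def leftIso (f : X ⟶ Y) : 𝟙 X ≫ f ≅ f :=
  mkIso (λ_ (Mor.top f)) (λ_ (Mor.bot f)) (by
    simp only [comp_cell, comp_top, comp_bot, id_top, id_bot, id_cell]; bicategory)

/-- The right unitor of the bicategory of cylinders. -/
def rightIso (f : X ⟶ Y) : f ≫ 𝟙 Y ≅ f :=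
  mkIso (ρ_ (Mor.top f)) (ρ_ (Mor.bot f)) (by
    simp only [comp_cell, comp_top, comp_bot, id_top, id_bot, id_cell]; bicategory)

/-- The bicategory of cylinders. -/
instance : Bicategory (Cyl C) where
  whiskerLeft f _ _ η := wL f η
  whiskerRight η h := wR η h
  associator f g h := assocIso f g h
  leftUnitor f := leftIso f
  rightUnitor f := rightIso f
  whiskerLeft_id f g := hom₂_ext (Bicategory.whiskerLeft_id _ _) (Bicategory.whiskerLeft_id _ _)
  whiskerLeft_comp f _ _ _ η θ :=
    hom₂_ext (Bicategory.whiskerLeft_comp _ _ _) (Bicategory.whiskerLeft_comp _ _ _)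
  id_whiskerLeft η := hom₂_ext (Bicategory.id_whiskerLeft _) (Bicategory.id_whiskerLeft _)
  comp_whiskerLeft f g _ _ η :=
    hom₂_ext (Bicategory.comp_whiskerLeft _ _ _) (Bicategory.comp_whiskerLeft _ _ _)
  id_whiskerRight f g := hom₂_ext (Bicategory.id_whiskerRight _ _) (Bicategory.id_whiskerRight _ _)
  comp_whiskerRight η θ i :=
    hom₂_ext (Bicategory.comp_whiskerRight _ _ _) (Bicategory.comp_whiskerRight _ _ _)
  whiskerRight_id η := hom₂_ext (Bicategory.whiskerRight_id _) (Bicategory.whiskerRight_id _)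
  whiskerRight_comp η g h :=
    hom₂_ext (Bicategory.whiskerRight_comp _ _ _) (Bicategory.whiskerRight_comp _ _ _)
  whisker_assoc f _ _ η h :=
    hom₂_ext (Bicategory.whisker_assoc _ _ _) (Bicategory.whisker_assoc _ _ _)
  whisker_exchange η θ :=
    hom₂_ext (Bicategory.whisker_exchange _ _) (Bicategory.whisker_exchange _ _)
  pentagon f g h i := hom₂_ext (Bicategory.pentagon _ _ _ _) (Bicategory.pentagon _ _ _ _)
  triangle f g := hom₂_ext (Bicategory.triangle _ _) (Bicategory.triangle _ _)

end Cyl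

/-- The pseudofunctor to the bicategory of cylinders associated to a pseudonatural
transformation. -/
def cylinderOf {A : Type u₁} [Bicategory.{w₁, v₁} A] {P Q : A ⥤ᵖ C}
    (κ : Pseudofunctor.StrongTrans P Q) : A ⥤ᵖ Cyl C where
  obj a := ⟨P.obj a, Q.obj a, κ.app a⟩
  map f := Cyl.Mor.mk (P.map f) (Q.map f) (κ.naturality f).hom
  map₂ η := Cyl.Mor₂.mk (P.map₂ η) (Q.map₂ η) (κ.naturality_naturality η).symm
  map₂_id f := Cyl.hom₂_ext (P.map₂_id f) (Q.map₂_id f)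
  map₂_comp η θ := Cyl.hom₂_ext (P.map₂_comp η θ) (Q.map₂_comp η θ)
  mapId a := Cyl.mkIso (P.mapId a) (Q.mapId a) (κ.naturality_id a)
  mapComp f g := Cyl.mkIso (P.mapComp f g) (Q.mapComp f g) (κ.naturality_comp f g)
  map₂_whisker_left f _ _ η :=
    Cyl.hom₂_ext (P.map₂_whisker_left f η) (Q.map₂_whisker_left f η)
  map₂_whisker_right η h :=
    Cyl.hom₂_ext (P.map₂_whisker_right η h) (Q.map₂_whisker_right η h)
  map₂_associator f g h := Cyl.hom₂_ext (P.map₂_associator f g h) (Q.map₂_associator f g h)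
  map₂_left_unitor f := Cyl.hom₂_ext (P.map₂_left_unitor f) (Q.map₂_left_unitor f)
  map₂_right_unitor f := Cyl.hom₂_ext (P.map₂_right_unitor f) (Q.map₂_right_unitor f)

end General

section Fractions

variable {C : Type u} [Bicategory.{w, v} C]

/-! ### Right bicalculus of fractions

Composition is written in diagrammatic order: `f ≫ g` is `g ∘ f`. -/

/-- `β` is a lift of `α : w ∘ f₁ ⟹ w ∘ f₂` along `w`, after precomposition with `v`: up to
associators, `α * v = w * β`. -/
def IsLift {a b c d : C} {w : b ⟶ a} {f₁ f₂ : c ⟶ b} (α : f₁ ≫ w ⟶ f₂ ≫ w) (v : d ⟶ c)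
    (β : v ≫ f₁ ⟶ v ≫ f₂) : Prop :=
  v ◁ α = (α_ v f₁ w).inv ≫ β ▷ w ≫ (α_ v f₂ w).hom

/-- The axioms (BF1)–(BF5) of a right bicalculus of fractions. -/
structure BF (W : MorphismProperty C) : Prop where
  bf1 : ∀ a : C, W (𝟙 a)
  bf2 : ∀ {a b c : C} (f : a ⟶ b) (g : b ⟶ c), W f → W g → W (f ≫ g)
  bf3 : ∀ {a b c : C} (w : a ⟶ b) (f : c ⟶ b), W w →
    ∃ (d : C) (w' : d ⟶ c) (f' : d ⟶ a), W w' ∧ Nonempty (w' ≫ f ≅ f' ≫ w)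
  bf4ab : ∀ {a b c : C} (w : b ⟶ a) (f₁ f₂ : c ⟶ b) (α : f₁ ≫ w ⟶ f₂ ≫ w), W w →
    ∃ (d : C) (v : d ⟶ c) (β : v ≫ f₁ ⟶ v ≫ f₂),
      W v ∧ IsLift α v β ∧ (IsIso α → IsIso β)
  bf4c : ∀ {a b c : C} (w : b ⟶ a) (f₁ f₂ : c ⟶ b) (α : f₁ ≫ w ⟶ f₂ ≫ w), W w →
    ∀ (d : C) (v : d ⟶ c) (β : v ≫ f₁ ⟶ v ≫ f₂)
      (d' : C) (v' : d' ⟶ c) (β' : v' ≫ f₁ ⟶ v' ≫ f₂),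
      W v → IsLift α v β → W v' → IsLift α v' β' →
      ∃ (e : C) (z : e ⟶ d) (z' : e ⟶ d') (ζ : z ≫ v ≅ z' ≫ v'), W (z ≫ v) ∧
        (α_ z v f₁).hom ≫ z ◁ β ≫ (α_ z v f₂).inv ≫ ζ.hom ▷ f₂ =
          ζ.hom ▷ f₁ ≫ (α_ z' v' f₁).hom ≫ z' ◁ β' ≫ (α_ z' v' f₂).inv
  bf5 : ∀ {a b : C} (f g : a ⟶ b), (f ≅ g) → W g → W f

/-- The right saturation of a class of morphisms. -/
def saturation (W : MorphismProperty C) : MorphismProperty C := fun b _ f =>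
  ∃ (c d : C) (g : c ⟶ b) (h : d ⟶ c), W (g ≫ f) ∧ W (h ≫ g)

/-- A square filled by an invertible 2-morphism `f ∘ fst ⟹ v ∘ snd`, with `fst` in `W`. -/
structure Square (W : MorphismProperty C) {a b c : C} (f : a ⟶ b) (v : c ⟶ b) where
  apex : C
  fst : apex ⟶ a
  snd : apex ⟶ c
  fst_mem : W fst
  iso : fst ≫ f ≅ snd ≫ v

/-- A set of choices of squares, as needed to define the composition of fractions. -/
structure Choices (W : MorphismProperty C) where
  square : ∀ {a b c : C} (f : a ⟶ b) (v : c ⟶ b), W v → Square W f v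
  square_id_left : ∀ {b c : C} (v : c ⟶ b) (hv : W v), square (𝟙 b) v hv =
    { apex := c, fst := v, snd := 𝟙 c, fst_mem := hv, iso := ρ_ v ≪≫ (λ_ v).symm }
  square_id_right : ∀ {a b : C} (f : a ⟶ b) (ha : W (𝟙 a)) (hb : W (𝟙 b)),
    square f (𝟙 b) hb =
      { apex := a, fst := 𝟙 a, snd := f, fst_mem := ha, iso := λ_ f ≪≫ (ρ_ f).symm }

/-- The morphisms `a ⟶ b` of the bicategory of fractions: triples `(apex, left, right)` with
`left` in `W`. -/
structure Roof (W : MorphismProperty C) (a b : C) where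
  apex : C
  left : apex ⟶ a
  right : apex ⟶ b
  left_mem : W left

/-- Representatives `(apex, p, q, α, β)` of the 2-morphisms of the bicategory of fractions
(that `q ≫ s.left` is in `W` as well follows from (BF5)). -/
structure PreCell {W : MorphismProperty C} {a b : C} (r s : Roof W a b) where
  apex : C
  p : apex ⟶ r.apex
  q : apex ⟶ s.apex
  p_mem : W (p ≫ r.left)
  α : p ≫ r.left ≅ q ≫ s.left
  β : p ≫ r.right ⟶ q ≫ s.right

/-- Two representatives are identified if they agree on a common refinement. -/
def PreCell.Rel {W : MorphismProperty C} {a b : C} {r s : Roof W a b} (x y : PreCell r s) :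
    Prop :=
  ∃ (e : C) (z : e ⟶ x.apex) (z' : e ⟶ y.apex) (σ : z ≫ x.p ≅ z' ≫ y.p)
    (τ : z ≫ x.q ≅ z' ≫ y.q), W (z ≫ x.p ≫ r.left) ∧
    z ◁ x.α.hom ≫ (α_ _ _ _).inv ≫ τ.hom ▷ s.left ≫ (α_ _ _ _).hom =
      (α_ _ _ _).inv ≫ σ.hom ▷ r.left ≫ (α_ _ _ _).hom ≫ z' ◁ y.α.hom ∧
    z ◁ x.β ≫ (α_ _ _ _).inv ≫ τ.hom ▷ s.right ≫ (α_ _ _ _).hom =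
      (α_ _ _ _).inv ≫ σ.hom ▷ r.right ≫ (α_ _ _ _).hom ≫ z' ◁ y.β

/-- The 2-morphisms of the bicategory of fractions. -/
def Cell {W : MorphismProperty C} {a b : C} (r s : Roof W a b) : Type _ :=
  Quot (PreCell.Rel (r := r) (s := s))

/-- The class of a representative. -/
def Cell.mk {W : MorphismProperty C} {a b : C} {r s : Roof W a b} (x : PreCell r s) : Cell r s :=
  Quot.mk _ x

variable {W : MorphismProperty C}

namespace BF

theorem lift_iso (hW : BF W) {a b c : C} (w : b ⟶ a) (hw : W w) {f₁ f₂ : c ⟶ b} (α : f₁ ≫ w ≅ f₂ ≫ w) :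
    ∃ (d : C) (v : d ⟶ c) (β : v ≫ f₁ ≅ v ≫ f₂), W v ∧
      v ◁ α.hom = (α_ v f₁ w).inv ≫ β.hom ▷ w ≫ (α_ v f₂ w).hom := by
  obtain ⟨d, v, β, hv, h, hi⟩ := hW.bf4ab w f₁ f₂ α.hom hw
  have : IsIso β := hi inferInstance
  exact ⟨d, v, asIso β, hv, h⟩

/-- Completion of a cospan `f, v` to a square, where only `w ∘ v` is in `W`, for some `w` in
`W`. -/
theorem square_of_comp (hW : BF W) {a b c e : C} (f : a ⟶ b) (v : c ⟶ b) (w : b ⟶ e) (hw : W w)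
    (hv : W (v ≫ w)) :
    ∃ (d : C) (m : d ⟶ a) (n : d ⟶ c), W m ∧ Nonempty (m ≫ f ≅ n ≫ v) := by
  obtain ⟨d, m, n, hm, ⟨i⟩⟩ := hW.bf3 (v ≫ w) (f ≫ w) hv
  obtain ⟨d', r, β, hr, -⟩ := hW.lift_iso w hw (f₁ := m ≫ f) (f₂ := n ≫ v)
    (α_ _ _ _ ≪≫ i ≪≫ (α_ _ _ _).symm)
  exact ⟨d', r ≫ m, r ≫ n, hW.bf2 _ _ hr hm, ⟨α_ _ _ _ ≪≫ β ≪≫ (α_ _ _ _).symm⟩⟩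

end BF

/-- The square chosen for a composable pair of roofs. -/
abbrev Choices.sq (𝒞 : Choices W) {a b c : C} (f : Roof W a b) (g : Roof W b c) :
    Square W f.right g.left :=
  𝒞.square f.right g.left g.left_mem

/-- The composite of two roofs along a square. -/
def Roof.comp (hW : BF W) {a b c : C} (f : Roof W a b) (g : Roof W b c)
    (S : Square W f.right g.left) : Roof W a c where
  apex := S.apex
  left := S.fst ≫ f.left
  right := S.snd ≫ g.right
  left_mem := hW.bf2 _ _ S.fst_mem f.left_mem

/-- The roof `(a, 𝟙 a, f)`. -/
def Roof.ofMor (hW : BF W) {a b : C} (f : a ⟶ b) : Roof W a b where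
  apex := a
  left := 𝟙 a
  right := f
  left_mem := hW.bf1 a

/-- The representative `(r.apex, 𝟙, 𝟙, 1, 1)` of the identity of `r`. -/
def PreCell.id (hW : BF W) {a b : C} (r : Roof W a b) : PreCell r r where
  apex := r.apex
  p := 𝟙 _
  q := 𝟙 _
  p_mem := hW.bf2 _ _ (hW.bf1 _) r.left_mem
  α := Iso.refl _
  β := 𝟙 _

/-! #### Vertical composition -/

/-- Auxiliary data for the vertical composition of two representatives. -/
structure VFiller {a b : C} {r s t : Roof W a b} (x : PreCell r s) (y : PreCell s t) where
  apex : C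
  m : apex ⟶ x.apex
  n : apex ⟶ y.apex
  mem : W (m ≫ x.p ≫ r.left)
  γ : m ≫ x.q ≅ n ≫ y.p

theorem VFiller.exists (hW : BF W) {a b : C} {r s t : Roof W a b} (x : PreCell r s)
    (y : PreCell s t) : Nonempty (VFiller x y) := by
  obtain ⟨d, m, n, hm, ⟨i⟩⟩ := hW.square_of_comp x.q y.p s.left s.left_mem y.p_mem
  exact ⟨⟨d, m, n, hW.bf2 _ _ hm x.p_mem, i⟩⟩

/-- The representative of a vertical composition given by the auxiliary data `k`. -/
def VFiller.cell (hW : BF W) {a b : C} {r s t : Roof W a b} {x : PreCell r s} {y : PreCell s t}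
    (k : VFiller x y) : PreCell r t where
  apex := k.apex
  p := k.m ≫ x.p
  q := k.n ≫ y.q
  p_mem := hW.bf5 _ _ (α_ _ _ _) k.mem
  α := α_ _ _ _ ≪≫ whiskerLeftIso k.m x.α ≪≫ (α_ _ _ _).symm ≪≫ whiskerRightIso k.γ s.left ≪≫
    α_ _ _ _ ≪≫ whiskerLeftIso k.n y.α ≪≫ (α_ _ _ _).symm
  β := (α_ _ _ _).hom ≫ k.m ◁ x.β ≫ (α_ _ _ _).inv ≫ k.γ.hom ▷ s.right ≫
    (α_ _ _ _).hom ≫ k.n ◁ y.β ≫ (α_ _ _ _).inv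

/-! #### Left whiskering -/

/-- Auxiliary data for the whiskering of the class of `y : g ⟹ h` with the roof `f`. -/
structure LFiller {a b c : C} (f : Roof W a b) {g h : Roof W b c} (y : PreCell g h)
    (S : Square W f.right g.left) (T : Square W f.right h.left) where
  apex : C
  m : apex ⟶ S.apex
  n : apex ⟶ T.apex
  k : apex ⟶ y.apex
  mem : W (m ≫ S.fst ≫ f.left)
  σ : m ≫ S.fst ≅ n ≫ T.fst
  τ₁ : m ≫ S.snd ≅ k ≫ y.p
  τ₂ : k ≫ y.q ≅ n ≫ T.snd
  comm : m ◁ S.iso.hom ⊗≫ τ₁.hom ▷ g.left ⊗≫ k ◁ y.α.hom ⊗≫ τ₂.hom ▷ h.left =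
    𝟙 _ ⊗≫ σ.hom ▷ f.right ⊗≫ n ◁ T.iso.hom ⊗≫ 𝟙 _

theorem LFiller.exists (hW : BF W) {a b c : C} (f : Roof W a b) {g h : Roof W b c}
    (y : PreCell g h) (S : Square W f.right g.left) (T : Square W f.right h.left) :
    Nonempty (LFiller f y S T) := by
  obtain ⟨d, m, k, hm, ⟨τ₁⟩⟩ := hW.square_of_comp S.snd y.p g.left g.left_mem y.p_mem
  obtain ⟨d₁, z, n, hz, ⟨σ⟩⟩ := hW.bf3 T.fst (m ≫ S.fst) T.fst_mem
  let A : (k ≫ y.q) ≫ h.left ≅ m ≫ S.fst ≫ f.right :=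
    α_ _ _ _ ≪≫ whiskerLeftIso k y.α.symm ≪≫ (α_ _ _ _).symm ≪≫
      whiskerRightIso τ₁.symm g.left ≪≫ α_ _ _ _ ≪≫ whiskerLeftIso m S.iso.symm
  have hA : m ◁ S.iso.hom ⊗≫ τ₁.hom ▷ g.left ⊗≫ k ◁ y.α.hom = A.inv ⊗≫ 𝟙 _ := by
    simp only [A, Iso.trans_inv, Iso.symm_inv, whiskerLeftIso_inv, whiskerRightIso_inv]
    bicategory
  clear_value A
  let Θ : (z ≫ k ≫ y.q) ≫ h.left ≅ (n ≫ T.snd) ≫ h.left :=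
    α_ _ _ _ ≪≫ whiskerLeftIso z A ≪≫
      whiskerLeftIso z (α_ _ _ _).symm ≪≫ (α_ _ _ _).symm ≪≫ whiskerRightIso σ f.right ≪≫
      α_ _ _ _ ≪≫ whiskerLeftIso n T.iso ≪≫ (α_ _ _ _).symm
  obtain ⟨e, v, β, hv, hβ⟩ := hW.lift_iso h.left h.left_mem Θ
  refine ⟨⟨e, v ≫ z ≫ m, v ≫ n, v ≫ z ≫ k, ?_,
    α_ _ _ _ ≪≫ whiskerLeftIso v (α_ _ _ _ ≪≫ σ) ≪≫ (α_ _ _ _).symm,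
    α_ _ _ _ ≪≫ whiskerLeftIso v (α_ _ _ _ ≪≫ whiskerLeftIso z τ₁ ≪≫ (α_ _ _ _).symm) ≪≫
      (α_ _ _ _).symm,
    α_ _ _ _ ≪≫ whiskerLeftIso v (α_ _ _ _) ≪≫ β ≪≫ (α_ _ _ _).symm, ?_⟩⟩
  · exact hW.bf2 _ _ (hW.bf2 _ _ hv (hW.bf2 _ _ hz hm)) (hW.bf2 _ _ S.fst_mem f.left_mem)
  · calc
      _ = 𝟙 _ ⊗≫ v ◁ z ◁ (m ◁ S.iso.hom ⊗≫ τ₁.hom ▷ g.left ⊗≫ k ◁ y.α.hom) ⊗≫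
          ((α_ v _ h.left).inv ≫ β.hom ▷ h.left ≫ (α_ v _ h.left).hom) ⊗≫ 𝟙 _ := by
        simp only [Iso.trans_hom, Iso.symm_hom, whiskerLeftIso_hom]
        bicategory
      _ = 𝟙 _ ⊗≫ v ◁ z ◁ (A.inv ≫ A.hom) ⊗≫ v ◁ σ.hom ▷ f.right ⊗≫
          v ◁ n ◁ T.iso.hom ⊗≫ 𝟙 _ := by
        rw [hA, ← hβ]
        simp only [Θ, Iso.trans_hom, Iso.symm_hom, whiskerLeftIso_hom, whiskerRightIso_hom]
        bicategory
      _ = _ := by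
        rw [Iso.inv_hom_id]
        simp only [Iso.trans_hom, Iso.symm_hom, whiskerLeftIso_hom]
        bicategory

/-- The representative of a left whiskering given by the auxiliary data `k`. -/
def LFiller.cell (hW : BF W) {a b c : C} {f : Roof W a b} {g h : Roof W b c} {y : PreCell g h}
    {S : Square W f.right g.left} {T : Square W f.right h.left} (k : LFiller f y S T) :
    PreCell (f.comp hW g S) (f.comp hW h T) where
  apex := k.apex
  p := k.m
  q := k.n
  p_mem := k.mem
  α := (α_ k.m S.fst f.left).symm ≪≫ whiskerRightIso k.σ f.left ≪≫ α_ k.n T.fst f.left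
  β := (α_ k.m S.snd g.right).inv ≫ k.τ₁.hom ▷ g.right ≫ (α_ _ _ _).hom ≫ k.k ◁ y.β ≫
    (α_ _ _ _).inv ≫ k.τ₂.hom ▷ h.right ≫ (α_ k.n T.snd h.right).hom

/-! #### Right whiskering -/

/-- Auxiliary data for the whiskering of the class of `x : f ⟹ g` with the roof `h`. -/
structure RFiller {a b c : C} {f g : Roof W a b} (x : PreCell f g) (h : Roof W b c)
    (S : Square W f.right h.left) (T : Square W g.right h.left) where
  apex : C
  m : apex ⟶ S.apex
  n : apex ⟶ T.apex
  k : apex ⟶ x.apex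
  mem : W (m ≫ S.fst ≫ f.left)
  τ₁ : m ≫ S.fst ≅ k ≫ x.p
  τ₂ : k ≫ x.q ≅ n ≫ T.fst
  σ : m ≫ S.snd ⟶ n ≫ T.snd
  comm : τ₁.hom ▷ f.right ⊗≫ k ◁ x.β ⊗≫ τ₂.hom ▷ g.right ⊗≫ n ◁ T.iso.hom =
    𝟙 _ ⊗≫ m ◁ S.iso.hom ⊗≫ σ ▷ h.left ⊗≫ 𝟙 _

theorem RFiller.exists (hW : BF W) {a b c : C} {f g : Roof W a b} (x : PreCell f g)
    (h : Roof W b c) (S : Square W f.right h.left) (T : Square W g.right h.left) :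
    Nonempty (RFiller x h S T) := by
  obtain ⟨d, k, m, hk, ⟨τ₁⟩⟩ := hW.bf3 S.fst x.p S.fst_mem
  obtain ⟨d₁, z, n, hz, ⟨τ₂⟩⟩ := hW.bf3 T.fst (k ≫ x.q) T.fst_mem
  let A : m ≫ S.snd ≫ h.left ≅ k ≫ x.p ≫ f.right :=
    whiskerLeftIso m S.iso.symm ≪≫ (α_ _ _ _).symm ≪≫ whiskerRightIso τ₁.symm f.right ≪≫
      α_ _ _ _
  have hA : τ₁.inv ▷ f.right = 𝟙 _ ⊗≫ m ◁ S.iso.hom ⊗≫ A.hom ⊗≫ 𝟙 _ := by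
    have : S.iso.hom ≫ S.iso.inv = 𝟙 _ := S.iso.hom_inv_id
    simp only [A, Iso.trans_hom, Iso.symm_hom, whiskerLeftIso_hom, whiskerRightIso_hom]
    calc
      _ = 𝟙 _ ⊗≫ m ◁ (S.iso.hom ≫ S.iso.inv) ⊗≫ τ₁.inv ▷ f.right ⊗≫ 𝟙 _ := by
        rw [this]; bicategory
      _ = _ := by bicategory
  clear_value A
  let Θ : (z ≫ m ≫ S.snd) ≫ h.left ⟶ (n ≫ T.snd) ≫ h.left :=
    (α_ _ _ _).hom ≫ z ◁ ((α_ _ _ _).hom ≫ A.hom ≫ k ◁ x.β ≫ (α_ _ _ _).inv) ≫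
      (α_ _ _ _).inv ≫ τ₂.hom ▷ g.right ≫ (α_ _ _ _).hom ≫ n ◁ T.iso.hom ≫ (α_ _ _ _).inv
  obtain ⟨e, v, β, hv, hβ, -⟩ := hW.bf4ab h.left (z ≫ m ≫ S.snd) (n ≫ T.snd) Θ h.left_mem
  refine ⟨⟨e, v ≫ z ≫ m, v ≫ n, v ≫ z ≫ k, ?_,
    α_ _ _ _ ≪≫ whiskerLeftIso v (α_ _ _ _ ≪≫ whiskerLeftIso z τ₁.symm ≪≫ (α_ _ _ _).symm) ≪≫
      (α_ _ _ _).symm,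
    α_ _ _ _ ≪≫ whiskerLeftIso v (α_ _ _ _ ≪≫ τ₂) ≪≫ (α_ _ _ _).symm,
    (α_ _ _ _).hom ≫ v ◁ (α_ _ _ _).hom ≫ β ≫ (α_ _ _ _).inv, ?_⟩⟩
  · refine hW.bf5 _ (v ≫ z ≫ k ≫ x.p ≫ f.left) ?_
      (hW.bf2 _ _ hv (hW.bf2 _ _ hz (hW.bf2 _ _ hk x.p_mem)))
    exact α_ _ _ _ ≪≫ whiskerLeftIso v (α_ _ _ _ ≪≫ whiskerLeftIso z ((α_ _ _ _).symm ≪≫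
      whiskerRightIso τ₁.symm f.left ≪≫ α_ _ _ _))
  · calc
      _ = 𝟙 _ ⊗≫ v ◁ (z ◁ (τ₁.inv ▷ f.right ⊗≫ k ◁ x.β) ⊗≫ τ₂.hom ▷ g.right ⊗≫
          n ◁ T.iso.hom) ⊗≫ 𝟙 _ := by
        simp only [Iso.trans_hom, Iso.symm_hom, whiskerLeftIso_hom]
        bicategory
      _ = 𝟙 _ ⊗≫ v ◁ z ◁ m ◁ S.iso.hom ⊗≫ v ◁ Θ ⊗≫ 𝟙 _ := by
        rw [hA]
        simp only [Θ]
        bicategory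
      _ = _ := by
        rw [hβ]
        bicategory

/-- The representative of a right whiskering given by the auxiliary data `k`. -/
def RFiller.cell (hW : BF W) {a b c : C} {f g : Roof W a b} {x : PreCell f g} {h : Roof W b c}
    {S : Square W f.right h.left} {T : Square W g.right h.left} (k : RFiller x h S T) :
    PreCell (f.comp hW h S) (g.comp hW h T) where
  apex := k.apex
  p := k.m
  q := k.n
  p_mem := k.mem
  α := (α_ k.m S.fst f.left).symm ≪≫ whiskerRightIso k.τ₁ f.left ≪≫ α_ _ _ _ ≪≫
    whiskerLeftIso k.k x.α ≪≫ (α_ _ _ _).symm ≪≫ whiskerRightIso k.τ₂ g.left ≪≫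
    α_ k.n T.fst g.left
  β := (α_ k.m S.snd h.right).inv ≫ k.σ ▷ h.right ≫ (α_ k.n T.snd h.right).hom

/-! #### Associators -/

/-- Auxiliary data for the associator of the roofs `f`, `g`, `h`, where `S₁`, `S₂` are the squares
used to compose `(f ≫ g) ≫ h` and `T₁`, `T₂` those used to compose `f ≫ (g ≫ h)`. -/
structure AFiller {a b c d : C} (f : Roof W a b) (g : Roof W b c) (h : Roof W c d)
    (S₁ : Square W f.right g.left) (S₂ : Square W (S₁.snd ≫ g.right) h.left)
    (T₁ : Square W g.right h.left) (T₂ : Square W f.right (T₁.fst ≫ g.left)) where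
  apex : C
  m : apex ⟶ S₂.apex
  n : apex ⟶ T₂.apex
  mem : W (m ≫ S₂.fst ≫ S₁.fst ≫ f.left)
  σ₁ : m ≫ S₂.fst ≫ S₁.fst ≅ n ≫ T₂.fst
  σ₂ : m ≫ S₂.fst ≫ S₁.snd ≅ n ≫ T₂.snd ≫ T₁.fst
  σ₃ : m ≫ S₂.snd ≅ n ≫ T₂.snd ≫ T₁.snd
  comm₁ : m ◁ S₂.fst ◁ S₁.iso.hom ⊗≫ σ₂.hom ▷ g.left =
    𝟙 _ ⊗≫ σ₁.hom ▷ f.right ⊗≫ n ◁ T₂.iso.hom ⊗≫ 𝟙 _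
  comm₂ : m ◁ S₂.iso.hom ⊗≫ σ₃.hom ▷ h.left =
    𝟙 _ ⊗≫ σ₂.hom ▷ g.right ⊗≫ n ◁ T₂.snd ◁ T₁.iso.hom ⊗≫ 𝟙 _

theorem AFiller.exists (hW : BF W) {a b c d : C} (f : Roof W a b) (g : Roof W b c)
    (h : Roof W c d) (S₁ : Square W f.right g.left)
    (S₂ : Square W (S₁.snd ≫ g.right) h.left) (T₁ : Square W g.right h.left)
    (T₂ : Square W f.right (T₁.fst ≫ g.left)) :
    Nonempty (AFiller f g h S₁ S₂ T₁ T₂) := by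
  obtain ⟨d₀, m, n, hm, ⟨σ₁⟩⟩ := hW.bf3 T₂.fst (S₂.fst ≫ S₁.fst) T₂.fst_mem
  let Θ : (m ≫ S₂.fst ≫ S₁.snd) ≫ g.left ≅ (n ≫ T₂.snd ≫ T₁.fst) ≫ g.left :=
    α_ _ _ _ ≪≫ whiskerLeftIso m (α_ _ _ _ ≪≫ whiskerLeftIso S₂.fst S₁.iso.symm ≪≫
      (α_ _ _ _).symm) ≪≫ (α_ _ _ _).symm ≪≫ whiskerRightIso σ₁ f.right ≪≫ α_ _ _ _ ≪≫
      whiskerLeftIso n T₂.iso ≪≫ whiskerLeftIso n (α_ _ _ _).symm ≪≫ (α_ _ _ _).symm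
  obtain ⟨d₁, r, β, hr, hβ⟩ := hW.lift_iso g.left g.left_mem Θ
  let Φ : (r ≫ m ≫ S₂.snd) ≫ h.left ≅ (r ≫ n ≫ T₂.snd ≫ T₁.snd) ≫ h.left :=
    α_ _ _ _ ≪≫ whiskerLeftIso r (α_ _ _ _ ≪≫ whiskerLeftIso m (S₂.iso.symm ≪≫
      (α_ _ _ _).symm) ≪≫ (α_ _ _ _).symm) ≪≫ (α_ _ _ _).symm ≪≫ whiskerRightIso β g.right ≪≫
      α_ _ _ _ ≪≫ whiskerLeftIso r (α_ _ _ _ ≪≫ whiskerLeftIso n (α_ _ _ _ ≪≫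
        whiskerLeftIso T₂.snd T₁.iso ≪≫ (α_ _ _ _).symm) ≪≫ (α_ _ _ _).symm) ≪≫ (α_ _ _ _).symm
  obtain ⟨e, v, δ, hv, hδ⟩ := hW.lift_iso h.left h.left_mem Φ
  have e₁ : S₁.iso.hom ≫ S₁.iso.inv = 𝟙 _ := S₁.iso.hom_inv_id
  have e₂ : S₂.iso.hom ≫ S₂.iso.inv = 𝟙 _ := S₂.iso.hom_inv_id
  refine ⟨⟨e, v ≫ r ≫ m, v ≫ r ≫ n, ?_,
    α_ _ _ _ ≪≫ whiskerLeftIso v (α_ _ _ _ ≪≫ whiskerLeftIso r σ₁ ≪≫ (α_ _ _ _).symm) ≪≫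
      (α_ _ _ _).symm,
    α_ _ _ _ ≪≫ whiskerLeftIso v (α_ _ _ _ ≪≫ β ≪≫ (α_ _ _ _).symm) ≪≫ (α_ _ _ _).symm,
    α_ _ _ _ ≪≫ whiskerLeftIso v (α_ _ _ _) ≪≫ δ ≪≫ whiskerLeftIso v (α_ _ _ _).symm ≪≫
      (α_ _ _ _).symm, ?_, ?_⟩⟩
  · exact hW.bf2 _ _ (hW.bf2 _ _ hv (hW.bf2 _ _ hr hm))
      (hW.bf2 _ _ S₂.fst_mem (hW.bf2 _ _ S₁.fst_mem f.left_mem))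
  · calc
      _ = 𝟙 _ ⊗≫ v ◁ (r ◁ m ◁ S₂.fst ◁ S₁.iso.hom ⊗≫
          ((α_ r _ g.left).inv ≫ β.hom ▷ g.left ≫ (α_ r _ g.left).hom)) ⊗≫ 𝟙 _ := by
        simp only [Iso.trans_hom, Iso.symm_hom, whiskerLeftIso_hom]
        bicategory
      _ = 𝟙 _ ⊗≫ v ◁ r ◁ (m ◁ S₂.fst ◁ (S₁.iso.hom ≫ S₁.iso.inv) ⊗≫ σ₁.hom ▷ f.right ⊗≫
          n ◁ T₂.iso.hom) ⊗≫ 𝟙 _ := by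
        rw [← hβ]
        simp only [Θ, Iso.trans_hom, Iso.symm_hom, whiskerLeftIso_hom, whiskerRightIso_hom]
        bicategory
      _ = _ := by
        rw [e₁]
        simp only [Iso.trans_hom, Iso.symm_hom, whiskerLeftIso_hom]
        bicategory
  · calc
      _ = 𝟙 _ ⊗≫ v ◁ r ◁ m ◁ S₂.iso.hom ⊗≫
          ((α_ v _ h.left).inv ≫ δ.hom ▷ h.left ≫ (α_ v _ h.left).hom) ⊗≫ 𝟙 _ := by
        simp only [Iso.trans_hom, Iso.symm_hom, whiskerLeftIso_hom]
        bicategory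
      _ = 𝟙 _ ⊗≫ v ◁ (r ◁ m ◁ (S₂.iso.hom ≫ S₂.iso.inv) ⊗≫ β.hom ▷ g.right ⊗≫
          r ◁ n ◁ T₂.snd ◁ T₁.iso.hom) ⊗≫ 𝟙 _ := by
        rw [← hδ]
        simp only [Φ, Iso.trans_hom, Iso.symm_hom, whiskerLeftIso_hom, whiskerRightIso_hom]
        bicategory
      _ = _ := by
        rw [e₂]
        simp only [Iso.trans_hom, Iso.symm_hom, whiskerLeftIso_hom]
        bicategory

/-- The representative of an associator given by the auxiliary data `k`. -/
def AFiller.cell (hW : BF W) {a b c d : C} {f : Roof W a b} {g : Roof W b c} {h : Roof W c d}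
    {S₁ : Square W f.right g.left} {S₂ : Square W (S₁.snd ≫ g.right) h.left}
    {T₁ : Square W g.right h.left} {T₂ : Square W f.right (T₁.fst ≫ g.left)}
    (k : AFiller f g h S₁ S₂ T₁ T₂) :
    PreCell ((f.comp hW g S₁).comp hW h S₂) (f.comp hW (g.comp hW h T₁) T₂) where
  apex := k.apex
  p := k.m
  q := k.n
  p_mem := k.mem
  α := (show k.m ≫ S₂.fst ≫ S₁.fst ≫ f.left ≅ k.n ≫ T₂.fst ≫ f.left from
    whiskerLeftIso k.m (α_ _ _ _).symm ≪≫ (α_ _ _ _).symm ≪≫ whiskerRightIso k.σ₁ f.left ≪≫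
      α_ _ _ _)
  β := (show k.m ≫ S₂.snd ≫ h.right ⟶ k.n ≫ T₂.snd ≫ T₁.snd ≫ h.right from
    (α_ _ _ _).inv ≫ k.σ₃.hom ▷ h.right ≫ (α_ _ _ _).hom ≫ k.n ◁ (α_ _ _ _).hom)

/-- The representative of the inverse of an associator given by the auxiliary data `k`. -/
def AFiller.invCell (hW : BF W) {a b c d : C} {f : Roof W a b} {g : Roof W b c} {h : Roof W c d}
    {S₁ : Square W f.right g.left} {S₂ : Square W (S₁.snd ≫ g.right) h.left}
    {T₁ : Square W g.right h.left} {T₂ : Square W f.right (T₁.fst ≫ g.left)}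
    (k : AFiller f g h S₁ S₂ T₁ T₂) :
    PreCell (f.comp hW (g.comp hW h T₁) T₂) ((f.comp hW g S₁).comp hW h S₂) where
  apex := k.apex
  p := k.n
  q := k.m
  p_mem := hW.bf5 _ _ (k.cell hW).α.symm k.mem
  α := (k.cell hW).α.symm
  β := (show k.n ≫ T₂.snd ≫ T₁.snd ≫ h.right ⟶ k.m ≫ S₂.snd ≫ h.right from
    k.n ◁ (α_ _ _ _).inv ≫ (α_ _ _ _).inv ≫ k.σ₃.inv ▷ h.right ≫ (α_ _ _ _).hom)

/-! #### Unitors -/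

/-- The representative of the left unitor of `f`, for a square `S` used to compose `𝟙 ≫ f`. -/
def PreCell.leftHom (hW : BF W) {a b : C} (f : Roof W a b)
    (S : Square W (Roof.ofMor hW (𝟙 a)).right f.left) :
    PreCell ((Roof.ofMor hW (𝟙 a)).comp hW f S) f where
  apex := S.apex
  p := 𝟙 S.apex
  q := S.snd
  p_mem := hW.bf2 _ _ (hW.bf1 _) (Roof.left_mem _)
  α := (show 𝟙 S.apex ≫ S.fst ≫ 𝟙 a ≅ S.snd ≫ f.left from λ_ _ ≪≫ S.iso)
  β := (show 𝟙 S.apex ≫ S.snd ≫ f.right ⟶ S.snd ≫ f.right from (λ_ _).hom)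

/-- The representative of the inverse of the left unitor of `f`. -/
def PreCell.leftInv (hW : BF W) {a b : C} (f : Roof W a b)
    (S : Square W (Roof.ofMor hW (𝟙 a)).right f.left) :
    PreCell f ((Roof.ofMor hW (𝟙 a)).comp hW f S) where
  apex := S.apex
  p := S.snd
  q := 𝟙 S.apex
  p_mem := hW.bf5 _ _ (PreCell.leftHom hW f S).α.symm (PreCell.leftHom hW f S).p_mem
  α := (PreCell.leftHom hW f S).α.symm
  β := (show S.snd ≫ f.right ⟶ 𝟙 S.apex ≫ S.snd ≫ f.right from (λ_ _).inv)

/-- The representative of the right unitor of `f`, for a square `S` used to compose `f ≫ 𝟙`. -/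
def PreCell.rightHom (hW : BF W) {a b : C} (f : Roof W a b)
    (S : Square W f.right (Roof.ofMor hW (𝟙 b)).left) :
    PreCell (f.comp hW (Roof.ofMor hW (𝟙 b)) S) f where
  apex := S.apex
  p := 𝟙 S.apex
  q := S.fst
  p_mem := hW.bf2 _ _ (hW.bf1 _) (Roof.left_mem _)
  α := (show 𝟙 S.apex ≫ S.fst ≫ f.left ≅ S.fst ≫ f.left from λ_ _)
  β := (show 𝟙 S.apex ≫ S.snd ≫ 𝟙 b ⟶ S.fst ≫ f.right from (λ_ _).hom ≫ S.iso.inv)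

/-- The representative of the inverse of the right unitor of `f`. -/
def PreCell.rightInv (hW : BF W) {a b : C} (f : Roof W a b)
    (S : Square W f.right (Roof.ofMor hW (𝟙 b)).left) :
    PreCell f (f.comp hW (Roof.ofMor hW (𝟙 b)) S) where
  apex := S.apex
  p := S.fst
  q := 𝟙 S.apex
  p_mem := hW.bf2 _ _ S.fst_mem f.left_mem
  α := (PreCell.rightHom hW f S).α.symm
  β := (show S.fst ≫ f.right ⟶ 𝟙 S.apex ≫ S.snd ≫ 𝟙 b from S.iso.hom ≫ (λ_ _).inv)

/-! #### The bicategory of fractions -/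

open Classical in
/-- The data of the right bicategory of fractions of `(C, W)`, for a set of choices `𝒞`.
Composites of 2-morphisms and associators are computed with arbitrary representatives and
arbitrary auxiliary data. -/
noncomputable def fractionData (hW : BF W) (𝒞 : Choices W) :
    BicategoryData.{max u v w, max u v} C where
  Hom a b := Roof W a b
  Hom₂ r s := Cell r s
  id₁ a := Roof.ofMor hW (𝟙 a)
  comp₁ f g := f.comp hW g (𝒞.sq f g)
  id₂ r := Cell.mk (PreCell.id hW r)
  comp₂ x y := Cell.mk ((choice (VFiller.exists hW x.out y.out)).cell hW)
  whiskerLeft f _ _ y :=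
    Cell.mk ((choice (LFiller.exists hW f y.out (𝒞.sq f _) (𝒞.sq f _))).cell hW)
  whiskerRight x h :=
    Cell.mk ((choice (RFiller.exists hW x.out h (𝒞.sq _ h) (𝒞.sq _ h))).cell hW)
  assocHom f g h := Cell.mk ((choice (AFiller.exists hW f g h (𝒞.sq f g)
    (𝒞.sq (f.comp hW g (𝒞.sq f g)) h) (𝒞.sq g h) (𝒞.sq f (g.comp hW h (𝒞.sq g h))))).cell hW)
  assocInv f g h := Cell.mk ((choice (AFiller.exists hW f g h (𝒞.sq f g)
    (𝒞.sq (f.comp hW g (𝒞.sq f g)) h) (𝒞.sq g h) (𝒞.sq f (g.comp hW h (𝒞.sq g h))))).invCell hW)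
  leftHom f := Cell.mk (PreCell.leftHom hW f (𝒞.sq _ f))
  leftInv f := Cell.mk (PreCell.leftInv hW f (𝒞.sq _ f))
  rightHom f := Cell.mk (PreCell.rightHom hW f (𝒞.sq f _))
  rightInv f := Cell.mk (PreCell.rightInv hW f (𝒞.sq f _))

/-! #### The universal pseudofunctor -/

/-- The representative `(a, 𝟙, 𝟙, 1, γ * 1)` of the image of the 2-morphism `γ`. -/
def PreCell.ofHom₂ (hW : BF W) {a b : C} {f g : a ⟶ b} (γ : f ⟶ g) :
    PreCell (Roof.ofMor hW f) (Roof.ofMor hW g) where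
  apex := a
  p := 𝟙 a
  q := 𝟙 a
  p_mem := hW.bf2 _ _ (hW.bf1 a) (hW.bf1 a)
  α := Iso.refl _
  β := (show 𝟙 a ≫ f ⟶ 𝟙 a ≫ g from 𝟙 a ◁ γ)

/-- The representative of the comparison of the image of `f ≫ g` with the composite of the images
of `f` and `g`, for a square `S` used to compose the latter. -/
def PreCell.compHom (hW : BF W) {a b c : C} (f : a ⟶ b) (g : b ⟶ c)
    (S : Square W (Roof.ofMor hW f).right (Roof.ofMor hW g).left) :
    PreCell (Roof.ofMor hW (f ≫ g)) ((Roof.ofMor hW f).comp hW (Roof.ofMor hW g) S) where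
  apex := S.apex
  p := S.fst
  q := 𝟙 S.apex
  p_mem := hW.bf2 _ _ S.fst_mem (hW.bf1 a)
  α := (show S.fst ≫ 𝟙 a ≅ 𝟙 S.apex ≫ S.fst ≫ 𝟙 a from (λ_ _).symm)
  β := (show S.fst ≫ f ≫ g ⟶ 𝟙 S.apex ≫ S.snd ≫ g from
    (α_ _ _ _).inv ≫ (S.iso.hom ≫ (ρ_ S.snd).hom) ▷ g ≫ (λ_ _).inv)

/-- The representative of the inverse comparison. -/
def PreCell.compInv (hW : BF W) {a b c : C} (f : a ⟶ b) (g : b ⟶ c)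
    (S : Square W (Roof.ofMor hW f).right (Roof.ofMor hW g).left) :
    PreCell ((Roof.ofMor hW f).comp hW (Roof.ofMor hW g) S) (Roof.ofMor hW (f ≫ g)) where
  apex := S.apex
  p := 𝟙 S.apex
  q := S.fst
  p_mem := hW.bf2 _ _ (hW.bf1 _) (Roof.left_mem _)
  α := (PreCell.compHom hW f g S).α.symm
  β := (show 𝟙 S.apex ≫ S.snd ≫ g ⟶ S.fst ≫ f ≫ g from
    (λ_ _).hom ≫ ((ρ_ S.snd).inv ≫ S.iso.inv) ▷ g ≫ (α_ _ _ _).hom)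

/-- The data of the universal pseudofunctor `C ⥤ᵖ C[W⁻¹]`. -/
noncomputable def universalData (hW : BF W) (𝒞 : Choices W)
    (l : (fractionData hW 𝒞).IsBicategory) :
    PseudofunctorData C (BicategoryData.Carrier l) where
  obj a := ⟨a⟩
  map f := Roof.ofMor hW f
  map₂ γ := Cell.mk (PreCell.ofHom₂ hW γ)
  idHom a := Cell.mk (PreCell.id hW (Roof.ofMor hW (𝟙 a)))
  idInv a := Cell.mk (PreCell.id hW (Roof.ofMor hW (𝟙 a)))
  compHom f g := Cell.mk (PreCell.compHom hW f g (𝒞.sq (Roof.ofMor hW f) (Roof.ofMor hW g)))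
  compInv f g := Cell.mk (PreCell.compInv hW f g (𝒞.sq (Roof.ofMor hW f) (Roof.ofMor hW g)))

/-- The construction of the bicategory of fractions and of the universal pseudofunctor is
lawful. -/
structure IsLawful (hW : BF W) (𝒞 : Choices W) : Prop where
  bicategory : (fractionData hW 𝒞).IsBicategory
  universal : (universalData hW 𝒞 bicategory).IsPseudofunctor

/-- The right bicategory of fractions `C[W⁻¹]` associated to a set of choices. -/
abbrev FractionBicategory {hW : BF W} {𝒞 : Choices W} (l : IsLawful hW 𝒞) :=
  BicategoryData.Carrier l.bicategory

/-- The universal pseudofunctor `C ⥤ᵖ C[W⁻¹]`. -/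
noncomputable def universalPseudofunctor {hW : BF W} {𝒞 : Choices W} (l : IsLawful hW 𝒞) :
    C ⥤ᵖ FractionBicategory l :=
  (universalData hW 𝒞 l.bicategory).toPseudofunctor l.universal

end Fractions

section Induced

variable {A : Type u₁} [Bicategory.{w₁, v₁} A] {B : Type u₂} [Bicategory.{w₂, v₂} B]
variable {WA : MorphismProperty A} {WB : MorphismProperty B}

/-- `F` maps the morphisms in `WA` to morphisms in `WB`. -/
def MapsInto (F : A ⥤ᵖ B) (WA : MorphismProperty A) (WB : MorphismProperty B) : Prop :=
  ∀ ⦃a b : A⦄ (f : a ⟶ b), WA f → WB (F.map f)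

/-- The roof `(F a', F w, F f)`, for a roof `(a', w, f)`. -/
def Roof.image (F : A ⥤ᵖ B) (hF : MapsInto F WA WB) {a b : A} (r : Roof WA a b) :
    Roof WB (F.obj a) (F.obj b) where
  apex := F.obj r.apex
  left := F.map r.left
  right := F.map r.right
  left_mem := hF _ r.left_mem

/-- The representative `(F a₃, F p, F q, ψ ∘ F α ∘ ψ⁻¹, ψ ∘ F β ∘ ψ⁻¹)`, for a representative
`(a₃, p, q, α, β)`, where `ψ` denotes the compositors of `F`. -/
def PreCell.image (hB : BF WB) (F : A ⥤ᵖ B) (hF : MapsInto F WA WB) {a b : A} {r s : Roof WA a b}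
    (x : PreCell r s) : PreCell (r.image F hF) (s.image F hF) where
  apex := F.obj x.apex
  p := F.map x.p
  q := F.map x.q
  p_mem := hB.bf5 _ _ (F.mapComp x.p r.left).symm (hF _ x.p_mem)
  α := (F.mapComp x.p r.left).symm ≪≫ F.map₂Iso x.α ≪≫ F.mapComp x.q s.left
  β := (F.mapComp x.p r.right).inv ≫ F.map₂ x.β ≫ (F.mapComp x.q s.right).hom

theorem image_comm (F : A ⥤ᵖ B) {a b c d e y : A} {z : e ⟶ a} {z' : e ⟶ b} {p : a ⟶ c}
    {q : a ⟶ d} {p' : b ⟶ c} {q' : b ⟶ d} {f : c ⟶ y} {g : d ⟶ y} (α : p ≫ f ⟶ q ≫ g)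
    (α' : p' ≫ f ⟶ q' ≫ g) (σ : z ≫ p ⟶ z' ≫ p') (τ : z ≫ q ⟶ z' ≫ q')
    (h : z ◁ α ≫ (α_ _ _ _).inv ≫ τ ▷ g ≫ (α_ _ _ _).hom =
      (α_ _ _ _).inv ≫ σ ▷ f ≫ (α_ _ _ _).hom ≫ z' ◁ α') :
    F.map z ◁ ((F.mapComp p f).inv ≫ F.map₂ α ≫ (F.mapComp q g).hom) ≫ (α_ _ _ _).inv ≫
        ((F.mapComp z q).inv ≫ F.map₂ τ ≫ (F.mapComp z' q').hom) ▷ F.map g ≫ (α_ _ _ _).hom =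
      (α_ _ _ _).inv ≫ ((F.mapComp z p).inv ≫ F.map₂ σ ≫ (F.mapComp z' p').hom) ▷ F.map f ≫
        (α_ _ _ _).hom ≫
          F.map z' ◁ ((F.mapComp p' f).inv ≫ F.map₂ α' ≫ (F.mapComp q' g).hom) := by
  have k : ∀ {a b c d : A} (f : a ⟶ b) (g : b ⟶ c) (h : c ⟶ d), F.map₂ (α_ f g h).inv =
      (F.mapComp f (g ≫ h)).hom ≫ F.map f ◁ (F.mapComp g h).hom ≫ (α_ _ _ _).inv ≫
        (F.mapComp f g).inv ▷ F.map h ≫ (F.mapComp (f ≫ g) h).inv := by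
    intro _ _ _ _ f g h
    rw [F.mapComp_assoc_right_hom_assoc]
    simp
  have h' := congrArg (fun x => F.map z ◁ (F.mapComp p f).inv ≫ (F.mapComp z (p ≫ f)).inv ≫
    F.map₂ x ≫ (F.mapComp z' (q' ≫ g)).hom ≫ F.map z' ◁ (F.mapComp q' g).hom) h
  simp only [PrelaxFunctor.map₂_comp, Pseudofunctor.map₂_whisker_left,
    Pseudofunctor.map₂_whisker_right, Pseudofunctor.map₂_associator, k, Category.assoc,
    Iso.inv_hom_id_assoc, whiskerLeft_inv_hom_assoc, whiskerLeft_inv_hom, Category.comp_id] at h'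
  simpa only [Bicategory.whiskerLeft_comp, Bicategory.comp_whiskerRight, Category.assoc] using h'

theorem PreCell.Rel.image (hB : BF WB) (F : A ⥤ᵖ B) (hF : MapsInto F WA WB) {a b : A}
    {r s : Roof WA a b} {x y : PreCell r s} (h : PreCell.Rel x y) :
    PreCell.Rel (x.image hB F hF) (y.image hB F hF) := by
  obtain ⟨e, z, z', σ, τ, hz, h₁, h₂⟩ := h
  refine ⟨F.obj e, F.map z, F.map z', (F.mapComp _ _).symm ≪≫ F.map₂Iso σ ≪≫ F.mapComp _ _,
    (F.mapComp _ _).symm ≪≫ F.map₂Iso τ ≪≫ F.mapComp _ _, ?_, ?_, ?_⟩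
  · exact hB.bf5 _ _ (whiskerLeftIso _ (F.mapComp _ _).symm ≪≫ (F.mapComp _ _).symm) (hF _ hz)
  · exact image_comm F _ _ _ _ h₁
  · exact image_comm F _ _ _ _ h₂

/-- The map on 2-morphisms of the bicategories of fractions sending the class of
`(a₃, p, q, α, β)` to the class of `(F a₃, F p, F q, ψ ∘ F α ∘ ψ⁻¹, ψ ∘ F β ∘ ψ⁻¹)`. -/
def Cell.image (hB : BF WB) (F : A ⥤ᵖ B) (hF : MapsInto F WA WB) {a b : A} {r s : Roof WA a b}
    (x : Cell r s) : Cell (r.image F hF) (s.image F hF) :=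
  Quot.map (fun y => y.image hB F hF) (fun _ _ h => h.image hB F hF) x

/-- The action of the induced pseudofunctor on objects, morphisms and 2-morphisms. -/
def inducedStruct {hA : BF WA} {𝒞A : Choices WA} (lA : IsLawful hA 𝒞A)
    {hB : BF WB} {𝒞B : Choices WB} (lB : IsLawful hB 𝒞B) (F : A ⥤ᵖ B) (hF : MapsInto F WA WB) :
    PrelaxFunctorStruct (FractionBicategory lA) (FractionBicategory lB) where
  obj a := ⟨F.obj a.as⟩
  map {a b} r := Roof.image F hF (a := a.as) (b := b.as) r
  map₂ {a b r s} x := Cell.image hB F hF (a := a.as) (b := b.as) (r := r) (s := s) x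

open scoped Pseudofunctor.StrongTrans in
/-- The constructions of `A[WA⁻¹]` and `B[WB⁻¹]` are lawful, and there are a pseudofunctor
`G : A[WA⁻¹] ⥤ᵖ B[WB⁻¹]` and a pseudonatural equivalence `κ` from `U_{WB} ∘ F` to `G ∘ U_{WA}` such
that the pseudofunctor `A ⥤ᵖ Cyl (B[WB⁻¹])` associated to `κ` maps the morphisms in `WA` to internal
equivalences, and such that `G` is given on objects, morphisms and 2-morphisms by the explicit
formulas of `inducedStruct`. -/
def HasExplicitInduced (hA : BF WA) (𝒞A : Choices WA) (hB : BF WB) (𝒞B : Choices WB)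
    (F : A ⥤ᵖ B) (hF : MapsInto F WA WB) : Prop :=
  ∃ (lA : IsLawful hA 𝒞A) (lB : IsLawful hB 𝒞B)
    (G : FractionBicategory lA ⥤ᵖ FractionBicategory lB)
    (κ : F.comp (universalPseudofunctor lB) ⟶ (universalPseudofunctor lA).comp G),
    IsInternalEquivalence κ ∧
    (∀ ⦃a b : A⦄ (f : a ⟶ b), WA f → IsInternalEquivalence ((cylinderOf κ).map f)) ∧
    G.toPrelaxFunctorStruct = inducedStruct lA lB F hF

end Induced

end BicatFrac

/-!
The comparison of bicategories of fractions is reduced to a bicategory in which the morphisms of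
`W` can be cancelled on either side.

Let `Loc hW` be the bicategory with the objects and the morphisms of `C`, whose 2-morphisms `f ⟶ g`
are the 2-morphisms of `C` which exist locally: they are given by compatible 2-morphisms
`z ≫ f ⟶ z ≫ g`, for sufficiently many `z`, and are equal if they agree along some morphism in `W`.
By (BF4), lifts along a morphism in `W` exist locally and are locally unique, and by construction
2-morphisms can be glued along morphisms in `W`. Hence whiskering with a morphism in `W`, on either
side, is bijective on 2-morphisms of `Loc hW` (`Loc.strict`).

In this situation, a roof `(w, f)` from `a` to `b` behaves like a functor on the morphisms
`u : e ⟶ a`, defined only for those `u` that factor through `w` up to an invertible 2-morphism. Such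
a factorisation, with the resulting value `y : e ⟶ b`, is a `Leg`. A 2-morphism `u ⟶ u'` lifts
uniquely along `w`, and thus acts on the values (`Leg.tr`), functorially. A 2-morphism between roofs
induces a natural family of 2-morphisms between their values, a `RoofTrans`. The assignment
`Cell.ev` is a bijection between the 2-morphisms of the bicategory of fractions and the
transformations of roofs of `Loc hW` (`Cell.ev_injective`, `Cell.exists_ev_eq`), and a
transformation is determined by its value on legs over a single morphism in `W`
(`RoofTrans.ext_of_mem`). Moreover, `Cell.ev` turns the operations of the bicategory of fractions,
which are defined by means of choices, into expressions in `Leg.tr` that do not involve the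
auxiliary choices: the legs of a composite of roofs are pairs of legs, the associators and unitors
are the comparison of different legs over the same morphism, and whiskering is evaluation. Therefore
every law of a bicategory or of a pseudofunctor can be checked on legs (`Cell.ext_legs`), where it
follows from the functoriality of `Leg.tr`. This gives `isLawful`.

A pseudofunctor `F` which maps `WA` into `WB` extends to the localised bicategories (`extension`,
`locMap`), since 2-morphisms of `Loc hB` can be glued along the images of morphisms in `WA`. It maps
roofs, legs and transformations of roofs, and the formula for the induced map on 2-morphisms is the
one for the image of a transformation (`isImage_ev_image`); a transformation has at most one image
(`RoofTrans.IsImage.unique`). Hence the formula defines a pseudofunctor (`inducedPseudofunctor`).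
The image of the roof `(𝟙, f)` is `(F 𝟙, F f)`, which is given by the same morphism of `Loc hB` as
the roof `(𝟙, F f)`. The resulting isomorphisms (`imageIso`) are the cells of a pseudonatural
equivalence whose components are identities (`comparison`). A morphism `w` in the class becomes
an internal equivalence, with quasi-inverse the roof `(w, 𝟙)` (`isInternalEquivalence_ofMor`), and
then so does the square of `comparison` at `w` (`isInternalEquivalence_cyl`).

It remains to see that the saturation satisfies (BF), so that all this applies to it
(`BF.saturation`). A morphism `f` of the saturation, with `g ≫ f` and `h ≫ g` in `W`, has local
sections up to `W`, which gives the existence of squares and of lifts. For uniqueness of lifts,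
whiskering with `f` is injective in `Loc hW`: locally, a 2-morphism into the source of `f` has the
form `κ ▷ h ▷ g`, and `κ ▷ h` is determined by its whiskering with `g ≫ f`
(`Strict.hom_ext_right_of_comp_mem`).
-/


namespace BicatFrac

/-! ### 2-morphisms of the localised bicategory -/

section Localisation

variable {C : Type u} [Bicategory.{w, v} C] {W : MorphismProperty C}

/-- The restriction of a 2-morphism along `k`. -/
def res {d d' e b : C} (k : d' ⟶ d) {z : d ⟶ e} {f g : e ⟶ b} (β : z ≫ f ⟶ z ≫ g) :
    (k ≫ z) ≫ f ⟶ (k ≫ z) ≫ g :=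
  (α_ k z f).hom ≫ k ◁ β ≫ (α_ k z g).inv

/-- The transport of a 2-morphism along an invertible 2-morphism. -/
def transp {d e b : C} {z z' : d ⟶ e} {f g : e ⟶ b} (ζ : z ≅ z') (β : z ≫ f ⟶ z ≫ g) :
    z' ≫ f ⟶ z' ≫ g :=
  ζ.inv ▷ f ≫ β ≫ ζ.hom ▷ g

section res

variable {d d' d'' e b : C} {z z' z'' : d ⟶ e} {f g h : e ⟶ b}

theorem res_res (k : d'' ⟶ d') (l : d' ⟶ d) (β : z ≫ f ⟶ z ≫ g) :
    res k (res l β) = transp (α_ k l z) (res (k ≫ l) β) := by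
  simp only [res, transp]; bicategory

theorem res_comp (k : d' ⟶ d) (β : z ≫ f ⟶ z ≫ g) (γ : z ≫ g ⟶ z ≫ h) :
    res k (β ≫ γ) = res k β ≫ res k γ := by
  simp [res]

theorem transp_comp (ζ : z ≅ z') (β : z ≫ f ⟶ z ≫ g) (γ : z ≫ g ⟶ z ≫ h) :
    transp ζ (β ≫ γ) = transp ζ β ≫ transp ζ γ := by
  simp only [transp, Category.assoc, hom_inv_whiskerRight_assoc]

theorem transp_transp (ζ : z ≅ z') (ζ' : z' ≅ z'') (β : z ≫ f ⟶ z ≫ g) :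
    transp ζ' (transp ζ β) = transp (ζ ≪≫ ζ') β := by
  simp [transp]

theorem transp_refl (β : z ≫ f ⟶ z ≫ g) : transp (Iso.refl z) β = β := by
  simp [transp]

theorem transp_res_whisker {k k' : d' ⟶ d} (ξ : k ≅ k') (β : z ≫ f ⟶ z ≫ g) :
    transp (whiskerRightIso ξ z) (res k β) = res k' β := by
  simp only [res, transp, whiskerRightIso_hom, whiskerRightIso_inv]
  calc
    _ = 𝟙 _ ⊗≫ ξ.inv ▷ (z ≫ f) ⊗≫ (k ◁ β ≫ ξ.hom ▷ (z ≫ g)) ⊗≫ 𝟙 _ := by bicategory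
    _ = 𝟙 _ ⊗≫ (ξ.inv ≫ ξ.hom) ▷ (z ≫ f) ⊗≫ k' ◁ β ⊗≫ 𝟙 _ := by
      rw [whisker_exchange]; bicategory
    _ = _ := by rw [ξ.inv_hom_id]; bicategory

theorem res_transp (k : d' ⟶ d) (ζ : z ≅ z') (β : z ≫ f ⟶ z ≫ g) :
    res k (transp ζ β) = transp (whiskerLeftIso k ζ) (res k β) := by
  simp only [res, transp, whiskerLeftIso_hom, whiskerLeftIso_inv]; bicategory

theorem res_whiskerRight {c : C} (k : d' ⟶ d) (β : z ≫ f ⟶ z ≫ g) (w : b ⟶ c) :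
    res k ((α_ z f w).inv ≫ β ▷ w ≫ (α_ z g w).hom) =
      (α_ _ f w).inv ≫ res k β ▷ w ≫ (α_ _ g w).hom := by
  simp only [res]; bicategory

theorem transp_whiskerRight {c : C} (ζ : z ≅ z') (β : z ≫ f ⟶ z ≫ g) (w : b ⟶ c) :
    transp ζ ((α_ z f w).inv ≫ β ▷ w ≫ (α_ z g w).hom) =
      (α_ _ f w).inv ≫ transp ζ β ▷ w ≫ (α_ _ g w).hom := by
  simp only [transp]; bicategory

/-- The two ways round a commutative square of restrictions. -/
theorem res_square {d₁ d₂ : C} {t' : d₁ ⟶ d'} {k : d' ⟶ d} {k' : d₁ ⟶ d₂} {t : d₂ ⟶ d}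
    (ξ : t' ≫ k ≅ k' ≫ t) (β : z ≫ f ⟶ z ≫ g) :
    transp ((α_ _ _ _).symm ≪≫ whiskerRightIso ξ.symm z ≪≫ α_ _ _ _) (res k' (res t β)) =
      res t' (res k β) := by
  rw [res_res, res_res, transp_transp, ← transp_res_whisker ξ, transp_transp]
  congr 1
  ext
  simp

/-- Two 2-morphisms are locally equal if they agree after restriction along a morphism in `W`. -/
def LocEq (W : MorphismProperty C) {x y : d ⟶ e} (β β' : x ⟶ y) : Prop :=
  ∃ (d' : C) (t : d' ⟶ d), W t ∧ t ◁ β = t ◁ β'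

theorem whiskerLeft_conj_iff (t : d' ⟶ d) {x x' y y' : d ⟶ e} (a : x' ≅ x) (b : y ≅ y')
    (β β' : x ⟶ y) :
    t ◁ (a.hom ≫ β ≫ b.hom) = t ◁ (a.hom ≫ β' ≫ b.hom) ↔ t ◁ β = t ◁ β' := by
  simp only [Bicategory.whiskerLeft_comp]
  rw [cancel_epi, cancel_mono]

theorem res_eq_iff (k : d' ⟶ d) (β β' : z ≫ f ⟶ z ≫ g) :
    res k β = res k β' ↔ k ◁ β = k ◁ β' := by
  simp [res]

theorem transp_eq_iff (ζ : z ≅ z') (β β' : z ≫ f ⟶ z ≫ g) :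
    transp ζ β = transp ζ β' ↔ β = β' := by
  refine ⟨fun h => ?_, fun h => h ▸ rfl⟩
  have := congrArg (transp ζ.symm) h
  simpa only [transp_transp, Iso.self_symm_id, transp_refl] using this

end res

theorem whiskerLeft_eq_of_comp {d d' d'' e : C} (k : d'' ⟶ d') (l : d' ⟶ d) {x y : d ⟶ e}
    {β β' : x ⟶ y} (h : k ◁ l ◁ β = k ◁ l ◁ β') : (k ≫ l) ◁ β = (k ≫ l) ◁ β' := by
  simp [h]

theorem whiskerLeft_eq_of_iso {d d' e : C} {k l : d' ⟶ d} (ζ : k ≅ l) {x y : d ⟶ e}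
    {β β' : x ⟶ y} (h : k ◁ β = k ◁ β') : l ◁ β = l ◁ β' := by
  rw [← cancel_epi (ζ.hom ▷ x), ← whisker_exchange, ← whisker_exchange, h]

namespace BF

variable (hW : BF W)
include hW

theorem locEq_of_comp_mem {d d' e : C} {z : d' ⟶ d} (hz : W z) {x y : d ⟶ e} {β β' : x ⟶ y}
    (h : LocEq W (z ◁ β) (z ◁ β')) : LocEq W β β' := by
  obtain ⟨d₁, t, ht, e⟩ := h
  exact ⟨d₁, t ≫ z, hW.bf2 _ _ ht hz, whiskerLeft_eq_of_comp _ _ e⟩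

/-- Common refinement of two morphisms in `W`. -/
theorem ore {a b c : C} (t : a ⟶ b) (f : c ⟶ b) (ht : W t) :
    ∃ (d : C) (t' : d ⟶ c) (f' : d ⟶ a), W t' ∧ Nonempty (t' ≫ f ≅ f' ≫ t) ∧
      (W f → W (f' ≫ t)) := by
  obtain ⟨d, t', f', ht', ⟨i⟩⟩ := hW.bf3 t f ht
  exact ⟨d, t', f', ht', ⟨i⟩, fun h => hW.bf5 _ _ i.symm (hW.bf2 _ _ ht' h)⟩

/-- Whiskering with a morphism in `W` is locally injective on 2-morphisms: if `β ▷ w = β' ▷ w`, then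
`β` and `β'` are both lifts of this 2-morphism along the identity, and two lifts agree locally. -/
theorem locEq_of_whiskerRight {a b c : C} {w : b ⟶ a} (hw : W w) {f₁ f₂ : c ⟶ b}
    {β β' : f₁ ⟶ f₂} (h : β ▷ w = β' ▷ w) : LocEq W β β' := by
  have l : ∀ γ : f₁ ⟶ f₂, γ ▷ w = β' ▷ w → IsLift (β' ▷ w) (𝟙 c) (𝟙 c ◁ γ) := by
    intro γ hγ
    rw [IsLift, ← hγ]; bicategory
  obtain ⟨e, z, z', ζ, hz, hζ⟩ := hW.bf4c w f₁ f₂ (β' ▷ w) hw _ (𝟙 c) _ _ (𝟙 c) _ (hW.bf1 c)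
    (l β h) (hW.bf1 c) (l β' rfl)
  refine ⟨e, z ≫ 𝟙 c, hz, ?_⟩
  rw [← cancel_mono (ζ.hom ▷ f₂)]
  calc
    _ = (α_ z (𝟙 c) f₁).hom ≫ z ◁ 𝟙 c ◁ β ≫ (α_ z (𝟙 c) f₂).inv ≫ ζ.hom ▷ f₂ := by
      bicategory
    _ = ζ.hom ▷ f₁ ≫ (z' ≫ 𝟙 c) ◁ β' := by rw [hζ]; bicategory
    _ = _ := by rw [whisker_exchange]

end BF

/-- The 2-morphisms of the localised bicategory, encoded as the sets of all their local
representatives: a representative over `z` is a 2-morphism between the restrictions along `z`.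
Keeping all the representatives, instead of a quotient of them, makes equality an equality of sets
and avoids any choice. The sets are stable under restriction and under transport along invertible
2-morphisms, a 2-morphism which becomes a representative along a morphism in `W` is one, two
representatives over the same `z` are locally equal, and representatives exist locally. -/
@[ext]
structure LHom (W : MorphismProperty C) {e b : C} (f g : e ⟶ b) where
  rel : ∀ {d : C} (z : d ⟶ e), (z ≫ f ⟶ z ≫ g) → Prop
  res : ∀ {d d' : C} (k : d' ⟶ d) {z : d ⟶ e} {β : z ≫ f ⟶ z ≫ g}, rel z β →
    rel (k ≫ z) (res k β)
  transp : ∀ {d : C} {z z' : d ⟶ e} (ζ : z ≅ z') {β : z ≫ f ⟶ z ≫ g}, rel z β →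
    rel z' (transp ζ β)
  local_mem : ∀ {d d' : C} (k : d' ⟶ d) {z : d ⟶ e} {β : z ≫ f ⟶ z ≫ g}, W k →
    rel (k ≫ z) (BicatFrac.res k β) → rel z β
  locEq : ∀ {d : C} {z : d ⟶ e} {β β' : z ≫ f ⟶ z ≫ g}, rel z β → rel z β' → LocEq W β β'
  exists_rel : ∀ {d : C} (z : d ⟶ e), ∃ (d' : C) (t : d' ⟶ d) (β : (t ≫ z) ≫ f ⟶ (t ≫ z) ≫ g),
    W t ∧ rel (t ≫ z) β

namespace LHom

variable (hW : BF W)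

/-- The 2-morphism with given local representatives. The family `R` need not contain all the
representatives: it is saturated under restriction along morphisms in `W`. -/
def ofRel (hW : BF W) {e b : C} {f g : e ⟶ b}
    (R : ∀ {d : C} (z : d ⟶ e), (z ≫ f ⟶ z ≫ g) → Prop)
    (hres : ∀ {d d' : C} (k : d' ⟶ d) {z : d ⟶ e} {β : z ≫ f ⟶ z ≫ g}, R z β →
      R (k ≫ z) (BicatFrac.res k β))
    (htransp : ∀ {d : C} {z z' : d ⟶ e} (ζ : z ≅ z') {β : z ≫ f ⟶ z ≫ g}, R z β →
      R z' (BicatFrac.transp ζ β))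
    (huniq : ∀ {d : C} {z : d ⟶ e} {β β' : z ≫ f ⟶ z ≫ g}, R z β → R z β' → LocEq W β β')
    (hex : ∀ {d : C} (z : d ⟶ e), ∃ (d' : C) (t : d' ⟶ d)
      (β : (t ≫ z) ≫ f ⟶ (t ≫ z) ≫ g), W t ∧ R (t ≫ z) β) : LHom W f g where
  rel {d} z β := ∃ (d' : C) (t : d' ⟶ d), W t ∧ R (t ≫ z) (BicatFrac.res t β)
  res := by
    rintro d d' k z β ⟨d₁, t, ht, h⟩
    obtain ⟨d₂, t', k', ht', ⟨ξ⟩, -⟩ := hW.ore t k ht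
    refine ⟨d₂, t', ht', ?_⟩
    rw [← res_square ξ]
    exact htransp _ (hres _ h)
  transp := by
    rintro d z z' ζ β ⟨d₁, t, ht, h⟩
    refine ⟨d₁, t, ht, ?_⟩
    rw [res_transp]
    exact htransp _ h
  local_mem := by
    rintro d d' k z β hk ⟨d₁, t, ht, h⟩
    refine ⟨d₁, t ≫ k, hW.bf2 _ _ ht hk, ?_⟩
    rw [res_res] at h
    have := htransp (α_ _ _ _).symm h
    rwa [transp_transp, Iso.self_symm_id, transp_refl] at this
  locEq := by
    rintro d z β β' ⟨d₁, t, ht, h⟩ ⟨d₁', t', ht', h'⟩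
    -- Both representatives are compared over a common refinement of `t` and `t'`.
    obtain ⟨d₂, s, s', hs, ⟨ξ⟩, -⟩ := hW.ore t t' ht
    have h₁ := htransp ((α_ _ _ _).symm ≪≫ whiskerRightIso ξ.symm z ≪≫ α_ _ _ _) (hres s' h)
    rw [res_square ξ] at h₁
    obtain ⟨d₃, r, hr, e⟩ := huniq h₁ (hres s h')
    refine ⟨d₃, r ≫ s ≫ t', hW.bf2 _ _ hr (hW.bf2 _ _ hs ht'), ?_⟩
    apply whiskerLeft_eq_of_comp
    rw [← res_eq_iff] at e ⊢
    simp only [res_res] at e ⊢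
    simp only [res_transp, transp_eq_iff] at e
    rw [res_eq_iff] at e ⊢
    have e' := (whiskerLeft_conj_iff r (α_ (s ≫ t') z f) (α_ (s ≫ t') z g).symm _ _).1 e
    simpa using e'
  exists_rel := by
    intro d z
    obtain ⟨d', t, β, ht, h⟩ := hex z
    refine ⟨d', t, β, ht, d', 𝟙 _, hW.bf1 _, hres _ h⟩

theorem ofRel_rel {e b : C} {f g : e ⟶ b} {R : ∀ {d : C} (z : d ⟶ e), (z ≫ f ⟶ z ≫ g) → Prop}
    {hres htransp huniq hex} {d : C} {z : d ⟶ e} {β : z ≫ f ⟶ z ≫ g} (h : R z β) :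
    (ofRel hW R hres htransp huniq hex).rel z β :=
  ⟨d, 𝟙 d, hW.bf1 d, hres _ h⟩

variable {hW}

/-- Two 2-morphisms of the localised bicategory with a common representative over a morphism in
`W` are equal. -/
theorem ext_of_rel (hW : BF W) {e b : C} {f g : e ⟶ b} {η θ : LHom W f g} {d : C} {z : d ⟶ e}
    (hz : W z) {β : z ≫ f ⟶ z ≫ g} (h : η.rel z β) (h' : θ.rel z β) : η = θ := by
  have key : ∀ {η θ : LHom W f g}, η.rel z β → θ.rel z β → ∀ {d' : C} (z' : d' ⟶ e)
      (β' : z' ≫ f ⟶ z' ≫ g), η.rel z' β' → θ.rel z' β' := by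
    intro η θ h h' d' z' β' hβ'
    obtain ⟨d₁, t, s, ht, ⟨ξ⟩, -⟩ := hW.ore z z' hz
    obtain ⟨d₂, r, hr, e⟩ := η.locEq (η.transp ξ.symm (η.res s h)) (η.res t hβ')
    apply θ.local_mem t ht
    apply θ.local_mem r hr
    rw [(res_eq_iff _ _ _).2 e.symm]
    exact θ.res _ (θ.transp _ (θ.res _ h'))
  ext d' z' β'
  exact ⟨key h h' z' β', key h' h z' β'⟩

/-- The image of a 2-morphism in the localised bicategory. -/
def of (hW : BF W) {e b : C} {f g : e ⟶ b} (β₀ : f ⟶ g) : LHom W f g :=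
  ofRel hW (fun z β => β = z ◁ β₀)
    (by rintro d d' k z β rfl; simp [BicatFrac.res])
    (by
      rintro d z z' ζ β rfl
      rw [BicatFrac.transp, whisker_exchange, inv_hom_whiskerRight_assoc])
    (by rintro d z β β' rfl rfl; exact ⟨d, 𝟙 d, hW.bf1 d, rfl⟩)
    (fun {d} z => ⟨d, 𝟙 d, _, hW.bf1 d, rfl⟩)

theorem rel_of (hW : BF W) {e b : C} {f g : e ⟶ b} (β₀ : f ⟶ g) {d : C} (z : d ⟶ e) :
    (of hW β₀).rel z (z ◁ β₀) :=
  ofRel_rel hW rfl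

/-- Vertical composition. -/
def comp (hW : BF W) {e b : C} {f g h : e ⟶ b} (η : LHom W f g) (θ : LHom W g h) : LHom W f h :=
  ofRel hW (fun z γ => ∃ β β', η.rel z β ∧ θ.rel z β' ∧ γ = β ≫ β')
    (by
      rintro d d' k z _ ⟨β, β', hβ, hβ', rfl⟩
      exact ⟨_, _, η.res _ hβ, θ.res _ hβ', res_comp _ _ _⟩)
    (by
      rintro d z z' ζ _ ⟨β, β', hβ, hβ', rfl⟩
      exact ⟨_, _, η.transp _ hβ, θ.transp _ hβ', transp_comp _ _ _⟩)
    (by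
      rintro d z _ _ ⟨β, β', hβ, hβ', rfl⟩ ⟨γ, γ', hγ, hγ', rfl⟩
      obtain ⟨d₁, t, ht, e₁⟩ := η.locEq hβ hγ
      obtain ⟨d₂, s, hs, e₂⟩ := θ.locEq hβ' hγ'
      obtain ⟨d₃, r, r', -, ⟨ξ⟩, h⟩ := hW.ore t s ht
      refine ⟨d₃, r' ≫ t, h hs, ?_⟩
      have e₁' : (r' ≫ t) ◁ β = (r' ≫ t) ◁ γ := whiskerLeft_eq_of_comp _ _ (by rw [e₁])
      have e₂' : (r' ≫ t) ◁ β' = (r' ≫ t) ◁ γ' :=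
        whiskerLeft_eq_of_iso ξ (whiskerLeft_eq_of_comp _ _ (by rw [e₂]))
      rw [Bicategory.whiskerLeft_comp, e₁', e₂', Bicategory.whiskerLeft_comp])
    (by
      intro d z
      obtain ⟨d₁, t, β, ht, h⟩ := η.exists_rel z
      obtain ⟨d₂, s, β', hs, h'⟩ := θ.exists_rel (t ≫ z)
      exact ⟨d₂, s ≫ t, _, hW.bf2 _ _ hs ht, _, _, η.transp (α_ _ _ _).symm (η.res s h),
        θ.transp (α_ _ _ _).symm h', rfl⟩)

theorem rel_comp (hW : BF W) {e b : C} {f g h : e ⟶ b} {η : LHom W f g} {θ : LHom W g h} {d : C}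
    {z : d ⟶ e} {β : z ≫ f ⟶ z ≫ g} {β' : z ≫ g ⟶ z ≫ h} (hβ : η.rel z β) (hβ' : θ.rel z β') :
    (comp hW η θ).rel z (β ≫ β') :=
  ofRel_rel hW ⟨β, β', hβ, hβ', rfl⟩

/-- Right whiskering. -/
def whiskerRight (hW : BF W) {e b c : C} {f g : e ⟶ b} (η : LHom W f g) (w : b ⟶ c) :
    LHom W (f ≫ w) (g ≫ w) :=
  ofRel hW (fun z γ => ∃ β, η.rel z β ∧ γ = (α_ z f w).inv ≫ β ▷ w ≫ (α_ z g w).hom)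
    (by
      rintro d d' k z _ ⟨β, hβ, rfl⟩
      exact ⟨_, η.res _ hβ, res_whiskerRight _ _ _⟩)
    (by
      rintro d z z' ζ _ ⟨β, hβ, rfl⟩
      exact ⟨_, η.transp _ hβ, transp_whiskerRight _ _ _⟩)
    (by
      rintro d z _ _ ⟨β, hβ, rfl⟩ ⟨γ, hγ, rfl⟩
      obtain ⟨d₁, t, ht, e₁⟩ := η.locEq hβ hγ
      refine ⟨d₁, t, ht, (whiskerLeft_conj_iff t (α_ z f w).symm (α_ z g w) _ _).2 ?_⟩
      have e₂ : (t ◁ β) ▷ w = (t ◁ γ) ▷ w := by rw [e₁]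
      simpa using e₂)
    (by
      intro d z
      obtain ⟨d₁, t, β, ht, h⟩ := η.exists_rel z
      exact ⟨d₁, t, _, ht, β, h, rfl⟩)

theorem rel_whiskerRight (hW : BF W) {e b c : C} {f g : e ⟶ b} {η : LHom W f g} (w : b ⟶ c)
    {d : C} {z : d ⟶ e} {β : z ≫ f ⟶ z ≫ g} (hβ : η.rel z β) :
    (whiskerRight hW η w).rel z ((α_ z f w).inv ≫ β ▷ w ≫ (α_ z g w).hom) :=
  ofRel_rel hW ⟨β, hβ, rfl⟩

/-- The representative over `z ≫ k` corresponding to a representative of a left whiskering. -/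
def unwhisker {d e e' b : C} {f g : e ⟶ b} (k : e' ⟶ e) (z : d ⟶ e') (γ : z ≫ k ≫ f ⟶ z ≫ k ≫ g) :
    (z ≫ k) ≫ f ⟶ (z ≫ k) ≫ g :=
  (α_ _ _ _).hom ≫ γ ≫ (α_ _ _ _).inv

theorem unwhisker_res {d d' e e' b : C} {f g : e ⟶ b} (k : e' ⟶ e) (z : d ⟶ e') (t : d' ⟶ d)
    (γ : z ≫ k ≫ f ⟶ z ≫ k ≫ g) : unwhisker k (t ≫ z) (BicatFrac.res t γ) =
      BicatFrac.transp (α_ _ _ _).symm (BicatFrac.res t (unwhisker k z γ)) := by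
  simp only [unwhisker, BicatFrac.res, BicatFrac.transp, Iso.symm_hom, Iso.symm_inv]; bicategory

/-- Left whiskering. -/
def whiskerLeft {e e' b : C} (k : e' ⟶ e) {f g : e ⟶ b} (η : LHom W f g) :
    LHom W (k ≫ f) (k ≫ g) where
  rel z γ := η.rel (z ≫ k) (unwhisker k z γ)
  res := by
    rintro d d' t z γ h
    rw [unwhisker_res]
    exact η.transp _ (η.res _ h)
  transp := by
    rintro d z z' ζ γ h
    have : unwhisker k z' (BicatFrac.transp ζ γ) =
        BicatFrac.transp (whiskerRightIso ζ k) (unwhisker k z γ) := by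
      simp only [unwhisker, BicatFrac.transp, whiskerRightIso_hom, whiskerRightIso_inv]; bicategory
    rw [this]
    exact η.transp _ h
  local_mem := by
    rintro d d' t z γ ht h
    rw [unwhisker_res] at h
    have := η.transp (α_ _ _ _) h
    rw [transp_transp, Iso.symm_self_id, transp_refl] at this
    exact η.local_mem t ht this
  locEq := by
    rintro d z γ γ' h h'
    obtain ⟨d₁, t, ht, e⟩ := η.locEq h h'
    exact ⟨d₁, t, ht, (whiskerLeft_conj_iff t (α_ z k f) (α_ z k g).symm _ _).1 e⟩
  exists_rel := by
    intro d z
    obtain ⟨d₁, t, β, ht, h⟩ := η.exists_rel (z ≫ k)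
    refine ⟨d₁, t, (α_ _ _ _).inv ≫ BicatFrac.transp (α_ _ _ _).symm β ≫ (α_ _ _ _).hom, ht, ?_⟩
    have := η.transp (α_ _ _ _).symm h
    simpa [unwhisker] using this

theorem rel_whiskerLeft {e e' b : C} (k : e' ⟶ e) {f g : e ⟶ b} {η : LHom W f g} {d : C}
    {z : d ⟶ e'} {β : (z ≫ k) ≫ f ⟶ (z ≫ k) ≫ g} (hβ : η.rel (z ≫ k) β) :
    (whiskerLeft k η).rel z ((α_ _ _ _).inv ≫ β ≫ (α_ _ _ _).hom) := by
  change η.rel _ _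
  simpa [unwhisker] using hβ

end LHom

end Localisation

/-! ### The localised bicategory -/

section Localisation

variable {C : Type u} [Bicategory.{w, v} C] {W : MorphismProperty C}

namespace LHom

theorem exists_rep (hW : BF W) {e b : C} {f g : e ⟶ b} (η : LHom W f g) :
    ∃ (d : C) (z : d ⟶ e) (β : z ≫ f ⟶ z ≫ g), W z ∧ η.rel z β := by
  obtain ⟨d, t, β, ht, h⟩ := η.exists_rel (𝟙 e)
  exact ⟨d, t ≫ 𝟙 e, β, hW.bf2 _ _ ht (hW.bf1 e), h⟩

theorem exists_rep₂ (hW : BF W) {e b b' : C} {f g : e ⟶ b} {f' g' : e ⟶ b'} (η : LHom W f g)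
    (η' : LHom W f' g') : ∃ (d : C) (z : d ⟶ e) (β : z ≫ f ⟶ z ≫ g) (β' : z ≫ f' ⟶ z ≫ g'),
      W z ∧ η.rel z β ∧ η'.rel z β' := by
  obtain ⟨d, z, β, hz, h⟩ := η.exists_rep hW
  obtain ⟨d', t, β', ht, h'⟩ := η'.exists_rel z
  exact ⟨d', t ≫ z, _, _, hW.bf2 _ _ ht hz, η.res t h, h'⟩

theorem exists_rep₃ (hW : BF W) {e b b' b'' : C} {f g : e ⟶ b} {f' g' : e ⟶ b'} {f'' g'' : e ⟶ b''}
    (η : LHom W f g) (η' : LHom W f' g') (η'' : LHom W f'' g'') :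
    ∃ (d : C) (z : d ⟶ e) (β : z ≫ f ⟶ z ≫ g) (β' : z ≫ f' ⟶ z ≫ g') (β'' : z ≫ f'' ⟶ z ≫ g''),
      W z ∧ η.rel z β ∧ η'.rel z β' ∧ η''.rel z β'' := by
  obtain ⟨d, z, β, β', hz, h, h'⟩ := exists_rep₂ hW η η'
  obtain ⟨d', t, β'', ht, h''⟩ := η''.exists_rel z
  exact ⟨d', t ≫ z, _, _, _, hW.bf2 _ _ ht hz, η.res t h, η'.res t h', h''⟩

theorem rel_of' (hW : BF W) {e b : C} {f g : e ⟶ b} (β₀ : f ⟶ g) {d : C} (z : d ⟶ e)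
    {β : z ≫ f ⟶ z ≫ g} (h : β = z ◁ β₀) : (of hW β₀).rel z β := h ▸ rel_of hW β₀ z

theorem eq_of_rel (hW : BF W) {e b : C} {f g : e ⟶ b} {η θ : LHom W f g} {d : C} {z : d ⟶ e}
    (hz : W z) {β β' : z ≫ f ⟶ z ≫ g} (h : η.rel z β) (h' : θ.rel z β') (e : β = β') : η = θ :=
  ext_of_rel hW hz h (e ▸ h')

theorem rel_whiskerLeft_of_eq {e e' b : C} {k : e' ⟶ e} {f g : e ⟶ b} {η : LHom W f g} {d : C}
    {z : d ⟶ e'} {β : z ≫ k ≫ f ⟶ z ≫ k ≫ g} {γ} (hγ : η.rel (z ≫ k) γ)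
    (h : γ = unwhisker k z β) :
    (whiskerLeft k η).rel z β := by subst h; exact hγ

theorem comp_of (hW : BF W) {e b : C} {f g h : e ⟶ b} (β : f ⟶ g) (γ : g ⟶ h) :
    comp hW (of hW β) (of hW γ) = of hW (β ≫ γ) :=
  eq_of_rel hW (hW.bf1 e) (rel_comp hW (rel_of hW β _) (rel_of hW γ _)) (rel_of hW _ _)
    (Bicategory.whiskerLeft_comp _ _ _).symm

theorem whiskerLeft_of (hW : BF W) {e e' b : C} (k : e' ⟶ e) {f g : e ⟶ b} (β : f ⟶ g) :
    whiskerLeft k (of hW β) = of hW (k ◁ β) :=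
  eq_of_rel hW (hW.bf1 e') (rel_whiskerLeft_of_eq (rel_of hW _ _) (by simp [unwhisker]))
    (rel_of hW _ _) rfl

theorem whiskerRight_of (hW : BF W) {e b c : C} {f g : e ⟶ b} (β : f ⟶ g) (k : b ⟶ c) :
    whiskerRight hW (of hW β) k = of hW (β ▷ k) :=
  eq_of_rel hW (hW.bf1 e) (rel_whiskerRight hW k (rel_of hW β _)) (rel_of' hW _ _ rfl)
    (by bicategory)

theorem whiskerLeft_eq_of_rel (hW : BF W) {a b d : C} {f g : a ⟶ b} {η : LHom W f g} {z : d ⟶ a}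
    {β : z ≫ f ⟶ z ≫ g} (h : η.rel z β) : whiskerLeft z η = of hW β := by
  refine eq_of_rel hW (hW.bf1 d) (rel_whiskerLeft_of_eq
    (η.transp (λ_ z).symm h) ?_) (rel_of hW β _) rfl
  simp only [unwhisker, BicatFrac.transp, Iso.symm_hom, Iso.symm_inv]; bicategory

variable (hW : BF W) {a b c d e : C}
include hW

theorem id_comp {f g : a ⟶ b} (η : LHom W f g) : comp hW (of hW (𝟙 f)) η = η := by
  obtain ⟨d, z, β, hz, h⟩ := η.exists_rep hW
  exact eq_of_rel hW hz (rel_comp hW (rel_of hW (𝟙 _) z) h) h (by simp)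

theorem comp_id {f g : a ⟶ b} (η : LHom W f g) : comp hW η (of hW (𝟙 g)) = η := by
  obtain ⟨d, z, β, hz, h⟩ := η.exists_rep hW
  exact eq_of_rel hW hz (rel_comp hW h (rel_of hW (𝟙 _) z)) h (by simp)

theorem assoc {f g h k : a ⟶ b} (η : LHom W f g) (θ : LHom W g h) (κ : LHom W h k) :
    comp hW (comp hW η θ) κ = comp hW η (comp hW θ κ) := by
  obtain ⟨d, z, β, β', β'', hz, h, h', h''⟩ := exists_rep₃ hW η θ κ
  exact eq_of_rel hW hz (rel_comp hW (rel_comp hW h h') h'')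
    (rel_comp hW h (rel_comp hW h' h'')) (by simp)

theorem whiskerLeft_comp (f : a ⟶ b) {g h i : b ⟶ c} (η : LHom W g h) (θ : LHom W h i) :
    whiskerLeft f (comp hW η θ) = comp hW (whiskerLeft f η) (whiskerLeft f θ) := by
  obtain ⟨d, z, β, β', hz, h, h'⟩ := exists_rep₂ hW (whiskerLeft f η) (whiskerLeft f θ)
  exact eq_of_rel hW hz (rel_whiskerLeft_of_eq (β := β ≫ β') (rel_comp hW h h')
    (by simp [unwhisker])) (rel_comp hW h h') rfl

theorem id_whiskerLeft {f g : a ⟶ b} (η : LHom W f g) : whiskerLeft (𝟙 a) η =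
    comp hW (of hW (λ_ f).hom) (comp hW η (of hW (λ_ g).inv)) := by
  obtain ⟨d, z, β, hz, h⟩ := η.exists_rep hW
  refine eq_of_rel hW hz (rel_whiskerLeft_of_eq (η.transp (ρ_ z).symm h) ?_)
      (rel_comp hW (rel_of hW _ z) (rel_comp hW h (rel_of hW _ z))) rfl
  simp only [unwhisker, BicatFrac.transp, Iso.symm_hom, Iso.symm_inv]; bicategory

theorem comp_whiskerLeft (f : a ⟶ b) (g : b ⟶ c) {h h' : c ⟶ d} (η : LHom W h h') :
    whiskerLeft (f ≫ g) η = comp hW (of hW (α_ f g h).hom)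
      (comp hW (whiskerLeft f (whiskerLeft g η)) (of hW (α_ f g h').inv)) := by
  obtain ⟨d, z, β, hz, k⟩ := (whiskerLeft f (whiskerLeft g η)).exists_rep hW
  refine eq_of_rel hW hz (rel_whiskerLeft_of_eq (η.transp (α_ z f g) k) ?_)
    (rel_comp hW (rel_of hW _ z) (rel_comp hW k (rel_of hW _ z))) rfl
  simp only [unwhisker, BicatFrac.transp]; bicategory

theorem comp_whiskerRight {f g h : a ⟶ b} (η : LHom W f g) (θ : LHom W g h) (i : b ⟶ c) :
    whiskerRight hW (comp hW η θ) i = comp hW (whiskerRight hW η i) (whiskerRight hW θ i) := by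
  obtain ⟨d, z, β, β', hz, h, h'⟩ := exists_rep₂ hW η θ
  exact eq_of_rel hW hz (rel_whiskerRight hW i (rel_comp hW h h'))
    (rel_comp hW (rel_whiskerRight hW i h) (rel_whiskerRight hW i h')) (by simp)

theorem whiskerRight_id {f g : a ⟶ b} (η : LHom W f g) : whiskerRight hW η (𝟙 b) =
    comp hW (of hW (ρ_ f).hom) (comp hW η (of hW (ρ_ g).inv)) := by
  obtain ⟨d, z, β, hz, h⟩ := η.exists_rep hW
  exact eq_of_rel hW hz (rel_whiskerRight hW _ h)
    (rel_comp hW (rel_of hW (ρ_ _).hom z) (rel_comp hW h (rel_of hW (ρ_ _).inv z)))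
    (by bicategory)

theorem whiskerRight_comp {f f' : a ⟶ b} (η : LHom W f f') (g : b ⟶ c) (h : c ⟶ d) :
    whiskerRight hW η (g ≫ h) = comp hW (of hW (α_ f g h).inv)
      (comp hW (whiskerRight hW (whiskerRight hW η g) h) (of hW (α_ f' g h).hom)) := by
  obtain ⟨d, z, β, hz, k⟩ := η.exists_rep hW
  exact eq_of_rel hW hz (rel_whiskerRight hW _ k)
    (rel_comp hW (rel_of hW (α_ _ _ _).inv z) (rel_comp hW
      (rel_whiskerRight hW h (rel_whiskerRight hW g k)) (rel_of hW (α_ _ _ _).hom z)))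
    (by bicategory)

theorem whisker_assoc (f : a ⟶ b) {g g' : b ⟶ c} (η : LHom W g g') (h : c ⟶ d) :
    whiskerRight hW (whiskerLeft f η) h = comp hW (of hW (α_ f g h).hom)
      (comp hW (whiskerLeft f (whiskerRight hW η h)) (of hW (α_ f g' h).inv)) := by
  obtain ⟨d, z, β, hz, k⟩ := (whiskerLeft f η).exists_rep hW
  refine eq_of_rel hW hz (rel_whiskerRight hW h k)
    (rel_comp hW (rel_of hW (α_ _ _ _).hom z) (rel_comp hW (rel_whiskerLeft _
      (rel_whiskerRight hW h k)) (rel_of hW (α_ _ _ _).inv z))) ?_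
  simp only [unwhisker]; bicategory

/-- The exchange law, under the assumption that the representative `β` of `η` lifts along the
morphism `z₀` over which `θ` has a representative: then `θ` may be restricted along the source and
the target of `κ`, and the claim becomes the exchange law for `κ` and `γ`. -/
theorem whisker_exchange_of_lift {f g : a ⟶ b} {h i : b ⟶ c} {η : LHom W f g} {θ : LHom W h i}
    {z : d ⟶ a} (hz : W z) {z₀ : e ⟶ b} {β : z ≫ f ⟶ z ≫ g} {γ : z₀ ≫ h ⟶ z₀ ≫ i}
    (hβ : η.rel z β) (hγ : θ.rel z₀ γ) {l l' : d ⟶ e} (ξ : z ≫ f ≅ l ≫ z₀) (ξ' : z ≫ g ≅ l' ≫ z₀)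
    (κ : l ⟶ l') (hκ : κ ▷ z₀ = ξ.inv ≫ β ≫ ξ'.hom) :
    comp hW (whiskerLeft f θ) (whiskerRight hW η i) =
      comp hW (whiskerRight hW η h) (whiskerLeft g θ) := by
  have hκ' : β = ξ.hom ≫ κ ▷ z₀ ≫ ξ'.inv := by simp [hκ]
  refine eq_of_rel hW hz
    (rel_comp hW (rel_whiskerLeft f (θ.transp ξ.symm (θ.res l hγ))) (rel_whiskerRight hW i hβ))
    (rel_comp hW (rel_whiskerRight hW h hβ) (rel_whiskerLeft g (θ.transp ξ'.symm (θ.res l' hγ))))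
    ?_
  have e₁ : ξ.inv ▷ i ≫ ξ.hom ▷ i = 𝟙 _ := inv_hom_whiskerRight _ _
  have e₂ : ξ'.inv ▷ h ≫ ξ'.hom ▷ h = 𝟙 _ := inv_hom_whiskerRight _ _
  simp only [BicatFrac.transp, BicatFrac.res, Iso.symm_hom, Iso.symm_inv, hκ']
  calc
    _ = 𝟙 _ ⊗≫ ξ.hom ▷ h ⊗≫ l ◁ γ ⊗≫ (ξ.inv ▷ i ≫ ξ.hom ▷ i) ⊗≫ κ ▷ z₀ ▷ i ⊗≫ ξ'.inv ▷ i ⊗≫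
        𝟙 _ := by bicategory
    _ = 𝟙 _ ⊗≫ ξ.hom ▷ h ⊗≫ (l ◁ γ ≫ κ ▷ (z₀ ≫ i)) ⊗≫ ξ'.inv ▷ i ⊗≫ 𝟙 _ := by
      rw [e₁]; bicategory
    _ = 𝟙 _ ⊗≫ ξ.hom ▷ h ⊗≫ κ ▷ z₀ ▷ h ⊗≫ 𝟙 ((l' ≫ z₀) ≫ h) ⊗≫ l' ◁ γ ⊗≫ ξ'.inv ▷ i ⊗≫ 𝟙 _ := by
      rw [whisker_exchange]; bicategory
    _ = _ := by rw [← e₂]; bicategory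

theorem whisker_exchange {f g : a ⟶ b} {h i : b ⟶ c} (η : LHom W f g) (θ : LHom W h i) :
    comp hW (whiskerLeft f θ) (whiskerRight hW η i) =
      comp hW (whiskerRight hW η h) (whiskerLeft g θ) := by
  obtain ⟨d, z, β, hz, hβ⟩ := η.exists_rep hW
  obtain ⟨e, z₀, γ, hz₀, hγ⟩ := θ.exists_rep hW
  obtain ⟨d₁, t₁, k₁, ht₁, ⟨ξ₁⟩⟩ := hW.bf3 z₀ (z ≫ f) hz₀
  obtain ⟨d₂, t₂, k₂, ht₂, ⟨ξ₂⟩⟩ := hW.bf3 z₀ (t₁ ≫ z ≫ g) hz₀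
  let ζ₁ : (t₂ ≫ t₁ ≫ z) ≫ f ≅ (t₂ ≫ k₁) ≫ z₀ :=
    α_ _ _ _ ≪≫ whiskerLeftIso t₂ (α_ _ _ _ ≪≫ ξ₁) ≪≫ (α_ _ _ _).symm
  let ζ₂ : (t₂ ≫ t₁ ≫ z) ≫ g ≅ k₂ ≫ z₀ := α_ _ _ _ ≪≫ whiskerLeftIso t₂ (α_ _ _ _) ≪≫ ξ₂
  -- The source and the target of `β` factor locally through `z₀`, and then `β` lifts along `z₀`.
  obtain ⟨d₃, v, κ, hv, hκ, -⟩ := hW.bf4ab z₀ (t₂ ≫ k₁) k₂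
    (ζ₁.inv ≫ BicatFrac.res t₂ (BicatFrac.res t₁ β) ≫ ζ₂.hom) hz₀
  refine whisker_exchange_of_lift hW (hW.bf2 _ _ hv (hW.bf2 _ _ ht₂ (hW.bf2 _ _ ht₁ hz)))
    (η.res v (η.res t₂ (η.res t₁ hβ))) hγ
    (α_ _ _ _ ≪≫ whiskerLeftIso v ζ₁ ≪≫ (α_ _ _ _).symm)
    (α_ _ _ _ ≪≫ whiskerLeftIso v ζ₂ ≪≫ (α_ _ _ _).symm) κ ?_
  rw [IsLift] at hκ
  calc
    κ ▷ z₀ = (α_ _ _ _).hom ≫ ((α_ v (t₂ ≫ k₁) z₀).inv ≫ κ ▷ z₀ ≫ (α_ v k₂ z₀).hom) ≫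
        (α_ _ _ _).inv := by simp
    _ = _ := by rw [← hκ]; simp [BicatFrac.res]

end LHom

/-- The localised bicategory: it has the objects and the morphisms of `C`, and its 2-morphisms are
those which exist locally with respect to `W`. -/
structure Loc (hW : BF W) where
  as : C

namespace Loc

variable {hW : BF W}

instance : CategoryStruct (Loc hW) where
  Hom a b := a.as ⟶ b.as
  id a := 𝟙 a.as
  comp f g := f ≫ g

instance instCategory (a b : Loc hW) : Category (a ⟶ b) where
  Hom f g := LHom W (e := a.as) (b := b.as) f g
  id f := LHom.of hW (e := a.as) (b := b.as) (𝟙 f)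
  comp η θ := LHom.comp hW (e := a.as) (b := b.as) η θ
  id_comp η := LHom.id_comp hW η
  comp_id η := LHom.comp_id hW η
  assoc η θ κ := LHom.assoc hW η θ κ

/-- The image in the localised bicategory of a morphism. -/
def mor (hW : BF W) {a b : C} (f : a ⟶ b) : (Loc.mk a : Loc hW) ⟶ Loc.mk b := f

/-- The image in the localised bicategory of a 2-morphism. -/
def mor₂ (hW : BF W) {a b : C} {f g : a ⟶ b} (β : f ⟶ g) : mor hW f ⟶ mor hW g := LHom.of hW β

theorem mor₂_comp {a b : C} {f g h : a ⟶ b} (β : f ⟶ g) (γ : g ⟶ h) :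
    mor₂ hW (β ≫ γ) = mor₂ hW β ≫ mor₂ hW γ := (LHom.comp_of hW β γ).symm

theorem mor₂_id {a b : C} (f : a ⟶ b) : mor₂ hW (𝟙 f) = 𝟙 _ := rfl

/-- The image in the localised bicategory of an invertible 2-morphism. -/
def iso (hW : BF W) {a b : C} {f g : a ⟶ b} (β : f ≅ g) : mor hW f ≅ mor hW g where
  hom := mor₂ hW β.hom
  inv := mor₂ hW β.inv
  hom_inv_id := by rw [← mor₂_comp, β.hom_inv_id]; rfl
  inv_hom_id := by rw [← mor₂_comp, β.inv_hom_id]; rfl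

/-- The bicategory structure, in which all the structural 2-morphisms are inherited from `C`. -/
instance : Bicategory (Loc hW) where
  homCategory := instCategory
  whiskerLeft f _ _ η := LHom.whiskerLeft f η
  whiskerRight η f := LHom.whiskerRight hW η f
  associator {a b c d} f g h := iso hW (α_ (show a.as ⟶ b.as from f) g h)
  leftUnitor {a b} f := iso hW (λ_ (show a.as ⟶ b.as from f))
  rightUnitor {a b} f := iso hW (ρ_ (show a.as ⟶ b.as from f))
  whiskerLeft_id _ _ :=
    (LHom.whiskerLeft_of hW _ _).trans (congrArg _ (Bicategory.whiskerLeft_id _ _))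
  id_whiskerRight _ _ :=
    (LHom.whiskerRight_of hW _ _).trans (congrArg _ (Bicategory.id_whiskerRight _ _))
  whiskerLeft_comp f _ _ _ η θ := LHom.whiskerLeft_comp hW f η θ
  id_whiskerLeft η := LHom.id_whiskerLeft hW η
  comp_whiskerLeft f g _ _ η := LHom.comp_whiskerLeft hW f g η
  comp_whiskerRight η θ i := LHom.comp_whiskerRight hW η θ i
  whiskerRight_id η := LHom.whiskerRight_id hW η
  whiskerRight_comp η g h := LHom.whiskerRight_comp hW η g h
  whisker_assoc f _ _ η h := LHom.whisker_assoc hW f η h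
  whisker_exchange η θ := LHom.whisker_exchange hW η θ
  pentagon {a b c d e} f g h i := by
    have := congrArg (LHom.of hW) (Bicategory.pentagon (show a.as ⟶ b.as from f) g h i)
    rw [← LHom.comp_of, ← LHom.comp_of, ← LHom.comp_of, ← LHom.whiskerLeft_of,
      ← LHom.whiskerRight_of] at this
    exact this
  triangle {a b c} f g := by
    have := congrArg (LHom.of hW) (Bicategory.triangle (show a.as ⟶ b.as from f) g)
    rw [← LHom.comp_of, ← LHom.whiskerLeft_of, ← LHom.whiskerRight_of] at this
    exact this

section mor

variable {a b c d : C}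

theorem mor₂_whiskerLeft (f : a ⟶ b) {g h : b ⟶ c} (β : g ⟶ h) :
    mor₂ hW (f ◁ β) = mor hW f ◁ mor₂ hW β := (LHom.whiskerLeft_of hW f β).symm
theorem mor₂_whiskerRight {f g : a ⟶ b} (β : f ⟶ g) (h : b ⟶ c) :
    mor₂ hW (β ▷ h) = mor₂ hW β ▷ mor hW h := (LHom.whiskerRight_of hW β h).symm
theorem iso_hom {f g : a ⟶ b} (β : f ≅ g) : (iso hW β).hom = mor₂ hW β.hom := rfl

/-- Two 2-morphisms of `C` are identified in the localised bicategory if and only if they are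
locally equal. -/
theorem mor₂_eq_iff {f g : a ⟶ b} {β β' : f ⟶ g} : mor₂ hW β = mor₂ hW β' ↔ LocEq W β β' := by
  constructor
  · intro h
    have h' : (LHom.of hW β).rel (𝟙 a) (𝟙 a ◁ β') := by
      have : LHom.of hW β = LHom.of hW β' := h
      rw [this]; exact LHom.rel_of hW _ _
    exact hW.locEq_of_comp_mem (hW.bf1 a) (LHom.locEq _ (LHom.rel_of hW β _) h')
  · rintro ⟨d, t, ht, e⟩
    exact LHom.eq_of_rel hW ht (LHom.rel_of hW β t) (LHom.rel_of hW β' t) e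

theorem whiskerLeft_eq_mor₂_of_rel {f g : a ⟶ b} {η : LHom W f g} {z : d ⟶ a}
    {β : z ≫ f ⟶ z ≫ g} (h : η.rel z β) :
    mor hW z ◁ (show mor hW f ⟶ mor hW g from η) = mor₂ hW β :=
  LHom.whiskerLeft_eq_of_rel hW h

/-- Every 2-morphism of the localised bicategory comes locally from a 2-morphism of `C`. -/
theorem exists_whiskerLeft_eq {f g : a ⟶ b} (η : mor hW f ⟶ mor hW g) :
    ∃ (d : C) (z : d ⟶ a) (β : z ≫ f ⟶ z ≫ g), W z ∧ mor hW z ◁ η = mor₂ hW β := by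
  obtain ⟨d, z, β, hz, h⟩ := LHom.exists_rep hW (show LHom W f g from η)
  exact ⟨d, z, β, hz, whiskerLeft_eq_mor₂_of_rel h⟩

end mor

end Loc

end Localisation

/-! ### Classes of morphisms with bijective whiskerings -/

section Strict

/-- A class of morphisms which contains the identities, is stable under composition, allows to
complete cospans to squares, and whose members induce bijections on 2-morphisms by whiskering on
either side. The image of `W` in the localised bicategory is such a class. -/
class Strict {D : Type u} [Bicategory.{w, v} D] (W : MorphismProperty D) : Prop where
  id_mem : ∀ a : D, W (𝟙 a)
  comp_mem : ∀ {a b c : D} {f : a ⟶ b} {g : b ⟶ c}, W f → W g → W (f ≫ g)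
  square : ∀ {a b c : D} (w : a ⟶ b) (f : c ⟶ b), W w →
    ∃ (d : D) (w' : d ⟶ c) (f' : d ⟶ a), W w' ∧ Nonempty (w' ≫ f ≅ f' ≫ w)
  whiskerRight_bijective : ∀ {a b c : D} {w : b ⟶ c}, W w → ∀ f g : a ⟶ b,
    Function.Bijective (fun η : f ⟶ g => η ▷ w)
  whiskerLeft_bijective : ∀ {a b c : D} {z : a ⟶ b}, W z → ∀ f g : b ⟶ c,
    Function.Bijective (fun η : f ⟶ g => z ◁ η)

end Strict

section Localisation

variable {C : Type u} [Bicategory.{w, v} C] {W : MorphismProperty C}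

namespace LHom

variable (hW : BF W) {a b c d e : C}
include hW

theorem eq_of_locEq {f g : a ⟶ b} {η θ : LHom W f g} {z : d ⟶ a} (hz : W z)
    {β β' : z ≫ f ⟶ z ≫ g} (h : η.rel z β) (h' : θ.rel z β') (e : LocEq W β β') : η = θ := by
  obtain ⟨d', t, ht, e⟩ := e
  exact eq_of_rel hW (hW.bf2 _ _ ht hz) (η.res t h) (θ.res t h') ((res_eq_iff _ _ _).2 e)

theorem whiskerRight_injective_of_locEq {f g : a ⟶ b} {w : b ⟶ c}
    (hw : ∀ {d : C} {f g : d ⟶ b} {β β' : f ⟶ g}, β ▷ w = β' ▷ w → LocEq W β β')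
    {η θ : LHom W f g}
    (h : whiskerRight hW η w = whiskerRight hW θ w) : η = θ := by
  obtain ⟨d, z, β, β', hz, hβ, hβ'⟩ := exists_rep₂ hW η θ
  obtain ⟨d', t, ht, e⟩ := (whiskerRight hW η w).locEq (rel_whiskerRight hW w hβ)
    (h ▸ rel_whiskerRight hW w hβ')
  refine eq_of_locEq hW hz hβ hβ' (hW.locEq_of_comp_mem ht (hw ?_))
  have := (whiskerLeft_conj_iff t (α_ z f w).symm (α_ z g w) _ _).1 e
  simpa using this

/-- If lifts along `w` exist and are unique locally, they glue to a 2-morphism of the localised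
bicategory, whose representatives are the 2-morphisms `β` such that `β ▷ w` represents `α`. -/
theorem whiskerRight_surjective_of_lift {f g : a ⟶ b} {w : b ⟶ c}
    (hw : ∀ {d : C} {f g : d ⟶ b} {β β' : f ⟶ g}, β ▷ w = β' ▷ w → LocEq W β β')
    (hw' : ∀ {d : C} {f g : d ⟶ b} (α : f ≫ w ⟶ g ≫ w), ∃ (d' : C) (v : d' ⟶ d)
      (β : v ≫ f ⟶ v ≫ g), W v ∧ IsLift α v β)
    (α : LHom W (f ≫ w) (g ≫ w)) : ∃ η : LHom W f g, whiskerRight hW η w = α := by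
  let η : LHom W f g := ofRel hW
    (fun {d} z β => α.rel z ((α_ z f w).inv ≫ β ▷ w ≫ (α_ z g w).hom))
    (by intro d d' k z β h; rw [← res_whiskerRight]; exact α.res k h)
    (by intro d z z' ζ β h; rw [← transp_whiskerRight]; exact α.transp ζ h)
    (fun {d z β β'} h h' => by
      obtain ⟨d', t, ht, e⟩ := α.locEq h h'
      refine hW.locEq_of_comp_mem ht (hw ?_)
      have := (whiskerLeft_conj_iff t (α_ z f w).symm (α_ z g w) _ _).1 e
      simpa using this)
    (fun {d} z => by
      obtain ⟨d₁, t, α', ht, hα'⟩ := α.exists_rel z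
      obtain ⟨d₂, v, β, hv, hβ⟩ := hw' ((α_ _ _ _).hom ≫ α' ≫ (α_ _ _ _).inv)
      refine ⟨d₂, v ≫ t, (α_ _ _ _).hom ▷ f ≫ (α_ _ _ _).hom ≫ β ≫ (α_ _ _ _).inv ≫
        (α_ _ _ _).inv ▷ g, hW.bf2 _ _ hv ht, ?_⟩
      have e := α.transp (α_ _ _ _).symm (α.res v hα')
      rw [IsLift] at hβ
      have : BicatFrac.transp (α_ v t z).symm (BicatFrac.res v α') =
          𝟙 _ ⊗≫ v ◁ ((α_ (t ≫ z) f w).hom ≫ α' ≫ (α_ (t ≫ z) g w).inv) ⊗≫ 𝟙 _ := by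
        simp only [BicatFrac.transp, BicatFrac.res, Iso.symm_hom, Iso.symm_inv]; bicategory
      rw [this, hβ] at e
      convert e using 1
      bicategory)
  obtain ⟨d, z, β, hz, hβ⟩ := exists_rep hW η
  refine ⟨η, eq_of_rel hW hz (rel_whiskerRight hW w hβ) ?_ rfl⟩
  obtain ⟨d', t, ht, h⟩ := hβ
  apply α.local_mem t ht
  rwa [res_whiskerRight]

theorem whiskerLeft_injective {z : a ⟶ b} (hz : W z) {f g : b ⟶ c} {η θ : LHom W f g}
    (h : whiskerLeft z η = whiskerLeft z θ) : η = θ := by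
  obtain ⟨d, t, β, ht, hβ⟩ := exists_rep hW (whiskerLeft z η)
  have hβ' : (whiskerLeft z θ).rel t β := h ▸ hβ
  exact ext_of_rel hW (hW.bf2 _ _ ht hz) hβ hβ'

/-- A 2-morphism between restrictions along `z` in `W` descends: over `y`, it is represented by the
representatives of `α` over the local factorisations `k ≫ z ≅ y`, and two such factorisations
agree locally. -/
theorem whiskerLeft_surjective {z : a ⟶ b} (hz : W z) {f g : b ⟶ c}
    (α : LHom W (z ≫ f) (z ≫ g)) : ∃ η : LHom W f g, whiskerLeft z η = α := by
  let η : LHom W f g := ofRel hW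
    (fun {d} y β => ∃ (k : d ⟶ a) (ζ : k ≫ z ≅ y) (γ : k ≫ z ≫ f ⟶ k ≫ z ≫ g), α.rel k γ ∧
      β = BicatFrac.transp ζ (unwhisker z k γ))
    (by
      rintro d d' l y _ ⟨k, ζ, γ, h, rfl⟩
      refine ⟨l ≫ k, α_ _ _ _ ≪≫ whiskerLeftIso l ζ, _, α.res l h, ?_⟩
      rw [unwhisker_res, res_transp, transp_transp]
      congr 1
      ext
      simp)
    (by
      rintro d y y' ξ _ ⟨k, ζ, γ, h, rfl⟩
      exact ⟨k, ζ ≪≫ ξ, γ, h, transp_transp _ _ _⟩)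
    (by
      rintro d y _ _ ⟨k, ζ, γ, h, rfl⟩ ⟨k', ζ', γ', h', rfl⟩
      -- `δ` compares the two factorisations locally.
      obtain ⟨d₁, v, δ, hv, hδ⟩ := hW.lift_iso z hz (ζ ≪≫ ζ'.symm)
      obtain ⟨d₂, t, ht, e⟩ := α.locEq (α.transp δ (α.res v h)) (α.res v h')
      refine ⟨d₂, t ≫ v, hW.bf2 _ _ ht hv, whiskerLeft_eq_of_comp _ _ ?_⟩
      have hδ' : v ◁ ζ.hom = (α_ _ _ _).inv ≫ δ.hom ▷ z ≫ (α_ _ _ _).hom ≫ v ◁ ζ'.hom := by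
        have := congrArg (fun x => x ≫ v ◁ ζ'.hom) hδ
        simpa using this
      have hδ'' : v ◁ ζ.inv = v ◁ ζ'.inv ≫ (α_ _ _ _).inv ≫ δ.inv ▷ z ≫ (α_ _ _ _).hom := by
        rw [← cancel_epi (v ◁ ζ.hom)]
        nth_rewrite 2 [hδ']
        simp
      have e₁ : v ◁ BicatFrac.transp ζ (unwhisker z k γ) = (v ◁ ζ'.inv ▷ f ≫ 𝟙 _) ⊗≫
          BicatFrac.transp δ (BicatFrac.res v γ) ⊗≫ v ◁ ζ'.hom ▷ g := by
        simp only [BicatFrac.transp, BicatFrac.res, unwhisker]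
        calc
          _ = 𝟙 _ ⊗≫ (v ◁ ζ.inv) ▷ f ⊗≫ v ◁ γ ⊗≫ (v ◁ ζ.hom) ▷ g ⊗≫ 𝟙 _ := by bicategory
          _ = _ := by rw [hδ', hδ'']; bicategory
      have e₂ : v ◁ BicatFrac.transp ζ' (unwhisker z k' γ') = (v ◁ ζ'.inv ▷ f ≫ 𝟙 _) ⊗≫
          BicatFrac.res v γ' ⊗≫ v ◁ ζ'.hom ▷ g := by
        simp only [BicatFrac.transp, BicatFrac.res, unwhisker]; bicategory
      have e₃ : ∀ x : (v ≫ k') ≫ z ≫ f ⟶ (v ≫ k') ≫ z ≫ g,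
          t ◁ ((v ◁ ζ'.inv ▷ f ≫ 𝟙 _) ⊗≫ x ⊗≫ v ◁ ζ'.hom ▷ g) =
          t ◁ v ◁ ζ'.inv ▷ f ⊗≫ t ◁ x ⊗≫ t ◁ v ◁ ζ'.hom ▷ g := by
        intro x; bicategory
      rw [e₁, e₂, e₃, e₃, e])
    (by
      intro d y
      obtain ⟨d₁, s, k, hs, ⟨ξ⟩⟩ := hW.bf3 z y hz
      obtain ⟨d₂, t, β, ht, h⟩ := α.exists_rel k
      exact ⟨d₂, t ≫ s, _, hW.bf2 _ _ ht hs, t ≫ k, α_ _ _ _ ≪≫ whiskerLeftIso t ξ.symm ≪≫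
        (α_ _ _ _).symm, β, h, rfl⟩)
  obtain ⟨d, t, β, ht, h⟩ := exists_rep hW α
  refine ⟨η, eq_of_rel hW ht (rel_whiskerLeft_of_eq (ofRel_rel hW
    ⟨t, Iso.refl _, β, h, (transp_refl _).symm⟩) rfl) h rfl⟩

end LHom

namespace Loc

/-- The class of morphisms of the localised bicategory given by `W`. -/
def prop (hW : BF W) : MorphismProperty (Loc hW) := fun a b f => W (show a.as ⟶ b.as from f)

instance strict (hW : BF W) : Strict (prop hW) where
  id_mem a := hW.bf1 a.as
  comp_mem {a b c} f g hf hg := hW.bf2 (a := a.as) (b := b.as) (c := c.as) f g hf hg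
  square {a b c} w f hw := by
    obtain ⟨d, w', f', hw', ⟨i⟩⟩ :=
      hW.bf3 (show a.as ⟶ b.as from w) (show c.as ⟶ b.as from f) hw
    exact ⟨⟨d⟩, mor hW w', mor hW f', hw', ⟨iso hW i⟩⟩
  whiskerRight_bijective {a b c w} hw f g :=
    ⟨fun _ _ => LHom.whiskerRight_injective_of_locEq hW (hW.locEq_of_whiskerRight hw),
      fun α => LHom.whiskerRight_surjective_of_lift hW (hW.locEq_of_whiskerRight hw)
        (fun α => by
          obtain ⟨d, v, β, hv, hβ, -⟩ := hW.bf4ab (show b.as ⟶ c.as from w) _ _ α hw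
          exact ⟨d, v, β, hv, hβ⟩) α⟩
  whiskerLeft_bijective hz f g :=
    ⟨fun _ _ => LHom.whiskerLeft_injective hW hz, LHom.whiskerLeft_surjective hW hz⟩

end Loc

end Localisation

section Legs

variable {D : Type u} [Bicategory.{w, v} D] {W : MorphismProperty D}

/-! ### Evaluation of roofs in a strict situation -/

namespace Strict

variable [Strict W]

theorem hom_ext_right {a b c : D} {w : b ⟶ c} (hw : W w) {f g : a ⟶ b} {η θ : f ⟶ g}
    (h : η ▷ w = θ ▷ w) : η = θ :=
  (whiskerRight_bijective hw f g).1 h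

theorem hom_ext_left {a b c : D} {z : a ⟶ b} (hz : W z) {f g : b ⟶ c} {η θ : f ⟶ g}
    (h : z ◁ η = z ◁ θ) : η = θ :=
  (whiskerLeft_bijective hz f g).1 h

/-- The 2-morphism with a given right whiskering. -/
noncomputable def lift {a b c : D} {w : b ⟶ c} (hw : W w) {f g : a ⟶ b} (η : f ≫ w ⟶ g ≫ w) :
    f ⟶ g :=
  ((whiskerRight_bijective hw f g).2 η).choose

@[simp]
theorem lift_whiskerRight {a b c : D} {w : b ⟶ c} (hw : W w) {f g : a ⟶ b}
    (η : f ≫ w ⟶ g ≫ w) : lift hw η ▷ w = η :=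
  ((whiskerRight_bijective hw f g).2 η).choose_spec

/-- The 2-morphism with a given left whiskering. -/
noncomputable def glue {a b c : D} {z : a ⟶ b} (hz : W z) {f g : b ⟶ c} (η : z ≫ f ⟶ z ≫ g) :
    f ⟶ g :=
  ((whiskerLeft_bijective hz f g).2 η).choose

@[simp]
theorem whiskerLeft_glue {a b c : D} {z : a ⟶ b} (hz : W z) {f g : b ⟶ c}
    (η : z ≫ f ⟶ z ≫ g) : z ◁ glue hz η = η :=
  ((whiskerLeft_bijective hz f g).2 η).choose_spec

end Strict

open Strict

/-- A leg of the roof `r` over `u`, with value `y`: a factorisation `m` of `u` through `r.left`,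
together with an identification of `y` with the corresponding composite `m ≫ r.right`. -/
structure Leg {a b e : D} (r : Roof W a b) (u : e ⟶ a) (y : e ⟶ b) where
  m : e ⟶ r.apex
  θ : m ≫ r.left ≅ u
  φ : m ≫ r.right ≅ y

namespace Leg

variable {a b e : D} {r s : Roof W a b} {u u' u'' : e ⟶ a} {y y' y'' : e ⟶ b}

/-- The restriction of a leg. -/
abbrev res (M : Leg r u y) {d : D} (z : d ⟶ e) : Leg r (z ≫ u) (z ≫ y) where
  m := z ≫ M.m
  θ := α_ _ _ _ ≪≫ whiskerLeftIso z M.θ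
  φ := α_ _ _ _ ≪≫ whiskerLeftIso z M.φ

variable [Strict W]

/-- The unique 2-morphism between two legs over a given 2-morphism. -/
noncomputable def lift (β : u ⟶ u') (M : Leg r u y) (M' : Leg r u' y') : M.m ⟶ M'.m :=
  Strict.lift r.left_mem (M.θ.hom ≫ β ≫ M'.θ.inv)

theorem lift_whisker (β : u ⟶ u') (M : Leg r u y) (M' : Leg r u' y') :
    lift β M M' ▷ r.left = M.θ.hom ≫ β ≫ M'.θ.inv :=
  lift_whiskerRight _ _

theorem eq_lift {β : u ⟶ u'} {M : Leg r u y} {M' : Leg r u' y'} {σ : M.m ⟶ M'.m}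
    (h : σ ▷ r.left ≫ M'.θ.hom = M.θ.hom ≫ β) : σ = lift β M M' := by
  apply hom_ext_right r.left_mem
  rw [lift_whisker, ← Category.assoc, ← h]
  simp

/-- The effect of the roof `r` on the 2-morphism `β`, relative to given legs. -/
noncomputable def tr (β : u ⟶ u') (M : Leg r u y) (M' : Leg r u' y') : y ⟶ y' :=
  M.φ.inv ≫ lift β M M' ▷ r.right ≫ M'.φ.hom

theorem tr_eq {β : u ⟶ u'} {M : Leg r u y} {M' : Leg r u' y'} (σ : M.m ⟶ M'.m)
    (h : σ ▷ r.left ≫ M'.θ.hom = M.θ.hom ≫ β) : tr β M M' = M.φ.inv ≫ σ ▷ r.right ≫ M'.φ.hom := by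
  rw [eq_lift h, tr]

@[simp]
theorem tr_id (M : Leg r u y) : tr (𝟙 u) M M = 𝟙 y := by
  rw [tr_eq (𝟙 _) (by simp)]; simp

@[simp]
theorem tr_comp (β : u ⟶ u') (β' : u' ⟶ u'') (M : Leg r u y) (M' : Leg r u' y')
    (M'' : Leg r u'' y'') : tr β M M' ≫ tr β' M' M'' = tr (β ≫ β') M M'' := by
  rw [tr_eq (β := β ≫ β') (lift β M M' ≫ lift β' M' M'') (by simp [lift_whisker])]
  simp [tr]

@[simp]
theorem tr_comp_assoc (β : u ⟶ u') (β' : u' ⟶ u'') (M : Leg r u y) (M' : Leg r u' y')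
    (M'' : Leg r u'' y'') {x : e ⟶ b} (γ : y'' ⟶ x) :
    tr β M M' ≫ tr β' M' M'' ≫ γ = tr (β ≫ β') M M'' ≫ γ := by
  rw [← tr_comp, Category.assoc]

theorem whiskerLeft_tr {d : D} (z : d ⟶ e) (β : u ⟶ u') (M : Leg r u y) (M' : Leg r u' y') :
    z ◁ tr β M M' = tr (z ◁ β) (M.res z) (M'.res z) := by
  rw [tr_eq (β := z ◁ β) (M := M.res z) (M' := M'.res z) (z ◁ lift β M M')]
  · simp [tr]
  · have := congrArg (z ◁ ·) (lift_whisker β M M')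
    simp only [Bicategory.whiskerLeft_comp] at this
    simp [reassoc_of% this]

/-- A roof acts on 2-morphisms `ζ ▷ u` through whiskering of its value. -/
theorem tr_whiskerRight {d : D} {z z' : d ⟶ e} (ζ : z ⟶ z') (M : Leg r u y) :
    tr (ζ ▷ u) (M.res z) (M.res z') = ζ ▷ y := by
  rw [tr_eq (β := ζ ▷ u) (M := M.res z) (M' := M.res z') (ζ ▷ M.m)]
  · have := whisker_exchange ζ M.φ.hom
    simp only [Bicategory.whiskerRight_comp, Category.assoc] at this
    simp [← this]
  · have := whisker_exchange ζ M.θ.hom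
    simp [this]

theorem tr_associator_hom {d d' : D} (t : d' ⟶ d) (z : d ⟶ e) (M : Leg r u y) :
    tr (α_ t z u).hom (M.res (t ≫ z)) ((M.res z).res t) = (α_ t z y).hom := by
  rw [tr_eq (M' := (M.res z).res t) (M := M.res (t ≫ z)) (α_ t z M.m).hom]
  · simp
  · simp

theorem tr_associator_inv {d d' : D} (t : d' ⟶ d) (z : d ⟶ e) (M : Leg r u y) :
    tr (α_ t z u).inv ((M.res z).res t) (M.res (t ≫ z)) = (α_ t z y).inv := by
  rw [tr_eq (M := (M.res z).res t) (M' := M.res (t ≫ z)) (α_ t z M.m).inv]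
  · simp
  · simp

end Leg

open Leg

/-- Every roof has legs locally. -/
theorem exists_leg [Strict W] {a b e : D} (r : Roof W a b) (u : e ⟶ a) :
    ∃ (d : D) (z : d ⟶ e) (y : d ⟶ b), W z ∧ Nonempty (Leg r (z ≫ u) y) := by
  obtain ⟨d, z, m, hz, ⟨i⟩⟩ := Strict.square r.left u r.left_mem
  exact ⟨d, z, _, hz, ⟨⟨m, i.symm, Iso.refl _⟩⟩⟩

/-- Finitely many roofs have legs over a common morphism in `W`. -/
theorem exists_legs [Strict W] {a b : D} (L : List (Roof W a b)) :
    ∃ (e : D) (u : e ⟶ a), W u ∧ ∀ r ∈ L, ∃ y, Nonempty (Leg r u y) := by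
  induction L with
  | nil => exact ⟨a, 𝟙 a, Strict.id_mem a, by simp⟩
  | cons r L ih =>
    obtain ⟨e, u, hu, h⟩ := ih
    obtain ⟨d, z, y, hz, hy⟩ := exists_leg r u
    refine ⟨d, z ≫ u, Strict.comp_mem hz hu, fun s hs => ?_⟩
    rcases List.mem_cons.1 hs with rfl | hs
    · exact ⟨y, hy⟩
    · obtain ⟨y', ⟨M⟩⟩ := h s hs
      exact ⟨_, ⟨M.res z⟩⟩

/-- A transformation between roofs: a natural family of 2-morphisms between their values. -/
structure RoofTrans [Strict W] {a b : D} (r s : Roof W a b) where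
  app : ∀ {e : D} {u u' : e ⟶ a} {y y' : e ⟶ b}, (u ⟶ u') → Leg r u y → Leg s u' y' → (y ⟶ y')
  tr_app : ∀ {e : D} {u u' u'' : e ⟶ a} {y y' y'' : e ⟶ b} (β : u ⟶ u') (β' : u' ⟶ u'')
    (M : Leg r u y) (M' : Leg r u' y') (N : Leg s u'' y''),
    tr β M M' ≫ app β' M' N = app (β ≫ β') M N
  app_tr : ∀ {e : D} {u u' u'' : e ⟶ a} {y y' y'' : e ⟶ b} (β : u ⟶ u') (β' : u' ⟶ u'')
    (M : Leg r u y) (N : Leg s u' y') (N' : Leg s u'' y''),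
    app β M N ≫ tr β' N N' = app (β ≫ β') M N'
  whiskerLeft_app : ∀ {e d : D} {u u' : e ⟶ a} {y y' : e ⟶ b} (z : d ⟶ e) (β : u ⟶ u')
    (M : Leg r u y) (N : Leg s u' y'), z ◁ app β M N = app (z ◁ β) (M.res z) (N.res z)

namespace RoofTrans

variable [Strict W] {a b : D} {r s t : Roof W a b}

@[simp]
theorem tr_app' (T : RoofTrans r s) {e : D} {u u' u'' : e ⟶ a} {y y' y'' : e ⟶ b} (β : u ⟶ u')
    (β' : u' ⟶ u'') (M : Leg r u y) (M' : Leg r u' y') (N : Leg s u'' y'') :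
    tr β M M' ≫ T.app β' M' N = T.app (β ≫ β') M N := T.tr_app _ _ _ _ _

@[simp]
theorem tr_app_assoc (T : RoofTrans r s) {e : D} {u u' u'' : e ⟶ a} {y y' y'' x : e ⟶ b}
    (β : u ⟶ u') (β' : u' ⟶ u'') (M : Leg r u y) (M' : Leg r u' y') (N : Leg s u'' y'')
    (γ : y'' ⟶ x) : tr β M M' ≫ T.app β' M' N ≫ γ = T.app (β ≫ β') M N ≫ γ := by
  rw [← T.tr_app', Category.assoc]

@[simp]
theorem app_tr' (T : RoofTrans r s) {e : D} {u u' u'' : e ⟶ a} {y y' y'' : e ⟶ b} (β : u ⟶ u')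
    (β' : u' ⟶ u'') (M : Leg r u y) (N : Leg s u' y') (N' : Leg s u'' y'') :
    T.app β M N ≫ tr β' N N' = T.app (β ≫ β') M N' := T.app_tr _ _ _ _ _

@[simp]
theorem app_tr_assoc (T : RoofTrans r s) {e : D} {u u' u'' : e ⟶ a} {y y' y'' x : e ⟶ b}
    (β : u ⟶ u') (β' : u' ⟶ u'') (M : Leg r u y) (N : Leg s u' y') (N' : Leg s u'' y'')
    (γ : y'' ⟶ x) : T.app β M N ≫ tr β' N N' ≫ γ = T.app (β ≫ β') M N' ≫ γ := by
  rw [← T.app_tr', Category.assoc]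

/-- The value of a transformation at a refinement of two given legs. -/
theorem whiskerLeft_app_eq (T : RoofTrans r s) {e d e₀ : D} {u u' : e ⟶ a} {y y' : e ⟶ b}
    {u₀ : e₀ ⟶ a} {y₀ y₀' : e₀ ⟶ b} (β : u ⟶ u') (M : Leg r u y) (N : Leg s u' y')
    (M₀ : Leg r u₀ y₀) (N₀ : Leg s u₀ y₀') (z : d ⟶ e) (k : d ⟶ e₀) (i : z ≫ u ⟶ k ≫ u₀)
    (j : k ≫ u₀ ⟶ z ≫ u') (h : i ≫ j = z ◁ β) :
    z ◁ T.app β M N = tr i (M.res z) (M₀.res k) ≫ k ◁ T.app (𝟙 u₀) M₀ N₀ ≫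
      tr j (N₀.res k) (N.res z) := by
  rw [whiskerLeft_app, whiskerLeft_app]
  simp [h]

/-- The transformation `T''` is the vertical composite of `T` and `T'`. -/
def IsComp (T : RoofTrans r s) (T' : RoofTrans s t) (T'' : RoofTrans r t) : Prop :=
  ∀ ⦃e : D⦄ ⦃u u' u'' : e ⟶ a⦄ ⦃y y' y'' : e ⟶ b⦄ (β : u ⟶ u') (β' : u' ⟶ u'')
    (M : Leg r u y) (N : Leg s u' y') (P : Leg t u'' y''),
    T.app β M N ≫ T'.app β' N P = T''.app (β ≫ β') M P

/-- A transformation is determined by its value on legs over a single morphism in `W`. -/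
theorem ext_of_mem {T T' : RoofTrans r s} {e₀ : D} {u₀ : e₀ ⟶ a} {y₀ y₀' : e₀ ⟶ b} (hu : W u₀)
    (M₀ : Leg r u₀ y₀) (N₀ : Leg s u₀ y₀') (h : T.app (𝟙 u₀) M₀ N₀ = T'.app (𝟙 u₀) M₀ N₀) :
    T = T' := by
  have : ∀ {e : D} {u u' : e ⟶ a} {y y' : e ⟶ b} (β : u ⟶ u') (M : Leg r u y) (N : Leg s u' y'),
      T.app β M N = T'.app β M N := by
    intro e u u' y y' β M N
    obtain ⟨d, z, k, hz, ⟨i⟩⟩ := Strict.square u₀ u hu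
    apply hom_ext_left hz
    rw [T.whiskerLeft_app_eq β M N M₀ N₀ z k i.hom (i.inv ≫ z ◁ β) (by simp), h,
      T'.whiskerLeft_app_eq β M N M₀ N₀ z k i.hom (i.inv ≫ z ◁ β) (by simp)]
  cases T
  cases T'
  congr
  funext e u u' y y' β M N
  exact this β M N

/-- Compatibility with composition may be checked on legs over a single morphism in `W`. -/
theorem isComp_of_mem {T : RoofTrans r s} {T' : RoofTrans s t} {T'' : RoofTrans r t} {e₀ : D}
    {u₀ : e₀ ⟶ a} {y₀ y₀' y₀'' : e₀ ⟶ b} (hu : W u₀) (M₀ : Leg r u₀ y₀) (N₀ : Leg s u₀ y₀')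
    (P₀ : Leg t u₀ y₀'')
    (h : T.app (𝟙 u₀) M₀ N₀ ≫ T'.app (𝟙 u₀) N₀ P₀ = T''.app (𝟙 u₀) M₀ P₀) : IsComp T T' T'' := by
  intro e u u' u'' y y' y'' β β' M N P
  obtain ⟨d, z, k, hz, ⟨i⟩⟩ := Strict.square u₀ u hu
  apply hom_ext_left hz
  rw [Bicategory.whiskerLeft_comp, T''.whiskerLeft_app_eq (β ≫ β') M P M₀ P₀ z k i.hom
    (i.inv ≫ z ◁ (β ≫ β')) (by simp), ← h,
    T.whiskerLeft_app_eq β M N M₀ N₀ z k i.hom (i.inv ≫ z ◁ β) (by simp), T'.whiskerLeft_app]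
  simp [T'.whiskerLeft_app]

/-- The identity transformation. -/
@[simps]
noncomputable def id (r : Roof W a b) : RoofTrans r r where
  app β M N := tr β M N
  tr_app := by simp
  app_tr := by simp
  whiskerLeft_app := by simp [whiskerLeft_tr]

end RoofTrans

namespace PreCell

variable {a b : D} {r s : Roof W a b}

/-- The leg of the source given by a representative. -/
abbrev legP (X : PreCell r s) : Leg r (X.p ≫ r.left) (X.p ≫ r.right) where
  m := X.p
  θ := Iso.refl _
  φ := Iso.refl _

/-- The leg of the target given by a representative. -/
abbrev legQ (X : PreCell r s) : Leg s (X.p ≫ r.left) (X.q ≫ s.right) where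
  m := X.q
  θ := X.α.symm
  φ := Iso.refl _

variable [Strict W] (X : PreCell r s)

/-- The value of a representative along `k`: the given legs are compared, by means of `i` and `j`,
with the legs of `X` restricted along `k`, where the value of `X` is the 2-morphism `X.β`. -/
noncomputable def val {e d : D} {u u' : e ⟶ a} {y y' : e ⟶ b} (M : Leg r u y) (N : Leg s u' y')
    (z : d ⟶ e) (k : d ⟶ X.apex) (i : z ≫ u ⟶ k ≫ X.p ≫ r.left) (j : k ≫ X.p ≫ r.left ⟶ z ≫ u') :
    z ≫ y ⟶ z ≫ y' :=
  tr i (M.res z) (X.legP.res k) ≫ k ◁ X.β ≫ tr j (X.legQ.res k) (N.res z)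

variable {X} {e d d' : D} {u u' : e ⟶ a} {y y' : e ⟶ b} {M : Leg r u y} {N : Leg s u' y'}
  {z z' : d ⟶ e}

/-- The value along `k` depends only on the composite `i ≫ j`, since `i.inv ≫ i'` lifts along the
member `X.p ≫ r.left` of the class to a 2-morphism from `k` to `k'`. -/
theorem val_eq_val {k k' : d ⟶ X.apex} {i : z ≫ u ≅ k ≫ X.p ≫ r.left}
    {j : k ≫ X.p ≫ r.left ⟶ z ≫ u'} {i' : z ≫ u ⟶ k' ≫ X.p ≫ r.left}
    {j' : k' ≫ X.p ≫ r.left ⟶ z ≫ u'} (h : i.hom ≫ j = i' ≫ j') :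
    X.val M N z k i.hom j = X.val M N z k' i' j' := by
  let κ : k ⟶ k' := Strict.lift X.p_mem (i.inv ≫ i')
  have hκ : κ ▷ (X.p ≫ r.left) = i.inv ≫ i' := lift_whiskerRight _ _
  have e₁ : i' = i.hom ≫ κ ▷ (X.p ≫ r.left) := by simp [hκ]
  have e₂ : j = κ ▷ (X.p ≫ r.left) ≫ j' := by simp [hκ, ← h]
  rw [val, val, e₁, e₂, ← tr_comp _ _ _ (X.legP.res k), ← tr_comp _ _ _ (X.legQ.res k'),
    tr_whiskerRight, tr_whiskerRight, Category.assoc, whisker_exchange_assoc]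

theorem whiskerLeft_val (t : d' ⟶ d) {k : d ⟶ X.apex} {i : z ≫ u ⟶ k ≫ X.p ≫ r.left}
    {j : k ≫ X.p ≫ r.left ⟶ z ≫ u'} : t ◁ X.val M N z k i j = (α_ _ _ _).inv ≫
      X.val M N (t ≫ z) (t ≫ k) ((α_ _ _ _).hom ≫ t ◁ i ≫ (α_ _ _ _).inv)
        ((α_ _ _ _).hom ≫ t ◁ j ≫ (α_ _ _ _).inv) ≫ (α_ _ _ _).hom := by
  simp only [val, Bicategory.whiskerLeft_comp, whiskerLeft_tr, comp_whiskerLeft, Category.assoc]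
  rw [← tr_associator_inv t z M, ← tr_associator_hom t z N,
    ← tr_associator_hom t k X.legP, ← tr_associator_inv t k X.legQ]
  simp

theorem val_iso (ζ : z ≅ z') {k : d ⟶ X.apex} {i : z' ≫ u ⟶ k ≫ X.p ≫ r.left}
    {j : k ≫ X.p ≫ r.left ⟶ z' ≫ u'} : X.val M N z' k i j =
      ζ.inv ▷ _ ≫ X.val M N z k (ζ.hom ▷ _ ≫ i) (j ≫ ζ.inv ▷ _) ≫ ζ.hom ▷ _ := by
  rw [← tr_whiskerRight ζ.inv M, ← tr_whiskerRight ζ.hom N]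
  simp [val]

variable (X M N)

/-- The values along the various `k` glue to a 2-morphism, since they agree locally. -/
theorem exists_val (β : u ⟶ u') : ∃ γ : y ⟶ y', ∀ {d : D} (z : d ⟶ e) (k : d ⟶ X.apex)
    (i : z ≫ u ⟶ k ≫ X.p ≫ r.left) (j : k ≫ X.p ≫ r.left ⟶ z ≫ u'), i ≫ j = z ◁ β →
    z ◁ γ = X.val M N z k i j := by
  -- The 2-morphism is glued from its value along one `z₀` in the class.
  obtain ⟨d₀, z₀, k₀, hz₀, ⟨i₀⟩⟩ := Strict.square (X.p ≫ r.left) u X.p_mem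
  refine ⟨glue hz₀ (X.val M N z₀ k₀ i₀.hom (i₀.inv ≫ z₀ ◁ β)), fun {d} z k i j h => ?_⟩
  obtain ⟨d', s, s₀, hs, ⟨ξ⟩⟩ := Strict.square z₀ z hz₀
  apply hom_ext_left hs
  have e : (s₀ ≫ z₀) ◁ glue hz₀ (X.val M N z₀ k₀ i₀.hom (i₀.inv ≫ z₀ ◁ β)) =
      X.val M N (s₀ ≫ z₀) (s₀ ≫ k₀) ((α_ _ _ _).hom ≫ s₀ ◁ i₀.hom ≫ (α_ _ _ _).inv)
        ((α_ _ _ _).hom ≫ s₀ ◁ (i₀.inv ≫ z₀ ◁ β) ≫ (α_ _ _ _).inv) := by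
    rw [comp_whiskerLeft, whiskerLeft_glue, whiskerLeft_val]
    simp
  set G := glue hz₀ (X.val M N z₀ k₀ i₀.hom (i₀.inv ≫ z₀ ◁ β))
  have e₁ : (s ≫ z) ◁ G = ξ.hom ▷ y ≫ (s₀ ≫ z₀) ◁ G ≫ ξ.inv ▷ y' := by
    rw [← whisker_exchange_assoc]; simp
  have e₂ : s ◁ z ◁ G = (α_ _ _ _).inv ≫ (s ≫ z) ◁ G ≫ (α_ _ _ _).hom := by simp
  have key := val_eq_val (X := X) (M := M) (N := N)
    (i := α_ _ _ _ ≪≫ whiskerLeftIso s₀ i₀ ≪≫ (α_ _ _ _).symm)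
    (j := (α_ _ _ _).hom ≫ s₀ ◁ (i₀.inv ≫ z₀ ◁ β) ≫ (α_ _ _ _).inv)
    (i' := ξ.inv ▷ u ≫ (α_ s z u).hom ≫ s ◁ i ≫ (α_ s k (X.p ≫ r.left)).inv)
    (j' := ((α_ s k (X.p ≫ r.left)).hom ≫ s ◁ j ≫ (α_ s z u').inv) ≫ ξ.hom ▷ u') (by
      have h₁ : s ◁ i ≫ s ◁ j = s ◁ z ◁ β := by rw [← Bicategory.whiskerLeft_comp, h]
      have h₂ := whisker_exchange ξ.inv β
      simp only [Iso.trans_hom, Iso.symm_hom, whiskerLeftIso_hom, Category.assoc,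
        Bicategory.whiskerLeft_comp, Iso.inv_hom_id_assoc, reassoc_of% h₁]
      calc
        _ = (s₀ ≫ z₀) ◁ β ≫ ξ.inv ▷ u' ≫ ξ.hom ▷ u' := by
          simp
        _ = _ := by rw [reassoc_of% h₂]; simp)
  rw [whiskerLeft_val, val_iso ξ.symm, e₂, e₁, e]
  exact congrArg (fun x => (α_ s z y).inv ≫ (ξ.hom ▷ y ≫ x ≫ ξ.inv ▷ y') ≫ (α_ s z y').hom) key

/-- The transformation of roofs given by a representative of a 2-morphism. -/
noncomputable def ev : RoofTrans r s where
  app β M N := (X.exists_val M N β).choose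
  tr_app {e u u' u'' y y' y''} β β' M M' N := by
    obtain ⟨d, z, k, hz, ⟨i⟩⟩ := Strict.square (X.p ≫ r.left) u' X.p_mem
    apply hom_ext_left hz
    rw [Bicategory.whiskerLeft_comp,
      (X.exists_val M' N β').choose_spec z k i.hom (i.inv ≫ z ◁ β') (by simp),
      (X.exists_val M N (β ≫ β')).choose_spec z k (z ◁ β ≫ i.hom) (i.inv ≫ z ◁ β') (by simp)]
    simp [val, whiskerLeft_tr]
  app_tr {e u u' u'' y y' y''} β β' M N N' := by
    obtain ⟨d, z, k, hz, ⟨i⟩⟩ := Strict.square (X.p ≫ r.left) u X.p_mem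
    apply hom_ext_left hz
    rw [Bicategory.whiskerLeft_comp,
      (X.exists_val M N β).choose_spec z k i.hom (i.inv ≫ z ◁ β) (by simp),
      (X.exists_val M N' (β ≫ β')).choose_spec z k i.hom (i.inv ≫ z ◁ (β ≫ β')) (by simp)]
    simp [val, whiskerLeft_tr]
  whiskerLeft_app {e d u u' y y'} t β M N := by
    obtain ⟨d', z, k, hz, ⟨i⟩⟩ := Strict.square (X.p ≫ r.left) (t ≫ u) X.p_mem
    apply hom_ext_left hz
    have e := (X.exists_val M N β).choose_spec (z ≫ t) k ((α_ _ _ _).hom ≫ i.hom)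
      (i.inv ≫ z ◁ t ◁ β ≫ (α_ _ _ _).inv) (by simp)
    rw [(X.exists_val (M.res t) (N.res t) (t ◁ β)).choose_spec z k i.hom (i.inv ≫ z ◁ t ◁ β)
      (by simp)]
    have e' : z ◁ t ◁ (X.exists_val M N β).choose = (α_ _ _ _).inv ≫
      (z ≫ t) ◁ (X.exists_val M N β).choose ≫ (α_ _ _ _).hom := by simp
    rw [e', e, ← tr_associator_inv z t M, ← tr_associator_hom z t N]
    simp [val]

/-- The value of `X` at its own legs. -/
theorem ev_app_self : X.ev.app (𝟙 _) X.legP X.legQ = X.β := by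
  apply hom_ext_left (Strict.id_mem (W := W) X.apex)
  refine ((X.exists_val X.legP X.legQ (𝟙 _)).choose_spec (𝟙 _) (𝟙 _) (𝟙 _) (𝟙 _)
    (by simp)).trans ?_
  simp [val]

/-- The value of `X` on legs which are compared with the legs of `X` along a morphism `k` to its
apex. -/
theorem ev_app_eq (β : u ⟶ u') (k : e ⟶ X.apex) (i : u ⟶ k ≫ X.p ≫ r.left)
    (j : k ≫ X.p ≫ r.left ⟶ u') (h : i ≫ j = β) :
    X.ev.app β M N = tr i M (X.legP.res k) ≫ k ◁ X.β ≫ tr j (X.legQ.res k) N := by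
  rw [← ev_app_self, RoofTrans.whiskerLeft_app]
  simp [h]

end PreCell
end Legs

section Horizontal

variable {D : Type u} [Bicategory.{w, v} D] {W : MorphismProperty D}

open Strict Leg

/-! ### Composites of roofs -/

/-- Data exhibiting the roof `R` as a composite of the roofs `f` and `g`. -/
structure CompData {a b c : D} (R : Roof W a c) (f : Roof W a b) (g : Roof W b c) where
  fst : R.apex ⟶ f.apex
  snd : R.apex ⟶ g.apex
  θ : fst ≫ f.left ≅ R.left
  iso : fst ≫ f.right ≅ snd ≫ g.left
  φ : snd ≫ g.right ≅ R.right

namespace Leg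

variable {a b c e : D} {R R' : Roof W a c} {f f' : Roof W a b} {g g' : Roof W b c}
  {u u' u'' : e ⟶ a} {y y' y'' : e ⟶ c}

/-- The first component of a leg of a composite. -/
abbrev fst (K : CompData R f g) (Q : Leg R u y) : Leg f u ((Q.m ≫ K.fst) ≫ f.right) where
  m := Q.m ≫ K.fst
  θ := α_ _ _ _ ≪≫ whiskerLeftIso Q.m K.θ ≪≫ Q.θ
  φ := Iso.refl _

/-- The second component of a leg of a composite. -/
abbrev snd (K : CompData R f g) (Q : Leg R u y) : Leg g ((Q.m ≫ K.fst) ≫ f.right) y where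
  m := Q.m ≫ K.snd
  θ := α_ _ _ _ ≪≫ whiskerLeftIso Q.m K.iso.symm ≪≫ (α_ _ _ _).symm
  φ := α_ _ _ _ ≪≫ whiskerLeftIso Q.m K.φ ≪≫ Q.φ

variable [Strict W] (K : CompData R f g)

/-- A composite of roofs acts on 2-morphisms through the composite of the actions. -/
theorem tr_fst_snd (β : u ⟶ u') (Q : Leg R u y) (Q' : Leg R u' y') :
    tr (tr β (Q.fst K) (Q'.fst K)) (Q.snd K) (Q'.snd K) = tr β Q Q' := by
  have h : tr β (Q.fst K) (Q'.fst K) = lift β Q Q' ▷ K.fst ▷ f.right := by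
    rw [tr_eq (M := Q.fst K) (M' := Q'.fst K) (lift β Q Q' ▷ K.fst)]
    · simp
    · have h₁ := lift_whisker β Q Q'
      have h₂ := whisker_exchange (lift β Q Q') K.θ.hom
      simp only [Iso.trans_hom, whiskerLeftIso_hom, Category.assoc]
      rw [associator_naturality_left_assoc, ← reassoc_of% h₂, reassoc_of% h₁]
      simp
  rw [h, tr_eq (M := Q.snd K) (M' := Q'.snd K) (lift β Q Q' ▷ K.snd)]
  · have h₂ := whisker_exchange (lift β Q Q') K.φ.hom
    simp only [Iso.trans_hom, whiskerLeftIso_hom, Category.assoc, Iso.trans_inv, whiskerLeftIso_inv]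
    rw [associator_naturality_left_assoc, ← reassoc_of% h₂]
    simp [tr]
  · have h₂ := whisker_exchange (lift β Q Q') K.iso.inv
    simp only [Iso.trans_hom, whiskerLeftIso_hom, Category.assoc, Iso.symm_hom]
    rw [associator_naturality_left_assoc, ← reassoc_of% h₂]
    simp

/-- The components of a restricted leg agree with the restrictions of the components. -/
theorem tr_res_fst_snd {d : D} (z : d ⟶ e) (Q : Leg R u y) :
    tr (tr (𝟙 (z ≫ u)) ((Q.res z).fst K) ((Q.fst K).res z)) ((Q.res z).snd K)
      ((Q.snd K).res z) = 𝟙 (z ≫ y) := by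
  have h : tr (𝟙 (z ≫ u)) ((Q.res z).fst K) ((Q.fst K).res z) =
      (α_ z Q.m K.fst).hom ▷ f.right ≫ (α_ _ _ _).hom := by
    rw [tr_eq (M := (Q.res z).fst K) (M' := (Q.fst K).res z) (α_ z Q.m K.fst).hom]
    · simp
    · simp
  rw [h, tr_eq (M := (Q.res z).snd K) (M' := (Q.snd K).res z) (α_ z Q.m K.snd).hom]
  · simp
  · simp

/-- The components of a restricted leg may be replaced by the restrictions of the components. -/
@[simp]
theorem tr_fst_res_snd_res {d : D} (z : d ⟶ e) {x : d ⟶ a} {w : d ⟶ c} (β : x ⟶ z ≫ u)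
    (X : Leg R x w) (Y : Leg R u y) :
    tr (tr β (X.fst K) ((Y.fst K).res z)) (X.snd K) ((Y.snd K).res z) = tr β X (Y.res z) := by
  have := congrArg (fun t => tr β X (Y.res z) ≫ t) (tr_res_fst_snd K z Y)
  dsimp only at this
  rw [← tr_fst_snd K, tr_comp, tr_comp] at this
  simpa [tr_fst_snd] using this

/-- The components of a restricted leg may be replaced by the restrictions of the components. -/
@[simp]
theorem tr_fst_res_snd_res' {d : D} (z : d ⟶ e) {x : d ⟶ a} {w : d ⟶ c} (β : z ≫ u ⟶ x)
    (X : Leg R x w) (Y : Leg R u y) :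
    tr (tr β ((Y.fst K).res z) (X.fst K)) ((Y.snd K).res z) (X.snd K) = tr β (Y.res z) X := by
  have := congrArg (fun t => t ≫ tr (tr β ((Y.fst K).res z) (X.fst K)) ((Y.snd K).res z) (X.snd K))
    (tr_res_fst_snd K z Y)
  dsimp only at this
  rw [tr_comp, tr_comp] at this
  simpa [tr_fst_snd] using this.symm

end Leg

namespace RoofTrans

variable [Strict W] {a b c d : D}

/-- The horizontal composite of two transformations. -/
@[simps]
def hcomp {R R' : Roof W a c} {f f' : Roof W a b} {g g' : Roof W b c} (K : CompData R f g)
    (K' : CompData R' f' g') (T : RoofTrans f f') (S : RoofTrans g g') : RoofTrans R R' where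
  app β Q Q' := S.app (T.app β (Q.fst K) (Q'.fst K')) (Q.snd K) (Q'.snd K')
  tr_app β β' M M' N := by
    rw [← tr_fst_snd K, tr_app', tr_app']
  app_tr β β' M N N' := by
    rw [← tr_fst_snd K', app_tr', app_tr']
  whiskerLeft_app z β M N := by
    have h₁ := tr_res_fst_snd K z M
    have h₂ := tr_fst_res_snd_res' K' z (𝟙 _) (N.res z) N
    rw [tr_id] at h₂
    rw [S.whiskerLeft_app, T.whiskerLeft_app,
      ← Category.id_comp (S.app (T.app (z ◁ β) ((M.fst K).res z) _) _ _), ← h₁,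
      ← Category.comp_id (_ ≫ S.app _ _ _), ← h₂, tr_app', tr_app', app_tr', app_tr',
      Category.id_comp, Category.comp_id]

theorem hcomp_id_id {R : Roof W a c} {f : Roof W a b} {g : Roof W b c} (K : CompData R f g) :
    hcomp K K (id f) (id g) = id R := by
  simp [hcomp, id, tr_fst_snd]

/-- The associator, for two ways of composing three roofs. -/
@[simps]
noncomputable def assoc {f : Roof W a b} {g : Roof W b c} {h : Roof W c d} {F : Roof W a c}
    {G : Roof W b d} {R R' : Roof W a d} (K₁ : CompData F f g) (K₂ : CompData R F h)
    (L₁ : CompData G g h) (L₂ : CompData R' f G) : RoofTrans R R' where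
  app β Q Q' := tr (tr (tr β ((Q.fst K₂).fst K₁) (Q'.fst L₂)) ((Q.fst K₂).snd K₁)
    ((Q'.snd L₂).fst L₁)) (Q.snd K₂) ((Q'.snd L₂).snd L₁)
  tr_app β β' M M' N := by
    rw [← tr_fst_snd K₂, ← tr_fst_snd K₁, tr_comp, tr_comp, tr_comp]
  app_tr β β' M N N' := by
    rw [← tr_fst_snd L₂, ← tr_fst_snd L₁, tr_comp, tr_comp, tr_comp]
  whiskerLeft_app z β M N := by
    have h₁ : tr (tr (tr (𝟙 _) (((M.res z).fst K₂).fst K₁) (((M.fst K₂).fst K₁).res z))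
      (((M.res z).fst K₂).snd K₁) (((M.fst K₂).snd K₁).res z)) ((M.res z).snd K₂)
      ((M.snd K₂).res z) = 𝟙 _ := by simp
    have h₂ : tr (tr (tr (𝟙 _) ((N.fst L₂).res z) ((N.res z).fst L₂))
      (((N.snd L₂).fst L₁).res z) (((N.res z).snd L₂).fst L₁)) (((N.snd L₂).snd L₁).res z)
      (((N.res z).snd L₂).snd L₁) = 𝟙 _ := by simp
    rw [whiskerLeft_tr, whiskerLeft_tr, whiskerLeft_tr, ← Category.id_comp (tr _ _ _), ← h₁,
      ← Category.comp_id (_ ≫ tr _ _ _), ← h₂, tr_comp, tr_comp, tr_comp, tr_comp, tr_comp,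
      tr_comp]
    simp

/-- The inverse of the associator, for two ways of composing three roofs. -/
@[simps]
noncomputable def assocInv {f : Roof W a b} {g : Roof W b c} {h : Roof W c d} {F : Roof W a c}
    {G : Roof W b d} {R R' : Roof W a d} (K₁ : CompData F f g) (K₂ : CompData R F h)
    (L₁ : CompData G g h) (L₂ : CompData R' f G) : RoofTrans R' R where
  app β Q Q' := tr (tr (tr β (Q.fst L₂) ((Q'.fst K₂).fst K₁)) ((Q.snd L₂).fst L₁)
    ((Q'.fst K₂).snd K₁)) ((Q.snd L₂).snd L₁) (Q'.snd K₂)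
  tr_app β β' M M' N := by
    rw [← tr_fst_snd L₂, ← tr_fst_snd L₁, tr_comp, tr_comp, tr_comp]
  app_tr β β' M N N' := by
    rw [← tr_fst_snd K₂, ← tr_fst_snd K₁, tr_comp, tr_comp, tr_comp]
  whiskerLeft_app z β M N := by
    have h₁ : tr (tr (tr (𝟙 _) (((N.fst K₂).fst K₁).res z) (((N.res z).fst K₂).fst K₁))
      (((N.fst K₂).snd K₁).res z) (((N.res z).fst K₂).snd K₁)) ((N.snd K₂).res z)
      ((N.res z).snd K₂) = 𝟙 _ := by simp
    have h₂ : tr (tr (tr (𝟙 _) ((M.res z).fst L₂) ((M.fst L₂).res z))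
      (((M.res z).snd L₂).fst L₁) (((M.snd L₂).fst L₁).res z)) (((M.res z).snd L₂).snd L₁)
      (((M.snd L₂).snd L₁).res z) = 𝟙 _ := by simp
    rw [whiskerLeft_tr, whiskerLeft_tr, whiskerLeft_tr, ← Category.id_comp (tr _ _ _), ← h₂,
      ← Category.comp_id (_ ≫ tr _ _ _), ← h₁, tr_comp, tr_comp, tr_comp, tr_comp, tr_comp,
      tr_comp]
    simp

end RoofTrans

/-- Data exhibiting the roof `I` as the one given by the morphism `f`. -/
abbrev MorData {a b : D} (I : Roof W a b) (f : a ⟶ b) := I.left ≫ f ≅ I.right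

namespace Leg

variable {a b e : D} {I J : Roof W a b} {f : a ⟶ b} {u u' : e ⟶ a} {y y' : e ⟶ b}

/-- The value of a roof given by a morphism is computed by composition. -/
def val (E : MorData I f) (M : Leg I u y) : u ≫ f ≅ y :=
  whiskerRightIso M.θ.symm f ≪≫ α_ _ _ _ ≪≫ whiskerLeftIso M.m E ≪≫ M.φ

theorem val_res (E : MorData I f) (M : Leg I u y) {d : D} (z : d ⟶ e) :
    (M.res z).val E = α_ _ _ _ ≪≫ whiskerLeftIso z (M.val E) := by
  ext; simp [val]

/-- The composite of two roofs given by morphisms is given by the composite of the morphisms. -/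
def _root_.BicatFrac.CompData.morData {c : D} {R : Roof W a c} {G : Roof W b c} {g : b ⟶ c}
    (K : CompData R I G) (E : MorData I f) (E' : MorData G g) : MorData R (f ≫ g) :=
  whiskerRightIso K.θ.symm (f ≫ g) ≪≫ α_ _ _ _ ≪≫ whiskerLeftIso K.fst ((α_ _ _ _).symm ≪≫
    whiskerRightIso E g) ≪≫ (α_ _ _ _).symm ≪≫ whiskerRightIso K.iso g ≪≫ α_ _ _ _ ≪≫
    whiskerLeftIso K.snd E' ≪≫ K.φ

theorem val_morData {c : D} {R : Roof W a c} {G : Roof W b c} {g : b ⟶ c} (K : CompData R I G)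
    (E : MorData I f) (E' : MorData G g) {y : e ⟶ c} (Q : Leg R u y) :
    Q.val (K.morData E E') = (α_ _ _ _).symm ≪≫ whiskerRightIso ((Q.fst K).val E) g ≪≫
      (Q.snd K).val E' := by
  ext
  simp [val, CompData.morData]

variable [Strict W]

/-- A roof given by a morphism `f` acts on 2-morphisms by whiskering with `f`. -/
theorem tr_eq_val (E : MorData I f) (β : u ⟶ u') (M : Leg I u y) (M' : Leg I u' y') :
    tr β M M' = (M.val E).inv ≫ β ▷ f ≫ (M'.val E).hom := by
  have h₁ := congrArg (· ▷ f) (lift_whisker β M M')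
  have h₂ := whisker_exchange (lift β M M') E.hom
  simp only [Bicategory.comp_whiskerRight] at h₁
  rw [← cancel_epi (M.val E).hom, Iso.hom_inv_id_assoc, tr]
  simp only [val, Iso.trans_hom, whiskerRightIso_hom, whiskerLeftIso_hom, Category.assoc,
    Iso.hom_inv_id_assoc, Iso.symm_hom]
  rw [reassoc_of% h₂, ← associator_naturality_left_assoc, reassoc_of% h₁]
  simp

end Leg

namespace RoofTrans

variable [Strict W] {a b c d : D}

/-- The transformation between roofs given by morphisms which is induced by a 2-morphism. -/
@[simps]
def ofHom₂ {I J : Roof W a b} {f g : a ⟶ b} (E : MorData I f) (E' : MorData J g) (γ : f ⟶ g) :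
    RoofTrans I J where
  app {e u u' y y'} β M N := (M.val E).inv ≫ β ▷ f ≫ u' ◁ γ ≫ (N.val E').hom
  tr_app β β' M M' N := by simp [tr_eq_val E]
  app_tr β β' M N N' := by
    simp [tr_eq_val E', whisker_exchange_assoc]
  whiskerLeft_app z β M N := by
    simp [val_res]

/-- The left unitor. -/
@[simps]
noncomputable def leftUnitor {R : Roof W a b} {I : Roof W a a} {f : Roof W a b}
    (K : CompData R I f) (E : MorData I (𝟙 a)) : RoofTrans R f where
  app {e u u' y y'} β Q M := tr (((Q.fst K).val E).inv ≫ (ρ_ u).hom ≫ β) (Q.snd K) M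
  tr_app β β' M M' N := by
    rw [← tr_fst_snd K, tr_comp, tr_eq_val E]; simp
  app_tr := by simp
  whiskerLeft_app z β M N := by
    rw [whiskerLeft_tr, ← Category.id_comp (tr _ _ _), ← tr_res_fst_snd K z M, tr_comp,
      tr_eq_val E]
    simp [val_res]

/-- The inverse of the left unitor. -/
@[simps]
noncomputable def leftUnitorInv {R : Roof W a b} {I : Roof W a a} {f : Roof W a b}
    (K : CompData R I f) (E : MorData I (𝟙 a)) : RoofTrans f R where
  app {e u u' y y'} β M Q := tr (β ≫ (ρ_ u').inv ≫ ((Q.fst K).val E).hom) M (Q.snd K)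
  tr_app := by simp
  app_tr β β' M M' N := by
    rw [← tr_fst_snd K, tr_comp, tr_eq_val E]; simp
  whiskerLeft_app z β M N := by
    have h := tr_fst_res_snd_res' K z (𝟙 _) (N.res z) N
    rw [tr_id] at h
    rw [whiskerLeft_tr, ← Category.comp_id (tr _ _ _), ← h, tr_comp,
      tr_eq_val E]
    simp [val_res]

/-- The right unitor. -/
@[simps]
noncomputable def rightUnitor {R : Roof W a b} {I : Roof W b b} {f : Roof W a b}
    (K : CompData R f I) (E : MorData I (𝟙 b)) : RoofTrans R f where
  app {e u u' y y'} β Q M := ((Q.snd K).val E).inv ≫ (ρ_ _).hom ≫ tr β (Q.fst K) M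
  tr_app β β' M M' N := by
    rw [← tr_fst_snd K, tr_eq_val E]; simp
  app_tr := by simp
  whiskerLeft_app z β M N := by
    rw [← Category.id_comp (z ◁ _), ← tr_res_fst_snd K z M, tr_eq_val E]
    simp [val_res, whiskerLeft_tr]

/-- The inverse of the right unitor. -/
@[simps]
noncomputable def rightUnitorInv {R : Roof W a b} {I : Roof W b b} {f : Roof W a b}
    (K : CompData R f I) (E : MorData I (𝟙 b)) : RoofTrans f R where
  app {e u u' y y'} β M Q := tr β M (Q.fst K) ≫ (ρ_ _).inv ≫ ((Q.snd K).val E).hom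
  tr_app := by simp
  app_tr β β' M M' N := by
    rw [← tr_fst_snd K, tr_eq_val E]; simp
  whiskerLeft_app z β M N := by
    have h := tr_fst_res_snd_res' K z (𝟙 _) (N.res z) N
    rw [tr_id] at h
    rw [← Category.comp_id (z ◁ _), ← h, tr_eq_val E]
    simp [val_res, whiskerLeft_tr]

end RoofTrans

end Horizontal

section Explicit

variable {C : Type u} [Bicategory.{w, v} C] {a b c d e e' : C}

/-! ### Explicit form of the coherence conditions -/

theorem LFiller.comm_iff {S T k₀ g₀ h₀ : C} {m : e ⟶ S} {n : e ⟶ T} {k : e ⟶ k₀} {Sf : S ⟶ a}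
    {Ss : S ⟶ g₀} {Tf : T ⟶ a} {Ts : T ⟶ h₀} {f : a ⟶ b} {g : g₀ ⟶ b} {h : h₀ ⟶ b}
    {p : k₀ ⟶ g₀} {q : k₀ ⟶ h₀} (i : Sf ≫ f ⟶ Ss ≫ g) (j : Tf ≫ f ⟶ Ts ≫ h)
    (α : p ≫ g ⟶ q ≫ h) (σ : m ≫ Sf ⟶ n ≫ Tf) (τ₁ : m ≫ Ss ⟶ k ≫ p) (τ₂ : k ≫ q ⟶ n ≫ Ts) :
    m ◁ i ⊗≫ τ₁ ▷ g ⊗≫ k ◁ α ⊗≫ τ₂ ▷ h = 𝟙 _ ⊗≫ σ ▷ f ⊗≫ n ◁ j ⊗≫ 𝟙 _ ↔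
    m ◁ i ≫ (α_ _ _ _).inv ≫ τ₁ ▷ g ≫ (α_ _ _ _).hom ≫ k ◁ α ≫ (α_ _ _ _).inv ≫ τ₂ ▷ h =
      (α_ _ _ _).inv ≫ σ ▷ f ≫ (α_ _ _ _).hom ≫ n ◁ j ≫ (α_ _ _ _).inv := by
  simp [bicategoricalComp]

theorem RFiller.comm_iff {S T k₀ f₀ g₀ h₀ : C} {m : e ⟶ S} {n : e ⟶ T} {k : e ⟶ k₀} {Sf : S ⟶ f₀}
    {Ss : S ⟶ h₀} {Tf : T ⟶ g₀} {Ts : T ⟶ h₀} {f : f₀ ⟶ b} {g : g₀ ⟶ b} {h : h₀ ⟶ b}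
    {p : k₀ ⟶ f₀} {q : k₀ ⟶ g₀} (i : Sf ≫ f ⟶ Ss ≫ h) (j : Tf ≫ g ⟶ Ts ≫ h)
    (β : p ≫ f ⟶ q ≫ g) (σ : m ≫ Ss ⟶ n ≫ Ts) (τ₁ : m ≫ Sf ⟶ k ≫ p) (τ₂ : k ≫ q ⟶ n ≫ Tf) :
    τ₁ ▷ f ⊗≫ k ◁ β ⊗≫ τ₂ ▷ g ⊗≫ n ◁ j = 𝟙 _ ⊗≫ m ◁ i ⊗≫ σ ▷ h ⊗≫ 𝟙 _ ↔
    τ₁ ▷ f ≫ (α_ _ _ _).hom ≫ k ◁ β ≫ (α_ _ _ _).inv ≫ τ₂ ▷ g ≫ (α_ _ _ _).hom ≫ n ◁ j =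
      (α_ _ _ _).hom ≫ m ◁ i ≫ (α_ _ _ _).inv ≫ σ ▷ h ≫ (α_ _ _ _).hom := by
  simp [bicategoricalComp]

theorem AFiller.comm₁_iff {S T S₁ f₀ g₀ T₁ : C} {m : e ⟶ S} {n : e ⟶ T} {Sf : S ⟶ S₁}
    {Sf₁ : S₁ ⟶ f₀} {Ss₁ : S₁ ⟶ g₀} {Tf : T ⟶ f₀} {Ts : T ⟶ T₁} {Tf₁ : T₁ ⟶ g₀} {f : f₀ ⟶ b}
    {g : g₀ ⟶ b} (i : Sf₁ ≫ f ⟶ Ss₁ ≫ g) (j : Tf ≫ f ⟶ Ts ≫ Tf₁ ≫ g)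
    (σ₁ : m ≫ Sf ≫ Sf₁ ⟶ n ≫ Tf) (σ₂ : m ≫ Sf ≫ Ss₁ ⟶ n ≫ Ts ≫ Tf₁) :
    m ◁ Sf ◁ i ⊗≫ σ₂ ▷ g = 𝟙 _ ⊗≫ σ₁ ▷ f ⊗≫ n ◁ j ⊗≫ 𝟙 _ ↔
    m ◁ Sf ◁ i ≫ m ◁ (α_ _ _ _).inv ≫ (α_ _ _ _).inv ≫ σ₂ ▷ g =
      m ◁ (α_ _ _ _).inv ≫ (α_ _ _ _).inv ≫ σ₁ ▷ f ≫ (α_ _ _ _).hom ≫ n ◁ j ≫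
        n ◁ (α_ _ _ _).inv ≫ (α_ _ _ _).inv := by
  simp [bicategoricalComp]

theorem AFiller.comm₂_iff {S T S₁ g₀ h₀ T₁ : C} {m : e ⟶ S} {n : e ⟶ T} {Sf : S ⟶ S₁}
    {Ss : S ⟶ h₀} {Ss₁ : S₁ ⟶ g₀} {Ts : T ⟶ T₁} {Tf₁ : T₁ ⟶ g₀} {Ts₁ : T₁ ⟶ h₀} {g : g₀ ⟶ b}
    {h : h₀ ⟶ b} (i : Sf ≫ Ss₁ ≫ g ⟶ Ss ≫ h) (j : Tf₁ ≫ g ⟶ Ts₁ ≫ h)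
    (σ₂ : m ≫ Sf ≫ Ss₁ ⟶ n ≫ Ts ≫ Tf₁) (σ₃ : m ≫ Ss ⟶ n ≫ Ts ≫ Ts₁) :
    m ◁ i ⊗≫ σ₃ ▷ h = 𝟙 _ ⊗≫ σ₂ ▷ g ⊗≫ n ◁ Ts ◁ j ⊗≫ 𝟙 _ ↔
    m ◁ i ≫ (α_ _ _ _).inv ≫ σ₃ ▷ h = m ◁ (α_ _ _ _).inv ≫ (α_ _ _ _).inv ≫ σ₂ ▷ g ≫
      (α_ _ _ _).hom ≫ n ◁ (α_ _ _ _).hom ≫ n ◁ Ts ◁ j ≫ n ◁ (α_ _ _ _).inv ≫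
        (α_ _ _ _).inv := by
  simp [bicategoricalComp]

end Explicit

section Fillers

variable {D : Type u} [Bicategory.{w, v} D] {W : MorphismProperty D} [Strict W]

open Strict Leg

/-! ### Evaluation of composites -/

/-- The composite of two roofs along a square. -/
abbrev Roof.scomp {a b c : D} (f : Roof W a b) (g : Roof W b c) (S : Square W f.right g.left) :
    Roof W a c where
  apex := S.apex
  left := S.fst ≫ f.left
  right := S.snd ≫ g.right
  left_mem := Strict.comp_mem S.fst_mem f.left_mem

/-- The composite along a square as a composite. -/
abbrev CompData.ofSquare {a b c : D} (f : Roof W a b) (g : Roof W b c)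
    (S : Square W f.right g.left) : CompData (f.scomp g S) f g where
  fst := S.fst
  snd := S.snd
  θ := Iso.refl _
  iso := S.iso
  φ := Iso.refl _

section

variable {a b c d : D}

/-- A representative with invertible components, read backwards, evaluates to the inverse. -/
theorem PreCell.ev_inv_eq {r s : Roof W a b} (X : PreCell r s) (h : W (X.q ≫ s.left))
    {β' : X.q ≫ s.right ⟶ X.p ≫ r.right} (hβ : β' ≫ X.β = 𝟙 _) {S : RoofTrans s r}
    (hS : RoofTrans.IsComp X.ev S (RoofTrans.id r)) :
    PreCell.ev { apex := X.apex, p := X.q, q := X.p, p_mem := h, α := X.α.symm, β := β' } = S := by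
  let Y : PreCell s r := { apex := X.apex, p := X.q, q := X.p, p_mem := h, α := X.α.symm, β := β' }
  have e₁ : X.ev.app (𝟙 _) Y.legQ Y.legP = X.β := by
    have e₂ : tr X.α.inv Y.legQ X.legP = 𝟙 _ := by
      rw [tr_eq (M := Y.legQ) (M' := X.legP) (𝟙 _) (by simp [Y])]; simp [Y]
    have e₃ : tr X.α.hom X.legQ Y.legP = 𝟙 _ := by
      rw [tr_eq (M := X.legQ) (M' := Y.legP) (𝟙 _) (by simp [Y])]; simp [Y]
    have := congrArg (fun t => tr X.α.inv Y.legQ X.legP ≫ t ≫ tr X.α.hom X.legQ Y.legP)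
      X.ev_app_self
    rw [RoofTrans.app_tr', RoofTrans.tr_app', Category.id_comp, Iso.inv_hom_id, e₂, e₃,
      Category.comp_id] at this
    exact this.trans (Category.id_comp _)
  refine RoofTrans.ext_of_mem h Y.legP Y.legQ ?_
  have e₄ := hS (𝟙 _) (𝟙 _) Y.legQ Y.legP Y.legQ
  rw [e₁, Category.id_comp, RoofTrans.id_app, tr_id] at e₄
  refine Y.ev_app_self.trans (Eq.trans ?_ (Category.id_comp _))
  rw [← hβ, Category.assoc, e₄, Category.comp_id]

theorem RoofTrans.isComp_assoc_assocInv {f : Roof W a b} {g : Roof W b c} {h : Roof W c d}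
    {F : Roof W a c} {G : Roof W b d} {R R' : Roof W a d} (K₁ : CompData F f g)
    (K₂ : CompData R F h) (L₁ : CompData G g h) (L₂ : CompData R' f G) :
    IsComp (assoc K₁ K₂ L₁ L₂) (assocInv K₁ K₂ L₁ L₂) (RoofTrans.id R) := by
  intro e u u' u'' y y' y'' β β' M N P
  simp [tr_fst_snd]

/-- The representative of a vertical composition given by the auxiliary data `k`. -/
abbrev VFiller.scell {r s t : Roof W a b} {x : PreCell r s} {y : PreCell s t}
    (k : VFiller x y) (h : W ((k.m ≫ x.p) ≫ r.left)) : PreCell r t where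
  apex := k.apex
  p := k.m ≫ x.p
  q := k.n ≫ y.q
  p_mem := h
  α := α_ _ _ _ ≪≫ whiskerLeftIso k.m x.α ≪≫ (α_ _ _ _).symm ≪≫ whiskerRightIso k.γ s.left ≪≫
    α_ _ _ _ ≪≫ whiskerLeftIso k.n y.α ≪≫ (α_ _ _ _).symm
  β := (α_ _ _ _).hom ≫ k.m ◁ x.β ≫ (α_ _ _ _).inv ≫ k.γ.hom ▷ s.right ≫
    (α_ _ _ _).hom ≫ k.n ◁ y.β ≫ (α_ _ _ _).inv

theorem VFiller.isComp_ev {r s t : Roof W a b} {x : PreCell r s} {y : PreCell s t}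
    (k : VFiller x y) (h : W ((k.m ≫ x.p) ≫ r.left)) :
    RoofTrans.IsComp x.ev y.ev (k.scell h).ev := by
  let N : Leg s ((k.m ≫ x.p) ≫ r.left) ((k.m ≫ x.q) ≫ s.right) :=
    ⟨k.m ≫ x.q, α_ _ _ _ ≪≫ whiskerLeftIso k.m x.α.symm ≪≫ (α_ _ _ _).symm, Iso.refl _⟩
  refine RoofTrans.isComp_of_mem h (k.scell h).legP N (k.scell h).legQ ?_
  rw [PreCell.ev_app_self, PreCell.ev_app_eq x _ _ _ k.m (α_ _ _ _).hom (α_ _ _ _).inv (by simp),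
    PreCell.ev_app_eq y N (k.scell h).legQ (𝟙 _) k.n ((α_ _ _ _).hom ≫ k.m ◁ x.α.hom ≫
      (α_ _ _ _).inv ≫
      k.γ.hom ▷ s.left ≫ (α_ _ _ _).hom) ((α_ _ _ _).inv ≫ k.γ.inv ▷ s.left ≫ (α_ _ _ _).hom ≫
      k.m ◁ x.α.inv ≫ (α_ _ _ _).inv) (by simp),
    tr_eq (M := (k.scell h).legP) (M' := x.legP.res k.m) (𝟙 _) (by simp),
    tr_eq (M := x.legQ.res k.m) (M' := N) (𝟙 _) (by simp [N]),
    tr_eq (M := N) (M' := y.legP.res k.n) k.γ.hom (by simp [N]),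
    tr_eq (M := y.legQ.res k.n) (M' := (k.scell h).legQ) (𝟙 _) (by simp)]
  simp [N]

/-- The representative of a left whiskering given by the auxiliary data `k`. -/
abbrev LFiller.scell {f : Roof W a b} {g h : Roof W b c} {y : PreCell g h}
    {S : Square W f.right g.left} {T : Square W f.right h.left} (k : LFiller f y S T) :
    PreCell (f.scomp g S) (f.scomp h T) where
  apex := k.apex
  p := k.m
  q := k.n
  p_mem := k.mem
  α := (α_ k.m S.fst f.left).symm ≪≫ whiskerRightIso k.σ f.left ≪≫ α_ k.n T.fst f.left
  β := (α_ k.m S.snd g.right).inv ≫ k.τ₁.hom ▷ g.right ≫ (α_ _ _ _).hom ≫ k.k ◁ y.β ≫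
    (α_ _ _ _).inv ≫ k.τ₂.hom ▷ h.right ≫ (α_ k.n T.snd h.right).hom

theorem LFiller.ev_scell {f : Roof W a b} {g h : Roof W b c} {y : PreCell g h}
    {S : Square W f.right g.left} {T : Square W f.right h.left} (k : LFiller f y S T) :
    k.scell.ev =
      RoofTrans.hcomp (.ofSquare f g S) (.ofSquare f h T) (RoofTrans.id f) y.ev := by
  refine RoofTrans.ext_of_mem k.mem k.scell.legP k.scell.legQ ?_
  have hc := (LFiller.comm_iff _ _ _ _ _ _).1 k.comm
  rw [PreCell.ev_app_self, RoofTrans.hcomp_app, RoofTrans.id_app,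
    tr_eq (M := k.scell.legP.fst (.ofSquare f g S)) (M' := k.scell.legQ.fst (.ofSquare f h T))
      k.σ.hom (by simp),
    PreCell.ev_app_eq y _ _ _ k.k ((α_ _ _ _).hom ≫ k.m ◁ S.iso.hom ≫ (α_ _ _ _).inv ≫
      k.τ₁.hom ▷ g.left ≫ (α_ _ _ _).hom) (k.k ◁ y.α.hom ≫ (α_ _ _ _).inv ≫ k.τ₂.hom ▷ h.left ≫
      (α_ _ _ _).hom ≫ k.n ◁ T.iso.inv ≫ (α_ _ _ _).inv) (by simp [reassoc_of% hc]),
    tr_eq (M := k.scell.legP.snd (.ofSquare f g S)) (M' := y.legP.res k.k) k.τ₁.hom (by simp),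
    tr_eq (M := y.legQ.res k.k) (M' := k.scell.legQ.snd (.ofSquare f h T)) k.τ₂.hom (by simp)]
  simp

/-- The representative of a right whiskering given by the auxiliary data `k`. -/
abbrev RFiller.scell {f g : Roof W a b} {x : PreCell f g} {h : Roof W b c}
    {S : Square W f.right h.left} {T : Square W g.right h.left} (k : RFiller x h S T) :
    PreCell (f.scomp h S) (g.scomp h T) where
  apex := k.apex
  p := k.m
  q := k.n
  p_mem := k.mem
  α := (α_ k.m S.fst f.left).symm ≪≫ whiskerRightIso k.τ₁ f.left ≪≫ α_ _ _ _ ≪≫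
    whiskerLeftIso k.k x.α ≪≫ (α_ _ _ _).symm ≪≫ whiskerRightIso k.τ₂ g.left ≪≫
    α_ k.n T.fst g.left
  β := (α_ k.m S.snd h.right).inv ≫ k.σ ▷ h.right ≫ (α_ k.n T.snd h.right).hom

theorem RFiller.ev_scell {f g : Roof W a b} {x : PreCell f g} {h : Roof W b c}
    {S : Square W f.right h.left} {T : Square W g.right h.left} (k : RFiller x h S T) :
    k.scell.ev =
      RoofTrans.hcomp (.ofSquare f h S) (.ofSquare g h T) x.ev (RoofTrans.id h) := by
  refine RoofTrans.ext_of_mem k.mem k.scell.legP k.scell.legQ ?_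
  have hc := (RFiller.comm_iff _ _ _ _ _ _).1 k.comm
  have hσ : k.σ ▷ h.left = (α_ _ _ _).hom ≫ k.m ◁ S.iso.inv ≫ (α_ _ _ _).inv ≫
      (k.τ₁.hom ▷ f.right ≫ (α_ _ _ _).hom ≫ k.k ◁ x.β ≫ (α_ _ _ _).inv ≫
      k.τ₂.hom ▷ g.right ≫ (α_ _ _ _).hom ≫ k.n ◁ T.iso.hom) ≫ (α_ _ _ _).inv := by
    rw [hc]; simp
  rw [PreCell.ev_app_self, RoofTrans.hcomp_app, RoofTrans.id_app,
    PreCell.ev_app_eq x _ _ _ k.k ((α_ _ _ _).inv ≫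
      k.τ₁.hom ▷ f.left ≫ (α_ _ _ _).hom) (k.k ◁ x.α.hom ≫ (α_ _ _ _).inv ≫ k.τ₂.hom ▷ g.left ≫
      (α_ _ _ _).hom ≫ k.scell.α.inv) (by simp),
    tr_eq (M := k.scell.legP.fst (.ofSquare f h S)) (M' := x.legP.res k.k) k.τ₁.hom (by simp),
    tr_eq (M := x.legQ.res k.k) (M' := k.scell.legQ.fst (.ofSquare g h T)) k.τ₂.hom (by simp),
    tr_eq (M := k.scell.legP.snd (.ofSquare f h S)) (M' := k.scell.legQ.snd (.ofSquare g h T)) k.σ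
      (by simp [hσ])]
  simp

/-- The representative of an associator given by the auxiliary data `k`. -/
abbrev AFiller.scell {f : Roof W a b} {g : Roof W b c} {h : Roof W c d}
    {S₁ : Square W f.right g.left} {S₂ : Square W (S₁.snd ≫ g.right) h.left}
    {T₁ : Square W g.right h.left} {T₂ : Square W f.right (T₁.fst ≫ g.left)}
    (k : AFiller f g h S₁ S₂ T₁ T₂) :
    PreCell ((f.scomp g S₁).scomp h S₂) (f.scomp (g.scomp h T₁) T₂) where
  apex := k.apex
  p := k.m
  q := k.n
  p_mem := k.mem
  α := whiskerLeftIso k.m (α_ S₂.fst S₁.fst f.left).symm ≪≫ (α_ _ _ _).symm ≪≫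
    whiskerRightIso k.σ₁ f.left ≪≫ α_ _ _ _
  β := (α_ k.m S₂.snd h.right).inv ≫ k.σ₃.hom ▷ h.right ≫ (α_ _ _ _).hom ≫
    k.n ◁ (α_ T₂.snd T₁.snd h.right).hom

/-- The representative of the inverse of an associator given by the auxiliary data `k`. -/
abbrev AFiller.sinvCell {f : Roof W a b} {g : Roof W b c} {h : Roof W c d}
    {S₁ : Square W f.right g.left} {S₂ : Square W (S₁.snd ≫ g.right) h.left}
    {T₁ : Square W g.right h.left} {T₂ : Square W f.right (T₁.fst ≫ g.left)}
    (k : AFiller f g h S₁ S₂ T₁ T₂) (hn : W (k.n ≫ T₂.fst ≫ f.left)) :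
    PreCell (f.scomp (g.scomp h T₁) T₂) ((f.scomp g S₁).scomp h S₂) where
  apex := k.apex
  p := k.n
  q := k.m
  p_mem := hn
  α := k.scell.α.symm
  β := k.n ◁ (α_ _ _ _).inv ≫ (α_ _ _ _).inv ≫ k.σ₃.inv ▷ h.right ≫ (α_ k.m S₂.snd h.right).hom

section

variable {f : Roof W a b} {g : Roof W b c} {h : Roof W c d}
    {S₁ : Square W f.right g.left} {S₂ : Square W (S₁.snd ≫ g.right) h.left}
    {T₁ : Square W g.right h.left} {T₂ : Square W f.right (T₁.fst ≫ g.left)}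
    (k : AFiller f g h S₁ S₂ T₁ T₂)

theorem AFiller.ev_scell : k.scell.ev =
    RoofTrans.assoc (.ofSquare f g S₁) (.ofSquare (f.scomp g S₁) h S₂) (.ofSquare g h T₁)
      (.ofSquare f (g.scomp h T₁) T₂) := by
  refine RoofTrans.ext_of_mem k.mem k.scell.legP k.scell.legQ ?_
  have e₁ : k.σ₂.hom ▷ g.left = (α_ _ _ _).hom ≫ k.m ◁ (α_ _ _ _).hom ≫
      k.m ◁ S₂.fst ◁ S₁.iso.inv ≫ (k.m ◁ (α_ _ _ _).inv ≫ (α_ _ _ _).inv ≫ k.σ₁.hom ▷ f.right ≫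
      (α_ _ _ _).hom ≫ k.n ◁ T₂.iso.hom ≫ k.n ◁ (α_ _ _ _).inv ≫ (α_ _ _ _).inv) := by
    rw [← (AFiller.comm₁_iff _ _ _ _).1 k.comm₁]; simp
  have e₂ : k.σ₃.hom ▷ h.left = (α_ _ _ _).hom ≫ k.m ◁ S₂.iso.inv ≫ (k.m ◁ (α_ _ _ _).inv ≫
      (α_ _ _ _).inv ≫ k.σ₂.hom ▷ g.right ≫ (α_ _ _ _).hom ≫ k.n ◁ (α_ _ _ _).hom ≫
      k.n ◁ T₂.snd ◁ T₁.iso.hom ≫ k.n ◁ (α_ _ _ _).inv ≫ (α_ _ _ _).inv) := by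
    rw [← (AFiller.comm₂_iff _ _ _ _).1 k.comm₂]; simp
  rw [PreCell.ev_app_self, RoofTrans.assoc_app,
    tr_eq (M := (k.scell.legP.fst (.ofSquare (f.scomp g S₁) h S₂)).fst (.ofSquare f g S₁))
      (M' := k.scell.legQ.fst (.ofSquare f (g.scomp h T₁) T₂)) ((α_ _ _ _).hom ≫ k.σ₁.hom)
      (by simp),
    tr_eq (M := (k.scell.legP.fst (.ofSquare (f.scomp g S₁) h S₂)).snd (.ofSquare f g S₁))
      (M' := (k.scell.legQ.snd (.ofSquare f (g.scomp h T₁) T₂)).fst (.ofSquare g h T₁))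
      ((α_ _ _ _).hom ≫ k.σ₂.hom ≫ (α_ _ _ _).inv) (by
      simp [e₁]),
    tr_eq (M := k.scell.legP.snd (.ofSquare (f.scomp g S₁) h S₂))
      (M' := (k.scell.legQ.snd (.ofSquare f (g.scomp h T₁) T₂)).snd (.ofSquare g h T₁))
      (k.σ₃.hom ≫ (α_ _ _ _).inv) (by
      simp [e₂])]
  simp

theorem AFiller.ev_sinvCell (hn : W (k.n ≫ T₂.fst ≫ f.left)) : (k.sinvCell hn).ev =
    RoofTrans.assocInv (.ofSquare f g S₁) (.ofSquare (f.scomp g S₁) h S₂) (.ofSquare g h T₁)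
      (.ofSquare f (g.scomp h T₁) T₂) :=
  k.scell.ev_inv_eq hn (by simp) (by
    rw [k.ev_scell]
    exact RoofTrans.isComp_assoc_assocInv _ _ _ _)
end

/-- The roof given by a morphism. -/
abbrev Roof.sofMor (W : MorphismProperty D) [Strict W] (f : a ⟶ b) : Roof W a b where
  apex := a
  left := 𝟙 a
  right := f
  left_mem := Strict.id_mem a

/-- The left unitor, as an exhibition of the roof given by a morphism. -/
abbrev MorData.ofMor (f : a ⟶ b) : MorData (Roof.sofMor W f) f := λ_ f

/-- The representative of an identity. -/
abbrev PreCell.sid (r : Roof W a b) (h : W (𝟙 _ ≫ r.left)) : PreCell r r where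
  apex := r.apex
  p := 𝟙 _
  q := 𝟙 _
  p_mem := h
  α := Iso.refl _
  β := 𝟙 _

theorem PreCell.ev_sid (r : Roof W a b) (h : W (𝟙 _ ≫ r.left)) :
    (PreCell.sid r h).ev = RoofTrans.id r := by
  refine RoofTrans.ext_of_mem h (PreCell.sid r h).legP (PreCell.sid r h).legQ ?_
  rw [PreCell.ev_app_self, RoofTrans.id_app,
    tr_eq (M := (PreCell.sid r h).legP) (M' := (PreCell.sid r h).legQ) (𝟙 _) (by simp)]
  simp

/-- The representative of the image of a 2-morphism. -/
abbrev PreCell.sofHom₂ {f g : a ⟶ b} (γ : f ⟶ g) (h : W (𝟙 a ≫ 𝟙 a)) :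
    PreCell (Roof.sofMor W f) (Roof.sofMor W g) where
  apex := a
  p := 𝟙 _
  q := 𝟙 _
  p_mem := h
  α := Iso.refl _
  β := 𝟙 a ◁ γ

theorem PreCell.ev_sofHom₂ {f g : a ⟶ b} (γ : f ⟶ g) (h : W (𝟙 a ≫ 𝟙 a)) :
    (PreCell.sofHom₂ γ h).ev = RoofTrans.ofHom₂ (.ofMor f) (.ofMor g) γ := by
  refine RoofTrans.ext_of_mem h (PreCell.sofHom₂ γ h).legP (PreCell.sofHom₂ γ h).legQ ?_
  rw [PreCell.ev_app_self]
  simp [Leg.val]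

section

variable (f : Roof W a b) (S : Square W (Roof.sofMor W (𝟙 a)).right f.left)

/-- The representative of a left unitor. -/
abbrev PreCell.sleftHom (h : W (𝟙 S.apex ≫ S.fst ≫ 𝟙 a)) :
    PreCell ((Roof.sofMor W (𝟙 a)).scomp f S) f where
  apex := S.apex
  p := 𝟙 S.apex
  q := S.snd
  p_mem := h
  α := λ_ _ ≪≫ S.iso
  β := (λ_ _).hom

theorem PreCell.ev_sleftHom (h : W (𝟙 S.apex ≫ S.fst ≫ 𝟙 a)) : (PreCell.sleftHom f S h).ev =
    RoofTrans.leftUnitor (.ofSquare _ f S) (.ofMor (𝟙 a)) := by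
  refine RoofTrans.ext_of_mem h (PreCell.sleftHom f S h).legP (PreCell.sleftHom f S h).legQ ?_
  rw [PreCell.ev_app_self, RoofTrans.leftUnitor_app,
    tr_eq (M := (PreCell.sleftHom f S h).legP.snd (.ofSquare _ f S))
      (M' := (PreCell.sleftHom f S h).legQ) (λ_ _).hom (by simp [Leg.val])]
  simp

theorem PreCell.ev_sleftInv (h : W (𝟙 S.apex ≫ S.fst ≫ 𝟙 a)) (h' : W (S.snd ≫ f.left)) :
    PreCell.ev (r := f) (s := (Roof.sofMor W (𝟙 a)).scomp f S)
      { apex := S.apex, p := S.snd, q := 𝟙 _, p_mem := h', α := (PreCell.sleftHom f S h).α.symm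
        β := (λ_ _).inv } =
    RoofTrans.leftUnitorInv (.ofSquare _ f S) (.ofMor (𝟙 a)) :=
  (PreCell.sleftHom f S h).ev_inv_eq h' (by simp) (by
    rw [PreCell.ev_sleftHom]
    intro e u u' u'' y y' y'' β β' M N P
    rw [RoofTrans.leftUnitor_app, RoofTrans.leftUnitorInv_app, tr_comp, RoofTrans.id_app,
      ← tr_fst_snd (.ofSquare _ f S), tr_eq_val (.ofMor (𝟙 a))]
    simp)

end

section

variable (f : Roof W a b) (S : Square W f.right (Roof.sofMor W (𝟙 b)).left)

/-- The representative of a right unitor. -/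
abbrev PreCell.srightHom (h : W (𝟙 S.apex ≫ S.fst ≫ f.left)) :
    PreCell (f.scomp (Roof.sofMor W (𝟙 b)) S) f where
  apex := S.apex
  p := 𝟙 S.apex
  q := S.fst
  p_mem := h
  α := λ_ _
  β := (λ_ _).hom ≫ S.iso.inv

theorem PreCell.ev_srightHom (h : W (𝟙 S.apex ≫ S.fst ≫ f.left)) : (PreCell.srightHom f S h).ev =
    RoofTrans.rightUnitor (.ofSquare f _ S) (.ofMor (𝟙 b)) := by
  refine RoofTrans.ext_of_mem h (PreCell.srightHom f S h).legP (PreCell.srightHom f S h).legQ ?_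
  rw [PreCell.ev_app_self, RoofTrans.rightUnitor_app,
    tr_eq (M := (PreCell.srightHom f S h).legP.fst (.ofSquare f _ S))
      (M' := (PreCell.srightHom f S h).legQ) (λ_ _).hom (by simp)]
  simp [Leg.val]

theorem PreCell.ev_srightInv (h : W (𝟙 S.apex ≫ S.fst ≫ f.left)) (h' : W (S.fst ≫ f.left)) :
    PreCell.ev (r := f) (s := f.scomp (Roof.sofMor W (𝟙 b)) S)
      { apex := S.apex, p := S.fst, q := 𝟙 _, p_mem := h', α := (PreCell.srightHom f S h).α.symm
        β := S.iso.hom ≫ (λ_ _).inv } =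
    RoofTrans.rightUnitorInv (.ofSquare f _ S) (.ofMor (𝟙 b)) :=
  (PreCell.srightHom f S h).ev_inv_eq h' (by simp) (by
    rw [PreCell.ev_srightHom]
    intro e u u' u'' y y' y'' β β' M N P
    simp only [RoofTrans.rightUnitor_app, RoofTrans.rightUnitorInv_app, RoofTrans.id_app,
      Category.assoc, tr_comp_assoc]
    rw [← tr_fst_snd (.ofSquare f _ S), tr_eq_val (.ofMor (𝟙 b))]
    simp)

end

section

variable (f : a ⟶ b) (g : b ⟶ c) (S : Square W (Roof.sofMor W f).right (Roof.sofMor W g).left)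

/-- The representative of the comparison of the image of `f ≫ g` with the composite of the images
of `f` and `g`. -/
abbrev PreCell.scompHom (h : W (S.fst ≫ 𝟙 a)) :
    PreCell (Roof.sofMor W (f ≫ g)) ((Roof.sofMor W f).scomp (Roof.sofMor W g) S) where
  apex := S.apex
  p := S.fst
  q := 𝟙 S.apex
  p_mem := h
  α := (λ_ _).symm
  β := (α_ _ _ _).inv ≫ (S.iso.hom ≫ (ρ_ S.snd).hom) ▷ g ≫ (λ_ _).inv

theorem PreCell.ev_scompHom (h : W (S.fst ≫ 𝟙 a)) : (PreCell.scompHom f g S h).ev =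
    RoofTrans.ofHom₂ (.ofMor (f ≫ g)) ((CompData.ofSquare _ _ S).morData (.ofMor f) (.ofMor g))
      (𝟙 _) := by
  refine RoofTrans.ext_of_mem h (PreCell.scompHom f g S h).legP (PreCell.scompHom f g S h).legQ ?_
  rw [PreCell.ev_app_self]
  simp [Leg.val_morData]
  simp [Leg.val]

theorem PreCell.ev_scompInv (h : W (S.fst ≫ 𝟙 a)) (h' : W (𝟙 _ ≫ S.fst ≫ 𝟙 a)) :
    PreCell.ev (r := (Roof.sofMor W f).scomp (Roof.sofMor W g) S) (s := Roof.sofMor W (f ≫ g))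
      { apex := S.apex, p := 𝟙 _, q := S.fst, p_mem := h', α := (PreCell.scompHom f g S h).α.symm
        β := (λ_ _).hom ≫ ((ρ_ S.snd).inv ≫ S.iso.inv) ▷ g ≫ (α_ _ _ _).hom } =
    RoofTrans.ofHom₂ ((CompData.ofSquare _ _ S).morData (.ofMor f) (.ofMor g)) (.ofMor (f ≫ g))
      (𝟙 _) :=
  (PreCell.scompHom f g S h).ev_inv_eq h' (by simp) (by
    rw [PreCell.ev_scompHom]
    intro e u u' u'' y y' y'' β β' M N P
    rw [RoofTrans.id_app, tr_eq_val (.ofMor (f ≫ g))]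
    simp)

end

end

end Fillers

/-! ### Comparison of representatives -/

section Rel

variable {C : Type u} [Bicategory.{w, v} C] {W : MorphismProperty C} {a b : C} {r s : Roof W a b}

/-- The representatives `x` and `y` agree along the given refinement data. -/
def PreCell.RelBy (x y : PreCell r s) {e : C} (z : e ⟶ x.apex) (z' : e ⟶ y.apex)
    (σ : z ≫ x.p ≅ z' ≫ y.p) (τ : z ≫ x.q ≅ z' ≫ y.q) : Prop :=
  z ◁ x.α.hom ≫ (α_ _ _ _).inv ≫ τ.hom ▷ s.left ≫ (α_ _ _ _).hom =
      (α_ _ _ _).inv ≫ σ.hom ▷ r.left ≫ (α_ _ _ _).hom ≫ z' ◁ y.α.hom ∧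
    z ◁ x.β ≫ (α_ _ _ _).inv ≫ τ.hom ▷ s.right ≫ (α_ _ _ _).hom =
      (α_ _ _ _).inv ≫ σ.hom ▷ r.right ≫ (α_ _ _ _).hom ≫ z' ◁ y.β

theorem PreCell.RelBy.refine_aux {e e' c d y a₀ b₀ : C} {z : e ⟶ a₀} {z' : e ⟶ b₀} {p : a₀ ⟶ c}
    {q : a₀ ⟶ d} {p' : b₀ ⟶ c} {q' : b₀ ⟶ d} {f : c ⟶ y} {g : d ⟶ y} (α : p ≫ f ⟶ q ≫ g)
    (α' : p' ≫ f ⟶ q' ≫ g) (σ : z ≫ p ⟶ z' ≫ p') (τ : z ≫ q ⟶ z' ≫ q') (t : e' ⟶ e)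
    (h : t ◁ (z ◁ α ≫ (α_ _ _ _).inv ≫ τ ▷ g ≫ (α_ _ _ _).hom) =
      t ◁ ((α_ _ _ _).inv ≫ σ ▷ f ≫ (α_ _ _ _).hom ≫ z' ◁ α')) :
    (t ≫ z) ◁ α ≫ (α_ _ _ _).inv ≫ ((α_ t z q).hom ≫ t ◁ τ ≫ (α_ t z' q').inv) ▷ g ≫
        (α_ _ _ _).hom =
      (α_ _ _ _).inv ≫ ((α_ t z p).hom ≫ t ◁ σ ≫ (α_ t z' p').inv) ▷ f ≫ (α_ _ _ _).hom ≫
        (t ≫ z') ◁ α' := by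
  have := congrArg (fun x => (α_ t z (p ≫ f)).hom ≫ x ≫ (α_ t z' (q' ≫ g)).inv) h
  simpa using this

/-- Restriction of an invertible 2-morphism between composites. -/
abbrev resIso {e e' a₀ b₀ c : C} {z : e ⟶ a₀} {z' : e ⟶ b₀} {p : a₀ ⟶ c} {p' : b₀ ⟶ c} (t : e' ⟶ e)
    (σ : z ≫ p ≅ z' ≫ p') : (t ≫ z) ≫ p ≅ (t ≫ z') ≫ p' :=
  α_ t z p ≪≫ whiskerLeftIso t σ ≪≫ (α_ t z' p').symm

theorem PreCell.RelBy.refine {x y : PreCell r s} {e e' : C} {z : e ⟶ x.apex} {z' : e ⟶ y.apex}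
    {σ : z ≫ x.p ≅ z' ≫ y.p} {τ : z ≫ x.q ≅ z' ≫ y.q} (h : PreCell.RelBy x y z z' σ τ)
    (t : e' ⟶ e) : PreCell.RelBy x y (t ≫ z) (t ≫ z') (resIso t σ) (resIso t τ) :=
  ⟨PreCell.RelBy.refine_aux _ _ _ _ t (congrArg (t ◁ ·) h.1),
    PreCell.RelBy.refine_aux _ _ _ _ t (congrArg (t ◁ ·) h.2)⟩

end Rel

section RelStrict

variable {D : Type u} [Bicategory.{w, v} D] {W : MorphismProperty D} [Strict W] {a b : D}
  {r s : Roof W a b}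

open Leg Strict

/-- Equivalent representatives have the same transformation: it suffices to evaluate on the legs of
`x`, restricted along a common refinement. -/
theorem PreCell.ev_eq_of_rel {x y : PreCell r s} (h : PreCell.Rel x y) : x.ev = y.ev := by
  obtain ⟨e, z, z', σ, τ, hz, h₁, h₂⟩ := h
  refine RoofTrans.ext_of_mem hz (x.legP.res z) (x.legQ.res z) ?_
  have h₁' : z' ◁ y.α.hom = (α_ _ _ _).inv ≫ σ.inv ▷ r.left ≫ (α_ _ _ _).hom ≫
      (z ◁ x.α.hom ≫ (α_ _ _ _).inv ≫ τ.hom ▷ s.left ≫ (α_ _ _ _).hom) := by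
    rw [h₁]; simp
  have h₁'' : τ.inv ▷ s.left ≫ (α_ _ _ _).hom ≫ z ◁ x.α.inv = (α_ _ _ _).hom ≫ z' ◁ y.α.inv ≫
      (α_ _ _ _).inv ≫ σ.inv ▷ r.left ≫ (α_ _ _ _).hom := by
    rw [← cancel_mono (z ◁ x.α.hom), ← cancel_epi (z' ◁ y.α.hom ≫ (α_ _ _ _).inv)]
    conv_lhs => rw [h₁']
    simp
  have e₁ := x.ev.whiskerLeft_app z (𝟙 _) x.legP x.legQ
  rw [x.ev_app_self, Bicategory.whiskerLeft_id] at e₁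
  rw [← e₁, PreCell.ev_app_eq y _ _ _ z' ((α_ _ _ _).inv ≫ σ.hom ▷ r.left ≫ (α_ _ _ _).hom)
    ((α_ _ _ _).inv ≫ σ.inv ▷ r.left ≫ (α_ _ _ _).hom) (by simp),
    tr_eq (M := x.legP.res z) (M' := y.legP.res z') σ.hom (by simp),
    tr_eq (M := y.legQ.res z') (M' := x.legQ.res z) τ.inv (by simp [h₁''])]
  have h₂' : z ◁ x.β = (z ◁ x.β ≫ (α_ _ _ _).inv ≫ τ.hom ▷ s.right ≫ (α_ _ _ _).hom) ≫
    (α_ _ _ _).inv ≫ τ.inv ▷ s.right ≫ (α_ _ _ _).hom := by simp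
  rw [h₂', h₂]
  simp

/-- The invertible 2-morphism with a given right whiskering. -/
noncomputable def Strict.liftIso {a b c : D} {w : b ⟶ c} (hw : W w) {f g : a ⟶ b}
    (η : f ≫ w ≅ g ≫ w) : f ≅ g where
  hom := lift hw η.hom
  inv := lift hw η.inv
  hom_inv_id := hom_ext_right hw (by simp)
  inv_hom_id := hom_ext_right hw (by simp)

theorem Strict.liftIso_hom_whiskerRight {a b c : D} {w : b ⟶ c} (hw : W w) {f g : a ⟶ b}
    (η : f ≫ w ≅ g ≫ w) : (liftIso hw η).hom ▷ w = η.hom :=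
  lift_whiskerRight hw _

theorem Strict.liftIso_inv_whiskerRight {a b c : D} {w : b ⟶ c} (hw : W w) {f g : a ⟶ b}
    (η : f ≫ w ≅ g ≫ w) : (liftIso hw η).inv ▷ w = η.inv :=
  lift_whiskerRight hw _

/-- Representatives with the same transformation agree along a refinement: `σ` and `τ` are obtained
by lifting along the left sides, and the condition on the second components is the equality of the
values on the legs of `x`. -/
theorem PreCell.exists_relBy_of_ev_eq {x y : PreCell r s} (h : x.ev = y.ev) :
    ∃ (e : D) (z : e ⟶ x.apex) (z' : e ⟶ y.apex) (σ : z ≫ x.p ≅ z' ≫ y.p)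
      (τ : z ≫ x.q ≅ z' ≫ y.q), W z ∧ PreCell.RelBy x y z z' σ τ := by
  obtain ⟨e, z, z', hz, ⟨i⟩⟩ := Strict.square (y.p ≫ r.left) (x.p ≫ r.left) y.p_mem
  let σ : z ≫ x.p ≅ z' ≫ y.p := liftIso r.left_mem (α_ _ _ _ ≪≫ i ≪≫ (α_ _ _ _).symm)
  have hσ : σ.hom ▷ r.left = _ := liftIso_hom_whiskerRight _ _
  let τ : z ≫ x.q ≅ z' ≫ y.q := liftIso s.left_mem (α_ _ _ _ ≪≫ whiskerLeftIso z x.α.symm ≪≫ i ≪≫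
    whiskerLeftIso z' y.α ≪≫ (α_ _ _ _).symm)
  have hτ : τ.hom ▷ s.left = _ := liftIso_hom_whiskerRight _ _
  have hτ' : τ.inv ▷ s.left = _ := liftIso_inv_whiskerRight _ _
  refine ⟨e, z, z', σ, τ, hz, by simp [hσ, hτ], ?_⟩
  have e₁ := x.ev.whiskerLeft_app z (𝟙 _) x.legP x.legQ
  rw [x.ev_app_self, Bicategory.whiskerLeft_id, h,
    PreCell.ev_app_eq y _ _ _ z' i.hom i.inv (by simp),
    tr_eq (M := x.legP.res z) (M' := y.legP.res z') σ.hom (by simp [hσ]),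
    tr_eq (M := y.legQ.res z') (M' := x.legQ.res z) τ.inv (by simp [hτ'])] at e₁
  rw [e₁]
  simp

end RelStrict

/-! ### Passage to the localised bicategory -/

section Transfer

variable {C : Type u} [Bicategory.{w, v} C] {W : MorphismProperty C} (hW : BF W)

/-- The image of a roof in the localised bicategory. -/
abbrev Roof.loc {a b : C} (r : Roof W a b) : Roof (Loc.prop hW) ⟨a⟩ ⟨b⟩ where
  apex := ⟨r.apex⟩
  left := Loc.mor hW r.left
  right := Loc.mor hW r.right
  left_mem := r.left_mem

/-- The image of a square in the localised bicategory. -/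
abbrev Square.loc {a b c : C} {f : a ⟶ b} {v : c ⟶ b} (S : Square W f v) :
    Square (Loc.prop hW) (Loc.mor hW f) (Loc.mor hW v) where
  apex := ⟨S.apex⟩
  fst := Loc.mor hW S.fst
  snd := Loc.mor hW S.snd
  fst_mem := S.fst_mem
  iso := Loc.iso hW S.iso

/-- The image of a representative in the localised bicategory. -/
abbrev PreCell.loc {a b : C} {r s : Roof W a b} (x : PreCell r s) :
    PreCell (r.loc hW) (s.loc hW) where
  apex := ⟨x.apex⟩
  p := Loc.mor hW x.p
  q := Loc.mor hW x.q
  p_mem := x.p_mem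
  α := Loc.iso hW x.α
  β := Loc.mor₂ hW x.β

open Loc

theorem PreCell.RelBy.loc {a b : C} {r s : Roof W a b} {x y : PreCell r s} {e : C} {z : e ⟶ x.apex}
    {z' : e ⟶ y.apex} {σ : z ≫ x.p ≅ z' ≫ y.p} {τ : z ≫ x.q ≅ z' ≫ y.q}
    (h : PreCell.RelBy x y z z' σ τ) :
    PreCell.RelBy (x.loc hW) (y.loc hW) (mor hW z) (mor hW z') (Loc.iso hW σ) (Loc.iso hW τ) := by
  have h₁ := congrArg (mor₂ hW) h.1
  have h₂ := congrArg (mor₂ hW) h.2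
  simp only [mor₂_comp, mor₂_whiskerLeft, mor₂_whiskerRight] at h₁ h₂
  exact ⟨h₁, h₂⟩

/-- Every invertible 2-morphism of the localised bicategory comes locally from an invertible
2-morphism of `C`. -/
theorem Loc.exists_whiskerLeft_eq_iso {a b : C} {f g : a ⟶ b} (η : mor hW f ≅ mor hW g) :
    ∃ (d : C) (z : d ⟶ a) (β : z ≫ f ≅ z ≫ g), W z ∧ mor hW z ◁ η.hom = mor₂ hW β.hom := by
  obtain ⟨d, z, β, β', hz, hβ, hβ'⟩ := LHom.exists_rep₂ hW (show LHom W f g from η.hom)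
    (show LHom W g f from η.inv)
  have e := whiskerLeft_eq_mor₂_of_rel (hW := hW) hβ
  have e' := whiskerLeft_eq_mor₂_of_rel (hW := hW) hβ'
  have h₁ : mor₂ hW (β ≫ β') = mor₂ hW (𝟙 _) := by
    rw [mor₂_comp, ← e, ← e', mor₂_id]
    exact whiskerLeft_hom_inv _ η
  have h₂ : mor₂ hW (β' ≫ β) = mor₂ hW (𝟙 _) := by
    rw [mor₂_comp, ← e, ← e', mor₂_id]
    exact whiskerLeft_inv_hom _ η
  obtain ⟨d₁, t₁, ht₁, e₁⟩ := mor₂_eq_iff.1 h₁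
  obtain ⟨d₂, t₂, ht₂, e₂⟩ := mor₂_eq_iff.1 h₂
  -- A common refinement along which `β` and `β'` become mutually inverse.
  obtain ⟨d₃, k, l, -, ⟨ξ⟩, hk⟩ := hW.ore t₁ t₂ ht₁
  have e₁' : (l ≫ t₁) ◁ (β ≫ β') = (l ≫ t₁) ◁ 𝟙 _ := whiskerLeft_eq_of_comp _ _ (by rw [e₁])
  have e₂' : (l ≫ t₁) ◁ (β' ≫ β) = (l ≫ t₁) ◁ 𝟙 _ :=
    whiskerLeft_eq_of_iso ξ (whiskerLeft_eq_of_comp _ _ (by rw [e₂]))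
  refine ⟨d₃, (l ≫ t₁) ≫ z, ⟨res (l ≫ t₁) β, res (l ≫ t₁) β', ?_, ?_⟩,
    hW.bf2 _ _ (hk ht₂) hz, ?_⟩
  · rw [← res_comp, res, e₁']; simp
  · rw [← res_comp, res, e₂']; simp
  · change _ = mor₂ hW (res (l ≫ t₁) β)
    have : mor hW ((l ≫ t₁) ≫ z) ◁ η.hom = (α_ (mor hW (l ≫ t₁)) (mor hW z) (mor hW f)).hom ≫
      mor hW (l ≫ t₁) ◁ mor hW z ◁ η.hom ≫ (α_ (mor hW (l ≫ t₁)) (mor hW z) (mor hW g)).inv :=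
        Bicategory.comp_whiskerLeft _ _ _
    rw [this, res, mor₂_comp, mor₂_comp, mor₂_whiskerLeft, ← e]
    rfl

/-- Agreement in the localised bicategory is agreement after a further refinement. -/
theorem PreCell.rel_of_relBy_loc {a b : C} {r s : Roof W a b} {x y : PreCell r s} {e : C}
    {z : e ⟶ x.apex} {z' : e ⟶ y.apex} {σ : z ≫ x.p ≅ z' ≫ y.p} {τ : z ≫ x.q ≅ z' ≫ y.q}
    (hz : W z)
    (h : PreCell.RelBy (x.loc hW) (y.loc hW) (mor hW z) (mor hW z') (Loc.iso hW σ)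
      (Loc.iso hW τ)) : PreCell.Rel x y := by
  obtain ⟨h₁, h₂⟩ := h
  have h₁' : mor₂ hW (z ◁ x.α.hom ≫ (α_ _ _ _).inv ≫ τ.hom ▷ s.left ≫ (α_ _ _ _).hom) =
      mor₂ hW ((α_ _ _ _).inv ≫ σ.hom ▷ r.left ≫ (α_ _ _ _).hom ≫ z' ◁ y.α.hom) := by
    simp only [mor₂_comp, mor₂_whiskerLeft, mor₂_whiskerRight]; exact h₁
  have h₂' : mor₂ hW (z ◁ x.β ≫ (α_ _ _ _).inv ≫ τ.hom ▷ s.right ≫ (α_ _ _ _).hom) =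
      mor₂ hW ((α_ _ _ _).inv ≫ σ.hom ▷ r.right ≫ (α_ _ _ _).hom ≫ z' ◁ y.β) := by
    simp only [mor₂_comp, mor₂_whiskerLeft, mor₂_whiskerRight]; exact h₂
  obtain ⟨d₁, t₁, ht₁, e₁⟩ := mor₂_eq_iff.1 h₁'
  obtain ⟨d₂, t₂, ht₂, e₂⟩ := mor₂_eq_iff.1 h₂'
  -- A common refinement along which both equations hold.
  obtain ⟨d₃, k, l, -, ⟨ξ⟩, hk⟩ := hW.ore t₁ t₂ ht₁
  have e₁' := whiskerLeft_eq_of_comp l t₁ (congrArg (l ◁ ·) e₁)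
  have e₂' := whiskerLeft_eq_of_iso ξ (whiskerLeft_eq_of_comp k t₂ (congrArg (k ◁ ·) e₂))
  refine ⟨d₃, (l ≫ t₁) ≫ z, (l ≫ t₁) ≫ z', resIso (l ≫ t₁) σ, resIso (l ≫ t₁) τ,
    hW.bf2 _ _ (hW.bf2 _ _ (hk ht₂) hz) x.p_mem, ?_, ?_⟩
  · exact PreCell.RelBy.refine_aux _ _ _ _ _ e₁'
  · exact PreCell.RelBy.refine_aux _ _ _ _ _ e₂'

section

variable {e e' a₀ b₀ c : C} {z : e ⟶ a₀} {z' : e ⟶ b₀} {p : a₀ ⟶ c} {p' : b₀ ⟶ c} {t : e' ⟶ e}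

theorem iso_resIso (σ : z ≫ p ≅ z' ≫ p') :
    Loc.iso hW (resIso t σ) = resIso (p := mor hW p) (p' := mor hW p') (z := mor hW z)
      (z' := mor hW z') (mor hW t) (Loc.iso hW σ) := by
  ext
  simp only [iso_hom, resIso, Iso.trans_hom, mor₂_comp, whiskerLeftIso_hom, mor₂_whiskerLeft]
  rfl

theorem iso_eq_resIso {σ : mor hW z ≫ mor hW p ≅ mor hW z' ≫ mor hW p'}
    {β : t ≫ z ≫ p ≅ t ≫ z' ≫ p'} (h : mor hW t ◁ σ.hom = mor₂ hW β.hom) :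
    Loc.iso hW (α_ t z p ≪≫ β ≪≫ (α_ t z' p').symm) = resIso (mor hW t) σ := by
  ext
  simp only [iso_hom, Iso.trans_hom, mor₂_comp]
  rw [← h]
  rfl

end

/-- Agreement in the localised bicategory implies equivalence, even if the refinement data `σ` and
`τ` exist only in the localised bicategory: they come locally from `C`. -/
theorem PreCell.rel_of_relBy {a b : C} {r s : Roof W a b} {x y : PreCell r s} {e : C}
    {z : e ⟶ x.apex} {z' : e ⟶ y.apex} {σ : mor hW z ≫ mor hW x.p ≅ mor hW z' ≫ mor hW y.p}
    {τ : mor hW z ≫ mor hW x.q ≅ mor hW z' ≫ mor hW y.q} (hz : W z)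
    (h : PreCell.RelBy (x.loc hW) (y.loc hW) (mor hW z) (mor hW z') σ τ) : PreCell.Rel x y := by
  obtain ⟨e₁, t, β, ht, hβ⟩ := Loc.exists_whiskerLeft_eq_iso hW (f := z ≫ x.p) (g := z' ≫ y.p) σ
  have E₁ := iso_eq_resIso hW (z := z) (z' := z') (p := x.p) (p' := y.p) (σ := σ) hβ
  have h' := h.refine (mor hW t)
  rw [← E₁] at h'
  obtain ⟨e₂, t', β', ht', hβ'⟩ := Loc.exists_whiskerLeft_eq_iso hW
    (f := (t ≫ z) ≫ x.q) (g := (t ≫ z') ≫ y.q) (resIso (mor hW t) τ)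
  have E₂ := iso_eq_resIso hW (z := t ≫ z) (z' := t ≫ z') (p := x.q) (p' := y.q)
    (σ := resIso (mor hW t) τ) hβ'
  have h'' := h'.refine (mor hW t')
  refine PreCell.rel_of_relBy_loc hW (z := t' ≫ t ≫ z) (z' := t' ≫ t ≫ z')
    (σ := resIso t' (α_ t z x.p ≪≫ β ≪≫ (α_ t z' y.p).symm))
    (τ := α_ t' (t ≫ z) x.q ≪≫ β' ≪≫ (α_ t' (t ≫ z') y.q).symm)
    (hW.bf2 _ _ ht' (hW.bf2 _ _ ht hz)) ?_
  have E₃ := iso_resIso hW (t := t') (z := t ≫ z) (z' := t ≫ z') (p := x.p) (p' := y.p)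
    (α_ t z x.p ≪≫ β ≪≫ (α_ t z' y.p).symm)
  exact E₃ ▸ E₂ ▸ h''

/-- Representatives whose images in the localised bicategory have the same transformation are
equivalent. -/
theorem PreCell.rel_of_ev_eq {a b : C} {r s : Roof W a b} {x y : PreCell r s}
    (h : (x.loc hW).ev = (y.loc hW).ev) : PreCell.Rel x y := by
  obtain ⟨⟨e⟩, z, z', σ, τ, hz, h⟩ := PreCell.exists_relBy_of_ev_eq h
  exact PreCell.rel_of_relBy (e := e) hW (σ := σ) (τ := τ) hz h

end Transfer

/-! ### The transformation of roofs given by a 2-morphism of the bicategory of fractions -/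

section Transfer

variable {C : Type u} [Bicategory.{w, v} C] {W : MorphismProperty C} (hW : BF W) {a b c d : C}

open Loc

/-- The image of the auxiliary data in the localised bicategory. -/
abbrev VFiller.loc {r s t : Roof W a b} {x : PreCell r s} {y : PreCell s t} (k : VFiller x y) :
    VFiller (x.loc hW) (y.loc hW) where
  apex := ⟨k.apex⟩
  m := mor hW k.m
  n := mor hW k.n
  mem := k.mem
  γ := Loc.iso hW k.γ

/-- The image of the auxiliary data in the localised bicategory. -/
abbrev LFiller.loc {f : Roof W a b} {g h : Roof W b c} {y : PreCell g h}
    {S : Square W f.right g.left} {T : Square W f.right h.left} (k : LFiller f y S T) :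
    LFiller (f.loc hW) (y.loc hW) (S.loc hW) (T.loc hW) where
  apex := ⟨k.apex⟩
  m := mor hW k.m
  n := mor hW k.n
  k := mor hW k.k
  mem := k.mem
  σ := Loc.iso hW k.σ
  τ₁ := Loc.iso hW k.τ₁
  τ₂ := Loc.iso hW k.τ₂
  comm := by
    have h := congrArg (mor₂ hW) ((LFiller.comm_iff _ _ _ _ _ _).1 k.comm)
    simp only [mor₂_comp, mor₂_whiskerLeft, mor₂_whiskerRight] at h
    exact (LFiller.comm_iff _ _ _ _ _ _).2 h

/-- The image of the auxiliary data in the localised bicategory. -/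
abbrev RFiller.loc {f g : Roof W a b} {x : PreCell f g} {h : Roof W b c}
    {S : Square W f.right h.left} {T : Square W g.right h.left} (k : RFiller x h S T) :
    RFiller (x.loc hW) (h.loc hW) (S.loc hW) (T.loc hW) where
  apex := ⟨k.apex⟩
  m := mor hW k.m
  n := mor hW k.n
  k := mor hW k.k
  mem := k.mem
  σ := mor₂ hW k.σ
  τ₁ := Loc.iso hW k.τ₁
  τ₂ := Loc.iso hW k.τ₂
  comm := by
    have h := congrArg (mor₂ hW) ((RFiller.comm_iff _ _ _ _ _ _).1 k.comm)
    simp only [mor₂_comp, mor₂_whiskerLeft, mor₂_whiskerRight] at h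
    exact (RFiller.comm_iff _ _ _ _ _ _).2 h

/-- The image of the auxiliary data in the localised bicategory. -/
abbrev AFiller.loc {f : Roof W a b} {g : Roof W b c} {h : Roof W c d}
    {S₁ : Square W f.right g.left} {S₂ : Square W (S₁.snd ≫ g.right) h.left}
    {T₁ : Square W g.right h.left} {T₂ : Square W f.right (T₁.fst ≫ g.left)}
    (k : AFiller f g h S₁ S₂ T₁ T₂) :
    AFiller (f.loc hW) (g.loc hW) (h.loc hW) (S₁.loc hW) (S₂.loc hW) (T₁.loc hW) (T₂.loc hW) where
  apex := ⟨k.apex⟩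
  m := mor hW k.m
  n := mor hW k.n
  mem := k.mem
  σ₁ := Loc.iso hW k.σ₁
  σ₂ := Loc.iso hW k.σ₂
  σ₃ := Loc.iso hW k.σ₃
  comm₁ := by
    have h := congrArg (mor₂ hW) ((AFiller.comm₁_iff _ _ _ _).1 k.comm₁)
    simp only [mor₂_comp, mor₂_whiskerLeft, mor₂_whiskerRight] at h
    exact (AFiller.comm₁_iff _ _ _ _).2 h
  comm₂ := by
    have h := congrArg (mor₂ hW) ((AFiller.comm₂_iff _ _ _ _).1 k.comm₂)
    simp only [mor₂_comp, mor₂_whiskerLeft, mor₂_whiskerRight] at h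
    exact (AFiller.comm₂_iff _ _ _ _).2 h

/-- The transformation of roofs of the localised bicategory given by a 2-morphism of the bicategory
of fractions. -/
noncomputable def Cell.ev {r s : Roof W a b} (x : Cell r s) : RoofTrans (r.loc hW) (s.loc hW) :=
  Quot.lift (fun x : PreCell r s => (x.loc hW).ev) (by
    rintro x y ⟨e, z, z', σ, τ, hz, h⟩
    exact PreCell.ev_eq_of_rel ⟨_, _, _, _, _, hz, PreCell.RelBy.loc hW h⟩) x

theorem Cell.ev_mk {r s : Roof W a b} (x : PreCell r s) :
    (Cell.mk x).ev hW = (x.loc hW).ev := rfl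

theorem Cell.ev_out {r s : Roof W a b} (x : Cell r s) :
    (x.out.loc hW).ev = x.ev hW := by
  rw [← Cell.ev_mk]
  exact congrArg _ (Quot.out_eq x)

/-- A 2-morphism of the bicategory of fractions is determined by its transformation. -/
theorem Cell.ev_injective {r s : Roof W a b} {x y : Cell r s} (h : x.ev hW = y.ev hW) : x = y := by
  induction x using Quot.ind
  induction y using Quot.ind
  exact Quot.sound (PreCell.rel_of_ev_eq hW h)

theorem Loc.mor₂_comp_eq {f g h : a ⟶ b} {β : f ⟶ g} {γ : g ⟶ h} {x : mor hW f ⟶ mor hW g}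
    {y : mor hW g ⟶ mor hW h} (hx : mor₂ hW β = x) (hy : mor₂ hW γ = y) :
    mor₂ hW (β ≫ γ) = x ≫ y := by
  rw [mor₂_comp, hx, hy]

theorem PreCell.mk_congr {D : Type u₁} [Bicategory.{w₁, v₁} D] {V : MorphismProperty D} {a b : D}
    {r s : Roof V a b} {e : D} {p : e ⟶ r.apex} {q : e ⟶ s.apex} {h : V (p ≫ r.left)}
    {α α' : p ≫ r.left ≅ q ≫ s.left} {β β' : p ≫ r.right ⟶ q ≫ s.right} (hα : α.hom = α'.hom)
    (hβ : β = β') : PreCell.mk e p q h α β = PreCell.mk e p q h α' β' := by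
  obtain rfl : α = α' := Iso.ext hα
  rw [hβ]

section ops

variable (𝒞 : Choices W)

/-- The composite of two roofs for the given choices. -/
abbrev Roof.cmp (f : Roof W a b) (g : Roof W b c) : Roof W a c := f.comp hW g (𝒞.sq f g)

/-- The identity of a roof. -/
noncomputable def Cell.id (r : Roof W a b) : Cell r r := (fractionData hW 𝒞).id₂ r

/-- The vertical composition of the bicategory of fractions. -/
noncomputable def Cell.comp {r s t : Roof W a b} (x : Cell r s) (y : Cell s t) : Cell r t :=
  (fractionData hW 𝒞).comp₂ x y

/-- The left whiskering of the bicategory of fractions. -/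
noncomputable def Cell.whiskerLeft (f : Roof W a b) {g h : Roof W b c} (y : Cell g h) :
    Cell (f.cmp hW 𝒞 g) (f.cmp hW 𝒞 h) :=
  (fractionData hW 𝒞).whiskerLeft f y

/-- The right whiskering of the bicategory of fractions. -/
noncomputable def Cell.whiskerRight {f g : Roof W a b} (x : Cell f g) (h : Roof W b c) :
    Cell (f.cmp hW 𝒞 h) (g.cmp hW 𝒞 h) :=
  (fractionData hW 𝒞).whiskerRight x h

/-- The associator of the bicategory of fractions. -/
noncomputable def Cell.assocHom (f : Roof W a b) (g : Roof W b c) (h : Roof W c d) :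
    Cell ((f.cmp hW 𝒞 g).cmp hW 𝒞 h) (f.cmp hW 𝒞 (g.cmp hW 𝒞 h)) :=
  (fractionData hW 𝒞).assocHom f g h

/-- The inverse of the associator of the bicategory of fractions. -/
noncomputable def Cell.assocInv (f : Roof W a b) (g : Roof W b c) (h : Roof W c d) :
    Cell (f.cmp hW 𝒞 (g.cmp hW 𝒞 h)) ((f.cmp hW 𝒞 g).cmp hW 𝒞 h) :=
  (fractionData hW 𝒞).assocInv f g h

/-- The left unitor of the bicategory of fractions. -/
noncomputable def Cell.leftHom (f : Roof W a b) : Cell ((Roof.ofMor hW (𝟙 a)).cmp hW 𝒞 f) f :=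
  (fractionData hW 𝒞).leftHom f

/-- The inverse of the left unitor of the bicategory of fractions. -/
noncomputable def Cell.leftInv (f : Roof W a b) : Cell f ((Roof.ofMor hW (𝟙 a)).cmp hW 𝒞 f) :=
  (fractionData hW 𝒞).leftInv f

/-- The right unitor of the bicategory of fractions. -/
noncomputable def Cell.rightHom (f : Roof W a b) : Cell (f.cmp hW 𝒞 (Roof.ofMor hW (𝟙 b))) f :=
  (fractionData hW 𝒞).rightHom f

/-- The inverse of the right unitor of the bicategory of fractions. -/
noncomputable def Cell.rightInv (f : Roof W a b) : Cell f (f.cmp hW 𝒞 (Roof.ofMor hW (𝟙 b))) :=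
  (fractionData hW 𝒞).rightInv f

/-- The image of a 2-morphism in the bicategory of fractions. -/
def Cell.ofHom₂ {f g : a ⟶ b} (γ : f ⟶ g) : Cell (Roof.ofMor hW f) (Roof.ofMor hW g) :=
  Cell.mk (PreCell.ofHom₂ hW γ)

/-- The comparison of the image of a composite with the composite of the images. -/
noncomputable def Cell.compHom (f : a ⟶ b) (g : b ⟶ c) :
    Cell (Roof.ofMor hW (f ≫ g)) ((Roof.ofMor hW f).cmp hW 𝒞 (Roof.ofMor hW g)) :=
  Cell.mk (PreCell.compHom hW f g (𝒞.sq (Roof.ofMor hW f) (Roof.ofMor hW g)))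

/-- The inverse of the comparison of the image of a composite with the composite of the images. -/
noncomputable def Cell.compInv (f : a ⟶ b) (g : b ⟶ c) :
    Cell ((Roof.ofMor hW f).cmp hW 𝒞 (Roof.ofMor hW g)) (Roof.ofMor hW (f ≫ g)) :=
  Cell.mk (PreCell.compInv hW f g (𝒞.sq (Roof.ofMor hW f) (Roof.ofMor hW g)))

/-- Vertical composition evaluates to the composite of the transformations, whichever auxiliary data
have been chosen to form it. -/
theorem ev_comp₂ {r s t : Roof W a b} (x : Cell r s) (y : Cell s t) :
    RoofTrans.IsComp (x.ev hW) (y.ev hW) ((x.comp hW 𝒞 y).ev hW) := by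
  have key : ∀ k : VFiller x.out y.out, RoofTrans.IsComp (x.ev hW) (y.ev hW)
      (((k.cell hW).loc hW).ev) := by
    intro k
    have := (k.loc hW).isComp_ev (k.cell hW).p_mem
    rw [x.ev_out, y.ev_out] at this
    convert this using 2
    refine PreCell.mk_congr ?_ ?_
    all_goals
      repeat'
        first
        | refine mor₂_comp_eq hW ?_ ?_
        | exact mor₂_whiskerLeft _ _
        | exact mor₂_whiskerRight _ _
        | rfl
  exact key _

/-- The composition data of two roofs in the localised bicategory. -/
abbrev compData (f : Roof W a b) (g : Roof W b c) :
    CompData ((f.cmp hW 𝒞 g).loc hW) (f.loc hW) (g.loc hW) :=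
  .ofSquare (f.loc hW) (g.loc hW) ((𝒞.sq f g).loc hW)

theorem ev_whiskerLeft (f : Roof W a b) {g h : Roof W b c} (y : Cell g h) :
    (y.whiskerLeft hW 𝒞 f).ev hW =
      RoofTrans.hcomp (compData hW 𝒞 f g) (compData hW 𝒞 f h) (RoofTrans.id _) (y.ev hW) := by
  have key : ∀ k : LFiller f y.out (𝒞.sq f g) (𝒞.sq f h), ((k.cell hW).loc hW).ev =
      RoofTrans.hcomp (compData hW 𝒞 f g) (compData hW 𝒞 f h) (RoofTrans.id _) (y.ev hW) := by
    intro k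
    have := (k.loc hW).ev_scell
    rw [y.ev_out] at this
    refine Eq.trans (congrArg PreCell.ev (PreCell.mk_congr ?_ ?_)) this
    all_goals
      repeat'
        first
        | refine mor₂_comp_eq hW ?_ ?_
        | exact mor₂_whiskerLeft _ _
        | exact mor₂_whiskerRight _ _
        | rfl
  exact key _

theorem ev_whiskerRight {f g : Roof W a b} (x : Cell f g) (h : Roof W b c) :
    (x.whiskerRight hW 𝒞 h).ev hW =
      RoofTrans.hcomp (compData hW 𝒞 f h) (compData hW 𝒞 g h) (x.ev hW) (RoofTrans.id _) := by
  have key : ∀ k : RFiller x.out h (𝒞.sq f h) (𝒞.sq g h), ((k.cell hW).loc hW).ev =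
      RoofTrans.hcomp (compData hW 𝒞 f h) (compData hW 𝒞 g h) (x.ev hW) (RoofTrans.id _) := by
    intro k
    have := (k.loc hW).ev_scell
    rw [x.ev_out] at this
    refine Eq.trans (congrArg PreCell.ev (PreCell.mk_congr ?_ ?_)) this
    all_goals
      repeat'
        first
        | refine mor₂_comp_eq hW ?_ ?_
        | exact mor₂_whiskerLeft _ _
        | exact mor₂_whiskerRight _ _
        | rfl
  exact key _

section assoc

variable (f : Roof W a b) (g : Roof W b c) (h : Roof W c d)

theorem ev_assocHom : (Cell.assocHom hW 𝒞 f g h).ev hW =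
    RoofTrans.assoc (compData hW 𝒞 f g) (compData hW 𝒞 (f.cmp hW 𝒞 g) h)
      (compData hW 𝒞 g h) (compData hW 𝒞 f (g.cmp hW 𝒞 h)) := by
  have key : ∀ k : AFiller f g h (𝒞.sq f g) (𝒞.sq (f.cmp hW 𝒞 g) h) (𝒞.sq g h)
      (𝒞.sq f (g.cmp hW 𝒞 h)), ((k.cell hW).loc hW).ev =
    RoofTrans.assoc (compData hW 𝒞 f g) (compData hW 𝒞 (f.cmp hW 𝒞 g) h)
      (compData hW 𝒞 g h) (compData hW 𝒞 f (g.cmp hW 𝒞 h)) := by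
    intro k
    refine Eq.trans (congrArg PreCell.ev (PreCell.mk_congr ?_ ?_)) (k.loc hW).ev_scell
    all_goals
      repeat'
        first
        | refine mor₂_comp_eq hW ?_ ?_
        | exact mor₂_whiskerLeft _ _
        | exact mor₂_whiskerRight _ _
        | rfl
  exact key _

theorem ev_assocInv : (Cell.assocInv hW 𝒞 f g h).ev hW =
    RoofTrans.assocInv (compData hW 𝒞 f g) (compData hW 𝒞 (f.cmp hW 𝒞 g) h)
      (compData hW 𝒞 g h) (compData hW 𝒞 f (g.cmp hW 𝒞 h)) := by
  have key : ∀ k : AFiller f g h (𝒞.sq f g) (𝒞.sq (f.cmp hW 𝒞 g) h) (𝒞.sq g h)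
      (𝒞.sq f (g.cmp hW 𝒞 h)), ((k.invCell hW).loc hW).ev =
    RoofTrans.assocInv (compData hW 𝒞 f g) (compData hW 𝒞 (f.cmp hW 𝒞 g) h)
      (compData hW 𝒞 g h) (compData hW 𝒞 f (g.cmp hW 𝒞 h)) := by
    intro k
    refine Eq.trans (congrArg PreCell.ev (PreCell.mk_congr ?_ ?_))
      ((k.loc hW).ev_sinvCell (k.invCell hW).p_mem)
    all_goals
      repeat'
        first
        | refine mor₂_comp_eq hW ?_ ?_
        | exact mor₂_whiskerLeft _ _
        | exact mor₂_whiskerRight _ _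
        | rfl
  exact key _

end assoc

theorem ev_id₂ (r : Roof W a b) : (Cell.id hW 𝒞 r).ev hW = RoofTrans.id _ :=
  PreCell.ev_sid (r.loc hW) (PreCell.id hW r).p_mem

section unitors

variable (f : Roof W a b)

/-- The roof of the localised bicategory given by a morphism of `C`. -/
abbrev morData {f : a ⟶ b} : MorData ((Roof.ofMor hW f).loc hW) (mor hW f) := λ_ (mor hW f)

/-- The roof of the localised bicategory given by an identity of `C`. -/
abbrev morDataId (a : C) : MorData ((Roof.ofMor hW (𝟙 a)).loc hW) (𝟙 (⟨a⟩ : Loc hW)) :=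
  λ_ (𝟙 (⟨a⟩ : Loc hW))

theorem ev_leftHom : (Cell.leftHom hW 𝒞 f).ev hW =
    RoofTrans.leftUnitor (compData hW 𝒞 (Roof.ofMor hW (𝟙 a)) f) (morDataId hW a) := by
  refine Eq.trans (congrArg PreCell.ev (PreCell.mk_congr ?_ ?_))
    (PreCell.ev_sleftHom (f.loc hW) ((𝒞.sq (Roof.ofMor hW (𝟙 a)) f).loc hW)
      (PreCell.leftHom hW f (𝒞.sq _ f)).p_mem)
  all_goals
    repeat'
      first
      | refine mor₂_comp_eq hW ?_ ?_
      | exact mor₂_whiskerLeft _ _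
      | exact mor₂_whiskerRight _ _
      | rfl

theorem ev_leftInv : (Cell.leftInv hW 𝒞 f).ev hW =
    RoofTrans.leftUnitorInv (compData hW 𝒞 (Roof.ofMor hW (𝟙 a)) f) (morDataId hW a) := by
  refine Eq.trans (congrArg PreCell.ev (PreCell.mk_congr ?_ ?_))
    (PreCell.ev_sleftInv (f.loc hW) ((𝒞.sq (Roof.ofMor hW (𝟙 a)) f).loc hW)
      (PreCell.leftHom hW f (𝒞.sq _ f)).p_mem
      (PreCell.leftInv hW f (𝒞.sq _ f)).p_mem)
  all_goals
    repeat'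
      first
      | refine mor₂_comp_eq hW ?_ ?_
      | exact mor₂_whiskerLeft _ _
      | exact mor₂_whiskerRight _ _
      | rfl

theorem ev_rightHom : (Cell.rightHom hW 𝒞 f).ev hW =
    RoofTrans.rightUnitor (compData hW 𝒞 f (Roof.ofMor hW (𝟙 b))) (morDataId hW b) := by
  refine Eq.trans (congrArg PreCell.ev (PreCell.mk_congr ?_ ?_))
    (PreCell.ev_srightHom (f.loc hW) ((𝒞.sq f (Roof.ofMor hW (𝟙 b))).loc hW)
      (PreCell.rightHom hW f (𝒞.sq f _)).p_mem)
  all_goals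
    repeat'
      first
      | refine mor₂_comp_eq hW ?_ ?_
      | exact mor₂_whiskerLeft _ _
      | exact mor₂_whiskerRight _ _
      | rfl

theorem ev_rightInv : (Cell.rightInv hW 𝒞 f).ev hW =
    RoofTrans.rightUnitorInv (compData hW 𝒞 f (Roof.ofMor hW (𝟙 b))) (morDataId hW b) := by
  refine Eq.trans (congrArg PreCell.ev (PreCell.mk_congr ?_ ?_))
    (PreCell.ev_srightInv (f.loc hW) ((𝒞.sq f (Roof.ofMor hW (𝟙 b))).loc hW)
      (PreCell.rightHom hW f (𝒞.sq f _)).p_mem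
      (PreCell.rightInv hW f (𝒞.sq f _)).p_mem)
  all_goals
    repeat'
      first
      | refine mor₂_comp_eq hW ?_ ?_
      | exact mor₂_whiskerLeft _ _
      | exact mor₂_whiskerRight _ _
      | rfl

end unitors

section universal

theorem ev_ofHom₂ {f g : a ⟶ b} (γ : f ⟶ g) : (Cell.ofHom₂ hW γ).ev hW =
    RoofTrans.ofHom₂ (morData hW) (morData hW) (mor₂ hW γ) := by
  refine Eq.trans (congrArg PreCell.ev (PreCell.mk_congr ?_ ?_))
    (PreCell.ev_sofHom₂ (mor₂ hW γ) (PreCell.ofHom₂ hW γ).p_mem)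
  · rfl
  · exact mor₂_whiskerLeft _ _

theorem ev_compHom (f : a ⟶ b) (g : b ⟶ c) :
    (Cell.compHom hW 𝒞 f g).ev hW =
      RoofTrans.ofHom₂ (morData hW) ((compData hW 𝒞 (Roof.ofMor hW f) (Roof.ofMor hW g)).morData
        (morData hW) (morData hW)) (𝟙 (mor hW f ≫ mor hW g)) := by
  refine Eq.trans (congrArg PreCell.ev (PreCell.mk_congr ?_ ?_))
    (PreCell.ev_scompHom (mor hW f) (mor hW g) ((𝒞.sq (Roof.ofMor hW f) (Roof.ofMor hW g)).loc hW)
      (PreCell.compHom hW f g (𝒞.sq (Roof.ofMor hW f) (Roof.ofMor hW g))).p_mem)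
  · rfl
  · refine mor₂_comp_eq hW rfl (mor₂_comp_eq hW ?_ rfl)
    exact (mor₂_whiskerRight _ _).trans (congrArg (· ▷ mor hW g) (mor₂_comp _ _))

theorem ev_compInv (f : a ⟶ b) (g : b ⟶ c) :
    (Cell.compInv hW 𝒞 f g).ev hW =
      RoofTrans.ofHom₂ ((compData hW 𝒞 (Roof.ofMor hW f) (Roof.ofMor hW g)).morData
        (morData hW) (morData hW)) (morData hW) (𝟙 (mor hW f ≫ mor hW g)) := by
  refine Eq.trans (congrArg PreCell.ev (PreCell.mk_congr ?_ ?_))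
    (PreCell.ev_scompInv (mor hW f) (mor hW g) ((𝒞.sq (Roof.ofMor hW f) (Roof.ofMor hW g)).loc hW)
      (PreCell.compHom hW f g (𝒞.sq (Roof.ofMor hW f) (Roof.ofMor hW g))).p_mem
      (PreCell.compInv hW f g (𝒞.sq (Roof.ofMor hW f) (Roof.ofMor hW g))).p_mem)
  · rfl
  · refine mor₂_comp_eq hW rfl (mor₂_comp_eq hW ?_ rfl)
    exact (mor₂_whiskerRight _ _).trans (congrArg (· ▷ mor hW g) (mor₂_comp _ _))

end universal

end ops

end Transfer

/-! ### The bicategory laws -/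

section Lawful

variable {C : Type u} [Bicategory.{w, v} C] {W : MorphismProperty C} (hW : BF W) {a b c d : C}

open Loc Leg

/-- To prove that two 2-morphisms of the bicategory of fractions are equal, it is enough to compare
their values on legs, with additional legs of finitely many roofs at hand. -/
theorem Cell.ext_legs {r s : Roof W a b} {x y : Cell r s} (L : List (Roof W a b))
    (h : ∀ {e : Loc hW} (u : e ⟶ ⟨a⟩), (∀ t ∈ L, ∃ y, Nonempty (Leg (t.loc hW) u y)) →
      ∀ {y₁ y₂ : e ⟶ ⟨b⟩} (M : Leg (r.loc hW) u y₁) (N : Leg (s.loc hW) u y₂),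
        (x.ev hW).app (𝟙 u) M N = (y.ev hW).app (𝟙 u) M N) : x = y := by
  obtain ⟨e, u, hu, H⟩ := exists_legs ((r :: s :: L).map (Roof.loc hW))
  obtain ⟨y₁, ⟨M⟩⟩ := H (r.loc hW) (by simp)
  obtain ⟨y₂, ⟨N⟩⟩ := H (s.loc hW) (by simp)
  refine Cell.ev_injective hW (RoofTrans.ext_of_mem hu M N (h u (fun t ht => H _ ?_) M N))
  exact List.mem_map_of_mem (List.mem_cons_of_mem _ (List.mem_cons_of_mem _ ht))

variable (𝒞 : Choices W)

/-- The value of a vertical composite may be computed by means of any leg `N` of the middle roof. -/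
theorem ev_comp₂_app {r s t : Roof W a b} (x : Cell r s) (y : Cell s t) {e : Loc hW}
    {u u' : e ⟶ ⟨a⟩} {y₁ y₂ y₃ : e ⟶ ⟨b⟩} (β : u ⟶ u') (M : Leg (r.loc hW) u y₁)
    (P : Leg (t.loc hW) u' y₃) (N : Leg (s.loc hW) u y₂) :
    ((x.comp hW 𝒞 y).ev hW).app β M P = (x.ev hW).app (𝟙 u) M N ≫ (y.ev hW).app β N P := by
  rw [ev_comp₂ hW 𝒞 x y, Category.id_comp]

namespace Cell

theorem id_comp {f g : Roof W a b} (η : Cell f g) : (Cell.id hW 𝒞 f).comp hW 𝒞 η = η := by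
  refine Cell.ext_legs hW [] fun u H _ _ M N => ?_
  rw [ev_comp₂_app hW 𝒞 _ _ _ _ _ M, ev_id₂]
  simp

theorem comp_id {f g : Roof W a b} (η : Cell f g) : η.comp hW 𝒞 (Cell.id hW 𝒞 g) = η := by
  refine Cell.ext_legs hW [] fun u H _ _ M N => ?_
  rw [ev_comp₂_app hW 𝒞 _ _ _ _ _ N, ev_id₂]
  simp

theorem assoc {f g h i : Roof W a b} (η : Cell f g) (θ : Cell g h) (κ : Cell h i) :
    (η.comp hW 𝒞 θ).comp hW 𝒞 κ = η.comp hW 𝒞 (θ.comp hW 𝒞 κ) := by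
  refine Cell.ext_legs hW [g, h] fun u H _ _ M N => ?_
  obtain ⟨_, ⟨P⟩⟩ := H g (by simp)
  obtain ⟨_, ⟨Q⟩⟩ := H h (by simp)
  rw [ev_comp₂_app hW 𝒞 _ _ _ _ _ Q, ev_comp₂_app hW 𝒞 _ _ _ _ _ P,
    ev_comp₂_app hW 𝒞 _ _ _ _ _ P, ev_comp₂_app hW 𝒞 _ _ _ _ _ Q, Category.assoc]

section

variable (f : Roof W a b) (g : Roof W b c) (h : Roof W c d)

theorem assoc_hom_inv : (assocHom hW 𝒞 f g h).comp hW 𝒞 (assocInv hW 𝒞 f g h) =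
    Cell.id hW 𝒞 _ := by
  refine Cell.ext_legs hW [f.cmp hW 𝒞 (g.cmp hW 𝒞 h)] fun u H _ _ M N => ?_
  obtain ⟨_, ⟨P⟩⟩ := H _ (by simp; rfl)
  rw [ev_comp₂_app hW 𝒞 _ _ _ _ _ P, ev_assocHom, ev_assocInv, ev_id₂]
  simp [tr_fst_snd]

theorem assoc_inv_hom : (assocInv hW 𝒞 f g h).comp hW 𝒞 (assocHom hW 𝒞 f g h) =
    Cell.id hW 𝒞 _ := by
  refine Cell.ext_legs hW [(f.cmp hW 𝒞 g).cmp hW 𝒞 h] fun u H _ _ M N => ?_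
  obtain ⟨_, ⟨P⟩⟩ := H _ (by simp; rfl)
  rw [ev_comp₂_app hW 𝒞 _ _ _ _ _ P, ev_assocHom, ev_assocInv, ev_id₂]
  simp [tr_fst_snd]

theorem left_hom_inv : (leftHom hW 𝒞 f).comp hW 𝒞 (leftInv hW 𝒞 f) = Cell.id hW 𝒞 _ := by
  refine Cell.ext_legs hW [f] fun u H _ _ M N => ?_
  obtain ⟨_, ⟨P⟩⟩ := H _ (by simp; rfl)
  rw [ev_comp₂_app hW 𝒞 _ _ _ _ _ P, ev_leftHom, ev_leftInv, ev_id₂, RoofTrans.id_app,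
    ← tr_fst_snd (compData hW 𝒞 (Roof.ofMor hW (𝟙 a)) f), tr_eq_val (morDataId hW a)]
  simp

theorem left_inv_hom : (leftInv hW 𝒞 f).comp hW 𝒞 (leftHom hW 𝒞 f) = Cell.id hW 𝒞 _ := by
  refine Cell.ext_legs hW [(Roof.ofMor hW (𝟙 a)).cmp hW 𝒞 f] fun u H _ _ M N => ?_
  obtain ⟨_, ⟨P⟩⟩ := H _ (by simp; rfl)
  rw [ev_comp₂_app hW 𝒞 _ _ _ _ _ P, ev_leftHom, ev_leftInv, ev_id₂]
  simp

theorem right_hom_inv : (rightHom hW 𝒞 f).comp hW 𝒞 (rightInv hW 𝒞 f) = Cell.id hW 𝒞 _ := by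
  refine Cell.ext_legs hW [f] fun u H _ _ M N => ?_
  obtain ⟨_, ⟨P⟩⟩ := H _ (by simp; rfl)
  rw [ev_comp₂_app hW 𝒞 _ _ _ _ _ P, ev_rightHom, ev_rightInv, ev_id₂, RoofTrans.id_app,
    ← tr_fst_snd (compData hW 𝒞 f (Roof.ofMor hW (𝟙 b))), tr_eq_val (morDataId hW b)]
  simp

theorem right_inv_hom : (rightInv hW 𝒞 f).comp hW 𝒞 (rightHom hW 𝒞 f) = Cell.id hW 𝒞 _ := by
  refine Cell.ext_legs hW [f.cmp hW 𝒞 (Roof.ofMor hW (𝟙 b))] fun u H _ _ M N => ?_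
  obtain ⟨_, ⟨P⟩⟩ := H _ (by simp; rfl)
  rw [ev_comp₂_app hW 𝒞 _ _ _ _ _ P, ev_rightHom, ev_rightInv, ev_id₂]
  simp

theorem whiskerLeft_id : (Cell.id hW 𝒞 g).whiskerLeft hW 𝒞 f = Cell.id hW 𝒞 _ := by
  apply Cell.ev_injective hW
  rw [ev_whiskerLeft, ev_id₂, ev_id₂, RoofTrans.hcomp_id_id]

theorem id_whiskerRight : (Cell.id hW 𝒞 f).whiskerRight hW 𝒞 g = Cell.id hW 𝒞 _ := by
  apply Cell.ev_injective hW
  rw [ev_whiskerRight, ev_id₂, ev_id₂, RoofTrans.hcomp_id_id]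

theorem triangle : (assocHom hW 𝒞 f (Roof.ofMor hW (𝟙 b)) g).comp hW 𝒞
    ((leftHom hW 𝒞 g).whiskerLeft hW 𝒞 f) = (rightHom hW 𝒞 f).whiskerRight hW 𝒞 g := by
  refine Cell.ext_legs hW [f.cmp hW 𝒞 ((Roof.ofMor hW (𝟙 b)).cmp hW 𝒞 g)] fun u H _ _ M N => ?_
  obtain ⟨_, ⟨P⟩⟩ := H _ (by simp; rfl)
  rw [ev_comp₂_app hW 𝒞 _ _ _ _ _ P, ev_assocHom, ev_whiskerLeft, ev_whiskerRight, ev_leftHom,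
    ev_rightHom]
  simp [tr_eq_val (morDataId hW b)]

theorem pentagon {e : C} (i : Roof W d e) : ((assocHom hW 𝒞 f g h).whiskerRight hW 𝒞 i).comp hW 𝒞
    ((assocHom hW 𝒞 f (g.cmp hW 𝒞 h) i).comp hW 𝒞 ((assocHom hW 𝒞 g h i).whiskerLeft hW 𝒞 f)) =
      (assocHom hW 𝒞 (f.cmp hW 𝒞 g) h i).comp hW 𝒞 (assocHom hW 𝒞 f g (h.cmp hW 𝒞 i)) := by
  refine Cell.ext_legs hW [(f.cmp hW 𝒞 (g.cmp hW 𝒞 h)).cmp hW 𝒞 i,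
    f.cmp hW 𝒞 ((g.cmp hW 𝒞 h).cmp hW 𝒞 i), (f.cmp hW 𝒞 g).cmp hW 𝒞 (h.cmp hW 𝒞 i)]
    fun u H _ _ M N => ?_
  obtain ⟨_, ⟨P⟩⟩ := H ((f.cmp hW 𝒞 (g.cmp hW 𝒞 h)).cmp hW 𝒞 i) (by simp)
  obtain ⟨_, ⟨Q⟩⟩ := H (f.cmp hW 𝒞 ((g.cmp hW 𝒞 h).cmp hW 𝒞 i)) (by simp)
  obtain ⟨_, ⟨R⟩⟩ := H ((f.cmp hW 𝒞 g).cmp hW 𝒞 (h.cmp hW 𝒞 i)) (by simp)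
  rw [ev_comp₂_app hW 𝒞 _ _ _ _ _ P, ev_comp₂_app hW 𝒞 _ _ _ _ _ Q,
    ev_comp₂_app hW 𝒞 _ _ _ _ _ R, ev_whiskerLeft, ev_whiskerRight, ev_assocHom, ev_assocHom,
    ev_assocHom, ev_assocHom, ev_assocHom]
  simp only [RoofTrans.hcomp_app, RoofTrans.assoc_app, RoofTrans.id_app]
  rw [← tr_fst_snd (compData hW 𝒞 g h), ← tr_fst_snd (compData hW 𝒞 h i),
    ← tr_fst_snd (compData hW 𝒞 f g)]
  simp

end

theorem whiskerLeft_comp (f : Roof W a b) {g h i : Roof W b c} (η : Cell g h) (θ : Cell h i) :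
    (η.comp hW 𝒞 θ).whiskerLeft hW 𝒞 f =
      (η.whiskerLeft hW 𝒞 f).comp hW 𝒞 (θ.whiskerLeft hW 𝒞 f) := by
  refine Cell.ext_legs hW [f.cmp hW 𝒞 h] fun u H _ _ M N => ?_
  obtain ⟨_, ⟨P⟩⟩ := H _ (by simp; rfl)
  rw [ev_comp₂_app hW 𝒞 _ _ _ _ _ P, ev_whiskerLeft, ev_whiskerLeft, ev_whiskerLeft]
  simp [ev_comp₂ hW 𝒞 η θ _ _ _ (P.snd (compData hW 𝒞 f h)) _]

theorem comp_whiskerRight {f g h : Roof W a b} (η : Cell f g) (θ : Cell g h) (i : Roof W b c) :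
    (η.comp hW 𝒞 θ).whiskerRight hW 𝒞 i =
      (η.whiskerRight hW 𝒞 i).comp hW 𝒞 (θ.whiskerRight hW 𝒞 i) := by
  refine Cell.ext_legs hW [g.cmp hW 𝒞 i] fun u H _ _ M N => ?_
  obtain ⟨_, ⟨P⟩⟩ := H _ (by simp; rfl)
  rw [ev_comp₂_app hW 𝒞 _ _ _ _ _ P, ev_whiskerRight, ev_whiskerRight, ev_whiskerRight]
  simp [ev_comp₂ hW 𝒞 η θ _ _ _ (P.fst (compData hW 𝒞 g i)) _]

theorem id_whiskerLeft {f g : Roof W a b} (η : Cell f g) :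
    η.whiskerLeft hW 𝒞 (Roof.ofMor hW (𝟙 a)) =
      (leftHom hW 𝒞 f).comp hW 𝒞 (η.comp hW 𝒞 (leftInv hW 𝒞 g)) := by
  refine Cell.ext_legs hW [f, g] fun u H _ _ M N => ?_
  obtain ⟨_, ⟨P⟩⟩ := H f (by simp)
  obtain ⟨_, ⟨Q⟩⟩ := H g (by simp)
  rw [ev_comp₂_app hW 𝒞 _ _ _ _ _ P, ev_comp₂_app hW 𝒞 _ _ _ _ _ Q, ev_whiskerLeft, ev_leftHom,
    ev_leftInv]
  simp [tr_eq_val (morDataId hW a)]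

theorem whiskerRight_id {f g : Roof W a b} (η : Cell f g) :
    η.whiskerRight hW 𝒞 (Roof.ofMor hW (𝟙 b)) =
      (rightHom hW 𝒞 f).comp hW 𝒞 (η.comp hW 𝒞 (rightInv hW 𝒞 g)) := by
  refine Cell.ext_legs hW [f, g] fun u H _ _ M N => ?_
  obtain ⟨_, ⟨P⟩⟩ := H f (by simp)
  obtain ⟨_, ⟨Q⟩⟩ := H g (by simp)
  rw [ev_comp₂_app hW 𝒞 _ _ _ _ _ P, ev_comp₂_app hW 𝒞 _ _ _ _ _ Q, ev_whiskerRight, ev_rightHom,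
    ev_rightInv]
  simp [tr_eq_val (morDataId hW b)]

theorem comp_whiskerLeft (f : Roof W a b) (g : Roof W b c) {h h' : Roof W c d} (η : Cell h h') :
    η.whiskerLeft hW 𝒞 (f.cmp hW 𝒞 g) = (assocHom hW 𝒞 f g h).comp hW 𝒞
      (((η.whiskerLeft hW 𝒞 g).whiskerLeft hW 𝒞 f).comp hW 𝒞 (assocInv hW 𝒞 f g h')) := by
  refine Cell.ext_legs hW [f.cmp hW 𝒞 (g.cmp hW 𝒞 h), f.cmp hW 𝒞 (g.cmp hW 𝒞 h')]
    fun u H _ _ M N => ?_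
  obtain ⟨_, ⟨P⟩⟩ := H (f.cmp hW 𝒞 (g.cmp hW 𝒞 h)) (by simp)
  obtain ⟨_, ⟨Q⟩⟩ := H (f.cmp hW 𝒞 (g.cmp hW 𝒞 h')) (by simp)
  rw [ev_comp₂_app hW 𝒞 _ _ _ _ _ P, ev_comp₂_app hW 𝒞 _ _ _ _ _ Q, ev_whiskerLeft,
    ev_whiskerLeft, ev_whiskerLeft, ev_assocHom, ev_assocInv]
  simp [tr_fst_snd]

theorem whiskerRight_comp {f f' : Roof W a b} (η : Cell f f') (g : Roof W b c) (h : Roof W c d) :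
    η.whiskerRight hW 𝒞 (g.cmp hW 𝒞 h) = (assocInv hW 𝒞 f g h).comp hW 𝒞
      (((η.whiskerRight hW 𝒞 g).whiskerRight hW 𝒞 h).comp hW 𝒞 (assocHom hW 𝒞 f' g h)) := by
  refine Cell.ext_legs hW [(f.cmp hW 𝒞 g).cmp hW 𝒞 h, (f'.cmp hW 𝒞 g).cmp hW 𝒞 h]
    fun u H _ _ M N => ?_
  obtain ⟨_, ⟨P⟩⟩ := H ((f.cmp hW 𝒞 g).cmp hW 𝒞 h) (by simp)
  obtain ⟨_, ⟨Q⟩⟩ := H ((f'.cmp hW 𝒞 g).cmp hW 𝒞 h) (by simp)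
  rw [ev_comp₂_app hW 𝒞 _ _ _ _ _ P, ev_comp₂_app hW 𝒞 _ _ _ _ _ Q, ev_whiskerRight,
    ev_whiskerRight, ev_whiskerRight, ev_assocHom, ev_assocInv]
  simp [tr_fst_snd]

theorem whisker_assoc (f : Roof W a b) {g g' : Roof W b c} (η : Cell g g') (h : Roof W c d) :
    (η.whiskerLeft hW 𝒞 f).whiskerRight hW 𝒞 h = (assocHom hW 𝒞 f g h).comp hW 𝒞
      (((η.whiskerRight hW 𝒞 h).whiskerLeft hW 𝒞 f).comp hW 𝒞 (assocInv hW 𝒞 f g' h)) := by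
  refine Cell.ext_legs hW [f.cmp hW 𝒞 (g.cmp hW 𝒞 h), f.cmp hW 𝒞 (g'.cmp hW 𝒞 h)]
    fun u H _ _ M N => ?_
  obtain ⟨_, ⟨P⟩⟩ := H (f.cmp hW 𝒞 (g.cmp hW 𝒞 h)) (by simp)
  obtain ⟨_, ⟨Q⟩⟩ := H (f.cmp hW 𝒞 (g'.cmp hW 𝒞 h)) (by simp)
  rw [ev_comp₂_app hW 𝒞 _ _ _ _ _ P, ev_comp₂_app hW 𝒞 _ _ _ _ _ Q, ev_whiskerRight,
    ev_whiskerLeft, ev_whiskerLeft, ev_whiskerRight, ev_assocHom, ev_assocInv]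
  simp

theorem whisker_exchange {f g : Roof W a b} {h i : Roof W b c} (η : Cell f g) (θ : Cell h i) :
    (θ.whiskerLeft hW 𝒞 f).comp hW 𝒞 (η.whiskerRight hW 𝒞 i) =
      (η.whiskerRight hW 𝒞 h).comp hW 𝒞 (θ.whiskerLeft hW 𝒞 g) := by
  refine Cell.ext_legs hW [f.cmp hW 𝒞 i, g.cmp hW 𝒞 h] fun u H _ _ M N => ?_
  obtain ⟨_, ⟨P⟩⟩ := H (f.cmp hW 𝒞 i) (by simp)
  obtain ⟨_, ⟨Q⟩⟩ := H (g.cmp hW 𝒞 h) (by simp)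
  rw [ev_comp₂_app hW 𝒞 _ _ _ _ _ P, ev_comp₂_app hW 𝒞 _ _ _ _ _ Q, ev_whiskerLeft,
    ev_whiskerLeft, ev_whiskerRight, ev_whiskerRight]
  simp

end Cell

/-- The bicategory of fractions is a bicategory. -/
theorem fractionData_isBicategory : (fractionData hW 𝒞).IsBicategory where
  id_comp := Cell.id_comp hW 𝒞
  comp_id := Cell.comp_id hW 𝒞
  assoc := Cell.assoc hW 𝒞
  assoc_hom_inv := Cell.assoc_hom_inv hW 𝒞
  assoc_inv_hom := Cell.assoc_inv_hom hW 𝒞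
  left_hom_inv := Cell.left_hom_inv hW 𝒞
  left_inv_hom := Cell.left_inv_hom hW 𝒞
  right_hom_inv := Cell.right_hom_inv hW 𝒞
  right_inv_hom := Cell.right_inv_hom hW 𝒞
  whiskerLeft_id := Cell.whiskerLeft_id hW 𝒞
  whiskerLeft_comp := Cell.whiskerLeft_comp hW 𝒞
  id_whiskerLeft := Cell.id_whiskerLeft hW 𝒞
  comp_whiskerLeft := Cell.comp_whiskerLeft hW 𝒞
  id_whiskerRight := Cell.id_whiskerRight hW 𝒞
  comp_whiskerRight := Cell.comp_whiskerRight hW 𝒞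
  whiskerRight_id := Cell.whiskerRight_id hW 𝒞
  whiskerRight_comp := Cell.whiskerRight_comp hW 𝒞
  whisker_assoc := Cell.whisker_assoc hW 𝒞
  whisker_exchange := Cell.whisker_exchange hW 𝒞
  pentagon _ _ _ _ := Cell.pentagon hW 𝒞 _ _ _ _
  triangle := Cell.triangle hW 𝒞

end Lawful

/-! ### The universal pseudofunctor -/

section Universal

variable {C : Type u} [Bicategory.{w, v} C] {W : MorphismProperty C} (hW : BF W) {a b c d : C}

open Loc Leg

/-- The roof of a composite of morphisms is given by the composite in the localised bicategory. The
composites in `C` and in the localised bicategory agree by definition, but not syntactically; this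
definition and the following ones fix the form in which the composite is written. -/
abbrev morDataComp (f : a ⟶ b) (g : b ⟶ c) :
    MorData ((Roof.ofMor hW (f ≫ g)).loc hW) (mor hW f ≫ mor hW g) :=
  λ_ (mor hW f ≫ mor hW g)

/-- The roof of a composite of three morphisms, bracketed to the left. -/
abbrev morDataCompLeft (f : a ⟶ b) (g : b ⟶ c) (h : c ⟶ d) :
    MorData ((Roof.ofMor hW ((f ≫ g) ≫ h)).loc hW) ((mor hW f ≫ mor hW g) ≫ mor hW h) :=
  λ_ ((mor hW f ≫ mor hW g) ≫ mor hW h)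

/-- The roof of a composite of three morphisms, bracketed to the right. -/
abbrev morDataCompRight (f : a ⟶ b) (g : b ⟶ c) (h : c ⟶ d) :
    MorData ((Roof.ofMor hW (f ≫ g ≫ h)).loc hW) (mor hW f ≫ mor hW g ≫ mor hW h) :=
  λ_ (mor hW f ≫ mor hW g ≫ mor hW h)

/-- The roof of a composite with an identity on the source. -/
abbrev morDataIdComp (f : a ⟶ b) :
    MorData ((Roof.ofMor hW (𝟙 a ≫ f)).loc hW) (𝟙 (⟨a⟩ : Loc hW) ≫ mor hW f) :=
  λ_ (𝟙 (⟨a⟩ : Loc hW) ≫ mor hW f)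

/-- The roof of a composite with an identity on the target. -/
abbrev morDataCompId (f : a ⟶ b) :
    MorData ((Roof.ofMor hW (f ≫ 𝟙 b)).loc hW) (mor hW f ≫ 𝟙 (⟨b⟩ : Loc hW)) :=
  λ_ (mor hW f ≫ 𝟙 (⟨b⟩ : Loc hW))

variable (𝒞 : Choices W)

theorem ev_compHom' (f : a ⟶ b) (g : b ⟶ c) :
    (Cell.compHom hW 𝒞 f g).ev hW =
      RoofTrans.ofHom₂ (morDataComp hW f g)
        ((compData hW 𝒞 (Roof.ofMor hW f) (Roof.ofMor hW g)).morData
        (morData hW) (morData hW)) (𝟙 (mor hW f ≫ mor hW g)) := ev_compHom hW 𝒞 f g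

theorem ev_compInv' (f : a ⟶ b) (g : b ⟶ c) :
    (Cell.compInv hW 𝒞 f g).ev hW =
      RoofTrans.ofHom₂ ((compData hW 𝒞 (Roof.ofMor hW f) (Roof.ofMor hW g)).morData
        (morData hW) (morData hW)) (morDataComp hW f g) (𝟙 (mor hW f ≫ mor hW g)) :=
  ev_compInv hW 𝒞 f g

namespace Cell

theorem ofHom₂_id (f : a ⟶ b) : ofHom₂ hW (𝟙 f) = Cell.id hW 𝒞 (Roof.ofMor hW f) := by
  refine Cell.ext_legs hW [] fun u H _ _ M N => ?_
  rw [ev_ofHom₂, ev_id₂, mor₂_id]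
  simp [tr_eq_val (morData hW)]

theorem ofHom₂_comp {f g h : a ⟶ b} (η : f ⟶ g) (θ : g ⟶ h) :
    ofHom₂ hW (η ≫ θ) = (ofHom₂ hW η).comp hW 𝒞 (ofHom₂ hW θ) := by
  refine Cell.ext_legs hW [Roof.ofMor hW g] fun u H _ _ M N => ?_
  obtain ⟨_, ⟨P⟩⟩ := H (Roof.ofMor hW g) (by simp)
  rw [ev_comp₂_app hW 𝒞 _ _ _ _ _ P, ev_ofHom₂, ev_ofHom₂, ev_ofHom₂, mor₂_comp]
  simp

theorem comp_hom_inv (f : a ⟶ b) (g : b ⟶ c) :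
    (compHom hW 𝒞 f g).comp hW 𝒞 (compInv hW 𝒞 f g) = Cell.id hW 𝒞 _ := by
  refine Cell.ext_legs hW [(Roof.ofMor hW f).cmp hW 𝒞 (Roof.ofMor hW g)] fun u H _ _ M N => ?_
  obtain ⟨_, ⟨P⟩⟩ := H _ (by simp; rfl)
  rw [ev_comp₂_app hW 𝒞 _ _ _ _ _ P, ev_compHom', ev_compInv', ev_id₂, RoofTrans.id_app,
    tr_eq_val (morDataComp hW f g)]
  simp

theorem comp_inv_hom (f : a ⟶ b) (g : b ⟶ c) :
    (compInv hW 𝒞 f g).comp hW 𝒞 (compHom hW 𝒞 f g) = Cell.id hW 𝒞 _ := by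
  refine Cell.ext_legs hW [Roof.ofMor hW (f ≫ g)] fun u H _ _ M N => ?_
  obtain ⟨_, ⟨P⟩⟩ := H _ (by simp; rfl)
  rw [ev_comp₂_app hW 𝒞 _ _ _ _ _ P, ev_compHom', ev_compInv', ev_id₂, RoofTrans.id_app,
    tr_eq_val ((compData hW 𝒞 (Roof.ofMor hW f) (Roof.ofMor hW g)).morData
        (morData hW) (morData hW))]
  simp

theorem ofHom₂_whiskerLeft (f : a ⟶ b) {g h : b ⟶ c} (η : g ⟶ h) :
    ofHom₂ hW (f ◁ η) = (compHom hW 𝒞 f g).comp hW 𝒞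
      (((ofHom₂ hW η).whiskerLeft hW 𝒞 (Roof.ofMor hW f)).comp hW 𝒞 (compInv hW 𝒞 f h)) := by
  have e : (ofHom₂ hW (f ◁ η)).ev hW =
      RoofTrans.ofHom₂ (morDataComp hW f g) (morDataComp hW f h) (mor hW f ◁ mor₂ hW η) :=
    (ev_ofHom₂ hW (f ◁ η)).trans (congrArg (RoofTrans.ofHom₂ _ _) (mor₂_whiskerLeft f η))
  refine Cell.ext_legs hW [(Roof.ofMor hW f).cmp hW 𝒞 (Roof.ofMor hW g),
    (Roof.ofMor hW f).cmp hW 𝒞 (Roof.ofMor hW h)] fun u H _ _ M N => ?_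
  obtain ⟨_, ⟨P⟩⟩ := H ((Roof.ofMor hW f).cmp hW 𝒞 (Roof.ofMor hW g)) (by simp)
  obtain ⟨_, ⟨Q⟩⟩ := H ((Roof.ofMor hW f).cmp hW 𝒞 (Roof.ofMor hW h)) (by simp)
  rw [ev_comp₂_app hW 𝒞 _ _ _ _ _ P, ev_comp₂_app hW 𝒞 _ _ _ _ _ Q, e, ev_compHom', ev_compInv',
    ev_whiskerLeft, ev_ofHom₂]
  have h₁ := Bicategory.whisker_exchange
    ((Q.fst (compData hW 𝒞 (Roof.ofMor hW f) (Roof.ofMor hW h))).val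
    (morData hW)).hom (mor₂ hW η)
  simp only [Bicategory.comp_whiskerLeft, Category.assoc] at h₁
  simp [val_morData, tr_eq_val (morData hW), ← reassoc_of% h₁]

theorem ofHom₂_whiskerRight {f g : a ⟶ b} (η : f ⟶ g) (h : b ⟶ c) :
    ofHom₂ hW (η ▷ h) = (compHom hW 𝒞 f h).comp hW 𝒞
      (((ofHom₂ hW η).whiskerRight hW 𝒞 (Roof.ofMor hW h)).comp hW 𝒞 (compInv hW 𝒞 g h)) := by
  have e : (ofHom₂ hW (η ▷ h)).ev hW =
      RoofTrans.ofHom₂ (morDataComp hW f h) (morDataComp hW g h) (mor₂ hW η ▷ mor hW h) :=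
    (ev_ofHom₂ hW (η ▷ h)).trans (congrArg (RoofTrans.ofHom₂ _ _) (mor₂_whiskerRight η h))
  refine Cell.ext_legs hW [(Roof.ofMor hW f).cmp hW 𝒞 (Roof.ofMor hW h),
    (Roof.ofMor hW g).cmp hW 𝒞 (Roof.ofMor hW h)] fun u H _ _ M N => ?_
  obtain ⟨_, ⟨P⟩⟩ := H ((Roof.ofMor hW f).cmp hW 𝒞 (Roof.ofMor hW h)) (by simp)
  obtain ⟨_, ⟨Q⟩⟩ := H ((Roof.ofMor hW g).cmp hW 𝒞 (Roof.ofMor hW h)) (by simp)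
  rw [ev_comp₂_app hW 𝒞 _ _ _ _ _ P, ev_comp₂_app hW 𝒞 _ _ _ _ _ Q, e, ev_compHom', ev_compInv',
    ev_whiskerRight, ev_ofHom₂]
  simp [val_morData, tr_eq_val (morData hW)]

theorem ofHom₂_associator (f : a ⟶ b) (g : b ⟶ c) (h : c ⟶ d) :
    ofHom₂ hW (α_ f g h).hom = (compHom hW 𝒞 (f ≫ g) h).comp hW 𝒞
      (((compHom hW 𝒞 f g).whiskerRight hW 𝒞 (Roof.ofMor hW h)).comp hW 𝒞
        ((assocHom hW 𝒞 (Roof.ofMor hW f) (Roof.ofMor hW g) (Roof.ofMor hW h)).comp hW 𝒞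
          (((compInv hW 𝒞 g h).whiskerLeft hW 𝒞 (Roof.ofMor hW f)).comp hW 𝒞
            (compInv hW 𝒞 f (g ≫ h))))) := by
  -- The transformations of the cells, with the composites expanded in the localised bicategory.
  have e : (ofHom₂ hW (α_ f g h).hom).ev hW =
      RoofTrans.ofHom₂ (f := (mor hW f ≫ mor hW g) ≫ mor hW h)
        (g := mor hW f ≫ mor hW g ≫ mor hW h) (morDataCompLeft hW f g h)
        (morDataCompRight hW f g h) (α_ _ _ _).hom := ev_ofHom₂ hW (α_ f g h).hom
  have e₁ : (compHom hW 𝒞 (f ≫ g) h).ev hW =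
      RoofTrans.ofHom₂ (f := (mor hW f ≫ mor hW g) ≫ mor hW h)
        (g := (mor hW f ≫ mor hW g) ≫ mor hW h) (morDataCompLeft hW f g h)
        ((compData hW 𝒞 (Roof.ofMor hW (f ≫ g)) (Roof.ofMor hW h)).morData
          (morDataComp hW f g) (morData hW)) (𝟙 _) := ev_compHom hW 𝒞 (f ≫ g) h
  have e₂ : (compInv hW 𝒞 f (g ≫ h)).ev hW =
      RoofTrans.ofHom₂ (f := mor hW f ≫ mor hW g ≫ mor hW h)
        (g := mor hW f ≫ mor hW g ≫ mor hW h)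
        ((compData hW 𝒞 (Roof.ofMor hW f) (Roof.ofMor hW (g ≫ h))).morData
          (morData hW) (morDataComp hW g h)) (morDataCompRight hW f g h) (𝟙 _) :=
    ev_compInv hW 𝒞 f (g ≫ h)
  refine Cell.ext_legs hW [(Roof.ofMor hW (f ≫ g)).cmp hW 𝒞 (Roof.ofMor hW h),
    ((Roof.ofMor hW f).cmp hW 𝒞 (Roof.ofMor hW g)).cmp hW 𝒞 (Roof.ofMor hW h),
    (Roof.ofMor hW f).cmp hW 𝒞 ((Roof.ofMor hW g).cmp hW 𝒞 (Roof.ofMor hW h)),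
    (Roof.ofMor hW f).cmp hW 𝒞 (Roof.ofMor hW (g ≫ h))] fun u H _ _ M N => ?_
  obtain ⟨_, ⟨P⟩⟩ := H ((Roof.ofMor hW (f ≫ g)).cmp hW 𝒞 (Roof.ofMor hW h)) (by simp)
  obtain ⟨_, ⟨Q⟩⟩ :=
    H (((Roof.ofMor hW f).cmp hW 𝒞 (Roof.ofMor hW g)).cmp hW 𝒞 (Roof.ofMor hW h)) (by simp)
  obtain ⟨_, ⟨R⟩⟩ :=
    H ((Roof.ofMor hW f).cmp hW 𝒞 ((Roof.ofMor hW g).cmp hW 𝒞 (Roof.ofMor hW h))) (by simp)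
  obtain ⟨_, ⟨S⟩⟩ := H ((Roof.ofMor hW f).cmp hW 𝒞 (Roof.ofMor hW (g ≫ h))) (by simp)
  rw [ev_comp₂_app hW 𝒞 _ _ _ _ _ P, ev_comp₂_app hW 𝒞 _ _ _ _ _ Q,
    ev_comp₂_app hW 𝒞 _ _ _ _ _ R, ev_comp₂_app hW 𝒞 _ _ _ _ _ S, e, e₁, e₂, ev_whiskerLeft,
    ev_whiskerRight, ev_assocHom, ev_compHom', ev_compInv']
  simp [val_morData, tr_eq_val (morData hW)]

theorem ofHom₂_leftUnitor (f : a ⟶ b) :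
    ofHom₂ hW (λ_ f).hom = (compHom hW 𝒞 (𝟙 a) f).comp hW 𝒞
      (((Cell.id hW 𝒞 (Roof.ofMor hW (𝟙 a))).whiskerRight hW 𝒞 (Roof.ofMor hW f)).comp hW 𝒞
        (leftHom hW 𝒞 (Roof.ofMor hW f))) := by
  have e : (ofHom₂ hW (λ_ f).hom).ev hW =
      RoofTrans.ofHom₂ (f := 𝟙 (⟨a⟩ : Loc hW) ≫ mor hW f) (morDataIdComp hW f)
        (morData hW) (λ_ (mor hW f)).hom := ev_ofHom₂ hW (λ_ f).hom
  have e₁ : (compHom hW 𝒞 (𝟙 a) f).ev hW =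
      RoofTrans.ofHom₂ (f := 𝟙 (⟨a⟩ : Loc hW) ≫ mor hW f) (g := 𝟙 (⟨a⟩ : Loc hW) ≫ mor hW f)
        (morDataIdComp hW f)
        ((compData hW 𝒞 (Roof.ofMor hW (𝟙 a)) (Roof.ofMor hW f)).morData
          (morDataId hW a) (morData hW)) (𝟙 _) := ev_compHom hW 𝒞 (𝟙 a) f
  rw [id_whiskerRight, id_comp]
  refine Cell.ext_legs hW [(Roof.ofMor hW (𝟙 a)).cmp hW 𝒞 (Roof.ofMor hW f)] fun u H _ _ M N => ?_
  obtain ⟨_, ⟨P⟩⟩ := H _ (by simp; rfl)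
  rw [ev_comp₂_app hW 𝒞 _ _ _ _ _ P, e, e₁, ev_leftHom]
  simp [val_morData, tr_eq_val (morData hW)]

theorem ofHom₂_rightUnitor (f : a ⟶ b) :
    ofHom₂ hW (ρ_ f).hom = (compHom hW 𝒞 f (𝟙 b)).comp hW 𝒞
      (((Cell.id hW 𝒞 (Roof.ofMor hW (𝟙 b))).whiskerLeft hW 𝒞 (Roof.ofMor hW f)).comp hW 𝒞
        (rightHom hW 𝒞 (Roof.ofMor hW f))) := by
  have e : (ofHom₂ hW (ρ_ f).hom).ev hW =
      RoofTrans.ofHom₂ (f := mor hW f ≫ 𝟙 (⟨b⟩ : Loc hW)) (morDataCompId hW f)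
        (morData hW) (ρ_ (mor hW f)).hom := ev_ofHom₂ hW (ρ_ f).hom
  have e₁ : (compHom hW 𝒞 f (𝟙 b)).ev hW =
      RoofTrans.ofHom₂ (f := mor hW f ≫ 𝟙 (⟨b⟩ : Loc hW)) (g := mor hW f ≫ 𝟙 (⟨b⟩ : Loc hW))
        (morDataCompId hW f)
        ((compData hW 𝒞 (Roof.ofMor hW f) (Roof.ofMor hW (𝟙 b))).morData
          (morData hW) (morDataId hW b)) (𝟙 _) := ev_compHom hW 𝒞 f (𝟙 b)
  rw [whiskerLeft_id, id_comp]
  refine Cell.ext_legs hW [(Roof.ofMor hW f).cmp hW 𝒞 (Roof.ofMor hW (𝟙 b))] fun u H _ _ M N => ?_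
  obtain ⟨_, ⟨P⟩⟩ := H _ (by simp; rfl)
  rw [ev_comp₂_app hW 𝒞 _ _ _ _ _ P, e, e₁, ev_rightHom]
  simp [val_morData, tr_eq_val (morData hW)]

end Cell

theorem universalData_isPseudofunctor (l : (fractionData hW 𝒞).IsBicategory) :
    (universalData hW 𝒞 l).IsPseudofunctor where
  map₂_id := Cell.ofHom₂_id hW 𝒞
  map₂_comp := Cell.ofHom₂_comp hW 𝒞
  id_hom_inv _ := Cell.id_comp hW 𝒞 _
  id_inv_hom _ := Cell.id_comp hW 𝒞 _
  comp_hom_inv := Cell.comp_hom_inv hW 𝒞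
  comp_inv_hom := Cell.comp_inv_hom hW 𝒞
  map₂_whisker_left := Cell.ofHom₂_whiskerLeft hW 𝒞
  map₂_whisker_right := Cell.ofHom₂_whiskerRight hW 𝒞
  map₂_associator := Cell.ofHom₂_associator hW 𝒞
  map₂_left_unitor := Cell.ofHom₂_leftUnitor hW 𝒞
  map₂_right_unitor := Cell.ofHom₂_rightUnitor hW 𝒞

/-- The bicategory of fractions is a bicategory, and the universal pseudofunctor is one. -/
theorem isLawful : IsLawful hW 𝒞 :=
  ⟨fractionData_isBicategory hW 𝒞, universalData_isPseudofunctor hW 𝒞 _⟩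

end Universal

/-! ### The saturation -/

section Saturation

variable {C : Type u} [Bicategory.{w, v} C] {W : MorphismProperty C}

/-- Whiskering with a morphism which has compatible one-sided inverses up to the class is
injective. -/
theorem Strict.hom_ext_right_of_comp_mem {D : Type u} [Bicategory.{w, v} D]
    {W : MorphismProperty D} [Strict W] {a b c d e : D} {f : b ⟶ a} {g : c ⟶ b} {h : d ⟶ c}
    (hgf : W (g ≫ f)) (hhg : W (h ≫ g)) {x y : e ⟶ b} {η θ : x ⟶ y} (H : η ▷ f = θ ▷ f) :
    η = θ := by
  obtain ⟨d₁, z₁, x₁, hz₁, ⟨i₁⟩⟩ := Strict.square (h ≫ g) x hhg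
  obtain ⟨d₂, z₂, y', hz₂, ⟨j⟩⟩ := Strict.square (h ≫ g) (z₁ ≫ y) hhg
  apply hom_ext_left hz₁
  apply hom_ext_left hz₂
  let i : z₂ ≫ z₁ ≫ x ≅ (z₂ ≫ x₁) ≫ h ≫ g := whiskerLeftIso z₂ i₁ ≪≫ (α_ _ _ _).symm
  -- Both 2-morphisms are locally of the form `κ ▷ h ▷ g`, and `κ ▷ h` is determined by its
  -- whiskering with `g ≫ f`.
  have key : ∀ η : x ⟶ y, ∃ κ : z₂ ≫ x₁ ⟶ y', (κ ▷ h) ▷ g =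
      (α_ _ _ _).hom ≫ i.inv ≫ z₂ ◁ z₁ ◁ η ≫ j.hom ≫ (α_ _ _ _).inv := by
    intro η
    refine ⟨lift hhg (i.inv ≫ z₂ ◁ z₁ ◁ η ≫ j.hom), ?_⟩
    have := lift_whiskerRight hhg (i.inv ≫ z₂ ◁ z₁ ◁ η ≫ j.hom)
    rw [Bicategory.whiskerRight_comp] at this
    rw [← cancel_epi (α_ _ _ _).inv, ← cancel_mono (α_ _ _ _).hom, Category.assoc, this]
    simp
  obtain ⟨κ, hκ⟩ := key η
  obtain ⟨κ', hκ'⟩ := key θ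
  have e : κ ▷ h = κ' ▷ h := by
    apply hom_ext_right hgf
    rw [Bicategory.whiskerRight_comp, Bicategory.whiskerRight_comp, hκ, hκ']
    have : (z₂ ◁ z₁ ◁ η) ▷ f = (z₂ ◁ z₁ ◁ θ) ▷ f := by simp [H]
    simp only [Bicategory.comp_whiskerRight, this]
  rw [e, hκ'] at hκ
  simpa using hκ.symm

namespace BF

variable (hW : BF W)
include hW

theorem locEq_of_whiskerRight_of_comp_mem {a b c d e : C} {f : b ⟶ a} {g : c ⟶ b} {h : d ⟶ c}
    (hgf : W (g ≫ f)) (hhg : W (h ≫ g)) {x y : e ⟶ b} {β β' : x ⟶ y} (H : β ▷ f = β' ▷ f) :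
    LocEq W β β' := by
  rw [← Loc.mor₂_eq_iff (hW := hW)]
  refine Strict.hom_ext_right_of_comp_mem (W := Loc.prop hW) (f := Loc.mor hW f)
    (g := Loc.mor hW g) (h := Loc.mor hW h) hgf hhg ?_
  rw [← Loc.mor₂_whiskerRight, ← Loc.mor₂_whiskerRight, H]

/-- If `g ≫ f` is in `W`, a 2-morphism between composites with `f` lifts locally as soon as the
morphisms `x` and `y` factor locally through `g`: lift along `g ≫ f`, and whisker with `g`. -/
theorem exists_lift_of_factor {a b c d e : C} {f : b ⟶ a} {g : c ⟶ b} (hgf : W (g ≫ f))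
    {x y : e ⟶ b} {z : d ⟶ e} {x' y' : d ⟶ c} (i : z ≫ x ≅ x' ≫ g) (j : z ≫ y ≅ y' ≫ g)
    (α : x ≫ f ⟶ y ≫ f) : ∃ (d' : C) (v : d' ⟶ d) (β : (v ≫ z) ≫ x ⟶ (v ≫ z) ≫ y),
      W v ∧ IsLift α (v ≫ z) β ∧ (IsIso α → IsIso β) := by
  obtain ⟨d', v, μ, hv, hμ, hi⟩ := hW.bf4ab (g ≫ f) x' y' ((α_ x' g f).inv ≫ i.inv ▷ f ≫
    (α_ z x f).hom ≫ z ◁ α ≫ (α_ z y f).inv ≫ j.hom ▷ f ≫ (α_ y' g f).hom) hgf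
  refine ⟨d', v, (α_ v z x).hom ≫ v ◁ i.hom ≫ (α_ v x' g).inv ≫ μ ▷ g ≫ (α_ v y' g).hom ≫
    v ◁ j.inv ≫ (α_ v z y).inv, hv, ?_, ?_⟩
  · rw [IsLift] at hμ ⊢
    symm
    calc
      _ = 𝟙 _ ⊗≫ (v ◁ i.hom) ▷ f ⊗≫ ((α_ v x' (g ≫ f)).inv ≫ μ ▷ (g ≫ f) ≫
          (α_ v y' (g ≫ f)).hom) ⊗≫ (v ◁ j.inv) ▷ f ⊗≫ 𝟙 _ := by bicategory
      _ = 𝟙 _ ⊗≫ v ◁ (i.hom ≫ i.inv) ▷ f ⊗≫ v ◁ z ◁ α ⊗≫ v ◁ (j.hom ≫ j.inv) ▷ f ⊗≫ 𝟙 _ := by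
        rw [← hμ]; bicategory
      _ = _ := by rw [i.hom_inv_id, j.hom_inv_id]; bicategory
  · intro
    have : IsIso μ := hi inferInstance
    infer_instance

/-- Morphisms into the source of `f` factor locally through `h ≫ g`, hence through `g`. -/
theorem saturation_bf4ab {a b c : C} (f : b ⟶ a) (x y : c ⟶ b) (α : x ≫ f ⟶ y ≫ f)
    (hf : saturation W f) : ∃ (d : C) (v : d ⟶ c) (β : v ≫ x ⟶ v ≫ y),
      W v ∧ IsLift α v β ∧ (IsIso α → IsIso β) := by
  obtain ⟨_, _, g, h, hgf, hhg⟩ := hf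
  obtain ⟨d₁, z₁, x₁, hz₁, ⟨i₁⟩⟩ := hW.bf3 (h ≫ g) x hhg
  obtain ⟨d₂, z₂, y₁, hz₂, ⟨j₁⟩⟩ := hW.bf3 (h ≫ g) (z₁ ≫ y) hhg
  obtain ⟨d, v, β, hv, hβ⟩ := hW.exists_lift_of_factor hgf (z := z₂ ≫ z₁) (x' := (z₂ ≫ x₁) ≫ h)
    (y' := y₁ ≫ h)
    (α_ _ _ _ ≪≫ whiskerLeftIso z₂ i₁ ≪≫ (α_ _ _ _).symm ≪≫ (α_ _ _ _).symm)
    (α_ _ _ _ ≪≫ j₁ ≪≫ (α_ _ _ _).symm) α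
  exact ⟨d, _, β, hW.bf2 _ _ hv (hW.bf2 _ _ hz₂ hz₁), hβ⟩

theorem saturation_lift_iso {a b c : C} {f : b ⟶ a} (hf : saturation W f) {x y : c ⟶ b}
    (α : x ≫ f ≅ y ≫ f) : ∃ (d : C) (v : d ⟶ c), W v ∧ Nonempty (v ≫ x ≅ v ≫ y) := by
  obtain ⟨d, v, β, hv, -, hi⟩ := hW.saturation_bf4ab f x y α.hom hf
  have : IsIso β := hi inferInstance
  exact ⟨d, v, hv, ⟨asIso β⟩⟩

theorem saturation_of_mem {a b : C} {f : a ⟶ b} (hf : W f) : saturation W f :=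
  ⟨a, a, 𝟙 a, 𝟙 a, hW.bf2 _ _ (hW.bf1 a) hf, hW.bf2 _ _ (hW.bf1 a) (hW.bf1 a)⟩

theorem saturation_of_iso {a b : C} {f g : a ⟶ b} (i : f ≅ g) (hg : saturation W g) :
    saturation W f := by
  obtain ⟨c, d, p, q, h, h'⟩ := hg
  exact ⟨c, d, p, q, hW.bf5 _ _ (whiskerLeftIso p i) h, h'⟩

/-- A section up to `W` of a morphism of the saturation again has a section up to `W`. -/
theorem exists_comp_mem_of_comp_mem {a b q : C} {f : b ⟶ a} (hf : saturation W f) {s : q ⟶ b}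
    (hs : W (s ≫ f)) : ∃ (r : C) (h : r ⟶ q), W (h ≫ s) := by
  obtain ⟨_, _, g, h, hgf, hhg⟩ := id hf
  obtain ⟨r, w', k, hw', ⟨i⟩⟩ := hW.bf3 (s ≫ f) ((h ≫ g) ≫ f) hs
  obtain ⟨d, v, hv, ⟨j⟩⟩ := hW.saturation_lift_iso hf (x := w' ≫ h ≫ g) (y := k ≫ s)
    (α_ _ _ _ ≪≫ i ≪≫ (α_ _ _ _).symm)
  exact ⟨d, v ≫ k, hW.bf5 _ _ (α_ _ _ _ ≪≫ j.symm) (hW.bf2 _ _ hv (hW.bf2 _ _ hw' hhg))⟩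

theorem saturation_comp {a b c : C} {f₁ : c ⟶ b} {f₂ : b ⟶ a} (h₁ : saturation W f₁)
    (h₂ : saturation W f₂) : saturation W (f₁ ≫ f₂) := by
  obtain ⟨_, _, g₁, k₁, hg₁, -⟩ := id h₁
  obtain ⟨_, _, g₂, k₂, hg₂, hk₂⟩ := h₂
  obtain ⟨p, w', q, hw', ⟨i⟩⟩ := hW.bf3 (g₁ ≫ f₁) g₂ hg₁
  obtain ⟨r, w'', l, hw'', ⟨j⟩⟩ := hW.bf3 w' k₂ hw'
  have hl : W ((l ≫ q ≫ g₁) ≫ f₁) :=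
    hW.bf5 _ _ (α_ _ _ _ ≪≫ whiskerLeftIso l (α_ _ _ _ ≪≫ i.symm) ≪≫ (α_ _ _ _).symm ≪≫
      whiskerRightIso j.symm g₂ ≪≫ α_ _ _ _) (hW.bf2 _ _ hw'' hk₂)
  obtain ⟨s, h, hh⟩ := hW.exists_comp_mem_of_comp_mem h₁ hl
  refine ⟨p, s, q ≫ g₁, h ≫ l, ?_, hW.bf5 _ _ (α_ _ _ _) hh⟩
  exact hW.bf5 _ _ ((α_ _ _ _).symm ≪≫ whiskerRightIso (α_ _ _ _ ≪≫ i.symm) f₂ ≪≫ α_ _ _ _)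
    (hW.bf2 _ _ hw' hg₂)

theorem saturation_bf3 {a b c : C} {f : a ⟶ b} (x : c ⟶ b) (hf : saturation W f) :
    ∃ (d : C) (w' : d ⟶ c) (x' : d ⟶ a), W w' ∧ Nonempty (w' ≫ x ≅ x' ≫ f) := by
  obtain ⟨_, _, g, h, hgf, -⟩ := hf
  obtain ⟨d, w', x', hw', ⟨i⟩⟩ := hW.bf3 (g ≫ f) x hgf
  exact ⟨d, w', x' ≫ g, hw', ⟨i ≪≫ (α_ _ _ _).symm⟩⟩

theorem saturation_bf4c {a b c : C} (f : b ⟶ a) (x y : c ⟶ b) (α : x ≫ f ⟶ y ≫ f)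
    (hf : saturation W f) (d : C) (v : d ⟶ c) (β : v ≫ x ⟶ v ≫ y) (d' : C) (v' : d' ⟶ c)
    (β' : v' ≫ x ⟶ v' ≫ y) (hv : saturation W v) (hβ : IsLift α v β) (hv' : saturation W v')
    (hβ' : IsLift α v' β') :
    ∃ (e : C) (z : e ⟶ d) (z' : e ⟶ d') (ζ : z ≫ v ≅ z' ≫ v'), saturation W (z ≫ v) ∧
      (α_ z v x).hom ≫ z ◁ β ≫ (α_ z v y).inv ≫ ζ.hom ▷ y =
        ζ.hom ▷ x ≫ (α_ z' v' x).hom ≫ z' ◁ β' ≫ (α_ z' v' y).inv := by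
  obtain ⟨e, z', z, hz', ⟨i⟩⟩ := hW.saturation_bf3 v' hv
  obtain ⟨_, _, g, h, hgf, hhg⟩ := hf
  rw [IsLift] at hβ hβ'
  obtain ⟨t, k, hk, H⟩ := hW.locEq_of_whiskerRight_of_comp_mem hgf hhg
    (β := (α_ z v x).hom ≫ z ◁ β ≫ (α_ z v y).inv ≫ i.inv ▷ y)
    (β' := i.inv ▷ x ≫ (α_ z' v' x).hom ≫ z' ◁ β' ≫ (α_ z' v' y).inv) (by
      calc
        _ = 𝟙 _ ⊗≫ z ◁ ((α_ v x f).inv ≫ β ▷ f ≫ (α_ v y f).hom) ⊗≫ i.inv ▷ (y ≫ f) ⊗≫ 𝟙 _ := by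
          bicategory
        _ = 𝟙 _ ⊗≫ ((z ≫ v) ◁ α ≫ i.inv ▷ (y ≫ f)) ⊗≫ 𝟙 _ := by rw [← hβ]; bicategory
        _ = 𝟙 _ ⊗≫ i.inv ▷ (x ≫ f) ⊗≫ z' ◁ v' ◁ α ⊗≫ 𝟙 _ := by
          rw [whisker_exchange]; bicategory
        _ = _ := by rw [hβ']; bicategory)
  refine ⟨t, k ≫ z, k ≫ z', α_ _ _ _ ≪≫ whiskerLeftIso k i.symm ≪≫ (α_ _ _ _).symm, ?_, ?_⟩
  · exact hW.saturation_of_iso (α_ _ _ _ ≪≫ whiskerLeftIso k i.symm ≪≫ (α_ _ _ _).symm)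
      (hW.saturation_comp (hW.saturation_of_mem (hW.bf2 _ _ hk hz')) hv')
  · simp only [Iso.trans_hom, whiskerLeftIso_hom, Iso.symm_hom]
    calc
      _ = 𝟙 _ ⊗≫ k ◁ ((α_ z v x).hom ≫ z ◁ β ≫ (α_ z v y).inv ≫ i.inv ▷ y) ⊗≫ 𝟙 _ := by
        bicategory
      _ = _ := by rw [H]; bicategory

/-- The saturation of a class satisfying the axioms of a right bicalculus of fractions satisfies
them as well. -/
theorem saturation : BF (saturation W) where
  bf1 a := hW.saturation_of_mem (hW.bf1 a)
  bf2 _ _ := hW.saturation_comp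
  bf3 f x hf := by
    obtain ⟨d, w', x', hw', h⟩ := hW.saturation_bf3 x hf
    exact ⟨d, w', x', hW.saturation_of_mem hw', h⟩
  bf4ab f x y α hf := by
    obtain ⟨d, v, β, hv, h⟩ := hW.saturation_bf4ab f x y α hf
    exact ⟨d, v, β, hW.saturation_of_mem hv, h⟩
  bf4c := hW.saturation_bf4c
  bf5 _ _ := hW.saturation_of_iso

end BF

end Saturation

/-! ### Extension of pseudofunctors to the localised bicategory -/

section Extension

variable {A : Type u₁} [Bicategory.{w₁, v₁} A] {D : Type u₂} [Bicategory.{w₂, v₂} D]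
  (P : A ⥤ᵖ D)

/-- The left whiskering of a 2-morphism with the image of `z`, up to the compositors of `P`. -/
def resMap {a b d : A} {f g : a ⟶ b} (z : d ⟶ a) (θ : P.map f ⟶ P.map g) :
    P.map (z ≫ f) ⟶ P.map (z ≫ g) :=
  (P.mapComp z f).hom ≫ P.map z ◁ θ ≫ (P.mapComp z g).inv

/-- The right whiskering of a 2-morphism with the image of `k`, up to the compositors of `P`. -/
def mapRes {a b c : A} {f g : a ⟶ b} (θ : P.map f ⟶ P.map g) (k : b ⟶ c) :
    P.map (f ≫ k) ⟶ P.map (g ≫ k) :=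
  (P.mapComp f k).hom ≫ θ ▷ P.map k ≫ (P.mapComp g k).inv

section

variable {P} {a b c d e : A} {f g h : a ⟶ b}

theorem resMap_map₂ (z : d ⟶ a) (β : f ⟶ g) : resMap P z (P.map₂ β) = P.map₂ (z ◁ β) := by
  rw [resMap, P.map₂_whisker_left]

theorem mapRes_map₂ (β : f ⟶ g) (k : b ⟶ c) : mapRes P (P.map₂ β) k = P.map₂ (β ▷ k) := by
  rw [mapRes, P.map₂_whisker_right]

theorem resMap_comp (z : d ⟶ a) (θ : P.map f ⟶ P.map g) (θ' : P.map g ⟶ P.map h) :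
    resMap P z (θ ≫ θ') = resMap P z θ ≫ resMap P z θ' := by
  simp [resMap]

theorem resMap_iso {z z' : d ⟶ a} (i : z ≅ z') (θ : P.map f ⟶ P.map g) :
    resMap P z θ = P.map₂ (i.hom ▷ f) ≫ resMap P z' θ ≫ P.map₂ (i.inv ▷ g) := by
  simp only [resMap, P.map₂_whisker_right, Category.assoc, Iso.inv_hom_id_assoc]
  rw [← whisker_exchange_assoc, ← Bicategory.comp_whiskerRight_assoc, ← P.map₂_comp]
  simp

theorem map₂_associator_inv (f : a ⟶ b) (g : b ⟶ c) (h : c ⟶ d) : P.map₂ (α_ f g h).inv =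
    (P.mapComp f (g ≫ h)).hom ≫ P.map f ◁ (P.mapComp g h).hom ≫ (α_ _ _ _).inv ≫
      (P.mapComp f g).inv ▷ P.map h ≫ (P.mapComp (f ≫ g) h).inv := by
  rw [P.mapComp_assoc_right_hom_assoc]
  simp

theorem resMap_resMap (t : e ⟶ d) (z : d ⟶ a) (θ : P.map f ⟶ P.map g) :
    resMap P t (resMap P z θ) =
      P.map₂ (α_ t z f).inv ≫ resMap P (t ≫ z) θ ≫ P.map₂ (α_ t z g).hom := by
  have h := whisker_exchange (P.mapComp t z).hom θ
  simp only [resMap, map₂_associator_inv, P.map₂_associator, Category.assoc,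
    Iso.inv_hom_id_assoc, reassoc_of% h]
  simp

theorem resMap_mapRes (z : d ⟶ a) (θ : P.map f ⟶ P.map g) (k : b ⟶ c) :
    resMap P z (mapRes P θ k) =
      P.map₂ (α_ z f k).inv ≫ mapRes P (resMap P z θ) k ≫ P.map₂ (α_ z g k).hom := by
  simp only [resMap, mapRes, map₂_associator_inv, P.map₂_associator, Category.assoc]
  simp

end

variable {WA : MorphismProperty A} {V : MorphismProperty D} [Strict V] (hA : BF WA)
  (hP : MapsInto P WA V)

variable {P} {a b c d e : A} {f g h : a ⟶ b}

section

open Loc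

variable {hA}

theorem whiskerLeft_comp_eq_mor₂ {η : mor hA f ⟶ mor hA g} {z : d ⟶ a} {β : z ≫ f ⟶ z ≫ g}
    (h : mor hA z ◁ η = mor₂ hA β) (t : e ⟶ d) : mor hA (t ≫ z) ◁ η = mor₂ hA (res t β) := by
  rw [res, mor₂_comp, mor₂_comp, mor₂_whiskerLeft, ← h]
  exact Bicategory.comp_whiskerLeft _ _ _

theorem whiskerLeft_comp_eq_mor₂' {η : mor hA f ⟶ mor hA g} {z : d ⟶ a} {t : e ⟶ d}
    {β : t ≫ z ≫ f ⟶ t ≫ z ≫ g} (h : mor hA t ◁ mor hA z ◁ η = mor₂ hA β) :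
    mor hA (t ≫ z) ◁ η = mor₂ hA ((α_ t z f).hom ≫ β ≫ (α_ t z g).inv) := by
  rw [mor₂_comp, mor₂_comp, ← h]
  exact Bicategory.comp_whiskerLeft _ _ _

theorem mor₂_eq_of_iso {η : mor hA f ⟶ mor hA g} {z z' : d ⟶ a} (i : z ≅ z')
    {β : z ≫ f ⟶ z ≫ g} {β' : z' ≫ f ⟶ z' ≫ g} (h : mor hA z ◁ η = mor₂ hA β)
    (h' : mor hA z' ◁ η = mor₂ hA β') : mor₂ hA β = mor₂ hA (i.hom ▷ f ≫ β' ≫ i.inv ▷ g) := by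
  have e := Bicategory.whisker_exchange_assoc (iso hA i).hom η ((iso hA i).inv ▷ mor hA g)
  rw [hom_inv_whiskerRight, Category.comp_id, h, h'] at e
  rw [mor₂_comp, mor₂_comp, mor₂_whiskerRight, mor₂_whiskerRight]
  exact e

end

include hP

/-- Since `P.map z` induces an injection by whiskering, equality may be checked locally. -/
theorem resMap_injective {z : d ⟶ a} (hz : WA z) {θ θ' : P.map f ⟶ P.map g}
    (h : resMap P z θ = resMap P z θ') : θ = θ' := by
  apply Strict.hom_ext_left (hP z hz)
  simpa [resMap] using h

/-- A pseudofunctor inverting whiskerings with `WA` identifies locally equal 2-morphisms. -/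
theorem map₂_eq_of_mor₂_eq {β β' : f ⟶ g} (h : Loc.mor₂ hA β = Loc.mor₂ hA β') :
    P.map₂ β = P.map₂ β' := by
  obtain ⟨d, t, ht, e⟩ := Loc.mor₂_eq_iff.1 h
  apply resMap_injective hP ht
  rw [resMap_map₂, resMap_map₂, e]

open Loc

/-- A 2-morphism `η` of the localised bicategory has a well-defined image `θ`: it is glued from the
image of one representative `β₀`, and is compatible with every other representative, because
any two of them agree locally. -/
theorem exists_extension (η : mor hA f ⟶ mor hA g) : ∃ θ : P.map f ⟶ P.map g,
    ∀ {d : A} (z : d ⟶ a) (β : z ≫ f ⟶ z ≫ g), mor hA z ◁ η = mor₂ hA β →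
      resMap P z θ = P.map₂ β := by
  obtain ⟨d₀, z₀, β₀, hz₀, h₀⟩ := exists_whiskerLeft_eq η
  obtain ⟨θ, hθ⟩ : ∃ θ : P.map f ⟶ P.map g, resMap P z₀ θ = P.map₂ β₀ := by
    refine ⟨Strict.glue (hP z₀ hz₀) ((P.mapComp _ _).inv ≫ P.map₂ β₀ ≫ (P.mapComp _ _).hom), ?_⟩
    simp [resMap]
  refine ⟨θ, fun {d} z β h => ?_⟩
  obtain ⟨e, t, k, ht, ⟨i⟩⟩ := hA.bf3 z₀ z hz₀
  apply resMap_injective hP ht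
  have e₁ : resMap P (k ≫ z₀) θ = P.map₂ ((α_ _ _ _).hom ≫ k ◁ β₀ ≫ (α_ _ _ _).inv) := by
    have := resMap_resMap (P := P) k z₀ θ
    rw [hθ, resMap_map₂] at this
    simp only [P.map₂_comp, this, Category.assoc]
    simp only [← P.map₂_comp, ← P.map₂_comp_assoc, Iso.hom_inv_id, P.map₂_id, Category.comp_id]
    simp
  rw [resMap_resMap, resMap_iso i, e₁, resMap_map₂]
  simp only [← P.map₂_comp]
  apply map₂_eq_of_mor₂_eq hA hP
  have e₂ := mor₂_eq_of_iso i (whiskerLeft_comp_eq_mor₂ h t) (whiskerLeft_comp_eq_mor₂ h₀ k)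
  rw [res, res] at e₂
  rw [mor₂_comp, mor₂_comp (_ ≫ _), ← e₂, ← mor₂_comp, ← mor₂_comp]
  simp

/-- The extension of `P` to the localised bicategory, on 2-morphisms. -/
noncomputable def extMap₂ (η : mor hA f ⟶ mor hA g) : P.map f ⟶ P.map g :=
  (exists_extension hA hP η).choose

theorem resMap_extMap₂ {η : mor hA f ⟶ mor hA g} {z : d ⟶ a} {β : z ≫ f ⟶ z ≫ g}
    (h : mor hA z ◁ η = mor₂ hA β) : resMap P z (extMap₂ hA hP η) = P.map₂ β :=
  (exists_extension hA hP η).choose_spec z β h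

theorem extMap₂_eq {η : mor hA f ⟶ mor hA g} {θ : P.map f ⟶ P.map g} {z : d ⟶ a} (hz : WA z)
    {β : z ≫ f ⟶ z ≫ g} (h : mor hA z ◁ η = mor₂ hA β) (hθ : resMap P z θ = P.map₂ β) :
    extMap₂ hA hP η = θ :=
  resMap_injective hP hz ((resMap_extMap₂ hA hP h).trans hθ.symm)

theorem extMap₂_mor₂ (β : f ⟶ g) : extMap₂ hA hP (mor₂ hA β) = P.map₂ β :=
  extMap₂_eq hA hP (hA.bf1 a) (mor₂_whiskerLeft _ _).symm (resMap_map₂ _ _)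

theorem extMap₂_comp (η : mor hA f ⟶ mor hA g) (η' : mor hA g ⟶ mor hA h) :
    extMap₂ hA hP (η ≫ η') = extMap₂ hA hP η ≫ extMap₂ hA hP η' := by
  obtain ⟨d, z, β, hz, e⟩ := exists_whiskerLeft_eq η
  obtain ⟨d', z', β', hz', e'⟩ := exists_whiskerLeft_eq (hW := hA) (f := z ≫ g) (g := z ≫ h)
    (mor hA z ◁ η')
  have e₁ := whiskerLeft_comp_eq_mor₂ e z'
  have e₂ := whiskerLeft_comp_eq_mor₂' e'
  refine extMap₂_eq hA hP (hA.bf2 _ _ hz' hz) (β := res z' β ≫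
    ((α_ z' z g).hom ≫ β' ≫ (α_ z' z h).inv)) ?_ ?_
  · rw [mor₂_comp, ← e₁, ← e₂]
    exact Bicategory.whiskerLeft_comp _ _ _
  · rw [resMap_comp, resMap_extMap₂ hA hP e₁, resMap_extMap₂ hA hP e₂, ← P.map₂_comp]

theorem extMap₂_whiskerLeft (k : d ⟶ a) (η : mor hA f ⟶ mor hA g) :
    extMap₂ hA hP (f := k ≫ f) (g := k ≫ g) (mor hA k ◁ η) = resMap P k (extMap₂ hA hP η) := by
  obtain ⟨e, z, β, hz, h⟩ := exists_whiskerLeft_eq (hW := hA) (f := k ≫ f) (g := k ≫ g)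
    (mor hA k ◁ η)
  refine extMap₂_eq hA hP hz h ?_
  have h' := whiskerLeft_comp_eq_mor₂' h
  rw [resMap_resMap, resMap_extMap₂ hA hP h', ← P.map₂_comp, ← P.map₂_comp]
  simp

theorem extMap₂_whiskerRight (η : mor hA f ⟶ mor hA g) (k : b ⟶ c) :
    extMap₂ hA hP (f := f ≫ k) (g := g ≫ k) (η ▷ mor hA k) = mapRes P (extMap₂ hA hP η) k := by
  obtain ⟨e, z, β, hz, h⟩ := exists_whiskerLeft_eq η
  refine extMap₂_eq hA hP hz (β := (α_ z f k).inv ≫ β ▷ k ≫ (α_ z g k).hom) ?_ ?_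
  · rw [mor₂_comp, mor₂_comp, mor₂_whiskerRight, ← h]
    exact (Bicategory.whisker_assoc_symm _ _ _)
  · rw [resMap_mapRes, resMap_extMap₂ hA hP h, mapRes_map₂, ← P.map₂_comp, ← P.map₂_comp]

/-- The extension to the localised bicategory of a pseudofunctor to a bicategory in which the
images of the morphisms in `WA` may be cancelled. -/
noncomputable def extension : Loc hA ⥤ᵖ D where
  obj a := P.obj a.as
  map {a b} f := P.map (show a.as ⟶ b.as from f)
  map₂ {a b f g} η := extMap₂ hA hP (f := show a.as ⟶ b.as from f) (g := g) η
  map₂_id {a b} f := (extMap₂_mor₂ hA hP (𝟙 (show a.as ⟶ b.as from f))).trans (P.map₂_id _)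
  map₂_comp {a b f g h} η η' :=
    extMap₂_comp hA hP (f := show a.as ⟶ b.as from f) (g := g) (h := h) η η'
  mapId a := P.mapId a.as
  mapComp {a b c} f g := P.mapComp (show a.as ⟶ b.as from f) (show b.as ⟶ c.as from g)
  map₂_whisker_left {a b c} f g h η := extMap₂_whiskerLeft hA hP
    (f := show b.as ⟶ c.as from g) (g := h) (show a.as ⟶ b.as from f) η
  map₂_whisker_right {a b c f g} η h := extMap₂_whiskerRight hA hP
    (f := show a.as ⟶ b.as from f) (g := g) η (show b.as ⟶ c.as from h)
  map₂_associator {a b c d} f g h := (extMap₂_mor₂ hA hP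
    (α_ (show a.as ⟶ b.as from f) (show b.as ⟶ c.as from g) (show c.as ⟶ d.as from h)).hom).trans
      (P.map₂_associator _ _ _)
  map₂_left_unitor {a b} f := (extMap₂_mor₂ hA hP (λ_ (show a.as ⟶ b.as from f)).hom).trans
    (P.map₂_left_unitor _)
  map₂_right_unitor {a b} f := (extMap₂_mor₂ hA hP (ρ_ (show a.as ⟶ b.as from f)).hom).trans
    (P.map₂_right_unitor _)

end Extension

/-! ### Images of roof transformations under a pseudofunctor -/

section Image

variable {D : Type u₁} [Bicategory.{w₁, v₁} D] {D' : Type u₂} [Bicategory.{w₂, v₂} D']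
  {W : MorphismProperty D} {W' : MorphismProperty D'} (E : D ⥤ᵖ D') (hE : MapsInto E W W')

open Leg Strict

/-- The image of an invertible 2-morphism. -/
@[simps]
def mapIso₂ {a b : D} {f g : a ⟶ b} (i : f ≅ g) : E.map f ≅ E.map g where
  hom := E.map₂ i.hom
  inv := E.map₂ i.inv
  hom_inv_id := by simp [← E.map₂_comp]
  inv_hom_id := by simp [← E.map₂_comp]

section

variable {E} {x : D'} {a b : D} {f g : a ⟶ b} (k : x ⟶ E.obj a)

@[simp]
theorem whiskerLeft_map₂_inv_hom (i : f ≅ g) : k ◁ E.map₂ i.inv ≫ k ◁ E.map₂ i.hom = 𝟙 _ :=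
  whiskerLeft_inv_hom k (mapIso₂ E i)

@[simp]
theorem whiskerLeft_map₂_inv_hom_assoc (i : f ≅ g) {z : x ⟶ E.obj b} (γ : k ≫ E.map g ⟶ z) :
    k ◁ E.map₂ i.inv ≫ k ◁ E.map₂ i.hom ≫ γ = γ :=
  whiskerLeft_inv_hom_assoc k (mapIso₂ E i) γ

@[simp]
theorem map₂_hom_inv_assoc (i : f ≅ g) {z : E.obj a ⟶ E.obj b} (γ : E.map f ⟶ z) :
    E.map₂ i.hom ≫ E.map₂ i.inv ≫ γ = γ :=
  Iso.hom_inv_id_assoc (mapIso₂ E i) γ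

theorem map₂_rightUnitor_inv (f : a ⟶ b) : E.map₂ (ρ_ f).inv =
    (ρ_ (E.map f)).inv ≫ E.map f ◁ (E.mapId b).inv ≫ (E.mapComp f (𝟙 b)).inv := by
  rw [← cancel_epi (E.map₂ (ρ_ f).hom), ← E.map₂_comp, E.map₂_right_unitor]
  simp

end

/-- The image of a roof. -/
abbrev Roof.map {a b : D} (r : Roof W a b) : Roof W' (E.obj a) (E.obj b) where
  apex := E.obj r.apex
  left := E.map r.left
  right := E.map r.right
  left_mem := hE _ r.left_mem

/-- The image of a representative. -/
abbrev PreCell.map {a b : D} {r s : Roof W a b} (X : PreCell r s)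
    (h : W' (E.map X.p ≫ E.map r.left)) : PreCell (r.map E hE) (s.map E hE) where
  apex := E.obj X.apex
  p := E.map X.p
  q := E.map X.q
  p_mem := h
  α := (E.mapComp X.p r.left).symm ≪≫ mapIso₂ E X.α ≪≫ E.mapComp X.q s.left
  β := (E.mapComp X.p r.right).inv ≫ E.map₂ X.β ≫ (E.mapComp X.q s.right).hom

namespace Leg

variable {a b c e : D} {r s : Roof W a b} {u u' u'' : e ⟶ a} {y y' y'' : e ⟶ b}

/-- The image of a leg. -/
abbrev map (M : Leg r u y) : Leg (r.map E hE) (E.map u) (E.map y) where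
  m := E.map M.m
  θ := (E.mapComp _ _).symm ≪≫ mapIso₂ E M.θ
  φ := (E.mapComp _ _).symm ≪≫ mapIso₂ E M.φ

variable [Strict W']

/-- The action of roofs on 2-morphisms is compatible with pseudofunctors. -/
theorem map₂_tr [Strict W] (β : u ⟶ u') (M : Leg r u y) (M' : Leg r u' y') :
    E.map₂ (tr β M M') = tr (E.map₂ β) (M.map E hE) (M'.map E hE) := by
  rw [tr_eq (β := E.map₂ β) (M := M.map E hE) (M' := M'.map E hE) (E.map₂ (lift β M M'))]
  · simp [tr]
  · have := congrArg E.map₂ (lift_whisker β M M')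
    rw [E.map₂_whisker_right, ← Iso.eq_inv_comp] at this
    have h := this =≫ E.map₂ M'.θ.hom
    simpa using h

theorem tr_res_map {d : D} (z : d ⟶ e) (M : Leg r u y) :
    tr (E.mapComp z u).hom ((M.res z).map E hE) ((M.map E hE).res (E.map z)) =
      (E.mapComp z y).hom := by
  rw [tr_eq (β := (E.mapComp z u).hom) (M := (M.res z).map E hE)
    (M' := (M.map E hE).res (E.map z)) (E.mapComp z M.m).hom]
  · simp [map₂_associator_inv]
  · simp

theorem tr_res_map_inv {d : D} (z : d ⟶ e) (M : Leg r u y) :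
    tr (E.mapComp z u).inv ((M.map E hE).res (E.map z)) ((M.res z).map E hE) =
      (E.mapComp z y).inv := by
  rw [← cancel_epi (E.mapComp z y).hom, Iso.hom_inv_id, ← tr_res_map E hE z M, tr_comp]
  simp

end Leg

/-- The image of composition data. -/
abbrev CompData.map {a b c : D} {R : Roof W a c} {f : Roof W a b} {g : Roof W b c}
    (K : CompData R f g) : CompData (R.map E hE) (f.map E hE) (g.map E hE) where
  fst := E.map K.fst
  snd := E.map K.snd
  θ := (E.mapComp _ _).symm ≪≫ mapIso₂ E K.θ
  iso := (E.mapComp _ _).symm ≪≫ mapIso₂ E K.iso ≪≫ E.mapComp _ _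
  φ := (E.mapComp _ _).symm ≪≫ mapIso₂ E K.φ

/-- The image of data exhibiting a roof as given by a morphism. -/
abbrev MorData.map {a b : D} {I : Roof W a b} {f : a ⟶ b} (e : MorData I f) :
    MorData (I.map E hE) (E.map f) :=
  (E.mapComp _ _).symm ≪≫ mapIso₂ E e

/-- The image of data exhibiting a roof as given by an identity. -/
abbrev MorData.mapId {a : D} {I : Roof W a a} (e : MorData I (𝟙 a)) :
    MorData (I.map E hE) (𝟙 (E.obj a)) :=
  whiskerLeftIso (E.map I.left) (E.mapId a).symm ≪≫ (E.mapComp _ _).symm ≪≫ mapIso₂ E e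

namespace Leg

variable {a b c e : D} {R : Roof W a c} {f : Roof W a b} {g : Roof W b c}
  {u u' : e ⟶ a} {y y' : e ⟶ c}

theorem val_map {I : Roof W a b} {k : a ⟶ b} (m : MorData I k) {w : e ⟶ b} (M : Leg I u w) :
    (M.map E hE).val (MorData.map E hE m) = (E.mapComp _ _).symm ≪≫ mapIso₂ E (M.val m) := by
  ext
  simp [val]

theorem val_mapId {I : Roof W a a} (m : MorData I (𝟙 a)) {w : e ⟶ a} (M : Leg I u w) :
    (M.map E hE).val (MorData.mapId E hE m) =
      ρ_ (E.map u) ≪≫ mapIso₂ E ((ρ_ u).symm ≪≫ M.val m) := by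
  ext
  simp [val, map₂_rightUnitor_inv, whisker_exchange_assoc]

variable [Strict W'] (K : CompData R f g)

theorem tr_fst_map_snd_map (Q : Leg R u y) :
    tr (tr (𝟙 _) ((Q.map E hE).fst (K.map E hE)) ((Q.fst K).map E hE))
      ((Q.map E hE).snd (K.map E hE)) ((Q.snd K).map E hE) = 𝟙 (E.map y) := by
  have h : tr (𝟙 _) ((Q.map E hE).fst (K.map E hE)) ((Q.fst K).map E hE) =
      (E.mapComp Q.m K.fst).inv ▷ E.map f.right ≫ (E.mapComp (Q.m ≫ K.fst) f.right).inv := by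
    rw [tr_eq (β := 𝟙 _) (M := (Q.map E hE).fst (K.map E hE)) (M' := (Q.fst K).map E hE)
      (E.mapComp Q.m K.fst).inv]
    · simp
    · simp
  rw [h, tr_eq (M := (Q.map E hE).snd (K.map E hE)) (M' := (Q.snd K).map E hE)
    (E.mapComp Q.m K.snd).inv]
  · simp
  · simp [map₂_associator_inv]

/-- The components of the image of a leg may be replaced by the images of the components. -/
@[simp]
theorem tr_fst_map_snd_map_right {x : E.obj e ⟶ E.obj a} {w : E.obj e ⟶ E.obj c}
    (β : x ⟶ E.map u) (X : Leg (R.map E hE) x w) (Y : Leg R u y) :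
    tr (tr β (X.fst (K.map E hE)) ((Y.fst K).map E hE)) (X.snd (K.map E hE))
      ((Y.snd K).map E hE) = tr β X (Y.map E hE) := by
  have := congrArg (fun t => tr β X (Y.map E hE) ≫ t) (tr_fst_map_snd_map E hE K Y)
  dsimp only at this
  rw [← tr_fst_snd (K.map E hE), tr_comp, tr_comp] at this
  simpa [tr_fst_snd] using this

@[simp]
theorem tr_fst_map_snd_map_left {x : E.obj e ⟶ E.obj a} {w : E.obj e ⟶ E.obj c}
    (β : E.map u ⟶ x) (X : Leg (R.map E hE) x w) (Y : Leg R u y) :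
    tr (tr β ((Y.fst K).map E hE) (X.fst (K.map E hE))) ((Y.snd K).map E hE)
      (X.snd (K.map E hE)) = tr β (Y.map E hE) X := by
  have := congrArg (fun t => t ≫ tr (tr β ((Y.fst K).map E hE) (X.fst (K.map E hE)))
    ((Y.snd K).map E hE) (X.snd (K.map E hE))) (tr_fst_map_snd_map E hE K Y)
  dsimp only at this
  rw [tr_comp, tr_comp] at this
  simpa [tr_fst_snd] using this.symm

end Leg

variable [Strict W] [Strict W']

/-- `T'` is the image of the transformation `T` under the pseudofunctor `E`. -/
def RoofTrans.IsImage {a b : D} {r s : Roof W a b} (T : RoofTrans r s)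
    (T' : RoofTrans (r.map E hE) (s.map E hE)) : Prop :=
  ∀ ⦃e : D⦄ ⦃u u' : e ⟶ a⦄ ⦃y y' : e ⟶ b⦄ (β : u ⟶ u') (M : Leg r u y) (N : Leg s u' y'),
    E.map₂ (T.app β M N) = T'.app (E.map₂ β) (M.map E hE) (N.map E hE)

namespace RoofTrans

variable {E hE} {a b c d : D} {r s : Roof W a b}

/-- Being the image of a transformation may be checked on legs over a single morphism in `W`. -/
theorem isImage_of_mem {T : RoofTrans r s} {T' : RoofTrans (r.map E hE) (s.map E hE)} {e₀ : D}
    {u₀ : e₀ ⟶ a} {y₀ y₀' : e₀ ⟶ b} (hu : W u₀) (M₀ : Leg r u₀ y₀) (N₀ : Leg s u₀ y₀')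
    (h : E.map₂ (T.app (𝟙 u₀) M₀ N₀) = T'.app (𝟙 _) (M₀.map E hE) (N₀.map E hE)) :
    T.IsImage E hE T' := by
  intro e u u' y y' β M N
  obtain ⟨d, z, k, hz, ⟨i⟩⟩ := Strict.square u₀ u hu
  apply hom_ext_left (hE z hz)
  -- Both sides are compared along `z`, with the given legs restricted along `k`.
  have h₁ : E.map z ◁ E.map₂ (T.app β M N) = (E.mapComp z y).inv ≫ E.map₂ (z ◁ T.app β M N) ≫
      (E.mapComp z y').hom := by simp
  have h₂ : E.map₂ (k ◁ T.app (𝟙 u₀) M₀ N₀) = (E.mapComp k y₀).hom ≫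
      E.map k ◁ T'.app (𝟙 _) (M₀.map E hE) (N₀.map E hE) ≫ (E.mapComp k y₀').inv := by
    rw [E.map₂_whisker_left, h]
  rw [h₁, T.whiskerLeft_app_eq β M N M₀ N₀ z k i.hom (i.inv ≫ z ◁ β) (by simp), E.map₂_comp,
    E.map₂_comp, h₂, map₂_tr E hE, map₂_tr E hE, ← tr_res_map E hE k M₀,
    ← tr_res_map_inv E hE k N₀, ← tr_res_map_inv E hE z M, ← tr_res_map E hE z N,
    whiskerLeft_app, whiskerLeft_app]
  simp only [Category.assoc, app_tr', tr_app']
  congr 1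
  simp [← E.map₂_comp_assoc]

/-- The image of a transformation is determined by the transformation, since its value on the image
of legs over a morphism in `W` is prescribed. -/
theorem IsImage.unique {T : RoofTrans r s} {T' T'' : RoofTrans (r.map E hE) (s.map E hE)}
    (h' : T.IsImage E hE T') (h'' : T.IsImage E hE T'') : T' = T'' := by
  obtain ⟨e, u, hu, H⟩ := exists_legs [r, s]
  obtain ⟨y, ⟨M⟩⟩ := H r (by simp)
  obtain ⟨y', ⟨N⟩⟩ := H s (by simp)
  refine ext_of_mem (hE u hu) (M.map E hE) (N.map E hE) ?_
  rw [← E.map₂_id, ← h', ← h'']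

theorem IsImage.congr {T : RoofTrans r s} {T' T'' : RoofTrans (r.map E hE) (s.map E hE)}
    (h : T.IsImage E hE T') (e : T' = T'') : T.IsImage E hE T'' := e ▸ h

theorem IsImage.isComp {t : Roof W a b} {T : RoofTrans r s} {S : RoofTrans s t}
    {U : RoofTrans r t} {T' : RoofTrans (r.map E hE) (s.map E hE)}
    {S' : RoofTrans (s.map E hE) (t.map E hE)} {U' : RoofTrans (r.map E hE) (t.map E hE)}
    (hT : T.IsImage E hE T') (hS : S.IsImage E hE S') (hU : U.IsImage E hE U')
    (h : IsComp T S U) : IsComp T' S' U' := by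
  obtain ⟨e, u, hu, H⟩ := exists_legs [r, s, t]
  obtain ⟨_, ⟨M⟩⟩ := H r (by simp)
  obtain ⟨_, ⟨N⟩⟩ := H s (by simp)
  obtain ⟨_, ⟨P⟩⟩ := H t (by simp)
  refine isComp_of_mem (hE u hu) (M.map E hE) (N.map E hE) (P.map E hE) ?_
  rw [← E.map₂_id, ← hT, ← hS, ← hU, ← E.map₂_comp, h, Category.comp_id]

variable (E hE)

theorem isImage_id (r : Roof W a b) : (id r).IsImage E hE (id _) := fun _ _ _ _ _ _ _ _ =>
  map₂_tr E hE _ _ _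

variable {E hE}

theorem IsImage.hcomp {R R' : Roof W a c} {f f' : Roof W a b} {g g' : Roof W b c}
    (K : CompData R f g) (K' : CompData R' f' g') {T : RoofTrans f f'} {S : RoofTrans g g'}
    {T' : RoofTrans (f.map E hE) (f'.map E hE)}
    {S' : RoofTrans (g.map E hE) (g'.map E hE)} (hT : T.IsImage E hE T')
    (hS : S.IsImage E hE S') :
    (hcomp K K' T S).IsImage E hE (hcomp (K.map E hE) (K'.map E hE) T' S') := by
  intro e u u' y y' β Q Q'
  have h₁ := tr_fst_map_snd_map E hE K Q
  have h₂ := tr_fst_map_snd_map_left E hE K' (𝟙 _) (Q'.map E hE) Q'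
  rw [tr_id] at h₂
  rw [hcomp_app, hS, hT, hcomp_app, ← Category.id_comp (S'.app _ ((Q.snd K).map E hE) _), ← h₁,
    ← Category.comp_id (_ ≫ S'.app _ _ _), ← h₂, tr_app', tr_app', app_tr', app_tr',
    Category.id_comp, Category.comp_id]

theorem isImage_assoc {f : Roof W a b} {g : Roof W b c} {h : Roof W c d} {F : Roof W a c}
    {G : Roof W b d} {R R' : Roof W a d} (K₁ : CompData F f g) (K₂ : CompData R F h)
    (L₁ : CompData G g h) (L₂ : CompData R' f G) :
    (assoc K₁ K₂ L₁ L₂).IsImage E hE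
      (assoc (K₁.map E hE) (K₂.map E hE) (L₁.map E hE) (L₂.map E hE)) := by
  intro e u u' y y' β Q Q'
  rw [assoc_app, map₂_tr E hE, map₂_tr E hE, map₂_tr E hE, assoc_app]
  have h₁ : tr (tr (tr (𝟙 _) (((Q.map E hE).fst (K₂.map E hE)).fst (K₁.map E hE))
      (((Q.fst K₂).fst K₁).map E hE)) (((Q.map E hE).fst (K₂.map E hE)).snd (K₁.map E hE))
      (((Q.fst K₂).snd K₁).map E hE)) ((Q.map E hE).snd (K₂.map E hE))
      ((Q.snd K₂).map E hE) = 𝟙 _ := by simp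
  have h₂ : tr (tr (tr (𝟙 _) ((Q'.fst L₂).map E hE) ((Q'.map E hE).fst (L₂.map E hE)))
      (((Q'.snd L₂).fst L₁).map E hE) (((Q'.map E hE).snd (L₂.map E hE)).fst (L₁.map E hE)))
      (((Q'.snd L₂).snd L₁).map E hE)
      (((Q'.map E hE).snd (L₂.map E hE)).snd (L₁.map E hE)) = 𝟙 _ := by simp
  rw [← Category.id_comp (tr _ ((Q.snd K₂).map E hE) _), ← h₁,
    ← Category.comp_id (_ ≫ tr _ _ _), ← h₂, tr_comp, tr_comp, tr_comp, tr_comp, tr_comp, tr_comp]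
  simp

theorem isImage_leftUnitor {R : Roof W a b} {I : Roof W a a} {f : Roof W a b}
    (K : CompData R I f) (m : MorData I (𝟙 a)) :
    (leftUnitor K m).IsImage E hE (leftUnitor (K.map E hE) (MorData.mapId E hE m)) := by
  intro e u u' y y' β Q M
  rw [leftUnitor_app, map₂_tr E hE, leftUnitor_app,
    ← Category.id_comp (tr _ ((Q.snd K).map E hE) _), ← tr_fst_map_snd_map E hE K Q, tr_comp,
    tr_eq_val (MorData.mapId E hE m)]
  simp [val_mapId, map₂_rightUnitor_inv]

theorem isImage_rightUnitor {R : Roof W a b} {I : Roof W b b} {f : Roof W a b}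
    (K : CompData R f I) (m : MorData I (𝟙 b)) :
    (rightUnitor K m).IsImage E hE (rightUnitor (K.map E hE) (MorData.mapId E hE m)) := by
  intro e u u' y y' β Q M
  rw [rightUnitor_app, E.map₂_comp, E.map₂_comp, map₂_tr E hE, rightUnitor_app,
    ← Category.id_comp (E.map₂ _ ≫ _), ← tr_fst_map_snd_map E hE K Q,
    tr_eq_val (MorData.mapId E hE m)]
  simp [val_mapId, map₂_rightUnitor_inv]

theorem isImage_ofHom₂ {I J : Roof W a b} {f g : a ⟶ b} (m : MorData I f) (m' : MorData J g)
    (γ : f ⟶ g) : (ofHom₂ m m' γ).IsImage E hE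
      (ofHom₂ (MorData.map E hE m) (MorData.map E hE m') (E.map₂ γ)) := by
  intro e u u' y y' β M N
  rw [ofHom₂_app, ofHom₂_app, val_map, val_map]
  simp

theorem isImage_ev (X : PreCell r s) (h : W' (E.map X.p ≫ E.map r.left)) :
    X.ev.IsImage E hE (X.map E hE h).ev := by
  refine isImage_of_mem X.p_mem X.legP X.legQ ?_
  have hP : tr (E.mapComp X.p r.left).hom (X.legP.map E hE) (X.map E hE h).legP =
      (E.mapComp X.p r.right).hom := by
    rw [tr_eq (M := X.legP.map E hE) (M' := (X.map E hE h).legP) (𝟙 _) (by simp)]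
    simp
  have hQ : tr (E.mapComp X.p r.left).inv (X.map E hE h).legQ (X.legQ.map E hE) =
      (E.mapComp X.q s.right).inv := by
    rw [tr_eq (M := (X.map E hE h).legQ) (M' := X.legQ.map E hE) (𝟙 _) (by simp)]
    simp
  have e : (X.map E hE h).ev.app (𝟙 _) (X.legP.map E hE) (X.legQ.map E hE) =
      tr (E.mapComp X.p r.left).hom (X.legP.map E hE) (X.map E hE h).legP ≫
        (X.map E hE h).ev.app (𝟙 _) (X.map E hE h).legP (X.map E hE h).legQ ≫
          tr (E.mapComp X.p r.left).inv (X.map E hE h).legQ (X.legQ.map E hE) := by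
    simp
  rw [e, PreCell.ev_app_self, PreCell.ev_app_self, hP, hQ]
  simp

end RoofTrans

end Image

section Full

variable {D : Type u} [Bicategory.{w, v} D] {W : MorphismProperty D} [Strict W] {a b : D}
  {r s : Roof W a b}

open Leg

/-! ### Transformations of roofs come from 2-morphisms of the bicategory of fractions -/

/-- A transformation is given by any representative which carries its value. -/
theorem PreCell.ev_eq {X : PreCell r s} {T : RoofTrans r s}
    (h : T.app (𝟙 _) X.legP X.legQ = X.β) : X.ev = T :=
  RoofTrans.ext_of_mem X.p_mem X.legP X.legQ (X.ev_app_self.trans h.symm)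

variable {e d : D} {p : e ⟶ r.apex} {q : e ⟶ s.apex}

/-- The value of a transformation on the legs given by an invertible 2-morphism. -/
abbrev RoofTrans.value (T : RoofTrans r s) (α : p ≫ r.left ≅ q ≫ s.left) :
    p ≫ r.right ⟶ q ≫ s.right :=
  T.app (𝟙 (p ≫ r.left)) ⟨p, Iso.refl _, Iso.refl _⟩ ⟨q, α.symm, Iso.refl _⟩

theorem RoofTrans.value_resIso (T : RoofTrans r s) (α : p ≫ r.left ≅ q ≫ s.left) (z : d ⟶ e) :
    T.value (resIso z α) = (α_ _ _ _).hom ≫ z ◁ T.value α ≫ (α_ _ _ _).inv := by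
  let P : Leg r (p ≫ r.left) (p ≫ r.right) := ⟨p, Iso.refl _, Iso.refl _⟩
  let Q : Leg s (p ≫ r.left) (q ≫ s.right) := ⟨q, α.symm, Iso.refl _⟩
  let P' : Leg r ((z ≫ p) ≫ r.left) ((z ≫ p) ≫ r.right) := ⟨z ≫ p, Iso.refl _, Iso.refl _⟩
  let Q' : Leg s ((z ≫ p) ≫ r.left) ((z ≫ q) ≫ s.right) :=
    ⟨z ≫ q, (resIso z α).symm, Iso.refl _⟩
  have h₁ : tr (α_ z p r.left).hom P' (P.res z) = (α_ z p r.right).hom := by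
    rw [tr_eq (M := P') (M' := P.res z) (𝟙 _) (by simp [P, P'])]; simp [P, P']
  have h₂ : tr (α_ z p r.left).inv (Q.res z) Q' = (α_ z q s.right).inv := by
    rw [tr_eq (M := Q.res z) (M' := Q') (𝟙 _) (by simp [Q, Q'])]; simp [Q, Q']
  change T.app _ P' Q' = _ ≫ z ◁ T.app _ P Q ≫ _
  rw [← h₁, ← h₂, RoofTrans.whiskerLeft_app]
  simp

end Full

section Transfer

variable {C : Type u} [Bicategory.{w, v} C] {W : MorphismProperty C} (hW : BF W) {a b c d : C}

open Loc Leg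

/-- Every transformation of roofs of the localised bicategory comes from a 2-morphism of the
bicategory of fractions. -/
theorem Cell.exists_ev_eq {r s : Roof W a b} (T : RoofTrans (r.loc hW) (s.loc hW)) :
    ∃ x : Cell r s, x.ev hW = T := by
  -- The value of `T` on the legs given by `α` need not come from `C`, but it does so along `z`.
  obtain ⟨e, p, q, hp, ⟨α⟩⟩ := hW.bf3 s.left r.left s.left_mem
  let α' : mor hW p ≫ mor hW r.left ≅ mor hW q ≫ mor hW s.left := iso hW α
  obtain ⟨d, z, β, hz, hβ⟩ := exists_whiskerLeft_eq (f := p ≫ r.right) (g := q ≫ s.right)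
    (T.value α')
  refine ⟨Cell.mk ⟨d, z ≫ p, z ≫ q, hW.bf2 _ _ (hW.bf2 _ _ hz hp) r.left_mem, resIso z α,
    (α_ _ _ _).hom ≫ β ≫ (α_ _ _ _).inv⟩, ?_⟩
  rw [Cell.ev_mk]
  refine PreCell.ev_eq ?_
  have h : T.value (p := mor hW (z ≫ p)) (q := mor hW (z ≫ q)) (iso hW (resIso z α)) = _ :=
    (congrArg T.value (iso_resIso hW α)).trans (T.value_resIso α' (mor hW z))
  exact h.trans (mor₂_comp_eq hW rfl (mor₂_comp_eq hW hβ.symm rfl)).symm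

/-- The 2-morphism of the bicategory of fractions with a given transformation of roofs. -/
noncomputable def Cell.ofTrans {r s : Roof W a b} (T : RoofTrans (r.loc hW) (s.loc hW)) :
    Cell r s :=
  (Cell.exists_ev_eq hW T).choose

@[simp]
theorem Cell.ev_ofTrans {r s : Roof W a b} (T : RoofTrans (r.loc hW) (s.loc hW)) :
    (Cell.ofTrans hW T).ev hW = T :=
  (Cell.exists_ev_eq hW T).choose_spec

end Transfer

section Image

variable {A : Type u₁} [Bicategory.{w₁, v₁} A] {B : Type u₂} [Bicategory.{w₂, v₂} B]
  {WA : MorphismProperty A} {WB : MorphismProperty B} (hA : BF WA) (hB : BF WB) (F : A ⥤ᵖ B)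
  (hF : MapsInto F WA WB)

open Loc RoofTrans

/-! ### The effect of the induced map on 2-morphisms -/

/-- The pseudofunctor `F`, followed by the localisation of its target. -/
def toLoc : A ⥤ᵖ Loc hB where
  obj a := ⟨F.obj a⟩
  map f := mor hB (F.map f)
  map₂ β := mor₂ hB (F.map₂ β)
  map₂_id f := congrArg (mor₂ hB) (F.map₂_id f)
  map₂_comp η θ := (congrArg (mor₂ hB) (F.map₂_comp η θ)).trans (mor₂_comp _ _)
  mapId a := iso hB (F.mapId a)
  mapComp f g := iso hB (F.mapComp f g)
  map₂_whisker_left f g h η := by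
    refine (congrArg (mor₂ hB) (F.map₂_whisker_left f η)).trans ?_
    repeat' first
      | refine mor₂_comp_eq hB ?_ ?_
      | exact mor₂_whiskerLeft _ _
      | exact mor₂_whiskerRight _ _
      | rfl
  map₂_whisker_right η h := by
    refine (congrArg (mor₂ hB) (F.map₂_whisker_right η h)).trans ?_
    repeat' first
      | refine mor₂_comp_eq hB ?_ ?_
      | exact mor₂_whiskerLeft _ _
      | exact mor₂_whiskerRight _ _
      | rfl
  map₂_associator f g h := by
    refine (congrArg (mor₂ hB) (F.map₂_associator f g h)).trans ?_
    repeat' first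
      | refine mor₂_comp_eq hB ?_ ?_
      | exact mor₂_whiskerLeft _ _
      | exact mor₂_whiskerRight _ _
      | rfl
  map₂_left_unitor f := by
    refine (congrArg (mor₂ hB) (F.map₂_left_unitor f)).trans ?_
    repeat' first
      | refine mor₂_comp_eq hB ?_ ?_
      | exact mor₂_whiskerLeft _ _
      | exact mor₂_whiskerRight _ _
      | rfl
  map₂_right_unitor f := by
    refine (congrArg (mor₂ hB) (F.map₂_right_unitor f)).trans ?_
    repeat' first
      | refine mor₂_comp_eq hB ?_ ?_
      | exact mor₂_whiskerLeft _ _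
      | exact mor₂_whiskerRight _ _
      | rfl

include hF in
theorem toLoc_mapsInto : MapsInto (toLoc hB F) WA (Loc.prop hB) := hF

/-- The pseudofunctor between the localised bicategories induced by `F`. -/
noncomputable def locMap : Loc hA ⥤ᵖ Loc hB := extension hA (toLoc_mapsInto hB F hF)

theorem locMap_mapsInto : MapsInto (locMap hA hB F hF) (Loc.prop hA) (Loc.prop hB) :=
  fun a b f hf => hF (show a.as ⟶ b.as from f) hf

variable {a b c d : A}

theorem locMap_map₂ {f g : a ⟶ b} (β : f ⟶ g) :
    (locMap hA hB F hF).map₂ (mor₂ hA β) = mor₂ hB (F.map₂ β) :=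
  extMap₂_mor₂ hA (toLoc_mapsInto hB F hF) β

/-- The image of a 2-morphism of the bicategory of fractions is given by the image of its
transformation. -/
theorem isImage_ev_image {r s : Roof WA a b} (x : Cell r s) :
    (x.ev hA).IsImage (locMap hA hB F hF) (locMap_mapsInto hA hB F hF)
      ((x.image hB F hF).ev hB) := by
  induction x using Quot.ind with
  | mk x =>
    have := isImage_ev (D := Loc hA) (D' := Loc hB) (E := locMap hA hB F hF)
      (hE := locMap_mapsInto hA hB F hF) (x.loc hA) (x.image hB F hF).p_mem
    have h : ((x.image hB F hF).loc hB).ev = ((x.loc hA).map (locMap hA hB F hF)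
        (locMap_mapsInto hA hB F hF) (x.image hB F hF).p_mem).ev := by
      refine congrArg (PreCell.ev (W := Loc.prop hB)) (PreCell.mk_congr ?_ ?_)
      all_goals
        refine mor₂_comp_eq hB rfl (mor₂_comp_eq hB ?_ rfl)
        exact (locMap_map₂ hA hB F hF _).symm
    exact this.congr h.symm

variable (𝒞A : Choices WA)

/-- The composition data of the image of a composite. -/
noncomputable def compDataImage (f : Roof WA a b) (g : Roof WA b c) :
    CompData (((f.cmp hA 𝒞A g).image F hF).loc hB) ((f.image F hF).loc hB)
      ((g.image F hF).loc hB) :=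
  CompData.map (locMap hA hB F hF) (locMap_mapsInto hA hB F hF) (compData hA 𝒞A f g)

/-- The image of the roof of a morphism is given by the image of the morphism. -/
noncomputable def morDataImage (f : a ⟶ b) :
    MorData (((Roof.ofMor hA f).image F hF).loc hB) (mor hB (F.map f)) :=
  MorData.map (locMap hA hB F hF) (locMap_mapsInto hA hB F hF) (morData hA (f := f))

/-- The image of the roof of an identity is given by an identity. -/
noncomputable def morDataImageId (a : A) :
    MorData (((Roof.ofMor hA (𝟙 a)).image F hF).loc hB) (𝟙 (⟨F.obj a⟩ : Loc hB)) :=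
  MorData.mapId (locMap hA hB F hF) (locMap_mapsInto hA hB F hF) (morDataId hA a)

theorem ev_image_id₂ (r : Roof WA a b) :
    ((Cell.id hA 𝒞A r).image hB F hF).ev hB = RoofTrans.id _ := by
  have := isImage_ev_image hA hB F hF (Cell.id hA 𝒞A r)
  rw [ev_id₂] at this
  exact this.unique (isImage_id _ _ _)

theorem ev_image_comp₂ {r s t : Roof WA a b} (x : Cell r s) (y : Cell s t) :
    IsComp ((x.image hB F hF).ev hB) ((y.image hB F hF).ev hB)
      (((x.comp hA 𝒞A y).image hB F hF).ev hB) := by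
  exact IsImage.isComp (isImage_ev_image hA hB F hF x) (isImage_ev_image hA hB F hF y)
    (isImage_ev_image hA hB F hF (x.comp hA 𝒞A y)) (ev_comp₂ hA 𝒞A x y)

theorem ev_image_whiskerLeft (f : Roof WA a b) {g h : Roof WA b c} (y : Cell g h) :
    ((y.whiskerLeft hA 𝒞A f).image hB F hF).ev hB =
      RoofTrans.hcomp (compDataImage hA hB F hF 𝒞A f g) (compDataImage hA hB F hF 𝒞A f h)
        (RoofTrans.id _) ((y.image hB F hF).ev hB) := by
  have := isImage_ev_image hA hB F hF (y.whiskerLeft hA 𝒞A f)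
  rw [ev_whiskerLeft] at this
  exact this.unique (IsImage.hcomp _ _ (isImage_id _ _ _) (isImage_ev_image hA hB F hF y))

theorem ev_image_whiskerRight {f g : Roof WA a b} (x : Cell f g) (h : Roof WA b c) :
    ((x.whiskerRight hA 𝒞A h).image hB F hF).ev hB =
      RoofTrans.hcomp (compDataImage hA hB F hF 𝒞A f h) (compDataImage hA hB F hF 𝒞A g h)
        ((x.image hB F hF).ev hB) (RoofTrans.id _) := by
  have := isImage_ev_image hA hB F hF (x.whiskerRight hA 𝒞A h)
  rw [ev_whiskerRight] at this
  exact this.unique (IsImage.hcomp _ _ (isImage_ev_image hA hB F hF x) (isImage_id _ _ _))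

theorem ev_image_assocHom (f : Roof WA a b) (g : Roof WA b c) (h : Roof WA c d) :
    ((Cell.assocHom hA 𝒞A f g h).image hB F hF).ev hB = RoofTrans.assoc
      (compDataImage hA hB F hF 𝒞A f g) (compDataImage hA hB F hF 𝒞A (f.cmp hA 𝒞A g) h)
      (compDataImage hA hB F hF 𝒞A g h) (compDataImage hA hB F hF 𝒞A f (g.cmp hA 𝒞A h)) := by
  have := isImage_ev_image hA hB F hF (Cell.assocHom hA 𝒞A f g h)
  rw [ev_assocHom] at this
  exact this.unique (isImage_assoc _ _ _ _)

theorem ev_image_leftHom (f : Roof WA a b) :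
    ((Cell.leftHom hA 𝒞A f).image hB F hF).ev hB = RoofTrans.leftUnitor
      (compDataImage hA hB F hF 𝒞A (Roof.ofMor hA (𝟙 a)) f) (morDataImageId hA hB F hF a) := by
  have := isImage_ev_image hA hB F hF (Cell.leftHom hA 𝒞A f)
  rw [ev_leftHom] at this
  exact this.unique (isImage_leftUnitor _ _)

theorem ev_image_rightHom (f : Roof WA a b) :
    ((Cell.rightHom hA 𝒞A f).image hB F hF).ev hB = RoofTrans.rightUnitor
      (compDataImage hA hB F hF 𝒞A f (Roof.ofMor hA (𝟙 b))) (morDataImageId hA hB F hF b) := by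
  have := isImage_ev_image hA hB F hF (Cell.rightHom hA 𝒞A f)
  rw [ev_rightHom] at this
  exact this.unique (isImage_rightUnitor _ _)

theorem ev_image_ofHom₂ {f g : a ⟶ b} (γ : f ⟶ g) :
    ((Cell.ofHom₂ hA γ).image hB F hF).ev hB = RoofTrans.ofHom₂ (morDataImage hA hB F hF f)
      (morDataImage hA hB F hF g) (mor₂ hB (F.map₂ γ)) := by
  have := isImage_ev_image hA hB F hF (Cell.ofHom₂ hA γ)
  rw [ev_ofHom₂] at this
  rw [this.unique (isImage_ofHom₂ _ _ _), locMap_map₂]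
  rfl

end Image

section Comparison

variable {C : Type u} [Bicategory.{w, v} C] {W : MorphismProperty C} (hW : BF W) (𝒞 : Choices W)
  {a b c : C}

open Loc Leg

/-! ### Comparison of roofs given by the same morphism -/

/-- The comparison of two roofs which are given by the same morphism of the localised
bicategory. -/
noncomputable def Cell.ofMorData {r s : Roof W a b} {g : (⟨a⟩ : Loc hW) ⟶ ⟨b⟩}
    (m : MorData (r.loc hW) g) (m' : MorData (s.loc hW) g) : Cell r s :=
  ofTrans hW (RoofTrans.ofHom₂ m m' (𝟙 g))

variable {hW}

theorem Cell.ev_ofMorData {r s : Roof W a b} {g : (⟨a⟩ : Loc hW) ⟶ ⟨b⟩}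
    (m : MorData (r.loc hW) g) (m' : MorData (s.loc hW) g) :
    (ofMorData hW m m').ev hW = RoofTrans.ofHom₂ m m' (𝟙 g) :=
  ev_ofTrans _ _

theorem Cell.ofMorData_comp_ofMorData {r s : Roof W a b} {g : (⟨a⟩ : Loc hW) ⟶ ⟨b⟩}
    (m : MorData (r.loc hW) g) (m' : MorData (s.loc hW) g) :
    (ofMorData hW m m').comp hW 𝒞 (ofMorData hW m' m) = Cell.id hW 𝒞 _ := by
  refine Cell.ext_legs hW [s] fun u H _ _ M N => ?_
  obtain ⟨_, ⟨P⟩⟩ := H _ (by simp; rfl)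
  rw [ev_comp₂_app hW 𝒞 _ _ _ _ _ P, ev_ofMorData, ev_ofMorData, ev_id₂, RoofTrans.id_app,
    tr_eq_val m]
  simp

end Comparison

section Induced

variable {A : Type u₁} [Bicategory.{w₁, v₁} A] {B : Type u₂} [Bicategory.{w₂, v₂} B]
  {WA : MorphismProperty A} {WB : MorphismProperty B} (hA : BF WA) (hB : BF WB) (F : A ⥤ᵖ B)
  (hF : MapsInto F WA WB) (𝒞A : Choices WA) (𝒞B : Choices WB) {a b c d : A}

open Loc Leg

/-! ### The induced pseudofunctor -/

namespace Cell

/-- The comparison of the image of a composite of roofs with the composite of the images. -/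
noncomputable def mapCompHom (f : Roof WA a b) (g : Roof WA b c) :
    Cell ((f.cmp hA 𝒞A g).image F hF) ((f.image F hF).cmp hB 𝒞B (g.image F hF)) :=
  ofTrans hB (RoofTrans.hcomp (compDataImage hA hB F hF 𝒞A f g)
    (compData hB 𝒞B (f.image F hF) (g.image F hF)) (RoofTrans.id _) (RoofTrans.id _))

/-- The inverse of the comparison of the image of a composite of roofs with the composite of the
images. -/
noncomputable def mapCompInv (f : Roof WA a b) (g : Roof WA b c) :
    Cell ((f.image F hF).cmp hB 𝒞B (g.image F hF)) ((f.cmp hA 𝒞A g).image F hF) :=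
  ofTrans hB (RoofTrans.hcomp (compData hB 𝒞B (f.image F hF) (g.image F hF))
    (compDataImage hA hB F hF 𝒞A f g) (RoofTrans.id _) (RoofTrans.id _))

/-- The comparison of the image of an identity roof with the identity roof. -/
noncomputable def mapIdHom (a : A) :
    Cell ((Roof.ofMor hA (𝟙 a)).image F hF) (Roof.ofMor hB (𝟙 (F.obj a))) :=
  ofMorData hB (morDataImageId hA hB F hF a) (morDataId hB (F.obj a))

/-- The inverse of the comparison of the image of an identity roof with the identity roof. -/
noncomputable def mapIdInv (a : A) :
    Cell (Roof.ofMor hB (𝟙 (F.obj a))) ((Roof.ofMor hA (𝟙 a)).image F hF) :=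
  ofMorData hB (morDataId hB (F.obj a)) (morDataImageId hA hB F hF a)

variable {hA hB F hF 𝒞A 𝒞B}

theorem ev_mapCompHom (f : Roof WA a b) (g : Roof WA b c) :
    (mapCompHom hA hB F hF 𝒞A 𝒞B f g).ev hB = RoofTrans.hcomp (compDataImage hA hB F hF 𝒞A f g)
      (compData hB 𝒞B (f.image F hF) (g.image F hF)) (RoofTrans.id _) (RoofTrans.id _) :=
  ev_ofTrans _ _

theorem ev_mapCompInv (f : Roof WA a b) (g : Roof WA b c) :
    (mapCompInv hA hB F hF 𝒞A 𝒞B f g).ev hB =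
      RoofTrans.hcomp (compData hB 𝒞B (f.image F hF) (g.image F hF))
        (compDataImage hA hB F hF 𝒞A f g) (RoofTrans.id _) (RoofTrans.id _) :=
  ev_ofTrans _ _

theorem ev_mapIdHom (a : A) : (mapIdHom hA hB F hF a).ev hB =
    RoofTrans.ofHom₂ (morDataImageId hA hB F hF a) (morDataId hB (F.obj a)) (𝟙 _) :=
  ev_ofTrans _ _

variable (hA hB F hF 𝒞A 𝒞B)

theorem image_id (r : Roof WA a b) :
    (Cell.id hA 𝒞A r).image hB F hF = Cell.id hB 𝒞B (r.image F hF) := by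
  apply Cell.ev_injective hB
  rw [ev_image_id₂, ev_id₂]

theorem image_comp {r s t : Roof WA a b} (x : Cell r s) (y : Cell s t) :
    (x.comp hA 𝒞A y).image hB F hF = (x.image hB F hF).comp hB 𝒞B (y.image hB F hF) := by
  refine Cell.ext_legs hB [s.image F hF] fun u H _ _ M N => ?_
  obtain ⟨_, ⟨P⟩⟩ := H _ (by simp; rfl)
  rw [ev_comp₂_app hB 𝒞B _ _ _ _ _ P, ev_image_comp₂ hA hB F hF 𝒞A x y, Category.id_comp]

theorem mapId_hom_inv (a : A) : (mapIdHom hA hB F hF a).comp hB 𝒞B (mapIdInv hA hB F hF a) =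
    Cell.id hB 𝒞B _ :=
  ofMorData_comp_ofMorData 𝒞B _ _

theorem mapId_inv_hom (a : A) : (mapIdInv hA hB F hF a).comp hB 𝒞B (mapIdHom hA hB F hF a) =
    Cell.id hB 𝒞B _ :=
  ofMorData_comp_ofMorData 𝒞B _ _

theorem mapComp_hom_inv (f : Roof WA a b) (g : Roof WA b c) :
    (mapCompHom hA hB F hF 𝒞A 𝒞B f g).comp hB 𝒞B (mapCompInv hA hB F hF 𝒞A 𝒞B f g) =
      Cell.id hB 𝒞B _ := by
  refine Cell.ext_legs hB [(f.image F hF).cmp hB 𝒞B (g.image F hF)] fun u H _ _ M N => ?_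
  obtain ⟨_, ⟨P⟩⟩ := H _ (by simp; rfl)
  rw [ev_comp₂_app hB 𝒞B _ _ _ _ _ P, ev_mapCompHom, ev_mapCompInv, ev_id₂]
  simp [tr_fst_snd]

theorem mapComp_inv_hom (f : Roof WA a b) (g : Roof WA b c) :
    (mapCompInv hA hB F hF 𝒞A 𝒞B f g).comp hB 𝒞B (mapCompHom hA hB F hF 𝒞A 𝒞B f g) =
      Cell.id hB 𝒞B _ := by
  refine Cell.ext_legs hB [(f.cmp hA 𝒞A g).image F hF] fun u H _ _ M N => ?_
  obtain ⟨_, ⟨P⟩⟩ := H _ (by simp; rfl)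
  rw [ev_comp₂_app hB 𝒞B _ _ _ _ _ P, ev_mapCompHom, ev_mapCompInv, ev_id₂]
  simp [tr_fst_snd]

theorem image_whiskerLeft (f : Roof WA a b) {g h : Roof WA b c} (η : Cell g h) :
    (η.whiskerLeft hA 𝒞A f).image hB F hF = (mapCompHom hA hB F hF 𝒞A 𝒞B f g).comp hB 𝒞B
      (((η.image hB F hF).whiskerLeft hB 𝒞B (f.image F hF)).comp hB 𝒞B
        (mapCompInv hA hB F hF 𝒞A 𝒞B f h)) := by
  refine Cell.ext_legs hB [(f.image F hF).cmp hB 𝒞B (g.image F hF),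
    (f.image F hF).cmp hB 𝒞B (h.image F hF)] fun u H _ _ M N => ?_
  obtain ⟨_, ⟨P⟩⟩ := H ((f.image F hF).cmp hB 𝒞B (g.image F hF)) (by simp)
  obtain ⟨_, ⟨Q⟩⟩ := H ((f.image F hF).cmp hB 𝒞B (h.image F hF)) (by simp)
  rw [ev_comp₂_app hB 𝒞B _ _ _ _ _ P, ev_comp₂_app hB 𝒞B _ _ _ _ _ Q, ev_mapCompHom,
    ev_mapCompInv, ev_image_whiskerLeft, ev_whiskerLeft]
  simp

theorem image_whiskerRight {f g : Roof WA a b} (η : Cell f g) (h : Roof WA b c) :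
    (η.whiskerRight hA 𝒞A h).image hB F hF = (mapCompHom hA hB F hF 𝒞A 𝒞B f h).comp hB 𝒞B
      (((η.image hB F hF).whiskerRight hB 𝒞B (h.image F hF)).comp hB 𝒞B
        (mapCompInv hA hB F hF 𝒞A 𝒞B g h)) := by
  refine Cell.ext_legs hB [(f.image F hF).cmp hB 𝒞B (h.image F hF),
    (g.image F hF).cmp hB 𝒞B (h.image F hF)] fun u H _ _ M N => ?_
  obtain ⟨_, ⟨P⟩⟩ := H ((f.image F hF).cmp hB 𝒞B (h.image F hF)) (by simp)
  obtain ⟨_, ⟨Q⟩⟩ := H ((g.image F hF).cmp hB 𝒞B (h.image F hF)) (by simp)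
  rw [ev_comp₂_app hB 𝒞B _ _ _ _ _ P, ev_comp₂_app hB 𝒞B _ _ _ _ _ Q, ev_mapCompHom,
    ev_mapCompInv, ev_image_whiskerRight, ev_whiskerRight]
  simp

theorem image_associator (f : Roof WA a b) (g : Roof WA b c) (h : Roof WA c d) :
    (assocHom hA 𝒞A f g h).image hB F hF =
      (mapCompHom hA hB F hF 𝒞A 𝒞B (f.cmp hA 𝒞A g) h).comp hB 𝒞B
        (((mapCompHom hA hB F hF 𝒞A 𝒞B f g).whiskerRight hB 𝒞B (h.image F hF)).comp hB 𝒞B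
          ((assocHom hB 𝒞B (f.image F hF) (g.image F hF) (h.image F hF)).comp hB 𝒞B
            (((mapCompInv hA hB F hF 𝒞A 𝒞B g h).whiskerLeft hB 𝒞B (f.image F hF)).comp hB 𝒞B
              (mapCompInv hA hB F hF 𝒞A 𝒞B f (g.cmp hA 𝒞A h))))) := by
  refine Cell.ext_legs hB [((f.cmp hA 𝒞A g).image F hF).cmp hB 𝒞B (h.image F hF),
    ((f.image F hF).cmp hB 𝒞B (g.image F hF)).cmp hB 𝒞B (h.image F hF),
    (f.image F hF).cmp hB 𝒞B ((g.image F hF).cmp hB 𝒞B (h.image F hF)),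
    (f.image F hF).cmp hB 𝒞B ((g.cmp hA 𝒞A h).image F hF)] fun u H _ _ M N => ?_
  obtain ⟨_, ⟨P⟩⟩ := H (((f.cmp hA 𝒞A g).image F hF).cmp hB 𝒞B (h.image F hF)) (by simp)
  obtain ⟨_, ⟨Q⟩⟩ :=
    H (((f.image F hF).cmp hB 𝒞B (g.image F hF)).cmp hB 𝒞B (h.image F hF)) (by simp)
  obtain ⟨_, ⟨R⟩⟩ :=
    H ((f.image F hF).cmp hB 𝒞B ((g.image F hF).cmp hB 𝒞B (h.image F hF))) (by simp)
  obtain ⟨_, ⟨S⟩⟩ := H ((f.image F hF).cmp hB 𝒞B ((g.cmp hA 𝒞A h).image F hF)) (by simp)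
  rw [ev_comp₂_app hB 𝒞B _ _ _ _ _ P, ev_comp₂_app hB 𝒞B _ _ _ _ _ Q,
    ev_comp₂_app hB 𝒞B _ _ _ _ _ R, ev_comp₂_app hB 𝒞B _ _ _ _ _ S, ev_mapCompHom,
    ev_mapCompInv, ev_whiskerRight, ev_whiskerLeft, ev_mapCompHom,
    ev_mapCompInv, ev_image_assocHom, ev_assocHom]
  simp only [RoofTrans.hcomp_app, RoofTrans.assoc_app, RoofTrans.id_app]
  rw [← tr_fst_snd (compDataImage hA hB F hF 𝒞A f g),
    ← tr_fst_snd (compDataImage hA hB F hF 𝒞A g h)]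
  simp

theorem image_leftUnitor (f : Roof WA a b) :
    (leftHom hA 𝒞A f).image hB F hF =
      (mapCompHom hA hB F hF 𝒞A 𝒞B (Roof.ofMor hA (𝟙 a)) f).comp hB 𝒞B
        (((mapIdHom hA hB F hF a).whiskerRight hB 𝒞B (f.image F hF)).comp hB 𝒞B
          (leftHom hB 𝒞B (f.image F hF))) := by
  refine Cell.ext_legs hB [((Roof.ofMor hA (𝟙 a)).image F hF).cmp hB 𝒞B (f.image F hF),
    (Roof.ofMor hB (𝟙 (F.obj a))).cmp hB 𝒞B (f.image F hF)] fun u H _ _ M N => ?_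
  obtain ⟨_, ⟨P⟩⟩ := H (((Roof.ofMor hA (𝟙 a)).image F hF).cmp hB 𝒞B (f.image F hF)) (by simp)
  obtain ⟨_, ⟨Q⟩⟩ := H ((Roof.ofMor hB (𝟙 (F.obj a))).cmp hB 𝒞B (f.image F hF)) (by simp)
  rw [ev_comp₂_app hB 𝒞B _ _ _ _ _ P, ev_comp₂_app hB 𝒞B _ _ _ _ _ Q, ev_mapCompHom,
    ev_whiskerRight, ev_mapIdHom, ev_image_leftHom, ev_leftHom]
  simp [tr_eq_val (morDataImageId hA hB F hF a)]

theorem image_rightUnitor (f : Roof WA a b) :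
    (rightHom hA 𝒞A f).image hB F hF =
      (mapCompHom hA hB F hF 𝒞A 𝒞B f (Roof.ofMor hA (𝟙 b))).comp hB 𝒞B
        (((mapIdHom hA hB F hF b).whiskerLeft hB 𝒞B (f.image F hF)).comp hB 𝒞B
          (rightHom hB 𝒞B (f.image F hF))) := by
  refine Cell.ext_legs hB [(f.image F hF).cmp hB 𝒞B ((Roof.ofMor hA (𝟙 b)).image F hF),
    (f.image F hF).cmp hB 𝒞B (Roof.ofMor hB (𝟙 (F.obj b)))] fun u H _ _ M N => ?_
  obtain ⟨_, ⟨P⟩⟩ := H ((f.image F hF).cmp hB 𝒞B ((Roof.ofMor hA (𝟙 b)).image F hF)) (by simp)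
  obtain ⟨_, ⟨Q⟩⟩ := H ((f.image F hF).cmp hB 𝒞B (Roof.ofMor hB (𝟙 (F.obj b)))) (by simp)
  rw [ev_comp₂_app hB 𝒞B _ _ _ _ _ P, ev_comp₂_app hB 𝒞B _ _ _ _ _ Q, ev_mapCompHom,
    ev_whiskerLeft, ev_mapIdHom, ev_image_rightHom, ev_rightHom]
  simp [tr_eq_val (morDataImageId hA hB F hF b)]

end Cell

variable {hA hB 𝒞A 𝒞B} (lA : IsLawful hA 𝒞A) (lB : IsLawful hB 𝒞B)

/-- The data of the pseudofunctor between the bicategories of fractions induced by `F`. -/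
noncomputable def inducedData :
    PseudofunctorData (FractionBicategory lA) (FractionBicategory lB) where
  toPrelaxFunctorStruct := inducedStruct lA lB F hF
  idHom a := Cell.mapIdHom hA hB F hF a.as
  idInv a := Cell.mapIdInv hA hB F hF a.as
  compHom {a b c} f g := Cell.mapCompHom hA hB F hF 𝒞A 𝒞B (a := a.as) (b := b.as) (c := c.as) f g
  compInv {a b c} f g := Cell.mapCompInv hA hB F hF 𝒞A 𝒞B (a := a.as) (b := b.as) (c := c.as) f g

theorem inducedData_isPseudofunctor : (inducedData F hF lA lB).IsPseudofunctor where
  map₂_id := Cell.image_id hA hB F hF 𝒞A 𝒞B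
  map₂_comp := Cell.image_comp hA hB F hF 𝒞A 𝒞B
  id_hom_inv a := Cell.mapId_hom_inv hA hB F hF 𝒞B a.as
  id_inv_hom a := Cell.mapId_inv_hom hA hB F hF 𝒞B a.as
  comp_hom_inv := Cell.mapComp_hom_inv hA hB F hF 𝒞A 𝒞B
  comp_inv_hom := Cell.mapComp_inv_hom hA hB F hF 𝒞A 𝒞B
  map₂_whisker_left := Cell.image_whiskerLeft hA hB F hF 𝒞A 𝒞B
  map₂_whisker_right := Cell.image_whiskerRight hA hB F hF 𝒞A 𝒞B
  map₂_associator := Cell.image_associator hA hB F hF 𝒞A 𝒞B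
  map₂_left_unitor := Cell.image_leftUnitor hA hB F hF 𝒞A 𝒞B
  map₂_right_unitor := Cell.image_rightUnitor hA hB F hF 𝒞A 𝒞B

/-- The pseudofunctor between the bicategories of fractions induced by `F`. -/
noncomputable def inducedPseudofunctor : FractionBicategory lA ⥤ᵖ FractionBicategory lB :=
  (inducedData F hF lA lB).toPseudofunctor (inducedData_isPseudofunctor F hF lA lB)

end Induced

section Image

variable {D : Type u₁} [Bicategory.{w₁, v₁} D] {D' : Type u₂} [Bicategory.{w₂, v₂} D']
  {W : MorphismProperty D} {W' : MorphismProperty D'} {E : D ⥤ᵖ D'} {hE : MapsInto E W W'}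
  {a b c : D} {e : D'}

/-! ### Images of identities and composites of morphisms -/

/-- The two ways in which the image of an identity roof is given by a morphism differ by the
comparison of `E` with identities. -/
theorem Leg.val_mapId_eq {I : Roof W a a} (m : MorData I (𝟙 a)) {u : e ⟶ E.obj a}
    {y : e ⟶ E.obj a} (M : Leg (I.map E hE) u y) : M.val (MorData.mapId E hE m) =
      whiskerLeftIso u (E.mapId a).symm ≪≫ M.val (MorData.map E hE m) := by
  ext
  simp [val, whisker_exchange_assoc]

theorem CompData.map_morData {R : Roof W a c} {I : Roof W a b} {J : Roof W b c} {f : a ⟶ b}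
    {g : b ⟶ c} (K : CompData R I J) (m : MorData I f) (m' : MorData J g) :
    MorData.map E hE (K.morData m m') = whiskerLeftIso (E.map R.left) (E.mapComp f g) ≪≫
      (K.map E hE).morData (MorData.map E hE m) (MorData.map E hE m') := by
  ext
  simp [CompData.morData, map₂_associator_inv]

theorem Leg.val_map_morData {R : Roof W a c} {I : Roof W a b} {J : Roof W b c} {f : a ⟶ b}
    {g : b ⟶ c} (K : CompData R I J) (m : MorData I f) (m' : MorData J g) {u : e ⟶ E.obj a}
    {y : e ⟶ E.obj c} (M : Leg (R.map E hE) u y) : M.val (MorData.map E hE (K.morData m m')) =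
      whiskerLeftIso u (E.mapComp f g) ≪≫
        M.val ((K.map E hE).morData (MorData.map E hE m) (MorData.map E hE m')) := by
  have h := whisker_exchange M.θ.inv (E.mapComp f g).hom
  simp only [whiskerRight_comp, Bicategory.comp_whiskerLeft] at h
  rw [CompData.map_morData]
  ext
  simp [val, reassoc_of% h]

/-- The image of the comparison of composites of morphisms is the comparison of the composites of
the images, corrected by the comparison of `E` with composites. -/
theorem RoofTrans.ofHom₂_map_morData [Strict W'] {L : Roof W a c} {R : Roof W a c}
    {I : Roof W a b} {J : Roof W b c} {f : a ⟶ b} {g : b ⟶ c} (K : CompData R I J)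
    (n : MorData L (f ≫ g)) (m : MorData I f) (m' : MorData J g) :
    ofHom₂ (MorData.map E hE n) (MorData.map E hE (K.morData m m')) (E.map₂ (𝟙 (f ≫ g))) =
      ofHom₂ (MorData.map E hE n)
        ((K.map E hE).morData (MorData.map E hE m) (MorData.map E hE m'))
        (E.mapComp f g).hom := by
  rw [ofHom₂, ofHom₂, RoofTrans.mk.injEq]
  funext e u u' y y' β M N
  simp [Leg.val_map_morData]

end Image

section Induced

variable {A : Type u₁} [Bicategory.{w₁, v₁} A] {B : Type u₂} [Bicategory.{w₂, v₂} B]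
  {WA : MorphismProperty A} {WB : MorphismProperty B} (hA : BF WA) (hB : BF WB) (F : A ⥤ᵖ B)
  (hF : MapsInto F WA WB) (𝒞A : Choices WA) (𝒞B : Choices WB) {a b c : A}

open Loc Leg

/-! ### Comparison of the roof of an image with the image of a roof -/

theorem ev_image_compHom (f : a ⟶ b) (g : b ⟶ c) :
    ((Cell.compHom hA 𝒞A f g).image hB F hF).ev hB = RoofTrans.ofHom₂
      (morDataImage hA hB F hF (f ≫ g))
      ((compDataImage hA hB F hF 𝒞A (Roof.ofMor hA f) (Roof.ofMor hA g)).morData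
        (morDataImage hA hB F hF f) (morDataImage hA hB F hF g))
      (mor₂ hB (F.mapComp f g).hom) := by
  have := isImage_ev_image hA hB F hF (Cell.compHom hA 𝒞A f g)
  rw [ev_compHom'] at this
  exact (this.unique (RoofTrans.isImage_ofHom₂ _ _ _)).trans
    (RoofTrans.ofHom₂_map_morData _ _ _ _)

namespace Cell

/-- The comparison of the roof of the image of a morphism with the image of its roof. -/
noncomputable def toImage (f : a ⟶ b) :
    Cell (Roof.ofMor hB (F.map f)) ((Roof.ofMor hA f).image F hF) :=
  ofMorData hB (morData hB) (morDataImage hA hB F hF f)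

/-- The inverse of the comparison of the roof of the image of a morphism with the image of its
roof. -/
noncomputable def fromImage (f : a ⟶ b) :
    Cell ((Roof.ofMor hA f).image F hF) (Roof.ofMor hB (F.map f)) :=
  ofMorData hB (morDataImage hA hB F hF f) (morData hB)

variable {hA hB F hF}

theorem ev_toImage (f : a ⟶ b) : (toImage hA hB F hF f).ev hB =
    RoofTrans.ofHom₂ (morData hB) (morDataImage hA hB F hF f) (𝟙 _) :=
  ev_ofTrans _ _

variable (hA hB F hF)

theorem ofHom₂_comp_toImage {f g : a ⟶ b} (η : f ⟶ g) :
    (ofHom₂ hB (F.map₂ η)).comp hB 𝒞B (toImage hA hB F hF g) =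
      (toImage hA hB F hF f).comp hB 𝒞B ((ofHom₂ hA η).image hB F hF) := by
  refine Cell.ext_legs hB [Roof.ofMor hB (F.map g), (Roof.ofMor hA f).image F hF]
    fun u H _ _ M N => ?_
  obtain ⟨_, ⟨P⟩⟩ := H (Roof.ofMor hB (F.map g)) (by simp)
  obtain ⟨_, ⟨Q⟩⟩ := H ((Roof.ofMor hA f).image F hF) (by simp)
  rw [ev_comp₂_app hB 𝒞B _ _ _ _ _ P, ev_comp₂_app hB 𝒞B _ _ _ _ _ Q, ev_toImage, ev_toImage,
    ev_ofHom₂, ev_image_ofHom₂]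
  simp

theorem toImage_id (a : A) :
    (toImage hA hB F hF (𝟙 a)).comp hB 𝒞B
        (((Cell.id hA 𝒞A (Roof.ofMor hA (𝟙 a))).image hB F hF).comp hB 𝒞B
          (mapIdHom hA hB F hF a)) =
      (ofHom₂ hB (F.mapId a).hom).comp hB 𝒞B
        (Cell.id hB 𝒞B (Roof.ofMor hB (𝟙 (F.obj a)))) := by
  rw [image_id hA hB F hF 𝒞A 𝒞B, id_comp, comp_id]
  refine Cell.ext_legs hB [(Roof.ofMor hA (𝟙 a)).image F hF] fun u H _ _ M N => ?_
  obtain ⟨_, ⟨P⟩⟩ := H _ (by simp; rfl)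
  let γ : mor hB (F.map (𝟙 a)) ≅ 𝟙 (⟨F.obj a⟩ : Loc hB) := iso hB (F.mapId a)
  have e : (ofHom₂ hB (F.mapId a).hom).ev hB = RoofTrans.ofHom₂ (morData hB)
    (morDataId hB (F.obj a)) γ.hom := ev_ofHom₂ hB _
  have e' : (P.val (morDataImageId hA hB F hF a)) =
    whiskerLeftIso _ γ.symm ≪≫ P.val (morDataImage hA hB F hF (𝟙 a)) :=
    val_mapId_eq (E := locMap hA hB F hF) (hE := locMap_mapsInto hA hB F hF)
      (morDataId hA a) P
  rw [ev_comp₂_app hB 𝒞B _ _ _ _ _ P, ev_toImage, ev_mapIdHom, e]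
  simp [e']

theorem toImage_comp (f : a ⟶ b) (g : b ⟶ c) :
    (toImage hA hB F hF (f ≫ g)).comp hB 𝒞B
        (((compHom hA 𝒞A f g).image hB F hF).comp hB 𝒞B
          (mapCompHom hA hB F hF 𝒞A 𝒞B (Roof.ofMor hA f) (Roof.ofMor hA g))) =
      ((ofHom₂ hB (F.mapComp f g).hom).comp hB 𝒞B (compHom hB 𝒞B (F.map f) (F.map g))).comp hB 𝒞B
        (((toImage hA hB F hF g).whiskerLeft hB 𝒞B (Roof.ofMor hB (F.map f))).comp hB 𝒞B
          ((toImage hA hB F hF f).whiskerRight hB 𝒞B ((Roof.ofMor hA g).image F hF))) := by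
  refine Cell.ext_legs hB [(Roof.ofMor hA (f ≫ g)).image F hF,
    ((Roof.ofMor hA f).cmp hA 𝒞A (Roof.ofMor hA g)).image F hF,
    Roof.ofMor hB (F.map f ≫ F.map g),
    (Roof.ofMor hB (F.map f)).cmp hB 𝒞B (Roof.ofMor hB (F.map g)),
    (Roof.ofMor hB (F.map f)).cmp hB 𝒞B ((Roof.ofMor hA g).image F hF)] fun u H _ _ M N => ?_
  obtain ⟨_, ⟨P⟩⟩ := H ((Roof.ofMor hA (f ≫ g)).image F hF) (by simp)
  obtain ⟨_, ⟨P'⟩⟩ :=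
    H (((Roof.ofMor hA f).cmp hA 𝒞A (Roof.ofMor hA g)).image F hF) (by simp)
  obtain ⟨_, ⟨Q⟩⟩ := H (Roof.ofMor hB (F.map f ≫ F.map g)) (by simp)
  obtain ⟨_, ⟨R⟩⟩ := H ((Roof.ofMor hB (F.map f)).cmp hB 𝒞B (Roof.ofMor hB (F.map g))) (by simp)
  obtain ⟨_, ⟨S⟩⟩ :=
    H ((Roof.ofMor hB (F.map f)).cmp hB 𝒞B ((Roof.ofMor hA g).image F hF)) (by simp)
  let γ : mor hB (F.map (f ≫ g)) ⟶ mor hB (F.map f) ≫ mor hB (F.map g) :=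
    mor₂ hB (F.mapComp f g).hom
  have e : (ofHom₂ hB (F.mapComp f g).hom).ev hB = RoofTrans.ofHom₂ (morData hB)
    (morDataComp hB (F.map f) (F.map g)) γ := ev_ofHom₂ hB _
  have e' : ((compHom hA 𝒞A f g).image hB F hF).ev hB = RoofTrans.ofHom₂
    (morDataImage hA hB F hF (f ≫ g))
    ((compDataImage hA hB F hF 𝒞A (Roof.ofMor hA f) (Roof.ofMor hA g)).morData
      (morDataImage hA hB F hF f) (morDataImage hA hB F hF g)) γ :=
    ev_image_compHom hA hB F hF 𝒞A f g
  rw [ev_comp₂_app hB 𝒞B _ _ _ _ _ P, ev_comp₂_app hB 𝒞B _ _ _ _ _ P',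
    ev_comp₂_app hB 𝒞B _ _ _ _ _ R, ev_comp₂_app hB 𝒞B _ _ _ _ _ Q,
    ev_comp₂_app hB 𝒞B _ _ _ _ _ S, ev_toImage, e', ev_mapCompHom, e, ev_compHom',
    ev_whiskerLeft, ev_whiskerRight, ev_toImage, ev_toImage]
  simp [val_morData, tr_eq_val (morData hB), tr_eq_val (morDataImage hA hB F hF _)]

end Cell

end Induced

section Icon

variable {Y : Type u} [Bicategory.{w, v} Y] {a b c : Y}

/-! ### Transformations with identity components -/

/-- An invertible 2-morphism between `p` and `q`, as an invertible filler of the square with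
vertical sides identities. -/
@[simps! hom]
def iconIso {p q : a ⟶ b} (j : p ≅ q) : p ≫ 𝟙 b ≅ 𝟙 a ≫ q :=
  ρ_ p ≪≫ j ≪≫ (λ_ q).symm

/-- For a family of 2-morphisms `j`, naturality of the squares `iconIso j` reduces to naturality of
`j`; the two lemmas below do the same for compatibility with identities and composites. -/
theorem iconIso_naturality {p p' q q' : a ⟶ b} {j : p ≅ q} {j' : p' ≅ q'} {η : p ⟶ p'}
    {θ : q ⟶ q'} (h : η ≫ j'.hom = j.hom ≫ θ) :
    η ▷ 𝟙 b ≫ (iconIso j').hom = (iconIso j).hom ≫ 𝟙 a ◁ θ := by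
  simp [reassoc_of% h]

theorem iconIso_id {p q : a ⟶ a} {j : p ≅ q} {i : p ⟶ 𝟙 a} {i' : q ⟶ 𝟙 a}
    (h : j.hom ≫ i' = i) :
    (iconIso j).hom ≫ 𝟙 a ◁ i' = i ▷ 𝟙 a ≫ (λ_ (𝟙 a)).hom ≫ (ρ_ (𝟙 a)).inv := by
  simp [← h, unitors_equal]

theorem iconIso_comp {p₁ q₁ : a ⟶ b} {p₂ q₂ : b ⟶ c} {p₃ q₃ : a ⟶ c} {j₁ : p₁ ≅ q₁}
    {j₂ : p₂ ≅ q₂} {j₃ : p₃ ≅ q₃} {k : p₃ ⟶ p₁ ≫ p₂} {k' : q₃ ⟶ q₁ ≫ q₂}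
    (h : j₃.hom ≫ k' = k ≫ p₁ ◁ j₂.hom ≫ j₁.hom ▷ q₂) :
    (iconIso j₃).hom ≫ 𝟙 a ◁ k' = k ▷ 𝟙 c ≫ (α_ _ _ _).hom ≫ p₁ ◁ (iconIso j₂).hom ≫
      (α_ _ _ _).inv ≫ (iconIso j₁).hom ▷ q₂ ≫ (α_ _ _ _).hom := by
  simp [reassoc_of% h]

/-- The conditions on a family `j` in `iconIso_naturality`, `iconIso_id` and `iconIso_comp` are
inherited by the family of inverses; the two lemmas below treat identities and composites. -/
theorem iso_symm_naturality {p p' q q' : a ⟶ b} {j : p ≅ q} {j' : p' ≅ q'} {η : p ⟶ p'}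
    {θ : q ⟶ q'} (h : η ≫ j'.hom = j.hom ≫ θ) : θ ≫ j'.symm.hom = j.symm.hom ≫ η := by
  rw [← cancel_epi j.hom, ← reassoc_of% h]
  simp

theorem iso_symm_id {p q : a ⟶ a} {j : p ≅ q} {i : p ⟶ 𝟙 a} {i' : q ⟶ 𝟙 a}
    (h : j.hom ≫ i' = i) : j.symm.hom ≫ i = i' := by
  simp [← h]

theorem iso_symm_comp {p₁ q₁ : a ⟶ b} {p₂ q₂ : b ⟶ c} {p₃ q₃ : a ⟶ c} {j₁ : p₁ ≅ q₁}
    {j₂ : p₂ ≅ q₂} {j₃ : p₃ ≅ q₃} {k : p₃ ⟶ p₁ ≫ p₂} {k' : q₃ ⟶ q₁ ≫ q₂}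
    (h : j₃.hom ≫ k' = k ≫ p₁ ◁ j₂.hom ≫ j₁.hom ▷ q₂) :
    j₃.symm.hom ≫ k = k' ≫ q₁ ◁ j₂.symm.hom ≫ j₁.symm.hom ▷ p₂ := by
  rw [← cancel_epi j₃.hom, reassoc_of% h]
  simp [whisker_exchange]

/-- The composite of the squares given by `j` and by its inverse is the identity square, up to
unitors. -/
theorem iconIso_hom_symm {p q : a ⟶ b} (j : p ≅ q) :
    p ◁ (λ_ (𝟙 b)).hom ≫ (ρ_ p).hom ≫ (λ_ p).inv =
      ((α_ _ _ _).inv ≫ (iconIso j).hom ▷ 𝟙 b ≫ (α_ _ _ _).hom ≫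
        𝟙 a ◁ (iconIso j.symm).hom ≫ (α_ _ _ _).inv) ≫ (λ_ (𝟙 a)).hom ▷ p := by
  simp [unitors_equal]

/-- A square of cylinders with vertical sides identities is an internal equivalence if its top side
is. -/
theorem isInternalEquivalence_cyl {p q : a ⟶ b} (j : p ≅ q) (h : IsInternalEquivalence p) :
    IsInternalEquivalence (C := Cyl Y) (a := ⟨a, a, 𝟙 a⟩) (b := ⟨b, b, 𝟙 b⟩)
      (Cyl.Mor.mk p q (iconIso j).hom) := by
  obtain ⟨e, ⟨i⟩, ⟨k⟩⟩ := h
  -- A quasi-inverse `e` of `p` is one of `q` as well, so that it may be taken for both horizontal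
  -- sides of the inverse square.
  refine ⟨Cyl.Mor.mk e e (iconIso (Iso.refl e)).hom,
    ⟨Cyl.mkIso i (i ≪≫ whiskerRightIso j e) ?_⟩,
    ⟨Cyl.mkIso k (whiskerLeftIso e j.symm ≪≫ k) ?_⟩⟩
  · simp [unitors_equal]
  · simp [unitors_equal]

end Icon

section Equivalence

variable {C : Type u} [Bicategory.{w, v} C] {W : MorphismProperty C} {hW : BF W} {𝒞 : Choices W}
  {a b : C}

open Loc

/-! ### Morphisms in the class become internal equivalences -/

/-- Roofs given by the same morphism of the localised bicategory are isomorphic. -/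
noncomputable def isoOfMorData (l : IsLawful hW 𝒞) {a b : FractionBicategory l} {r s : a ⟶ b}
    {g : (⟨a.as⟩ : Loc hW) ⟶ ⟨b.as⟩}
    (m : MorData (Roof.loc hW (a := a.as) (b := b.as) r) g)
    (m' : MorData (Roof.loc hW (a := a.as) (b := b.as) s) g) : r ≅ s where
  hom := Cell.ofMorData hW m m'
  inv := Cell.ofMorData hW m' m
  hom_inv_id := Cell.ofMorData_comp_ofMorData 𝒞 m m'
  inv_hom_id := Cell.ofMorData_comp_ofMorData 𝒞 m' m

/-- A morphism `w` in the class is sent to an internal equivalence, with quasi-inverse given by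
the roof with left side `w` and right side the identity. -/
theorem isInternalEquivalence_ofMor (l : IsLawful hW 𝒞) {w : a ⟶ b} (hw : W w) :
    IsInternalEquivalence (C := FractionBicategory l) (a := ⟨a⟩) (b := ⟨b⟩)
      (Roof.ofMor hW w) := by
  let r : Roof W b a := ⟨a, w, 𝟙 a, hw⟩
  refine ⟨r, ⟨isoOfMorData l (a := ⟨a⟩) (b := ⟨a⟩) (morDataId hW a) ?_⟩,
    ⟨isoOfMorData l (a := ⟨b⟩) (b := ⟨b⟩) ?_ (morDataId hW b)⟩⟩
  · -- The two projections of the square over `w` and `w` agree, since they agree after `w`.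
    let S := 𝒞.sq (Roof.ofMor hW w) r
    let η : mor hW S.fst ≫ mor hW w ≅ mor hW S.snd ≫ mor hW w := iso hW S.iso
    let ζ : mor hW S.fst ≅ mor hW S.snd := Strict.liftIso (W := Loc.prop hW) hw η
    exact (show (mor hW S.fst ≫ 𝟙 (⟨a⟩ : Loc hW)) ≫ 𝟙 (⟨a⟩ : Loc hW) ≅
      mor hW S.snd ≫ 𝟙 (⟨a⟩ : Loc hW) from ρ_ _ ≪≫ whiskerRightIso ζ _)
  · -- The projections of the square over two identities agree, and the composite is given by `w`
    -- after either of them.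
    let S := 𝒞.sq r (Roof.ofMor hW w)
    let ζ : mor hW S.fst ≫ 𝟙 (⟨a⟩ : Loc hW) ≅ mor hW S.snd ≫ 𝟙 (⟨a⟩ : Loc hW) := iso hW S.iso
    exact (show (mor hW S.fst ≫ mor hW w) ≫ 𝟙 (⟨b⟩ : Loc hW) ≅ mor hW S.snd ≫ mor hW w from
      ρ_ _ ≪≫ whiskerRightIso ((ρ_ _).symm ≪≫ ζ ≪≫ ρ_ _) _)

end Equivalence

section Induced

variable {A : Type u₁} [Bicategory.{w₁, v₁} A] {B : Type u₂} [Bicategory.{w₂, v₂} B]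
  {WA : MorphismProperty A} {WB : MorphismProperty B} {hA : BF WA} {hB : BF WB} (F : A ⥤ᵖ B)
  (hF : MapsInto F WA WB) {𝒞A : Choices WA} {𝒞B : Choices WB} (lA : IsLawful hA 𝒞A)
  (lB : IsLawful hB 𝒞B) {a b c : A}

/-! ### The comparison transformation -/

/-- The comparison of the roof of the image of a morphism with the image of its roof. -/
noncomputable def imageIso (f : a ⟶ b) :
    (F.comp (universalPseudofunctor lB)).map f ≅
      ((universalPseudofunctor lA).comp (inducedPseudofunctor F hF lA lB)).map f where
  hom := Cell.toImage hA hB F hF f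
  inv := Cell.fromImage hA hB F hF f
  hom_inv_id := Cell.ofMorData_comp_ofMorData 𝒞B _ _
  inv_hom_id := Cell.ofMorData_comp_ofMorData 𝒞B _ _

theorem imageIso_naturality {f g : a ⟶ b} (η : f ⟶ g) :
    (F.comp (universalPseudofunctor lB)).map₂ η ≫ (imageIso F hF lA lB g).hom =
      (imageIso F hF lA lB f).hom ≫
        ((universalPseudofunctor lA).comp (inducedPseudofunctor F hF lA lB)).map₂ η :=
  Cell.ofHom₂_comp_toImage hA hB F hF 𝒞B η

theorem imageIso_id (a : A) :
    (imageIso F hF lA lB (𝟙 a)).hom ≫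
        (((universalPseudofunctor lA).comp (inducedPseudofunctor F hF lA lB)).mapId a).hom =
      ((F.comp (universalPseudofunctor lB)).mapId a).hom :=
  Cell.toImage_id hA hB F hF 𝒞A 𝒞B a

theorem imageIso_comp (f : a ⟶ b) (g : b ⟶ c) :
    (imageIso F hF lA lB (f ≫ g)).hom ≫
        (((universalPseudofunctor lA).comp (inducedPseudofunctor F hF lA lB)).mapComp f g).hom =
      ((F.comp (universalPseudofunctor lB)).mapComp f g).hom ≫
        (F.comp (universalPseudofunctor lB)).map f ◁ (imageIso F hF lA lB g).hom ≫
        (imageIso F hF lA lB f).hom ▷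
          ((universalPseudofunctor lA).comp (inducedPseudofunctor F hF lA lB)).map g :=
  Cell.toImage_comp hA hB F hF 𝒞A 𝒞B f g

/-- The pseudonatural transformation comparing the localisation of `F` with the induced
pseudofunctor. Its components are identities. -/
noncomputable def comparison : Pseudofunctor.StrongTrans (F.comp (universalPseudofunctor lB))
    ((universalPseudofunctor lA).comp (inducedPseudofunctor F hF lA lB)) where
  app a := 𝟙 (⟨F.obj a⟩ : FractionBicategory lB)
  naturality f := iconIso (imageIso F hF lA lB f)
  naturality_naturality η := iconIso_naturality (imageIso_naturality F hF lA lB η)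
  naturality_id a := iconIso_id (imageIso_id F hF lA lB a)
  naturality_comp f g := iconIso_comp (imageIso_comp F hF lA lB f g)

/-- The inverse of the comparison transformation. -/
noncomputable def comparisonInv : Pseudofunctor.StrongTrans
    ((universalPseudofunctor lA).comp (inducedPseudofunctor F hF lA lB))
    (F.comp (universalPseudofunctor lB)) where
  app a := 𝟙 (⟨F.obj a⟩ : FractionBicategory lB)
  naturality f := iconIso (imageIso F hF lA lB f).symm
  naturality_naturality η :=
    iconIso_naturality (iso_symm_naturality (imageIso_naturality F hF lA lB η))
  naturality_id a := iconIso_id (iso_symm_id (imageIso_id F hF lA lB a))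
  naturality_comp f g := iconIso_comp (iso_symm_comp (imageIso_comp F hF lA lB f g))

open scoped Pseudofunctor.StrongTrans in
theorem comparison_isInternalEquivalence :
    IsInternalEquivalence (C := A ⥤ᵖ FractionBicategory lB) (comparison F hF lA lB) := by
  refine ⟨comparisonInv F hF lA lB, ⟨Iso.symm (Pseudofunctor.StrongTrans.isoMk
    (fun a => λ_ (𝟙 (⟨F.obj a⟩ : FractionBicategory lB))) fun f => ?_)⟩,
    ⟨Pseudofunctor.StrongTrans.isoMk
    (fun a => λ_ (𝟙 (⟨F.obj a⟩ : FractionBicategory lB))) fun f => ?_⟩⟩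
  · exact iconIso_hom_symm (imageIso F hF lA lB f)
  · exact iconIso_hom_symm (imageIso F hF lA lB f).symm

theorem hasExplicitInduced (hA : BF WA) (𝒞A : Choices WA) (hB : BF WB) (𝒞B : Choices WB) :
    HasExplicitInduced hA 𝒞A hB 𝒞B F hF := by
  refine ⟨isLawful hA 𝒞A, isLawful hB 𝒞B, inducedPseudofunctor F hF _ _,
    comparison F hF _ _, comparison_isInternalEquivalence F hF _ _, fun a b f hf => ?_, rfl⟩
  exact isInternalEquivalence_cyl _ (isInternalEquivalence_ofMor (isLawful hB 𝒞B) (hF f hf))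

end Induced

end BicatFrac

theorem mainTheorem2 {A : Type u₁} [Bicategory.{w₁, v₁} A] {B : Type u₂} [Bicategory.{w₂, v₂} B]
    (WA : MorphismProperty A) (WB : MorphismProperty B)
    (hA : BicatFrac.BF WA) (hB : BicatFrac.BF WB) (F : A ⥤ᵖ B)
    (𝒞A : BicatFrac.Choices WA) :
    (∀ hF : BicatFrac.MapsInto F WA (BicatFrac.saturation WB),
      ∃ hsat : BicatFrac.BF (BicatFrac.saturation WB),
        ∀ 𝒞B : BicatFrac.Choices (BicatFrac.saturation WB),
          BicatFrac.HasExplicitInduced hA 𝒞A hsat 𝒞B F hF) ∧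
    (∀ hF : BicatFrac.MapsInto F WA WB,
      ∀ 𝒞B : BicatFrac.Choices WB,
        BicatFrac.HasExplicitInduced hA 𝒞A hB 𝒞B F hF) := by
  exact ⟨fun hF => ⟨hB.saturation, fun 𝒞B => BicatFrac.hasExplicitInduced F hF hA 𝒞A _ 𝒞B⟩,
    fun hF 𝒞B => BicatFrac.hasExplicitInduced F hF hA 𝒞A hB 𝒞B⟩
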